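/- Let $n\ge 1$, $k\ge 0$, and let $Y$ be a complex variety (more generally, a Hausdorff reduced complex space) of dimension $k+2$ with transversal $A_n$ singularities: its singular locus $S$ is connected and near every point of $S$ the pair $(S,Y)$ is isomorphic, in the complex topology, to $(\mathbb C^k\times\{0\},\ \mathbb C^k\times R)$ with $R=\{xy=z^{n+1}\}\subset\mathbb C^3$. Let $[Y]$ be the associated orbifold structure (near $S$): its charts are the compositions of such local isomorphisms with the quotient map $\mathbb C^k\times\mathbb C^2\to\mathbb C^k\times R$, $(w,u,v)\mapsto(w,u^{n+1},v^{n+1},uv)$, by the group $\mu_{n+1}$ of $(n+1)$-th roots of unity acting by $\zeta(w,u,v)=(w,\zeta u,\zeta^{-1}v)$, and its arrows are the germs $\varphi$ of isomorphisms between charts over $Y$. Let $[S]\subset[Y]$ be the suborbifold over $S$ (the fixed loci $u=v=0$ of the charts), $[N]$ its normal bundle, and $f:[S]\to S$ the canonical map. Assume that $[Y]$ has trivial monodromy, i.e. the covering of $S$ whose fibre over $y$ is the set of non-trivial elements of the local group at $y$ (an arrow $\varphi$ identifying $g$ with $\varphi g\varphi^{-1}$) has trivial monodromy. Then the charts can be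 chosen such that $\varphi\circ\zeta\circ\varphi^{-1}=\zeta$ for all arrows $\varphi$ between fixed points and all $\zeta\in\mu_{n+1}$. For every such choice the following holds. If $n\ge 2$, let $[N]=[N]^{\mathfrak g}\oplus[N]^{\mathfrak g^{-1}}$ be the decomposition into the eigenbundles on which $\zeta$ acts by $\zeta$ and by $\zeta^{-1}$ (spanned by $\partial/\partial u$ and by $\partial/\partial v$), and let $K$ be the $\mathcal O_S$-module with $[N]^{\mathfrak g}\otimes[N]^{\mathfrak g^{-1}}\cong f^*K$ obtained by descent, with transition functions $\frac{\partial F}{\partial u}\frac{\partial G}{\partial v}$ on $S$ for an arrow $\varphi$ with $\mathbb C^2$-components $(F,G)$; if $n=1$, let $K$ be the $\mathcal O_S$-module with $\bigwedge^2[N]\cong f^*K$ obtained by descent. Then $K$ is a line bundle on $S$. Let $\rho:Z\to Y$ be the resolution obtained by blowing up the (reduced) singular locus, then the singular locus of the blow-up, and so on until the space is smooth. Let $E_1,\dots,E_n$ be the irreducible components of $E=\rho^{-1}(S)$, numbered such that $E_l\cap E_m=\emptyset$ if $|l-m|>1$ and $E_l\cap E_m\ne\emptyset$ if $|l-m|=1$.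 For $\mu\le\nu$ in $\{1,\dots,n\}$ put $E_{\mu\nu}=E_\mu\cup\dots\cup E_\nu$ (with its reduced structure) and let $\pi_{\mu\nu}:E_{\mu\nu}\to S$ be the restriction of $\rho$, and $N_{E_{\mu\nu}/Z}$ the normal sheaf. Then, for all $\mu\le\nu$, there is an isomorphism of $\mathcal O_S$-modules $$R^1(\pi_{\mu\nu})_*N_{E_{\mu\nu}/Z}\;\cong\;K .$$ -/

import Mathlib

open Topology Filter Set

noncomputable section

namespace TransversalAn

universe u v

/-! ### Reduced complex spaces as spaces with a sheaf of complex-valued functions -/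

/-- A sheaf of `ℂ`-algebras of complex-valued functions on a topological space, given by its
stalks: `𝒪 x` is the algebra of the functions `X → ℂ` that are holomorphic near `x` (only the germ
of the function at `x` matters). -/
class HolSpace (X : Type u) [TopologicalSpace X] where
  𝒪 : X → Subalgebra ℂ (X → ℂ)
  congr : ∀ {x : X} {f g : X → ℂ}, f ∈ 𝒪 x → f =ᶠ[𝓝 x] g → g ∈ 𝒪 x
  eventually : ∀ {x : X} {f : X → ℂ}, f ∈ 𝒪 x → ∀ᶠ y in 𝓝 x, f ∈ 𝒪 y

open HolSpace (𝒪)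

/-- The ring of the functions that are holomorphic near `x`. -/
def Stalk {X : Type u} [TopologicalSpace X] [HolSpace X] (x : X) : Type u := ↥(𝒪 x)

instance instCommRingStalk {X : Type u} [TopologicalSpace X] [HolSpace X] (x : X) :
    CommRing (Stalk x) :=
  inferInstanceAs (CommRing ↥(𝒪 x))

/-- A function that is holomorphic near `x` as an element of `Stalk x`. -/
def Stalk.mk {X : Type u} [TopologicalSpace X] [HolSpace X] {x : X} (f : X → ℂ) (h : f ∈ 𝒪 x) :
    Stalk x := ⟨f, h⟩

/-- The function `X → ℂ` underlying an element of `Stalk x`. -/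
def Stalk.fn {X : Type u} [TopologicalSpace X] [HolSpace X] {x : X} : Stalk x →+* (X → ℂ) :=
  (𝒪 x).subtype

lemma Stalk.fn_mem {X : Type u} [TopologicalSpace X] [HolSpace X] {x : X} (f : Stalk x) :
    f.fn ∈ 𝒪 x := f.2

/-- A complex normed space with its sheaf of analytic functions. -/
instance instHolSpaceNormed (V : Type u) [NormedAddCommGroup V] [NormedSpace ℂ V] : HolSpace V where
  𝒪 x :=
    { carrier := {f | AnalyticAt ℂ f x}
      mul_mem' := fun ha hb => AnalyticAt.mul ha hb
      add_mem' := fun ha hb => AnalyticAt.add ha hb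
      algebraMap_mem' := fun _ => analyticAt_const }
  congr hf h := AnalyticAt.congr hf h
  eventually hf := AnalyticAt.eventually_analyticAt hf

/-- A subset with the reduced induced structure: the functions that extend locally to the ambient
space. -/
instance instHolSpaceSubtype {X : Type u} [TopologicalSpace X] [HolSpace X] (A : Set X) :
    HolSpace A where
  𝒪 a :=
    { carrier := {f | ∃ F ∈ 𝒪 (a : X), ∀ᶠ b : A in 𝓝 a, f b = F b}
      mul_mem' := by
        rintro f g ⟨F, hF, hf⟩ ⟨G, hG, hg⟩
        refine ⟨F * G, mul_mem hF hG, ?_⟩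
        filter_upwards [hf, hg] with b h1 h2
        simp [h1, h2]
      add_mem' := by
        rintro f g ⟨F, hF, hf⟩ ⟨G, hG, hg⟩
        refine ⟨F + G, add_mem hF hG, ?_⟩
        filter_upwards [hf, hg] with b h1 h2
        simp [h1, h2]
      algebraMap_mem' := fun r =>
        ⟨algebraMap ℂ (X → ℂ) r, Subalgebra.algebraMap_mem _ r, Eventually.of_forall fun _ => rfl⟩ }
  congr := by
    rintro a f g ⟨F, hF, hf⟩ h
    refine ⟨F, hF, ?_⟩
    filter_upwards [hf, h] with b h1 h2
    rw [← h2, h1]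
  eventually := by
    rintro a f ⟨F, hF, hf⟩
    have h1 : ∀ᶠ b : A in 𝓝 a, F ∈ 𝒪 (b : X) :=
      continuous_subtype_val.continuousAt.eventually (HolSpace.eventually hF)
    filter_upwards [h1, hf.eventually_nhds] with b h2 h3
    exact ⟨F, h2, h3⟩

/-- Holomorphic maps. -/
structure HolMap (X : Type u) (Y : Type v) [TopologicalSpace X] [HolSpace X]
    [TopologicalSpace Y] [HolSpace Y] where
  toFun : X → Y
  continuous_toFun : Continuous toFun
  hol : ∀ (x : X) (f : Y → ℂ), f ∈ 𝒪 (toFun x) → f ∘ toFun ∈ 𝒪 x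

instance {X : Type u} {Y : Type v} [TopologicalSpace X] [HolSpace X]
    [TopologicalSpace Y] [HolSpace Y] : CoeFun (HolMap X Y) (fun _ => X → Y) := ⟨HolMap.toFun⟩

/-- The identity map. -/
def HolMap.id (X : Type u) [TopologicalSpace X] [HolSpace X] : HolMap X X where
  toFun x := x
  continuous_toFun := continuous_id
  hol _ _ hf := hf

/-- Composition of holomorphic maps. -/
def HolMap.comp {X Y Z : Type u} [TopologicalSpace X] [HolSpace X] [TopologicalSpace Y] [HolSpace Y]
    [TopologicalSpace Z] [HolSpace Z] (g : HolMap Y Z) (f : HolMap X Y) : HolMap X Z where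
  toFun x := g (f x)
  continuous_toFun := g.continuous_toFun.comp f.continuous_toFun
  hol x h hh := f.hol x (h ∘ g.toFun) (g.hol (f x) h hh)

/-- The restriction of a holomorphic map to subsets with their reduced structures. -/
def HolMap.restrict {X Y : Type u} [TopologicalSpace X] [HolSpace X] [TopologicalSpace Y]
    [HolSpace Y] (f : HolMap X Y) (A : Set X) (B : Set Y) (h : ∀ x ∈ A, f x ∈ B) : HolMap A B where
  toFun x := ⟨f x, h x x.2⟩
  continuous_toFun := (f.continuous_toFun.comp continuous_subtype_val).subtype_mk _
  hol := by
    rintro x g ⟨G, hG, hg⟩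
    refine ⟨G ∘ f.toFun, f.hol x G hG, ?_⟩
    have hc : Continuous fun x : A => (⟨f x, h x x.2⟩ : B) :=
      (f.continuous_toFun.comp continuous_subtype_val).subtype_mk _
    exact hc.continuousAt.eventually hg

/-- A homeomorphism between open subsets that identifies the sheaves of functions. -/
def IsBihol {X : Type u} {Y : Type v} [TopologicalSpace X] [HolSpace X]
    [TopologicalSpace Y] [HolSpace Y] (ψ : OpenPartialHomeomorph X Y) : Prop :=
  ∀ x ∈ ψ.source, ∀ f : Y → ℂ, f ∈ 𝒪 (ψ x) ↔ f ∘ ψ ∈ 𝒪 x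

/-- Near `x` the space is a complex manifold of dimension `d`. -/
def SmoothAt (d : ℕ) {X : Type u} [TopologicalSpace X] [HolSpace X] (x : X) : Prop :=
  ∃ ψ : OpenPartialHomeomorph X (Fin d → ℂ), x ∈ ψ.source ∧ IsBihol ψ

/-- The singular locus of a `d`-dimensional space. -/
def singularLocus (d : ℕ) (X : Type u) [TopologicalSpace X] [HolSpace X] : Set X :=
  {x | ¬ SmoothAt d x}

/-- The regular points of a subset `A` with its reduced structure. -/
def regLocus {X : Type u} [TopologicalSpace X] [HolSpace X] (A : Set X) : Set X :=
  {x | ∃ h : x ∈ A, ∃ m : ℕ, SmoothAt m (⟨x, h⟩ : A)}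

/-- The irreducible components of an analytic subset `A`: the closures (in `A`) of the connected
components of its regular locus. -/
def irredComponents {X : Type u} [TopologicalSpace X] [HolSpace X] (A : Set X) : Set (Set X) :=
  {C | ∃ x ∈ regLocus A, C = A ∩ closure (connectedComponentIn (regLocus A) x)}

/-- `h` is a section near `x` of the ideal sheaf of `A`: it is holomorphic at `x` and vanishes on
`A` near `x`. -/
def MemIdeal {X : Type u} [TopologicalSpace X] [HolSpace X] (A : Set X) (x : X) (h : X → ℂ) :
    Prop :=
  h ∈ 𝒪 x ∧ ∀ᶠ y in 𝓝 x, y ∈ A → h y = 0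

/-! ### Blow-ups -/

/-- The quotient topology on the projective space of lines in `ℂ^m`. -/
instance instTopologicalSpaceProj (m : ℕ) :
    TopologicalSpace (Projectivization ℂ (Fin m → ℂ)) :=
  TopologicalSpace.coinduced
    (fun w : {w : Fin m → ℂ // w ≠ 0} => Projectivization.mk ℂ w.1 w.2) inferInstance

/-- The ratios `ℓ_i / ℓ_j` of the homogeneous coordinates of `ℓ` (used where `ℓ_j ≠ 0`). -/
def affineCoord {m : ℕ} (j : Fin m) (ℓ : Projectivization ℂ (Fin m → ℂ)) : Fin m → ℂ :=
  fun i => ℓ.rep i / ℓ.rep j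

/-- `β : X' → X` is the blow-up of the reduced space `X` along (the reduced ideal of) `S`:
locally on `X`, if `f_0, …, f_r` generate the ideal of `S` over `V`, then `X'` over `V` is the
closure in `V × ℙ^r` of the graph of `[f_0 : … : f_r]` over `V ∖ S`, with its reduced structure. -/
def IsBlowUp {X' X : Type u} [TopologicalSpace X'] [HolSpace X'] [TopologicalSpace X] [HolSpace X]
    (S : Set X) (β : HolMap X' X) : Prop :=
  ∀ x : X, ∃ V : Set X, IsOpen V ∧ x ∈ V ∧
    ∃ (r : ℕ) (f : Fin (r + 1) → X → ℂ) (g : X' → Projectivization ℂ (Fin (r + 1) → ℂ)),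
      -- `f_0, …, f_r` generate the ideal sheaf of `S` on `V`
      (∀ y ∈ V, (∀ i, MemIdeal S y (f i)) ∧ ∀ h, MemIdeal S y h →
        ∃ c : Fin (r + 1) → X → ℂ, (∀ i, c i ∈ 𝒪 y) ∧ ∀ᶠ t in 𝓝 y, h t = ∑ i, c i t * f i t) ∧
      -- `(β, g)` identifies the part of `X'` over `V` with the closure of the graph
      IsEmbedding (fun p : β.toFun ⁻¹' V => (β p, g p)) ∧
      (fun p => (β p, g p)) '' (β.toFun ⁻¹' V) =
        closure {q : X × Projectivization ℂ (Fin (r + 1) → ℂ) |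
          q.1 ∈ V \ S ∧ ∃ h : (fun i => f i q.1) ≠ 0, q.2 = Projectivization.mk ℂ _ h}
          ∩ V ×ˢ univ ∧
      -- the functions on `X'` are the restrictions of the holomorphic functions on `V × ℙ^r`
      ∀ p ∈ β.toFun ⁻¹' V, ∀ h : X' → ℂ, h ∈ 𝒪 p ↔
        ∃ j, (g p).rep j ≠ 0 ∧ ∃ (m : ℕ) (a : Fin m → X → ℂ), (∀ i, a i ∈ 𝒪 (β p)) ∧
          ∃ F : (Fin m → ℂ) × (Fin (r + 1) → ℂ) → ℂ,
            AnalyticAt ℂ F (fun i => a i (β p), affineCoord j (g p)) ∧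
            ∀ᶠ p' in 𝓝 p, h p' = F (fun i => a i (β p'), affineCoord j (g p'))

/-- `ρ : Z → Y` is the composition of the successive blow-ups of the singular loci, starting with
the `d`-dimensional space `Y` and stopping as soon as the space is smooth. -/
inductive IsBlowUpResolution (d : ℕ) :
    ∀ (Z Y : Type u) [TopologicalSpace Z] [HolSpace Z] [TopologicalSpace Y] [HolSpace Y],
      HolMap Z Y → Prop
  | smooth (Y : Type u) [TopologicalSpace Y] [HolSpace Y] (h : singularLocus d Y = ∅) :
      IsBlowUpResolution d Y Y (HolMap.id Y)
  | step (Z Y₁ Y : Type u) [TopologicalSpace Z] [HolSpace Z] [TopologicalSpace Y₁] [HolSpace Y₁]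
      [TopologicalSpace Y] [HolSpace Y] (ρ : HolMap Z Y₁) (β : HolMap Y₁ Y)
      (h : (singularLocus d Y).Nonempty) (hβ : IsBlowUp (singularLocus d Y) β)
      (hρ : IsBlowUpResolution d Z Y₁ ρ) : IsBlowUpResolution d Z Y (β.comp ρ)

/-! ### Sheaves of modules and the first higher direct image -/

/-- The holomorphic functions on `U` (with arbitrary values outside `U`). -/
def holOn {X : Type u} [TopologicalSpace X] [HolSpace X] (U : Set X) : Subalgebra ℂ (X → ℂ) :=
  ⨅ x ∈ U, 𝒪 x

lemma mem_holOn {X : Type u} [TopologicalSpace X] [HolSpace X] {U : Set X} {f : X → ℂ} :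
    f ∈ holOn U ↔ ∀ x ∈ U, f ∈ 𝒪 x := by
  simp [holOn, Algebra.mem_iInf]

/-- The ring of the holomorphic functions on `U`. -/
def Sect {X : Type u} [TopologicalSpace X] [HolSpace X] (U : Set X) : Type u := ↥(holOn U)

instance instCommRingSect {X : Type u} [TopologicalSpace X] [HolSpace X] (U : Set X) :
    CommRing (Sect U) :=
  inferInstanceAs (CommRing ↥(holOn U))

/-- Restriction of functions on `U` to germs at a point of `U`. -/
def germ {X : Type u} [TopologicalSpace X] [HolSpace X] {U : Set X} (x : U) :
    Sect U →+* Stalk (x : X) :=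
  (Subalgebra.inclusion (S := holOn U) (T := 𝒪 (x : X))
    fun _ hf => mem_holOn.1 hf x x.2).toRingHom

/-- Evaluation at `x` of functions holomorphic at `x`. -/
def evalAt {X : Type u} [TopologicalSpace X] [HolSpace X] (x : X) : Stalk x →+* ℂ :=
  (Pi.evalRingHom (fun _ : X => ℂ) x).comp Stalk.fn

/-- A sheaf of `𝒪`-modules on `X` whose sections are (dependent) functions `x ↦ s x`, `s x` in an
`Stalk x`-module `Fib x`; `Hol x s` says that `s` is a section of the sheaf near `x`. -/
structure OMod (X : Type u) [TopologicalSpace X] [HolSpace X] where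
  Fib : X → Type u
  [addCommGroup : ∀ x, AddCommGroup (Fib x)]
  [module : ∀ x, Module (Stalk x) (Fib x)]
  Hol : X → (∀ x, Fib x) → Prop
  hol_congr : ∀ {x s t}, Hol x s → (∀ᶠ y in 𝓝 x, s y = t y) → Hol x t
  hol_zero : ∀ x, Hol x 0
  hol_add : ∀ {x s t}, Hol x s → Hol x t → Hol x (s + t)
  hol_smul : ∀ {x s} (f : X → ℂ), f ∈ 𝒪 x → Hol x s →
    ∃ t, Hol x t ∧ ∀ᶠ y in 𝓝 x, ∃ h : f ∈ 𝒪 y, t y = Stalk.mk f h • s y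

attribute [instance] OMod.addCommGroup OMod.module

section OMod

variable {X : Type u} [TopologicalSpace X] [HolSpace X]

/-- The fibre at a point of `U` as a module over the functions on `U`. -/
instance instModuleFib (M : OMod X) (U : Set X) (x : U) : Module (Sect U) (M.Fib x) :=
  Module.compHom (M.Fib x) (germ x)

lemma fib_smul_def (M : OMod X) (U : Set X) (x : U) (f : Sect U) (m : M.Fib x) :
    f • m = Stalk.mk f.1 (mem_holOn.1 f.2 x x.2) • m := rfl

/-- The module of sections over an open set `U`. -/
def OMod.Γ (M : OMod X) (U : TopologicalSpace.Opens X) :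
    Submodule (Sect (U : Set X)) (∀ x : (U : Set X), M.Fib x) where
  carrier := {s | ∀ x : (U : Set X), ∃ t, M.Hol x t ∧ ∀ᶠ y : (U : Set X) in 𝓝 x, s y = t y}
  add_mem' := by
    intro a b ha hb x
    obtain ⟨s, hs, h1⟩ := ha x
    obtain ⟨t, ht, h2⟩ := hb x
    refine ⟨s + t, M.hol_add hs ht, ?_⟩
    filter_upwards [h1, h2] with y h3 h4
    simp [h3, h4]
  zero_mem' := fun x => ⟨0, M.hol_zero x, Eventually.of_forall fun _ => rfl⟩
  smul_mem' := by
    intro f a ha x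
    obtain ⟨s, hs, h1⟩ := ha x
    obtain ⟨t, ht, h2⟩ := M.hol_smul f.1 (mem_holOn.1 f.2 x x.2) hs
    refine ⟨t, ht, ?_⟩
    have h3 := continuous_subtype_val.continuousAt.eventually h2
    filter_upwards [h1, h3] with y h4 h5
    obtain ⟨h6, h7⟩ := h5
    rw [Pi.smul_apply, h4, h7, fib_smul_def]

/-- An isomorphism of sheaves of `𝒪`-modules: an `𝒪(U)`-linear bijection between the sections over
every open `U`, compatible with restriction. -/
structure OMod.Iso (M N : OMod X) where
  toEquiv : ∀ U : TopologicalSpace.Opens X, M.Γ U ≃ₗ[Sect (U : Set X)] N.Γ U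
  restrict : ∀ (U V : TopologicalSpace.Opens X) (h : V ≤ U) (s : M.Γ U) (t : M.Γ V),
    (∀ x : (V : Set X), t.1 x = s.1 ⟨x, h x.2⟩) →
      ∀ x : (V : Set X), (toEquiv V t).1 x = (toEquiv U s).1 ⟨x, h x.2⟩

end OMod

/-- A sheaf of `𝒪`-modules whose sections are determined by their values in complex vector spaces
`Fib x`, with functions acting by pointwise multiplication. -/
structure ValSheaf (X : Type u) [TopologicalSpace X] [HolSpace X] where
  Fib : X → Type u
  [addCommGroup : ∀ x, AddCommGroup (Fib x)]
  [module : ∀ x, Module ℂ (Fib x)]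
  Hol : X → (∀ x, Fib x) → Prop
  hol_congr : ∀ {x s t}, Hol x s → (∀ᶠ y in 𝓝 x, s y = t y) → Hol x t
  hol_zero : ∀ x, Hol x 0
  hol_add : ∀ {x s t}, Hol x s → Hol x t → Hol x (s + t)
  hol_smul : ∀ {x s} (f : X → ℂ), f ∈ 𝒪 x → Hol x s → Hol x (fun y => f y • s y)

attribute [instance] ValSheaf.addCommGroup ValSheaf.module

section ValSheaf

variable {X : Type u} [TopologicalSpace X] [HolSpace X]

/-- The underlying sheaf of `𝒪`-modules. -/
def ValSheaf.toOMod (F : ValSheaf X) : OMod X where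
  Fib := F.Fib
  module x := Module.compHom (F.Fib x) (evalAt x)
  Hol := F.Hol
  hol_congr := F.hol_congr
  hol_zero := F.hol_zero
  hol_add := F.hol_add
  hol_smul f hf hs := by
    refine ⟨_, F.hol_smul f hf hs, ?_⟩
    filter_upwards [HolSpace.eventually hf] with y hy
    exact ⟨hy, rfl⟩

/-- `F` is a line bundle: near every point there is a section `e`, nowhere zero, that spans every
fibre, and the sections are the multiples of `e` by holomorphic functions. -/
def ValSheaf.IsLineBundle (F : ValSheaf X) : Prop :=
  ∀ x : X, ∃ U : Set X, IsOpen U ∧ x ∈ U ∧ ∃ e : ∀ y, F.Fib y,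
    ∀ y ∈ U, F.Hol y e ∧ e y ≠ 0 ∧ (∀ a : F.Fib y, ∃ c : ℂ, a = c • e y) ∧
      ∀ s, F.Hol y s → ∃ f ∈ 𝒪 y, ∀ᶠ t in 𝓝 y, s t = f t • e t

end ValSheaf


/-- A choice of an open neighbourhood `𝒰 p ⊆ W` of every point `p` of `W`: an open covering of `W`
indexed by the points of `W`. -/
def IsNhdCover {X : Type u} [TopologicalSpace X] (W : Set X) (𝒰 : X → Set X) : Prop :=
  ∀ p ∈ W, IsOpen (𝒰 p) ∧ p ∈ 𝒰 p ∧ 𝒰 p ⊆ W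

lemma IsNhdCover.inter {X : Type u} [TopologicalSpace X] {W W' : Set X} {𝒰 𝒱 : X → Set X}
    (h : IsNhdCover W 𝒰) (h' : IsNhdCover W' 𝒱) : IsNhdCover (W ∩ W') fun p => 𝒰 p ∩ 𝒱 p := fun p hp =>
  ⟨(h p hp.1).1.inter (h' p hp.2).1, ⟨(h p hp.1).2.1, (h' p hp.2).2.1⟩,
    inter_subset_inter (h p hp.1).2.2 (h' p hp.2).2.2⟩

lemma isNhdCover_of_isOpen {X : Type u} [TopologicalSpace X] {W : Set X} (h : IsOpen W) :
    IsNhdCover W fun _ => W :=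
  fun _ hp => ⟨h, hp, Subset.rfl⟩

section R1

variable {X S : Type u} [TopologicalSpace X] [HolSpace X] [TopologicalSpace S] [HolSpace S]

/-- `c` is a Čech `1`-cocycle of `F` on `W` for some covering of `W`. -/
def IsCocycle (F : ValSheaf X) (W : Set X) (c : X → X → ∀ x, F.Fib x) : Prop :=
  ∃ 𝒰, IsNhdCover W 𝒰 ∧
    (∀ p ∈ W, ∀ q ∈ W, ∀ x ∈ 𝒰 p ∩ 𝒰 q, F.Hol x (c p q)) ∧
    ∀ p ∈ W, ∀ q ∈ W, ∀ r ∈ W, ∀ x ∈ 𝒰 p ∩ 𝒰 q ∩ 𝒰 r, c p q x + c q r x = c p r x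

/-- `c` is a Čech `1`-coboundary of `F` on `W` for some covering of `W`. -/
def IsCoboundary (F : ValSheaf X) (W : Set X) (c : X → X → ∀ x, F.Fib x) : Prop :=
  ∃ 𝒰, IsNhdCover W 𝒰 ∧ ∃ b : X → ∀ x, F.Fib x,
    (∀ p ∈ W, ∀ x ∈ 𝒰 p, F.Hol x (b p)) ∧
    ∀ p ∈ W, ∀ q ∈ W, ∀ x ∈ 𝒰 p ∩ 𝒰 q, c p q x = b q x - b p x

lemma IsCocycle.mono {F : ValSheaf X} {W W' : Set X} {c : X → X → ∀ x, F.Fib x}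
    (h : IsCocycle F W c) (hW : IsOpen W') (hs : W' ⊆ W) : IsCocycle F W' c := by
  obtain ⟨𝒰, h𝒰, h1, h2⟩ := h
  refine ⟨fun p => 𝒰 p ∩ W', ?_, ?_, ?_⟩
  · have := h𝒰.inter (isNhdCover_of_isOpen hW)
    rwa [inter_eq_right.2 hs] at this
  · exact fun p hp q hq x hx => h1 p (hs hp) q (hs hq) x ⟨hx.1.1, hx.2.1⟩
  · exact fun p hp q hq r hr x hx =>
      h2 p (hs hp) q (hs hq) r (hs hr) x ⟨⟨hx.1.1.1, hx.1.2.1⟩, hx.2.1⟩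

lemma isCocycle_zero (F : ValSheaf X) {W : Set X} (hW : IsOpen W) : IsCocycle F W 0 :=
  ⟨_, isNhdCover_of_isOpen hW, fun _ _ _ _ x _ => F.hol_zero x,
    fun _ _ _ _ _ _ x _ => by simp⟩

lemma IsCocycle.add {F : ValSheaf X} {W W' : Set X} {c c' : X → X → ∀ x, F.Fib x}
    (h : IsCocycle F W c) (h' : IsCocycle F W' c') : IsCocycle F (W ∩ W') (c + c') := by
  obtain ⟨𝒰, h𝒰, h1, h2⟩ := h
  obtain ⟨𝒱, h𝒱, h3, h4⟩ := h'
  refine ⟨_, h𝒰.inter h𝒱, ?_, ?_⟩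
  · exact fun p hp q hq x hx => F.hol_add (h1 p hp.1 q hq.1 x ⟨hx.1.1, hx.2.1⟩)
      (h3 p hp.2 q hq.2 x ⟨hx.1.2, hx.2.2⟩)
  · intro p hp q hq r hr x hx
    have e1 := h2 p hp.1 q hq.1 r hr.1 x ⟨⟨hx.1.1.1, hx.1.2.1⟩, hx.2.1⟩
    have e2 := h4 p hp.2 q hq.2 r hr.2 x ⟨⟨hx.1.1.2, hx.1.2.2⟩, hx.2.2⟩
    simp only [Pi.add_apply, ← e1, ← e2]
    abel

lemma IsCocycle.smul {F : ValSheaf X} {W : Set X} {c : X → X → ∀ x, F.Fib x}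
    (h : IsCocycle F W c) (f : X → ℂ) (hf : ∀ x ∈ W, f ∈ 𝒪 x) :
    IsCocycle F W fun p q x => f x • c p q x := by
  obtain ⟨𝒰, h𝒰, h1, h2⟩ := h
  refine ⟨𝒰, h𝒰, ?_, ?_⟩
  · exact fun p hp q hq x hx => F.hol_smul f (hf x ((h𝒰 p hp).2.2 hx.1)) (h1 p hp q hq x hx)
  · intro p hp q hq r hr x hx
    simp only [← h2 p hp q hq r hr x hx, smul_add]

lemma isCoboundary_zero (F : ValSheaf X) {W : Set X} (hW : IsOpen W) : IsCoboundary F W 0 :=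
  ⟨_, isNhdCover_of_isOpen hW, 0, fun _ _ x _ => F.hol_zero x, fun _ _ _ _ x _ => by simp⟩

lemma IsCoboundary.add {F : ValSheaf X} {W W' : Set X} {c c' : X → X → ∀ x, F.Fib x}
    (h : IsCoboundary F W c) (h' : IsCoboundary F W' c') :
    IsCoboundary F (W ∩ W') (c + c') := by
  obtain ⟨𝒰, h𝒰, b, h1, h2⟩ := h
  obtain ⟨𝒱, h𝒱, b', h3, h4⟩ := h'
  refine ⟨_, h𝒰.inter h𝒱, b + b', ?_, ?_⟩
  · exact fun p hp x hx => F.hol_add (h1 p hp.1 x hx.1) (h3 p hp.2 x hx.2)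
  · intro p hp q hq x hx
    have e1 := h2 p hp.1 q hq.1 x ⟨hx.1.1, hx.2.1⟩
    have e2 := h4 p hp.2 q hq.2 x ⟨hx.1.2, hx.2.2⟩
    simp only [Pi.add_apply, e1, e2]
    abel

lemma IsCoboundary.smul {F : ValSheaf X} {W : Set X} {c : X → X → ∀ x, F.Fib x}
    (h : IsCoboundary F W c) (f : X → ℂ) (hf : ∀ x ∈ W, f ∈ 𝒪 x) :
    IsCoboundary F W fun p q x => f x • c p q x := by
  obtain ⟨𝒰, h𝒰, b, h1, h2⟩ := h
  refine ⟨𝒰, h𝒰, fun p x => f x • b p x, ?_, ?_⟩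
  · exact fun p hp x hx => F.hol_smul f (hf x ((h𝒰 p hp).2.2 hx)) (h1 p hp x hx)
  · intro p hp q hq x hx
    simp only [h2 p hp q hq x hx, smul_sub]

lemma IsCoboundary.mono {F : ValSheaf X} {W W' : Set X} {c : X → X → ∀ x, F.Fib x}
    (h : IsCoboundary F W c) (hW : IsOpen W') (hs : W' ⊆ W) : IsCoboundary F W' c := by
  obtain ⟨𝒰, h𝒰, b, h1, h2⟩ := h
  refine ⟨fun p => 𝒰 p ∩ W', ?_, b, ?_, ?_⟩
  · have := h𝒰.inter (isNhdCover_of_isOpen hW)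
    rwa [inter_eq_right.2 hs] at this
  · exact fun p hp x hx => h1 p (hs hp) x hx.1
  · exact fun p hp q hq x hx => h2 p (hs hp) q (hs hq) x ⟨hx.1.1, hx.2.1⟩

variable (π : HolMap X S) (F : ValSheaf X)

/-- The families `c p q` of (arbitrary) sections of `F`, as a module over the functions on `S`
that are holomorphic at `s`, which act through `π`. -/
def Cochain (_π : HolMap X S) (F : ValSheaf X) (_s : S) : Type u := X → X → ∀ x, F.Fib x

instance instAddCommGroupCochain (s : S) : AddCommGroup (Cochain π F s) :=
  inferInstanceAs (AddCommGroup (X → X → ∀ x, F.Fib x))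

instance instModuleCochain (s : S) : Module (Stalk s) (Cochain π F s) where
  smul f c := fun p q x => f.fn (π x) • c p q x
  one_smul c := by funext p q x; exact one_smul ℂ (c p q x)
  mul_smul f g c := by funext p q x; exact mul_smul (f.fn (π x)) (g.fn (π x)) (c p q x)
  smul_zero f := by funext p q x; exact smul_zero (f.fn (π x))
  smul_add f c d := by funext p q x; exact smul_add (f.fn (π x)) (c p q x) (d p q x)
  add_smul f g c := by funext p q x; exact add_smul (f.fn (π x)) (g.fn (π x)) (c p q x)
  zero_smul c := by funext p q x; exact zero_smul ℂ (c p q x)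

lemma exists_open_holOn {s : S} {f : S → ℂ} (hf : f ∈ 𝒪 s) :
    ∃ U : Set S, IsOpen U ∧ s ∈ U ∧ ∀ x ∈ π.toFun ⁻¹' U, (fun x => f (π x)) ∈ 𝒪 x := by
  obtain ⟨U, hU, h1, h2⟩ := eventually_nhds_iff.1 (HolSpace.eventually hf)
  exact ⟨U, h1, h2, fun x hx => π.hol x f (hU _ hx)⟩

/-- The Čech `1`-cocycles of `F` on `π⁻¹(U)`, for some neighbourhood `U` of `s`. -/
def cocyclesAt (s : S) : Submodule (Stalk s) (Cochain π F s) where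
  carrier := {c | ∃ U : Set S, IsOpen U ∧ s ∈ U ∧ IsCocycle F (π.toFun ⁻¹' U) c}
  add_mem' := by
    rintro a b ⟨U, hU, hs, h⟩ ⟨V, hV, hs', h'⟩
    exact ⟨U ∩ V, hU.inter hV, ⟨hs, hs'⟩, h.add h'⟩
  zero_mem' := ⟨univ, isOpen_univ, trivial, isCocycle_zero F isOpen_univ⟩
  smul_mem' := by
    rintro f c ⟨U, hU, hs, h⟩
    obtain ⟨V, hV, hs', hf⟩ := exists_open_holOn π f.fn_mem
    refine ⟨U ∩ V, hU.inter hV, ⟨hs, hs'⟩, ?_⟩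
    exact (h.mono ((hU.inter hV).preimage π.continuous_toFun)
      (preimage_mono inter_subset_left)).smul _ fun x hx => hf x hx.2

/-- The Čech `1`-coboundaries of `F` on `π⁻¹(U)`, for some neighbourhood `U` of `s`. -/
def coboundariesAt (s : S) : Submodule (Stalk s) (Cochain π F s) where
  carrier := {c | ∃ U : Set S, IsOpen U ∧ s ∈ U ∧ IsCoboundary F (π.toFun ⁻¹' U) c}
  add_mem' := by
    rintro a b ⟨U, hU, hs, h⟩ ⟨V, hV, hs', h'⟩
    exact ⟨U ∩ V, hU.inter hV, ⟨hs, hs'⟩, h.add h'⟩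
  zero_mem' := ⟨univ, isOpen_univ, trivial, isCoboundary_zero F isOpen_univ⟩
  smul_mem' := by
    rintro f c ⟨U, hU, hs, h⟩
    obtain ⟨V, hV, hs', hf⟩ := exists_open_holOn π f.fn_mem
    refine ⟨U ∩ V, hU.inter hV, ⟨hs, hs'⟩, ?_⟩
    exact (h.mono ((hU.inter hV).preimage π.continuous_toFun)
      (preimage_mono inter_subset_left)).smul _ fun x hx => hf x hx.2

/-- The stalk at `s` of `R¹π_* F`: the direct limit of the Čech cohomology groups
`H¹(π⁻¹(U), F)` over the neighbourhoods `U` of `s` (on every topological space the Čech `H¹`,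
taken over all coverings, is the sheaf cohomology `H¹`). -/
abbrev R1Stalk (s : S) : Type u :=
  cocyclesAt π F s ⧸ (coboundariesAt π F s).submoduleOf (cocyclesAt π F s)

/-- The class in the stalk at `s` of a cocycle on `π⁻¹(U)`, for `s ∈ U`. -/
def R1class {U : Set S} (hU : IsOpen U) {c : X → X → ∀ x, F.Fib x}
    (hc : IsCocycle F (π.toFun ⁻¹' U) c) (s : U) : R1Stalk π F s :=
  Submodule.Quotient.mk ⟨c, U, hU, s.2, hc⟩

/-- The first higher direct image `R¹π_* F`, the sheaf associated with
`U ↦ H¹(π⁻¹(U), F)`: its sections are the families of elements of the stalks that are locally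
given by one Čech class on some `π⁻¹(U)`. -/
def R1 : OMod S where
  Fib s := R1Stalk π F s
  Hol s σ := ∃ (U : Set S) (hU : IsOpen U) (c : X → X → ∀ x, F.Fib x)
    (hc : IsCocycle F (π.toFun ⁻¹' U) c), s ∈ U ∧ ∀ t : U, σ t = R1class π F hU hc t
  hol_congr := by
    rintro s σ τ ⟨U, hU, c, hc, hs, h⟩ he
    obtain ⟨V, hV, h1, h2⟩ := eventually_nhds_iff.1 he
    refine ⟨U ∩ V, hU.inter h1, c, hc.mono
      ((hU.inter h1).preimage π.continuous_toFun) (preimage_mono inter_subset_left), ⟨hs, h2⟩, ?_⟩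
    intro t
    rw [← hV t t.2.2]
    exact h ⟨t, t.2.1⟩
  hol_zero s := ⟨univ, isOpen_univ, 0, isCocycle_zero F isOpen_univ, trivial, fun t => rfl⟩
  hol_add := by
    rintro s σ τ ⟨U, hU, c, hc, hs, h⟩ ⟨V, hV, c', hc', hs', h'⟩
    refine ⟨U ∩ V, hU.inter hV, c + c', hc.add hc', ⟨hs, hs'⟩, fun t => ?_⟩
    have h1 := h ⟨t, t.2.1⟩
    have h2 := h' ⟨t, t.2.2⟩
    simp only at h1 h2
    rw [Pi.add_apply, h1, h2]
    rfl
  hol_smul := by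
    rintro s σ f hf ⟨U, hU, c, hc, hs, h⟩
    obtain ⟨V, hV, hs', hfV⟩ := exists_open_holOn π hf
    have hc' : IsCocycle F (π.toFun ⁻¹' (U ∩ V)) fun p q x => f (π x) • c p q x :=
      (hc.mono ((hU.inter hV).preimage π.continuous_toFun)
        (preimage_mono inter_subset_left)).smul _ fun x hx => hfV x hx.2
    classical
    refine ⟨fun t => if h1 : t ∈ U ∩ V then R1class π F (hU.inter hV) hc' ⟨t, h1⟩ else 0,
      ⟨U ∩ V, hU.inter hV, _, hc', ⟨hs, hs'⟩, fun t => dif_pos t.2⟩, ?_⟩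
    filter_upwards [HolSpace.eventually hf, (hU.inter hV).mem_nhds ⟨hs, hs'⟩] with t h1 ht
    refine ⟨h1, ?_⟩
    have h2 := h ⟨t, ht.1⟩
    simp only at h2
    rw [dif_pos ht, h2]
    rfl

end R1

/-! ### The normal sheaf -/

section Normal

variable {Z : Type u} [TopologicalSpace Z] [HolSpace Z] (A : Set Z)

/-- The `𝒪_p`-linear maps from the stalk at `p` of the ideal sheaf of `A` to the residue field `ℂ`
at `p` (extended by zero to functions that are not in the ideal). -/
def normalFib (p : Z) : Submodule ℂ ((Z → ℂ) → ℂ) where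
  carrier := {l | (∀ h, ¬ MemIdeal A p h → l h = 0) ∧
    (∀ h h', MemIdeal A p h → MemIdeal A p h' → l (h + h') = l h + l h') ∧
    ∀ f h, f ∈ 𝒪 p → MemIdeal A p h → l (f * h) = f p * l h}
  add_mem' := by
    rintro l m ⟨h1, h2, h3⟩ ⟨h4, h5, h6⟩
    refine ⟨fun h hh => ?_, fun h h' hh hh' => ?_, fun f h hf hh => ?_⟩
    · simp [h1 h hh, h4 h hh]
    · simp only [Pi.add_apply, h2 h h' hh hh', h5 h h' hh hh']; ring
    · simp only [Pi.add_apply, h3 f h hf hh, h6 f h hf hh]; ring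
  zero_mem' := ⟨fun _ _ => rfl, fun _ _ _ _ => by simp, fun _ _ _ _ => by simp⟩
  smul_mem' := by
    rintro c l ⟨h1, h2, h3⟩
    refine ⟨fun h hh => ?_, fun h h' hh hh' => ?_, fun f h hf hh => ?_⟩
    · simp [h1 h hh]
    · simp only [Pi.smul_apply, smul_eq_mul, h2 h h' hh hh']; ring
    · simp only [Pi.smul_apply, smul_eq_mul, h3 f h hf hh]; ring

/-- The normal sheaf `N_{A/Z} = ℋom(I/I², 𝒪_A) = ℋom_{𝒪_Z}(I, 𝒪_A)` of `A` in `Z`, `I` the ideal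
sheaf of `A`. A homomorphism `ν` from `I` to the sheaf `𝒪_A` of functions is the family of the
functionals `h ↦ ν(h)(p)`, for `p ∈ A`, on the stalks of `I`. -/
def normalSheaf : ValSheaf A where
  Fib p := normalFib A (p : Z)
  Hol p σ := ∀ h, MemIdeal A (p : Z) h → (fun q => (σ q).1 h) ∈ 𝒪 p
  hol_congr := by
    intro p s t hs he h hh
    refine HolSpace.congr (hs h hh) ?_
    filter_upwards [he] with q hq
    rw [hq]
  hol_zero := fun p _ _ => zero_mem (𝒪 p)
  hol_add := fun hs ht h hh => add_mem (hs h hh) (ht h hh)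
  hol_smul := fun _ hf hs h hh => mul_mem hf (hs h hh)

end Normal

/-! ### Transversal `A_n` singularities and their orbifold structure -/

/-- The model `ℂ^k × R`, where `R` is the surface `x y = z^(n+1)` in `ℂ³`. -/
def AModel (n k : ℕ) : Set ((Fin k → ℂ) × ℂ × ℂ × ℂ) :=
  {p | p.2.1 * p.2.2.1 = p.2.2.2 ^ (n + 1)}

/-- A local isomorphism of the pair (singular locus, `Y`) with `(ℂ^k × {0}, ℂ^k × R)`. -/
structure AChart (n k : ℕ) (Y : Type u) [TopologicalSpace Y] [HolSpace Y] where
  ψ : OpenPartialHomeomorph Y (AModel n k)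
  bihol : IsBihol ψ
  core : ∀ y ∈ ψ.source, y ∈ singularLocus (k + 2) Y ↔ (ψ y : (Fin k → ℂ) × ℂ × ℂ × ℂ).2 = 0

/-- `Y` has transversal `A_n` singularities (and dimension `k + 2`): the singular locus is
connected and near its points the pair (singular locus, `Y`) is isomorphic to
`(ℂ^k × {0}, ℂ^k × R)`. -/
structure IsTransversalA (n k : ℕ) (Y : Type u) [TopologicalSpace Y] [HolSpace Y] : Prop where
  connected : IsConnected (singularLocus (k + 2) Y)
  local_model : ∀ y ∈ singularLocus (k + 2) Y, ∃ a : AChart n k Y, y ∈ a.ψ.source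

/-- The quotient map `ℂ^k × ℂ² → ℂ^k × R` by the group of `(n+1)`-th roots of unity. -/
def quotMap (n k : ℕ) (p : (Fin k → ℂ) × ℂ × ℂ) : AModel n k :=
  ⟨(p.1, p.2.1 ^ (n + 1), p.2.2 ^ (n + 1), p.2.1 * p.2.2), by
    simp only [AModel, mem_ofPred_eq]; rw [mul_pow]⟩

/-- The action of a root of unity on `ℂ^k × ℂ²`. -/
def rootAct {k : ℕ} (ζ : ℂ) (p : (Fin k → ℂ) × ℂ × ℂ) : (Fin k → ℂ) × ℂ × ℂ :=
  (p.1, ζ * p.2.1, ζ⁻¹ * p.2.2)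

section Orbifold

variable {n k : ℕ} {Y : Type u} [TopologicalSpace Y] [HolSpace Y]

/-- The domain of the orbifold chart, an open subset of `ℂ^k × ℂ²`. -/
def AChart.dom (a : AChart n k Y) : Set ((Fin k → ℂ) × ℂ × ℂ) := quotMap n k ⁻¹' a.ψ.target

/-- The map `χ` from the domain of the orbifold chart to `Y`. -/
def AChart.χ (a : AChart n k Y) (p : (Fin k → ℂ) × ℂ × ℂ) : Y := a.ψ.symm (quotMap n k p)

/-- The point of the fixed locus of the chart over the point `y` of the singular locus. -/
def AChart.lift (a : AChart n k Y) (y : Y) : (Fin k → ℂ) × ℂ × ℂ :=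
  ((a.ψ y : (Fin k → ℂ) × ℂ × ℂ × ℂ).1, 0, 0)

/-- `φ` is (near `p`) a local isomorphism between the charts `a` and `b` over `Y`, an arrow of the
orbifold groupoid with source `p` and target `φ p`. -/
structure IsArrow (a b : AChart n k Y) (p : (Fin k → ℂ) × ℂ × ℂ)
    (φ : (Fin k → ℂ) × ℂ × ℂ → (Fin k → ℂ) × ℂ × ℂ) : Prop where
  source : p ∈ a.dom
  target : φ p ∈ b.dom
  analytic : AnalyticAt ℂ φ p
  invertible : (fderiv ℂ φ p).IsInvertible
  comm : ∀ᶠ x in 𝓝 p, b.χ (φ x) = a.χ x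

/-- The charts in `𝒜` define the orbifold structure of `Y` near the singular locus. -/
structure IsOrbifoldAtlas (𝒜 : Set (AChart n k Y)) : Prop where
  cover : ∀ y ∈ singularLocus (k + 2) Y, ∃ a ∈ 𝒜, y ∈ a.ψ.source
  arrows : ∀ a ∈ 𝒜, ∀ b ∈ 𝒜, ∀ p ∈ a.dom, ∀ p' ∈ b.dom, a.χ p = b.χ p' →
    ∃ φ, IsArrow a b p φ ∧ φ p = p'

/-- A section over the singular locus `S` of the covering of `S` by the sectors, whose fibre over
`y` is the local group at `y`: in the chart `a` it is the element `σ a y` of the group of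
`(n+1)`-th roots of unity; it is locally constant, and an arrow `φ` identifies `g` with
`φ ∘ g ∘ φ⁻¹`. -/
structure IsSectorSection (𝒜 : Set (AChart n k Y)) (σ : AChart n k Y → Y → ℂ) : Prop where
  root : ∀ a ∈ 𝒜, ∀ y ∈ singularLocus (k + 2) Y, y ∈ a.ψ.source → σ a y ^ (n + 1) = 1
  locally_const : ∀ a ∈ 𝒜, ∀ y ∈ singularLocus (k + 2) Y, y ∈ a.ψ.source →
    ∀ᶠ y' in 𝓝[singularLocus (k + 2) Y] y, σ a y' = σ a y
  compat : ∀ a ∈ 𝒜, ∀ b ∈ 𝒜, ∀ y ∈ singularLocus (k + 2) Y, y ∈ a.ψ.source → ∀ φ,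
    IsArrow a b (a.lift y) φ →
      ∀ᶠ x in 𝓝 (a.lift y), φ (rootAct (σ a y) x) = rootAct (σ b y) (φ x)

/-- The covering of the (connected) singular locus by the sectors has trivial monodromy: through
every point of the covering there is a global section. -/
def TrivialMonodromy (𝒜 : Set (AChart n k Y)) : Prop :=
  ∀ a ∈ 𝒜, ∀ y ∈ singularLocus (k + 2) Y, y ∈ a.ψ.source → ∀ ζ : ℂ, ζ ^ (n + 1) = 1 →
    ∃ σ, IsSectorSection 𝒜 σ ∧ σ a y = ζ

/-- The identifications of the local groups at the points of the singular locus with the group of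
`(n+1)`-th roots of unity that are given by the charts in `𝒜` are compatible with the orbifold
structure: `φ ∘ g ∘ φ⁻¹ = g` for all arrows `φ`. -/
def TrivializesMonodromy (𝒜 : Set (AChart n k Y)) : Prop :=
  ∀ a ∈ 𝒜, ∀ b ∈ 𝒜, ∀ y ∈ singularLocus (k + 2) Y, y ∈ a.ψ.source → ∀ φ,
    IsArrow a b (a.lift y) φ → ∀ ζ : ℂ, ζ ^ (n + 1) = 1 →
      ∀ᶠ x in 𝓝 (a.lift y), φ (rootAct ζ x) = rootAct ζ (φ x)

/-- For a local isomorphism `φ` between charts, with components `F, G` in the directions of the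
coordinates `u, v` of `ℂ²`, the derivative of `φ` on the normal space of the fixed locus at `p` is
the matrix `(∂F/∂u, ∂F/∂v; ∂G/∂u, ∂G/∂v)`. -/
def normalDeriv (φ : (Fin k → ℂ) × ℂ × ℂ → (Fin k → ℂ) × ℂ × ℂ) (p : (Fin k → ℂ) × ℂ × ℂ) :
    Matrix (Fin 2) (Fin 2) ℂ :=
  !![(fderiv ℂ φ p (0, 1, 0)).2.1, (fderiv ℂ φ p (0, 0, 1)).2.1;
     (fderiv ℂ φ p (0, 1, 0)).2.2, (fderiv ℂ φ p (0, 0, 1)).2.2]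

/-- The fibre at `s` of the sheaf `descend` below. -/
def descendFib (𝒜 : Set (AChart n k Y)) (J : Matrix (Fin 2) (Fin 2) ℂ → ℂ) (s : Y) :
    Submodule ℂ ({a : AChart n k Y // a ∈ 𝒜 ∧ s ∈ a.ψ.source} → ℂ) where
  carrier := {σ | ∀ a b φ, IsArrow a.1 b.1 (a.1.lift s) φ →
    σ b = J (normalDeriv φ (a.1.lift s)) * σ a}
  add_mem' := by
    intro σ τ h1 h2 a b φ hφ
    simp only [Pi.add_apply, h1 a b φ hφ, h2 a b φ hφ, mul_add]
  zero_mem' := by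
    intro a b φ _
    simp
  smul_mem' := by
    intro c σ h a b φ hφ
    simp only [Pi.smul_apply, smul_eq_mul, h a b φ hφ]
    ring

/-- The sheaf on the singular locus `S` obtained by descent (push-forward along `[S] → S`) from the
orbifold line bundle on `[S]` that is trivialized by a frame on the fixed locus of every chart
and on which an arrow with normal derivative `D` acts by multiplication with `J D`. Its sections
are the families of functions `σ_a`, one for every chart `a`, with `σ_b = J D · σ_a` for every
arrow from `a` to `b`. -/
def descend (𝒜 : Set (AChart n k Y)) (J : Matrix (Fin 2) (Fin 2) ℂ → ℂ) :
    ValSheaf (singularLocus (k + 2) Y) where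
  Fib s := descendFib 𝒜 J (s : Y)
  Hol s σ := ∀ (a : AChart n k Y) (ha : a ∈ 𝒜), (s : Y) ∈ a.ψ.source →
    ∃ f ∈ 𝒪 s, ∀ᶠ t : singularLocus (k + 2) Y in 𝓝 s, ∀ ht : (t : Y) ∈ a.ψ.source,
      (σ t).1 ⟨a, ha, ht⟩ = f t
  hol_congr := by
    intro s σ τ hσ he a ha hs
    obtain ⟨f, hf, h⟩ := hσ a ha hs
    refine ⟨f, hf, ?_⟩
    filter_upwards [h, he] with t h1 h2 ht
    rw [← h2, h1 ht]
  hol_zero s a ha hs := ⟨0, zero_mem _, Eventually.of_forall fun _ _ => rfl⟩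
  hol_add := by
    intro s σ τ hσ hτ a ha hs
    obtain ⟨f, hf, h⟩ := hσ a ha hs
    obtain ⟨g, hg, h'⟩ := hτ a ha hs
    refine ⟨f + g, add_mem hf hg, ?_⟩
    filter_upwards [h, h'] with t h1 h2 ht
    exact congrArg₂ (· + ·) (h1 ht) (h2 ht)
  hol_smul := by
    intro s σ g hg hσ a ha hs
    obtain ⟨f, hf, h⟩ := hσ a ha hs
    refine ⟨g * f, mul_mem hg hf, ?_⟩
    filter_upwards [h] with t h1 ht
    exact congrArg (g t * ·) (h1 ht)

/-- The line bundle `K` on the singular locus `S`, for `n ≥ 2`, obtained by descent from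
`[N]^𝔤 ⊗ [N]^(𝔤⁻¹)`. Here `[N]` is the normal bundle of `[S]` in `[Y]`; on the fixed locus of a chart
it has the frame `∂/∂u, ∂/∂v`, on which a root of unity `ζ` acts by `ζ, ζ⁻¹`, so `∂/∂u` is a frame of
`[N]^𝔤` and `∂/∂v` of `[N]^(𝔤⁻¹)`. An arrow acts on the frame `∂/∂u ⊗ ∂/∂v` by the multiplication
with `(∂F/∂u) (∂G/∂v)`. -/
def bundleK (𝒜 : Set (AChart n k Y)) : ValSheaf (singularLocus (k + 2) Y) :=
  descend 𝒜 fun D => D 0 0 * D 1 1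

/-- The line bundle on the singular locus `S` obtained by descent from `⋀² [N]`. -/
def bundleDetN (𝒜 : Set (AChart n k Y)) : ValSheaf (singularLocus (k + 2) Y) :=
  descend 𝒜 Matrix.det

end Orbifold

/-! ### The exceptional divisor -/

section Exceptional

variable {Y Z : Type u} [TopologicalSpace Y] [HolSpace Y] [TopologicalSpace Z] [HolSpace Z]

/-- `E 0, …, E (n-1)` are the irreducible components, each listed once, of the exceptional divisor
`ρ⁻¹(S)`, numbered such that exactly consecutive components meet. -/
structure IsExceptionalChain (ρ : HolMap Z Y) (S : Set Y) {n : ℕ} (E : Fin n → Set Z) : Prop where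
  injective : Function.Injective E
  range_eq : Set.range E = irredComponents (ρ.toFun ⁻¹' S)
  disjoint : ∀ l m : Fin n, 1 < |(l : ℤ) - (m : ℤ)| → E l ∩ E m = ∅
  meet : ∀ l m : Fin n, |(l : ℤ) - (m : ℤ)| = 1 → (E l ∩ E m).Nonempty

/-- `E_{μν}`, the union of the components `E_μ, …, E_ν`. -/
def chainUnion {n : ℕ} (E : Fin n → Set Z) (μ ν : Fin n) : Set Z := ⋃ l ∈ Set.Icc μ ν, E l

lemma IsExceptionalChain.maps {ρ : HolMap Z Y} {S : Set Y} {n : ℕ} {E : Fin n → Set Z}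
    (h : IsExceptionalChain ρ S E) (μ ν : Fin n) : ∀ z ∈ chainUnion E μ ν, ρ z ∈ S := by
  intro z hz
  simp only [chainUnion, mem_iUnion] at hz
  obtain ⟨l, _, hl⟩ := hz
  have : E l ∈ irredComponents (ρ.toFun ⁻¹' S) := h.range_eq ▸ mem_range_self l
  obtain ⟨x, _, hx⟩ := this
  rw [hx] at hl
  exact hl.1

/-- The projection `π_{μν} : E_{μν} → S`, the restriction of `ρ`. -/
def IsExceptionalChain.proj {ρ : HolMap Z Y} {S : Set Y} {n : ℕ} {E : Fin n → Set Z}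
    (h : IsExceptionalChain ρ S E) (μ ν : Fin n) : HolMap (chainUnion E μ ν) S :=
  ρ.restrict (chainUnion E μ ν) S (h.maps μ ν)

end Exceptional

end TransversalAn

end

open Topology Filter Set Complex

noncomputable section

namespace TransversalAn

open HolSpace (𝒪)

universe u v

notation "Ana" => AnalyticAt ℂ
notation "OPH" => OpenPartialHomeomorph
notation "ℙ" r:max => Projectivization ℂ (Fin (r + 1) → ℂ)
notation "Sing" k:max Y:max => singularLocus (k + 2) Y

/-! ### Integrals depending analytically on a parameter -/

section ParametricIntegral

open MeasureTheory ENNReal NNReal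

variable {G : Type*} [NormedAddCommGroup G] [NormedSpace ℂ G]

lemma hasFPowerSeriesOnBall_setIntegral_translate {g : G → ℂ} {x : G} {R : ℝ≥0∞}
    {p : FormalMultilinearSeries ℂ G ℂ} (hp : HasFPowerSeriesOnBall g p x R) {r : ℝ≥0}
    (hr : 0 < r) (hrR : (r + r : ℝ≥0∞) < R) {γ : ℝ → G} (hγ : Continuous γ) {A : Set ℝ}
    (hA : MeasurableSet A) (hfin : volume A ≠ ∞) (hAr : ∀ t ∈ A, ‖γ t - x‖₊ ≤ r) :
    HasFPowerSeriesOnBall (fun y => ∫ t in A, g (γ t + y))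
      (fun m => ∫ t in A, p.changeOrigin (γ t - x) m) 0 r := by
  have hpR : (r + r : ℝ≥0∞) < p.radius := hrR.trans_le hp.r_le
  have hrp : (r : ℝ≥0∞) < p.radius := lt_of_le_of_lt le_self_add hpR
  have hsum := p.changeOriginSeries_summable_aux₁ hpR
  have hsig := NNReal.summable_sigma.1 hsum
  set C : ℕ → ℝ≥0 := fun m =>
    ∑' s : Σ l : ℕ, { s : Finset (Fin (m + l)) // s.card = l }, ‖p (m + s.1)‖₊ * r ^ s.1 * r ^ m
    with hC
  have hCs := hsig.2
  have hbd : ∀ t ∈ A, ∀ m, ‖p.changeOrigin (γ t - x) m‖₊ * r ^ m ≤ C m := by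
    intro t ht m
    have h1 : (‖γ t - x‖₊ : ℝ≥0∞) < p.radius :=
      lt_of_le_of_lt (by exact_mod_cast hAr t ht) hrp
    have h2 := p.nnnorm_changeOrigin_le m h1
    have h3 := p.changeOriginSeries_summable_aux₂ hrp m
    calc _ ≤ (∑' s : Σ l : ℕ, { s : Finset (Fin (m + l)) // s.card = l },
            ‖p (m + s.1)‖₊ * r ^ s.1) * r ^ m := by
          gcongr
          refine h2.trans ?_
          refine Summable.tsum_le_tsum (fun s => ?_) (p.changeOriginSeries_summable_aux₂ h1 m) h3
          gcongr
          exact hAr t ht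
      _ = C m := by rw [hC]; exact (NNReal.tsum_mul_right _ _).symm
  have hbd' : ∀ t ∈ A, ∀ m, ‖p.changeOrigin (γ t - x) m‖ ≤ C m / r ^ m := by
    intro t ht m
    rw [le_div_iff₀ (by positivity)]
    exact_mod_cast hbd t ht m
  have hmeas : ∀ m, AEStronglyMeasurable (fun t => p.changeOrigin (γ t - x) m)
      (volume.restrict A) := by
    intro m
    refine ContinuousOn.aestronglyMeasurable ?_ hA
    have h1 := (p.hasFPowerSeriesOnBall_changeOrigin m (lt_of_le_of_lt bot_le hrp)).continuousOn
    refine h1.comp (hγ.sub continuous_const).continuousOn ?_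
    intro t ht
    rw [Metric.mem_eball, edist_zero_right]
    exact lt_of_le_of_lt (by exact_mod_cast hAr t ht) hrp
  have hfinm : IsFiniteMeasure (volume.restrict A) := ⟨by simpa using hfin.lt_top⟩
  have hint : ∀ m, Integrable (fun t => p.changeOrigin (γ t - x) m) (volume.restrict A) := by
    intro m
    refine Integrable.of_bound (hmeas m) (C m / r ^ m) ?_
    exact (ae_restrict_iff' hA).2 (Eventually.of_forall fun t ht => hbd' t ht m)
  refine ⟨?_, by exact_mod_cast hr, ?_⟩
  · refine FormalMultilinearSeries.le_radius_of_bound _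
      ((volume.restrict A).real univ * ∑' m, (C m : ℝ)) fun m => ?_
    have h1 : ‖∫ t in A, p.changeOrigin (γ t - x) m‖ ≤
        (C m / r ^ m) * (volume.restrict A).real univ := by
      refine norm_integral_le_of_norm_le_const ?_
      exact (ae_restrict_iff' hA).2 (Eventually.of_forall fun t ht => hbd' t ht m)
    have h2 :=
      (NNReal.summable_coe.2 hCs).le_tsum m fun _ _ => by positivity
    calc _ ≤ (C m / r ^ m) * (volume.restrict A).real univ * r ^ m := by gcongr
      _ = (volume.restrict A).real univ * C m := by field_simp
      _ ≤ _ := by gcongr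
  · intro y hy
    rw [zero_add]
    have hyr : ‖y‖₊ < r := by
      rw [Metric.mem_eball, edist_zero_right] at hy
      exact_mod_cast hy
    have happ : ∀ m, (∫ t in A, p.changeOrigin (γ t - x) m) (fun _ => y) =
        ∫ t in A, p.changeOrigin (γ t - x) m (fun _ => y) := fun m =>
      ((ContinuousMultilinearMap.apply ℂ (fun _ => G) ℂ fun _ => y).integral_comp_comm
        (hint m)).symm
    simp only [happ]
    refine hasSum_integral_of_dominated_convergence (fun m _ => (C m : ℝ)) (fun m => ?_)
      (fun m => ?_) ?_ ?_ ?_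
    · exact (ContinuousMultilinearMap.apply ℂ (fun _ => G) ℂ
        fun _ => y).continuous.comp_aestronglyMeasurable (hmeas m)
    · refine (ae_restrict_iff' hA).2 (Eventually.of_forall fun t ht => ?_)
      refine (ContinuousMultilinearMap.le_opNorm _ _).trans ?_
      simp
      calc _ ≤ ‖p.changeOrigin (γ t - x) m‖ * r ^ m := by
            gcongr
            exact_mod_cast hyr.le
        _ ≤ C m := by exact_mod_cast hbd t ht m
    · exact Eventually.of_forall fun _ => NNReal.summable_coe.2 hCs
    · exact integrable_const _
    · refine (ae_restrict_iff' hA).2 (Eventually.of_forall fun t ht => ?_)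
      have h1 : (‖γ t - x‖₊ : ℝ≥0∞) ≤ r := by exact_mod_cast hAr t ht
      have h2 := hp.changeOrigin
        (lt_of_le_of_lt h1 (lt_of_le_of_lt le_self_add hrR))
      have h3 := h2.hasSum (y := y) ?_
      · rwa [add_sub_cancel] at h3
      · rw [Metric.mem_eball, edist_zero_right]
        rw [lt_tsub_iff_right]
        refine lt_of_le_of_lt ?_ hrR
        gcongr
        exact_mod_cast hyr.le

lemma analyticAt_setIntegral_translate {g : G → ℂ} {γ : ℝ → G} (hγ : Continuous γ) {K : Set ℝ}
    (hK : IsCompact K) (hg : ∀ t ∈ K, Ana g (γ t)) :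
    Ana (fun y => ∫ t in K, g (γ t + y)) 0 := by
  have key : ∃ T, IsOpen T ∧ K ⊆ T ∧ ∀ A, MeasurableSet A → volume A ≠ ∞ → A ⊆ T → A ⊆ K →
      Ana (fun y => ∫ t in A, g (γ t + y)) 0 ∧
        ∀ᶠ y in 𝓝 (0 : G), IntegrableOn (fun t => g (γ t + y)) A := by
    refine hK.induction_on (p := fun s => ∃ T, IsOpen T ∧ s ⊆ T ∧ ∀ A, MeasurableSet A →
      volume A ≠ ∞ → A ⊆ T → A ⊆ K → Ana (fun y => ∫ t in A, g (γ t + y)) 0 ∧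
        ∀ᶠ y in 𝓝 (0 : G), IntegrableOn (fun t => g (γ t + y)) A) ?_ ?_ ?_ ?_
    · refine ⟨∅, isOpen_empty, Subset.rfl, fun A _ _ h _ => ?_⟩
      rw [subset_empty_iff.1 h]
      simp [analyticAt_const]
    · rintro s t hst ⟨T, h1, h2, h3⟩
      exact ⟨T, h1, hst.trans h2, h3⟩
    · rintro s s' ⟨T, h1, h2, h3⟩ ⟨T', h1', h2', h3'⟩
      refine ⟨T ∪ T', h1.union h1', union_subset_union h2 h2', fun A hA hfin hAT hAK => ?_⟩
      obtain ⟨a1, i1⟩ := h3 (A ∩ T) (hA.inter h1.measurableSet)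
        (measure_ne_top_of_subset inter_subset_left hfin) inter_subset_right
        (inter_subset_left.trans hAK)
      obtain ⟨a2, i2⟩ := h3' (A \ T) (hA.diff h1.measurableSet)
        (measure_ne_top_of_subset sdiff_subset hfin)
        (fun t ht => (hAT ht.1).resolve_left ht.2) (sdiff_subset.trans hAK)
      constructor
      · refine (a1.add a2).congr ?_
        filter_upwards [i1, i2] with y j1 j2
        rw [Pi.add_apply, ← setIntegral_union disjoint_sdiff_inter.symm (hA.diff h1.measurableSet)
          j1 j2, inter_union_sdiff]
      · filter_upwards [i1, i2] with y j1 j2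
        rw [← inter_union_sdiff A T]
        exact j1.union j2
    · intro t0 ht0
      obtain ⟨p, R, hp⟩ := hg t0 ht0
      obtain ⟨r, hr, hrR⟩ : ∃ r : ℝ≥0, 0 < r ∧ (r + r : ℝ≥0∞) < R := by
        obtain ⟨q, hq0, hqR⟩ := ENNReal.lt_iff_exists_nnreal_btwn.1 hp.r_pos
        refine ⟨q / 2, by simpa using hq0, ?_⟩
        rw [← ENNReal.coe_add, add_halves]
        exact hqR
      set T := γ ⁻¹' Metric.ball (γ t0) r with hT
      have hTo : IsOpen T := Metric.isOpen_ball.preimage hγ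
      refine ⟨T, mem_nhdsWithin_of_mem_nhds (hTo.mem_nhds (Metric.mem_ball_self (by exact_mod_cast hr))),
        T, hTo, Subset.rfl, fun A hA hfin hAT hAK => ?_⟩
      have hAr : ∀ t ∈ A, ‖γ t - γ t0‖₊ ≤ r := by
        intro t ht
        have := hAT ht
        rw [hT, mem_preimage, mem_ball_iff_norm] at this
        exact_mod_cast this.le
      refine ⟨⟨_, _, hasFPowerSeriesOnBall_setIntegral_translate hp hr hrR hγ hA hfin hAr⟩, ?_⟩
      filter_upwards [Metric.ball_mem_nhds (0 : G) (NNReal.coe_pos.2 hr)] with y hy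
      have hcont : ContinuousOn (fun t => g (γ t + y)) (γ ⁻¹' Metric.closedBall (γ t0) r) := by
        refine hp.continuousOn.comp (hγ.add continuous_const).continuousOn fun t ht => ?_
        rw [mem_preimage, mem_closedBall_iff_norm] at ht
        rw [mem_ball_zero_iff] at hy
        rw [Metric.mem_eball, edist_eq_enorm_sub, enorm_eq_nnnorm]
        refine lt_of_le_of_lt ?_ hrR
        rw [← ENNReal.coe_add, ENNReal.coe_le_coe, ← NNReal.coe_le_coe, coe_nnnorm, NNReal.coe_add]
        calc ‖γ t + y - γ t0‖ = ‖(γ t - γ t0) + y‖ := by congr 1; abel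
          _ ≤ ‖γ t - γ t0‖ + ‖y‖ := norm_add_le _ _
          _ ≤ r + r := add_le_add ht hy.le
      have hcl : IsClosed (γ ⁻¹' Metric.closedBall (γ t0) r) := Metric.isClosed_closedBall.preimage hγ
      have : IntegrableOn (fun t => g (γ t + y)) (K ∩ γ ⁻¹' Metric.closedBall (γ t0) r) :=
        (hcont.mono inter_subset_right).integrableOn_compact (hK.inter_right hcl)
      exact this.mono_set fun t ht => ⟨hAK ht, Metric.ball_subset_closedBall (hAT ht)⟩
  obtain ⟨T, _, h2, h3⟩ := key
  exact (h3 K hK.measurableSet hK.measure_lt_top.ne h2 Subset.rfl).1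

/-- The integral over a compact interval of a function that is analytic in a parameter and in the
variable of integration depends analytically on the parameter. -/
lemma analyticAt_intervalIntegral {g : G × ℂ → ℂ} {e : G} {a b : ℝ}
    (hg : ∀ t ∈ uIcc a b, Ana g (e, (t : ℂ))) :
    Ana (fun y => ∫ t in a..b, g (y, (t : ℂ))) e := by
  wlog hab : a ≤ b generalizing a b
  · have h := this (by rwa [uIcc_comm]) (le_of_not_ge hab)
    simp only [intervalIntegral.integral_symm b a]
    exact h.neg
  rw [uIcc_of_le hab] at hg
  have h1 := analyticAt_setIntegral_translate
    (by fun_prop) isCompact_Icc hg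
  have h2 : Ana (fun y : G => ((y - e, 0) : G × ℂ)) e := by fun_prop
  have h3 := AnalyticAt.fun_comp (g := fun y => ∫ t in Icc a b, g ((e, (t : ℂ)) + y))
    (x := e) (by rw [sub_self]; exact h1) h2
  refine h3.congr (Eventually.of_forall fun y => ?_)
  simp
  rw [intervalIntegral.integral_of_le hab, integral_Icc_eq_integral_Ioc]

end ParametricIntegral

/-! ### Division and Laurent splitting with parameters -/

attribute [fun_prop] analyticAt_fst analyticAt_snd

section Cauchy

variable {G : Type*} [NormedAddCommGroup G] [NormedSpace ℂ G]

lemma analyticAt_circleIntegral {f : G × ℂ → ℂ} {e : G} {c : ℂ} {R : ℝ} (hR : 0 ≤ R)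
    (hf : ∀ η ∈ Metric.sphere c R, Ana f (e, η)) :
    Ana (fun y => ∮ η in C(c, R), f (y, η)) e := by
  have h := analyticAt_intervalIntegral (G := G) (a := 0) (b := 2 * Real.pi) (e := e)
    (g := fun q => (R * exp (q.2 * I) * I) *
      f (q.1, c + R * exp (q.2 * I))) ?_
  · refine h.congr (Eventually.of_forall fun y => ?_)
    simp only [circleIntegral, deriv_circleMap, circleMap, smul_eq_mul, zero_add]
  · intro t _
    have h1 : Ana f (e, c + R * exp (t * I)) := by
      refine hf _ ?_
      have := circleMap_mem_sphere c hR t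
      simpa [circleMap] using this
    have h2 : Ana (fun q => (q.1, c + R * exp (q.2 * I)))
        (e, (t : ℂ)) := by
      fun_prop
    have h3 := AnalyticAt.fun_comp
      (x := (e, (t : ℂ))) h1 h2
    exact (by fun_prop : Ana (fun q =>
      (R * exp (q.2 * I) * I)) (e, (t : ℂ))).mul h3

lemma analyticAt_dslope_zero {F : G × ℂ → ℂ} {e : G} (hF : Ana F (e, 0)) :
    Ana (fun q : G × ℂ => dslope (fun ξ => F (q.1, ξ)) 0 q.2) (e, 0) := by
  obtain ⟨ε, hε, hb⟩ := hF.exists_ball_analyticOnNhd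
  set r := ε / 2 with hr
  have hr0 : 0 < r := by positivity
  have hmem : ∀ y : G, ∀ ξ : ℂ, dist y e < ε → ‖ξ‖ ≤ r → Ana F (y, ξ) := by
    intro y ξ hy hξ
    refine hb _ ?_
    rw [Metric.mem_ball, Prod.dist_eq]
    refine max_lt hy ?_
    rw [dist_zero_right]
    exact lt_of_le_of_lt hξ (by rw [hr]; linarith)
  have hker : Ana (fun q => (2 * Real.pi * I : ℂ)⁻¹ *
      ∮ η in C(0, r), (η - q.2)⁻¹ * ((F (q.1, η) - F (q.1, 0)) / η)) (e, 0) := by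
    refine analyticAt_const.mul ?_
    refine analyticAt_circleIntegral (G := G × ℂ) (e := (e, 0)) (c := 0) (R := r)
      (f := fun p : (G × ℂ) × ℂ => (p.2 - p.1.2)⁻¹ * ((F (p.1.1, p.2) - F (p.1.1, 0)) / p.2))
      hr0.le ?_
    intro η hη
    have hη' : ‖η‖ = r := by simpa using hη
    have hη0 : η ≠ 0 := by
      intro h; rw [h, norm_zero] at hη'; linarith
    have a1 :=
      AnalyticAt.fun_comp (g := F) (f := fun p : (G × ℂ) × ℂ => (p.1.1, p.2)) (x := ((e, 0), η))
        (hmem e η (by simpa using hε) hη'.le) (by fun_prop)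
    have a2 :=
      AnalyticAt.fun_comp (g := F) (f := fun p : (G × ℂ) × ℂ => (p.1.1, (0 : ℂ))) (x := ((e, 0), η))
        hF (by fun_prop)
    refine AnalyticAt.mul (AnalyticAt.inv (by fun_prop) (by simpa using hη0)) ?_
    exact (a1.sub a2).div (by fun_prop) hη0
  refine hker.congr ?_
  have h1 : ∀ᶠ q in 𝓝 (e, 0), q ∈ Metric.ball (e, (0 : ℂ)) r :=
    Metric.ball_mem_nhds _ hr0
  filter_upwards [h1] with q hq
  rw [Metric.mem_ball, Prod.dist_eq, max_lt_iff, dist_zero_right] at hq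
  have hd : DifferentiableOn ℂ (fun ξ => F (q.1, ξ)) (Metric.closedBall 0 r) := by
    intro ξ hξ
    have a1 := hmem q.1 ξ (hq.1.trans (by rw [hr]; linarith))
      (by simpa using hξ)
    exact (AnalyticAt.fun_comp a1
      (by fun_prop)).differentiableAt.differentiableWithinAt
  have hd2 :=
    (differentiableOn_dslope (Metric.closedBall_mem_nhds _ hr0)).2 hd
  have hC := hd2.diffContOnCl_ball Subset.rfl
  have hC2 := hC.two_pi_i_inv_smul_circleIntegral_sub_inv_smul
    (by simpa using hq.2)
  rw [← hC2, smul_eq_mul]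
  congr 1
  refine circleIntegral.integral_congr hr0.le fun η hη => ?_
  have hη' : ‖η‖ = r := by simpa using hη
  have hη0 : η ≠ 0 := by
    intro h; rw [h, norm_zero] at hη'; linarith
  simp only [smul_eq_mul]
  rw [dslope_of_ne _ hη0, slope_def_field, sub_zero]

/-- An analytic function that vanishes where the last variable does is divisible by the last
variable. -/
lemma exists_eq_mul_of_analyticAt {F : G × ℂ → ℂ} {e : G} (hF : Ana F (e, 0))
    (h0 : ∀ᶠ y in 𝓝 e, F (y, 0) = 0) :
    ∃ F₁ : G × ℂ → ℂ, Ana F₁ (e, 0) ∧ ∀ᶠ q in 𝓝 (e, (0 : ℂ)), F q = q.2 * F₁ q := by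
  refine ⟨_, analyticAt_dslope_zero hF, ?_⟩
  have h1 :=
    (continuous_fst.tendsto' (e, (0 : ℂ)) e rfl).eventually h0
  filter_upwards [h1] with q hq
  have := sub_smul_dslope (fun ξ => F (q.1, ξ)) 0 q.2
  simp only [sub_zero, smul_eq_mul, hq] at this
  exact this.symm

lemma laurent_splitting {T : Set G} {f : G × ℂ → ℂ}
    (hf : ∀ e ∈ T, ∀ a : ℂ, 1 / 2 < ‖a‖ → ‖a‖ < 2 → Ana f (e, a)) :
    ∃ f₁ f₂ : G × ℂ → ℂ, (∀ e ∈ T, ∀ a : ℂ, ‖a‖ < 3 / 2 → Ana f₁ (e, a)) ∧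
      (∀ e ∈ T, ∀ b : ℂ, ‖b‖ < 3 / 2 → Ana f₂ (e, b)) ∧
      ∀ e ∈ T, ∀ a : ℂ, 2 / 3 < ‖a‖ → ‖a‖ < 3 / 2 → f (e, a) = f₁ (e, a) + f₂ (e, a⁻¹) := by
  have hpi := two_pi_I_ne_zero
  refine ⟨fun q => (2 * Real.pi * I : ℂ)⁻¹ * ∮ η in C(0, 3 / 2), (η - q.2)⁻¹ * f (q.1, η),
    fun q => -((2 * Real.pi * I : ℂ)⁻¹ *
      ∮ η in C(0, 2 / 3), q.2 * (η * q.2 - 1)⁻¹ * f (q.1, η)), ?_, ?_, ?_⟩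
  · intro e he a ha
    refine analyticAt_const.mul ?_
    refine analyticAt_circleIntegral (G := G × ℂ) (e := (e, a)) (c := 0) (R := 3 / 2)
      (f := fun p => (p.2 - p.1.2)⁻¹ * f (p.1.1, p.2)) (by norm_num) ?_
    intro η hη
    have hη' : ‖η‖ = 3 / 2 := by simpa using hη
    have a1 :=
      AnalyticAt.fun_comp (g := f) (f := fun p => (p.1.1, p.2)) (x := ((e, a), η))
        (hf e he η (by rw [hη']; norm_num) (by rw [hη']; norm_num)) (by fun_prop)
    refine AnalyticAt.mul (AnalyticAt.inv (by fun_prop) ?_) a1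
    intro h
    rw [sub_eq_zero] at h
    simp only at h
    rw [← h, hη'] at ha
    linarith
  · intro e he b hb
    refine (analyticAt_const.mul ?_).neg
    refine analyticAt_circleIntegral (G := G × ℂ) (e := (e, b)) (c := 0) (R := 2 / 3)
      (f := fun p => p.1.2 * (p.2 * p.1.2 - 1)⁻¹ * f (p.1.1, p.2)) (by norm_num) ?_
    intro η hη
    have hη' : ‖η‖ = 2 / 3 := by simpa using hη
    have a1 :=
      AnalyticAt.fun_comp (g := f) (f := fun p => (p.1.1, p.2)) (x := ((e, b), η))
        (hf e he η (by rw [hη']; norm_num) (by rw [hη']; norm_num)) (by fun_prop)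
    refine AnalyticAt.mul (AnalyticAt.mul (by fun_prop) (AnalyticAt.inv (by fun_prop) ?_)) a1
    intro h
    rw [sub_eq_zero] at h
    have := congrArg norm h
    simp only [norm_mul, hη', norm_one] at this
    linarith
  · intro e he a ha1 ha2
    have ha0 : a ≠ 0 := by
      intro h; rw [h, norm_zero] at ha1; linarith
    have hfd :=
      fun z h1 h2 => (AnalyticAt.fun_comp (g := f) (f := fun ξ => (e, ξ)) (x := z)
        (hf e he z h1 h2) (by fun_prop)).differentiableAt
    set U : Set ℂ := {z | 1 / 2 < ‖z‖ ∧ ‖z‖ < 2} with hU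
    have hUo : IsOpen U := (isOpen_lt continuous_const continuous_norm).inter
      (isOpen_lt continuous_norm continuous_const)
    have haU : a ∈ U := ⟨by linarith, by linarith⟩
    have hdU : DifferentiableOn ℂ (fun ξ => f (e, ξ)) U := fun z hz =>
      (hfd z hz.1 hz.2).differentiableWithinAt
    have hds :=
      (differentiableOn_dslope (hUo.mem_nhds haU)).2 hdU
    have hdsa := fun z hz =>
      (hds z hz).differentiableAt (hUo.mem_nhds hz)
    have hann := circleIntegral_eq_of_differentiable_on_annulus_off_countable
      (c := 0) (r := 2 / 3) (R := 3 / 2) (by norm_num) (by norm_num) (s := ∅)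
      (f := dslope (fun ξ => f (e, ξ)) a) countable_empty ?_ ?_
    · have hsub : ∀ R : ℝ, 1 / 2 < R → R < 2 → R ≠ ‖a‖ →
          (∮ z in C(0, R), dslope (fun ξ => f (e, ξ)) a z) =
          (∮ z in C(0, R), (z - a)⁻¹ * f (e, z)) - f (e, a) * ∮ z in C(0, R), (z - a)⁻¹ := by
        intro R h1 h2 h3
        have hR0 : 0 ≤ R := by linarith
        have hne : ∀ z ∈ Metric.sphere (0 : ℂ) R, z - a ≠ 0 := by
          intro z hz h
          rw [sub_eq_zero] at h
          apply h3
          rw [← h]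
          simpa using hz.symm
        have c1 :=
          ContinuousOn.inv₀ (by fun_prop) hne
        have c2 : ContinuousOn (fun z => f (e, z)) (Metric.sphere 0 R) := by
          intro z hz
          have hz' : ‖z‖ = R := by simpa using hz
          exact (hfd z (by rw [hz']; exact h1) (by rw [hz']; exact h2)).continuousAt.continuousWithinAt
        rw [← circleIntegral.integral_const_mul, ← circleIntegral.integral_sub]
        · refine circleIntegral.integral_congr hR0 fun z hz => ?_
          have hza := fun h => hne z hz (sub_eq_zero.2 h)
          rw [dslope_of_ne _ hza, slope_def_field, div_eq_inv_mul, mul_sub, mul_comm (f (e, a))]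
        · exact (c1.mul c2).circleIntegrable hR0
        · exact (continuousOn_const.mul c1).circleIntegrable hR0
      rw [hsub _ (by norm_num) (by norm_num) (by linarith),
        hsub _ (by norm_num) (by norm_num) (by linarith)] at hann
      have w1 : (∮ z in C(0, 3 / 2), (z - a)⁻¹) = 2 * Real.pi * I :=
        circleIntegral.integral_sub_inv_of_mem_ball (by simpa using ha2)
      have w2 : (∮ z in C(0, 2 / 3), (z - a)⁻¹) = 0 := by
        refine DiffContOnCl.circleIntegral_eq_zero (by norm_num) ?_
        refine DifferentiableOn.diffContOnCl_ball ?_ Subset.rfl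
        intro z hz
        have hz' : ‖z‖ ≤ 2 / 3 := by simpa using hz
        refine (DifferentiableAt.inv (by fun_prop) ?_).differentiableWithinAt
        intro h
        rw [sub_eq_zero] at h
        rw [h] at hz'
        linarith
      rw [w1, w2, mul_zero, sub_zero] at hann
      have h2 : (∮ η in C(0, 2 / 3), a⁻¹ * (η * a⁻¹ - 1)⁻¹ * f (e, η)) =
          ∮ η in C(0, 2 / 3), (η - a)⁻¹ * f (e, η) := by
        refine circleIntegral.integral_congr (by norm_num) fun η hη => ?_
        congr 1
        rw [← mul_inv, mul_sub, mul_comm a, mul_assoc, inv_mul_cancel₀ ha0, mul_one, mul_one]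
      simp only
      rw [h2, ← hann]
      linear_combination (-f (e, a)) * inv_mul_cancel₀ hpi
    · intro z hz
      refine (hdsa z ?_).continuousAt.continuousWithinAt
      obtain ⟨h1, h2⟩ := hz
      simp at h1 h2
      exact ⟨by linarith, by linarith⟩
    · intro z hz
      refine hdsa z ?_
      obtain ⟨⟨h1, h2⟩, -⟩ := hz
      simp at h1 h2
      exact ⟨by linarith, by linarith⟩

end Cauchy

/-! ### Cousin's lemma with parameters -/

section Cousin

variable {G : Type*} [NormedAddCommGroup G] [NormedSpace ℂ G]

lemma log_sub_log_neg_of_im_pos {z : ℂ} (hz : 0 < z.im) :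
    log z - log (-z) = Real.pi * I := by
  simp only [log, norm_neg, arg_neg_eq_arg_sub_pi_of_im_pos hz]
  push_cast
  ring

lemma log_sub_log_neg_of_im_neg {z : ℂ} (hz : z.im < 0) :
    log z - log (-z) = -(Real.pi * I) := by
  simp only [log, norm_neg, arg_neg_eq_arg_add_pi_of_im_neg hz]
  push_cast
  ring

lemma intervalIntegral_inv_affine {a b : ℝ} {m c : ℂ} (hm : m ≠ 0)
    (h : ∀ t ∈ uIcc a b, (t : ℂ) * m + c ∈ slitPlane) :
    m * ∫ t in a..b, ((t : ℂ) * m + c)⁻¹ = log (b * m + c) - log (a * m + c) := by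
  have hder : ∀ t ∈ uIcc a b, HasDerivAt (fun t : ℝ => m⁻¹ * log ((t : ℂ) * m + c))
      ((t : ℂ) * m + c)⁻¹ t := by
    intro t ht
    have h1 : HasDerivAt (fun t : ℝ => (t : ℂ) * m + c) m t := by
      simpa using ((ofRealCLM.hasDerivAt).mul_const m).add_const c
    have h2 := (h1.clog_real (h t ht)).const_mul m⁻¹
    rwa [← mul_div_assoc, inv_mul_cancel₀ hm, one_div] at h2
  rw [intervalIntegral.integral_eq_sub_of_hasDerivAt hder]
  · field_simp
  · refine ContinuousOn.intervalIntegrable ?_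
    refine ContinuousOn.inv₀ (by fun_prop) fun t ht => slitPlane_ne_zero (h t ht)

/-- The winding number of the boundary of a rectangle around an interior point. -/
lemma integral_boundary_rect_inv {x₀ x₁ y₀ y₁ : ℝ} {ζ : ℂ} (h1 : x₀ < ζ.re) (h2 : ζ.re < x₁)
    (h3 : y₀ < ζ.im) (h4 : ζ.im < y₁) :
    (∫ x in x₀..x₁, ((x : ℂ) + y₀ * I - ζ)⁻¹) -
      (∫ x in x₀..x₁, ((x : ℂ) + y₁ * I - ζ)⁻¹) +
      I * (∫ y in y₀..y₁, ((x₁ : ℂ) + y * I - ζ)⁻¹) -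
      I * (∫ y in y₀..y₁, ((x₀ : ℂ) + y * I - ζ)⁻¹) = 2 * Real.pi * I := by
  have b := intervalIntegral_inv_affine (a := x₀) (b := x₁) (m := 1) (c := y₀ * I - ζ)
    one_ne_zero (fun t _ => Or.inr (by simp; linarith))
  have t := intervalIntegral_inv_affine (a := x₀) (b := x₁) (m := 1) (c := y₁ * I - ζ)
    one_ne_zero (fun t _ => Or.inr (by simp; linarith))
  have r := intervalIntegral_inv_affine (a := y₀) (b := y₁) (m := I) (c := x₁ - ζ)
    I_ne_zero (fun t _ => Or.inl (by simp; linarith))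
  have l := intervalIntegral_inv_affine (a := y₀) (b := y₁) (m := -I) (c := ζ - x₀)
    (neg_ne_zero.2 I_ne_zero) (fun t _ => Or.inl (by simp; linarith))
  have l' : ∫ y in y₀..y₁, ((x₀ : ℂ) + y * I - ζ)⁻¹ =
      - ∫ y in y₀..y₁, ((y : ℂ) * -I + (ζ - x₀))⁻¹ := by
    rw [← intervalIntegral.integral_neg]
    congr 1
    funext y
    rw [← inv_neg]
    congr 1
    ring
  have e1 : ∀ (y : ℝ), ∀ x : ℝ, (x : ℂ) + y * I - ζ = (x : ℂ) * 1 + (y * I - ζ) :=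
    fun y x => by ring
  have e2 : ∀ y : ℝ, (x₁ : ℂ) + y * I - ζ = (y : ℂ) * I + (x₁ - ζ) :=
    fun y => by ring
  have u := log_sub_log_neg_of_im_pos (z := (x₀ : ℂ) * 1 + (y₁ * I - ζ)) (by simp; linarith)
  have v := log_sub_log_neg_of_im_neg (z := (x₀ : ℂ) * 1 + (y₀ * I - ζ)) (by simp; linarith)
  have n1 : -((x₀ : ℂ) * 1 + (y₁ * I - ζ)) = (y₁ : ℂ) * -I + (ζ - x₀) := by ring
  have n2 : -((x₀ : ℂ) * 1 + (y₀ * I - ζ)) = (y₀ : ℂ) * -I + (ζ - x₀) := by ring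
  have n3 : (y₁ : ℂ) * I + (x₁ - ζ) = (x₁ : ℂ) * 1 + (y₁ * I - ζ) := by ring
  have n4 : (y₀ : ℂ) * I + (x₁ - ζ) = (x₁ : ℂ) * 1 + (y₀ * I - ζ) := by ring
  rw [n1] at u
  rw [n2] at v
  rw [n3, n4] at r
  rw [l']
  simp only [e1 y₀, e1 y₁, e2]
  linear_combination b - t + r - l + u - v

lemma rect_splitting {T : Set G} {f : G × ℂ → ℂ} {x y₀ y₁ δ : ℝ} (hδ : 0 < δ) (hy : y₀ ≤ y₁)
    (hf : ∀ e ∈ T, ∀ ζ : ℂ, x - 2 * δ < ζ.re → ζ.re < x + 2 * δ → y₀ - 2 * δ < ζ.im →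
      ζ.im < y₁ + 2 * δ → Ana f (e, ζ)) :
    ∃ f₁ f₂ : G × ℂ → ℂ,
      (∀ e ∈ T, ∀ ζ : ℂ, ζ.re < x + δ → y₀ - δ < ζ.im → ζ.im < y₁ + δ →
        Ana f₁ (e, ζ)) ∧
      (∀ e ∈ T, ∀ ζ : ℂ, x - δ < ζ.re → Ana f₂ (e, ζ)) ∧
      ∀ e ∈ T, ∀ ζ : ℂ, x - δ < ζ.re → ζ.re < x + δ → y₀ - δ < ζ.im → ζ.im < y₁ + δ →
        f (e, ζ) = f₁ (e, ζ) - f₂ (e, ζ) := by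
  have hpi : (2 * Real.pi * I : ℂ) ≠ 0 := two_pi_I_ne_zero
  have hedge : ∀ (p m : ℂ) (a b : ℝ) (e : G) (ζ : ℂ), (∀ t ∈ uIcc a b,
      Ana f (e, p + t * m) ∧ p + t * m ≠ ζ) →
      Ana (fun q => ∫ t in a..b, (p + t * m - q.2)⁻¹ * f (q.1, p + t * m))
        (e, ζ) := by
    intro p m a b e ζ h
    refine analyticAt_intervalIntegral (G := G × ℂ) (e := (e, ζ))
      (g := fun q => (p + q.2 * m - q.1.2)⁻¹ * f (q.1.1, p + q.2 * m)) ?_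
    intro t ht
    refine AnalyticAt.mul (AnalyticAt.inv (by fun_prop) ?_) ?_
    · exact sub_ne_zero.2 (h t ht).2
    · exact AnalyticAt.fun_comp
        (h t ht).1 (by fun_prop)
  have hx1 : x - δ ≤ x + δ := by linarith
  have hy1 : y₀ - δ ≤ y₁ + δ := by linarith
  refine ⟨fun q => (2 * Real.pi * I : ℂ)⁻¹ *
    ((∫ t in (x - δ)..(x + δ), ((y₀ - δ : ℝ) * I + t * 1 - q.2)⁻¹ *
        f (q.1, (y₀ - δ : ℝ) * I + t * 1)) -
      (∫ t in (x - δ)..(x + δ), ((y₁ + δ : ℝ) * I + t * 1 - q.2)⁻¹ *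
        f (q.1, (y₁ + δ : ℝ) * I + t * 1)) +
      I * ∫ t in (y₀ - δ)..(y₁ + δ), ((x + δ : ℝ) + t * I - q.2)⁻¹ *
        f (q.1, (x + δ : ℝ) + t * I)),
    fun q => (2 * Real.pi * I : ℂ)⁻¹ * (I * ∫ t in (y₀ - δ)..(y₁ + δ),
      ((x - δ : ℝ) + t * I - q.2)⁻¹ * f (q.1, (x - δ : ℝ) + t * I)),
    ?_, ?_, ?_⟩
  · intro e he ζ h1 h2 h3
    refine analyticAt_const.mul (((hedge _ _ _ _ _ _ ?_).sub (hedge _ _ _ _ _ _ ?_)).add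
      (analyticAt_const.mul (hedge _ _ _ _ _ _ ?_)))
    · intro t ht
      rw [uIcc_of_le hx1, mem_Icc] at ht
      refine ⟨hf e he _ ?_ ?_ ?_ ?_, ?_⟩
      iterate 4 · simp; linarith
      · intro h; rw [← h] at h2; simp at h2
    · intro t ht
      rw [uIcc_of_le hx1, mem_Icc] at ht
      refine ⟨hf e he _ ?_ ?_ ?_ ?_, ?_⟩
      iterate 4 · simp; linarith
      · intro h; rw [← h] at h3; simp at h3
    · intro t ht
      rw [uIcc_of_le hy1, mem_Icc] at ht
      refine ⟨hf e he _ ?_ ?_ ?_ ?_, ?_⟩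
      iterate 4 · simp; linarith
      · intro h; rw [← h] at h1; simp at h1
  · intro e he ζ h1
    refine analyticAt_const.mul (analyticAt_const.mul (hedge _ _ _ _ _ _ ?_))
    intro t ht
    rw [uIcc_of_le hy1, mem_Icc] at ht
    refine ⟨hf e he _ ?_ ?_ ?_ ?_, ?_⟩
    iterate 4 · simp; linarith
    · intro h; rw [← h] at h1; simp at h1
  · intro e he ζ h1 h2 h3 h4
    have hfd : ∀ z : ℂ, x - 2 * δ < z.re → z.re < x + 2 * δ → y₀ - 2 * δ < z.im →
        z.im < y₁ + 2 * δ → DifferentiableAt ℂ (fun ξ => f (e, ξ)) z :=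
      fun z h1 h2 h3 h4 => (AnalyticAt.fun_comp
        (hf e he z h1 h2 h3 h4) (by fun_prop)).differentiableAt
    set U : Set ℂ := {z | (x - 2 * δ < z.re ∧ z.re < x + 2 * δ) ∧ y₀ - 2 * δ < z.im ∧
      z.im < y₁ + 2 * δ} with hU
    have hUo : IsOpen U :=
      ((isOpen_lt continuous_const continuous_re).inter
        (isOpen_lt continuous_re continuous_const)).inter
      ((isOpen_lt continuous_const continuous_im).inter
        (isOpen_lt continuous_im continuous_const))
    have hζU : ζ ∈ U := ⟨⟨by linarith, by linarith⟩, by linarith, by linarith⟩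
    have hdU : DifferentiableOn ℂ (fun ξ => f (e, ξ)) U := fun z hz =>
      (hfd z hz.1.1 hz.1.2 hz.2.1 hz.2.2).differentiableWithinAt
    have hds :=
      (differentiableOn_dslope (hUo.mem_nhds hζU)).2 hdU
    have hrect := integral_boundary_rect_eq_zero_of_differentiableOn
      (dslope (fun ξ => f (e, ξ)) ζ) ⟨x - δ, y₀ - δ⟩ ⟨x + δ, y₁ + δ⟩ (hds.mono ?_)
    swap
    · intro z hz
      rw [mem_reProdIm] at hz
      simp only [uIcc_of_le hx1, uIcc_of_le hy1, mem_Icc] at hz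
      exact ⟨⟨by linarith, by linarith⟩, by linarith, by linarith⟩
    simp only [smul_eq_mul] at hrect
    have hsub : ∀ (a b : ℝ) (p m : ℂ), (∀ t ∈ uIcc a b, p + t * m ∈ U ∧ p + t * m ≠ ζ) →
        ∫ t in a..b, dslope (fun ξ => f (e, ξ)) ζ (p + t * m) =
          (∫ t in a..b, (p + t * m - ζ)⁻¹ * f (e, p + t * m)) -
            f (e, ζ) * ∫ t in a..b, (p + t * m - ζ)⁻¹ := by
      intro a b p m h
      have c0 : ContinuousOn (fun t : ℝ => p + t * m) (uIcc a b) := by fun_prop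
      have c1 :=
        ContinuousOn.inv₀ (by fun_prop) fun t ht => sub_ne_zero.2 (h t ht).2
      have c2 :=
        hdU.continuousOn.comp c0 fun t ht => (h t ht).1
      rw [← intervalIntegral.integral_const_mul, ← intervalIntegral.integral_sub]
      · refine intervalIntegral.integral_congr fun t ht => ?_
        rw [dslope_of_ne _ (h t ht).2, slope_def_field]
        ring
      · exact (c1.mul c2).intervalIntegrable
      · exact (continuousOn_const.mul c1).intervalIntegrable
    have e1 := hsub (x - δ) (x + δ) ((y₀ - δ : ℝ) * I) 1 (by
      intro t ht
      rw [uIcc_of_le hx1, mem_Icc] at ht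
      refine ⟨⟨⟨?_, ?_⟩, ?_, ?_⟩, ?_⟩
      iterate 4 · simp; linarith
      · intro h; rw [← h] at h3; simp at h3)
    have e2 := hsub (x - δ) (x + δ) ((y₁ + δ : ℝ) * I) 1 (by
      intro t ht
      rw [uIcc_of_le hx1, mem_Icc] at ht
      refine ⟨⟨⟨?_, ?_⟩, ?_, ?_⟩, ?_⟩
      iterate 4 · simp; linarith
      · intro h; rw [← h] at h4; simp at h4)
    have e3 := hsub (y₀ - δ) (y₁ + δ) (x + δ : ℝ) I (by
      intro t ht
      rw [uIcc_of_le hy1, mem_Icc] at ht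
      refine ⟨⟨⟨?_, ?_⟩, ?_, ?_⟩, ?_⟩
      iterate 4 · simp; linarith
      · intro h; rw [← h] at h2; simp at h2)
    have e4 := hsub (y₀ - δ) (y₁ + δ) (x - δ : ℝ) I (by
      intro t ht
      rw [uIcc_of_le hy1, mem_Icc] at ht
      refine ⟨⟨⟨?_, ?_⟩, ?_, ?_⟩, ?_⟩
      iterate 4 · simp; linarith
      · intro h; rw [← h] at h1; simp at h1)
    have w := integral_boundary_rect_inv
      h1 h2 h3 h4
    have sw : ∀ (y t : ℝ), (t : ℂ) + y * I = y * I + t * 1 := fun y t => by ring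
    simp only [sw (y₀ - δ), sw (y₁ + δ)] at w hrect
    rw [e1, e2, e3, e4] at hrect
    simp only
    rw [eq_comm, ← mul_sub, inv_mul_eq_iff_eq_mul₀ hpi]
    linear_combination hrect + f (e, ζ) * w

end Cousin

lemma abs_sub_clamp_le {a b s δ : ℝ} (h : a ≤ b) (h1 : a - δ < s) (h2 : s < b + δ) (hδ : 0 ≤ δ) :
    |s - max a (min b s)| ≤ δ := by
  rcases le_total b s with h3 | h3 <;> rcases le_total a s with h4 | h4 <;>
    simp [*, abs_le] <;> constructor <;> linarith

/-- A neighbourhood of the product of a point and a compact rectangle contains the product of a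
neighbourhood and a larger rectangle. -/
lemma exists_tube_rect {G : Type*} [TopologicalSpace G] {e : G} {W : Set (G × ℂ)} (hW : IsOpen W) {x₀ x₁ y₀ y₁ : ℝ}
    (h : {e} ×ˢ (Icc x₀ x₁ ×ℂ Icc y₀ y₁) ⊆ W) :
    ∃ T : Set G, IsOpen T ∧ e ∈ T ∧ ∃ δ > 0, ∀ e' ∈ T, ∀ ζ : ℂ, x₀ - 2 * δ < ζ.re →
      ζ.re < x₁ + 2 * δ → y₀ - 2 * δ < ζ.im → ζ.im < y₁ + 2 * δ → x₀ ≤ x₁ → y₀ ≤ y₁ →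
      (e', ζ) ∈ W := by
  have hK : IsCompact (Icc x₀ x₁ ×ℂ Icc y₀ y₁) := isCompact_Icc.reProdIm isCompact_Icc
  obtain ⟨T, V, hT, hV, heT, hKV, hTV⟩ := generalized_tube_lemma isCompact_singleton hK hW h
  obtain ⟨ε, hε, hεV⟩ := hK.exists_thickening_subset_open hV hKV
  refine ⟨T, hT, heT rfl, ε / 5, by positivity, fun e' he' ζ h1 h2 h3 h4 h5 h6 => hTV ⟨he', hεV ?_⟩⟩
  rw [Metric.mem_thickening_iff]
  refine ⟨⟨max x₀ (min x₁ ζ.re), max y₀ (min y₁ ζ.im)⟩, ?_, ?_⟩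
  · rw [mem_reProdIm]
    exact ⟨⟨le_max_left _ _, max_le h5 (min_le_left _ _)⟩, le_max_left _ _,
      max_le h6 (min_le_left _ _)⟩
  · rw [dist_eq]
    refine lt_of_le_of_lt (norm_le_abs_re_add_abs_im _) ?_
    simp only [sub_re, sub_im]
    have hε' : 0 ≤ 2 * (ε / 5) := by positivity
    linarith [abs_sub_clamp_le h5 h1 h2 hε', abs_sub_clamp_le h6 h3 h4 hε']

section Cousin

variable {G : Type*} [NormedAddCommGroup G] [NormedSpace ℂ G]

/-- The cocycle `c` of functions for the covering `𝒰` is on `W` the coboundary of the analytic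
functions `b`. -/
def SplitsOn {ι : Type*} (𝒰 : ι → Set (G × ℂ)) (c : ι → ι → G × ℂ → ℂ) (W : Set (G × ℂ))
    (b : ι → G × ℂ → ℂ) : Prop :=
  (∀ i, ∀ q ∈ 𝒰 i ∩ W, Ana (b i) q) ∧ ∀ i j, ∀ q ∈ 𝒰 i ∩ 𝒰 j ∩ W, c i j q = b j q - b i q

/-- The cocycle `c` of functions for the covering `𝒰` is a coboundary near the product of `{e}` and
a closed rectangle. -/
def SplitsOnRect {ι : Type*} (Ω : Set (G × ℂ)) (𝒰 : ι → Set (G × ℂ)) (c : ι → ι → G × ℂ → ℂ)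
    (e : G) (x₀ x₁ y₀ y₁ : ℝ) : Prop :=
  ∃ W : Set (G × ℂ), IsOpen W ∧ W ⊆ Ω ∧ {e} ×ˢ (Icc x₀ x₁ ×ℂ Icc y₀ y₁) ⊆ W ∧ ∃ b, SplitsOn 𝒰 c W b

/-- `𝒰` is an open covering of the open set `Ω` and `c` an analytic cocycle. -/
structure IsAnalyticCocycle {ι : Type*} (Ω : Set (G × ℂ)) (𝒰 : ι → Set (G × ℂ))
    (c : ι → ι → G × ℂ → ℂ) : Prop where
  isOpen : IsOpen Ω
  open_cover : ∀ i, IsOpen (𝒰 i)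
  cover : ∀ q ∈ Ω, ∃ i, q ∈ 𝒰 i
  analytic : ∀ i j, ∀ q ∈ 𝒰 i ∩ 𝒰 j ∩ Ω, Ana (c i j) q
  cocycle : ∀ i j l, ∀ q ∈ 𝒰 i ∩ 𝒰 j ∩ 𝒰 l ∩ Ω, c i j q + c j l q = c i l q

variable {ι : Type*} {Ω : Set (G × ℂ)} {𝒰 : ι → Set (G × ℂ)} {c : ι → ι → G × ℂ → ℂ} {e : G}

lemma SplitsOn.mono {W V : Set (G × ℂ)} {b : ι → G × ℂ → ℂ} (h : SplitsOn 𝒰 c W b) (hV : V ⊆ W) :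
    SplitsOn 𝒰 c V b :=
  ⟨fun i q hq => h.1 i q ⟨hq.1, hV hq.2⟩, fun i j q hq => h.2 i j q ⟨hq.1, hV hq.2⟩⟩

lemma SplitsOnRect.mono {x₀ x₁ y₀ y₁ x₀' x₁' y₀' y₁' : ℝ} (h : SplitsOnRect Ω 𝒰 c e x₀ x₁ y₀ y₁)
    (h0 : x₀ ≤ x₀') (h1 : x₁' ≤ x₁) (h2 : y₀ ≤ y₀') (h3 : y₁' ≤ y₁) :
    SplitsOnRect Ω 𝒰 c e x₀' x₁' y₀' y₁' := by
  obtain ⟨W, hW, hΩ, hs, hb⟩ := h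
  refine ⟨W, hW, hΩ, Subset.trans ?_ hs, hb⟩
  refine prod_mono_right fun z hz => ?_
  rw [mem_reProdIm] at hz ⊢
  exact ⟨Icc_subset_Icc h0 h1 hz.1, Icc_subset_Icc h2 h3 hz.2⟩

lemma IsAnalyticCocycle.exists_splitsOnRect (hc : IsAnalyticCocycle Ω 𝒰 c) {ζ : ℂ}
    (hζ : (e, ζ) ∈ Ω) : ∃ ε > 0, SplitsOnRect Ω 𝒰 c e (ζ.re - ε) (ζ.re + ε) (ζ.im - ε) (ζ.im + ε) := by
  obtain ⟨i, hi⟩ := hc.cover _ hζ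
  have h1 : ∀ᶠ z in 𝓝 ζ, (e, z) ∈ 𝒰 i ∩ Ω := by
    have : Continuous fun z : ℂ => (e, z) := by fun_prop
    exact this.continuousAt.eventually (((hc.open_cover i).inter hc.isOpen).mem_nhds ⟨hi, hζ⟩)
  obtain ⟨ε, hε, hb⟩ := Metric.eventually_nhds_iff.1 h1
  refine ⟨ε / 3, by positivity, 𝒰 i ∩ Ω, (hc.open_cover i).inter hc.isOpen, inter_subset_right, ?_,
    fun j => c i j, fun j q hq => hc.analytic i j q ⟨⟨hq.2.1, hq.1⟩, hq.2.2⟩, fun j l q hq => ?_⟩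
  · rintro ⟨e', z⟩ ⟨he, hz⟩
    rw [mem_singleton_iff] at he
    simp only at he
    rw [he]
    refine hb ?_
    rw [mem_reProdIm] at hz
    simp only [mem_Icc] at hz
    rw [dist_eq]
    refine lt_of_le_of_lt (norm_le_abs_re_add_abs_im _) ?_
    simp only [sub_re, sub_im]
    have a1 : |z.re - ζ.re| ≤ ε / 3 := abs_le.2 ⟨by linarith, by linarith⟩
    have a2 : |z.im - ζ.im| ≤ ε / 3 := abs_le.2 ⟨by linarith, by linarith⟩
    linarith
  · have := hc.cocycle i j l q ⟨⟨⟨hq.2.1, hq.1.1⟩, hq.1.2⟩, hq.2.2⟩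
    simp only [← this]
    ring

/-- Two solutions on subsets `W₁, W₂` can be glued if their difference is the difference of
functions that are analytic on the subsets. -/
lemma IsAnalyticCocycle.glue (hc : IsAnalyticCocycle Ω 𝒰 c) {W₁ W₂ : Set (G × ℂ)} (h₁ : IsOpen W₁)
    (h₂ : IsOpen W₂) {b₁ b₂ : ι → G × ℂ → ℂ}
    (s₁ : SplitsOn 𝒰 c W₁ b₁) (s₂ : SplitsOn 𝒰 c W₂ b₂) {f₁ f₂ : G × ℂ → ℂ}
    (g₁ : ∀ q ∈ W₁, Ana f₁ q) (g₂ : ∀ q ∈ W₂, Ana f₂ q)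
    (hf : ∀ i, ∀ q ∈ 𝒰 i ∩ (W₁ ∩ W₂), b₁ i q - b₂ i q = f₁ q - f₂ q) :
    ∃ b, SplitsOn 𝒰 c (W₁ ∪ W₂) b := by
  classical
  set b : ι → G × ℂ → ℂ := fun i q => if q ∈ W₁ then b₁ i q - f₁ q else b₂ i q - f₂ q with hb
  have hb1 : ∀ i, ∀ q ∈ W₁, b i q = b₁ i q - f₁ q := fun i q hq => if_pos hq
  have hb2 : ∀ i, ∀ q ∈ 𝒰 i ∩ W₂, b i q = b₂ i q - f₂ q := by
    intro i q hq
    by_cases h : q ∈ W₁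
    · rw [hb1 i q h]
      linear_combination hf i q ⟨hq.1, h, hq.2⟩
    · exact if_neg h
  refine ⟨b, ?_, ?_⟩
  · rintro i q ⟨hi, hq | hq⟩
    · refine ((s₁.1 i q ⟨hi, hq⟩).sub (g₁ q hq)).congr ?_
      filter_upwards [h₁.mem_nhds hq] with q' hq'
      exact (hb1 i q' hq').symm
    · refine ((s₂.1 i q ⟨hi, hq⟩).sub (g₂ q hq)).congr ?_
      filter_upwards [(hc.open_cover i).mem_nhds hi, h₂.mem_nhds hq] with q' hq1 hq2
      exact (hb2 i q' ⟨hq1, hq2⟩).symm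
  · rintro i j q ⟨⟨hi, hj⟩, hq | hq⟩
    · rw [hb1 i q hq, hb1 j q hq, s₁.2 i j q ⟨⟨hi, hj⟩, hq⟩]
      ring
    · rw [hb2 i q ⟨hi, hq⟩, hb2 j q ⟨hj, hq⟩, s₂.2 i j q ⟨⟨hi, hj⟩, hq⟩]
      ring

lemma IsAnalyticCocycle.exists_difference (hc : IsAnalyticCocycle Ω 𝒰 c) {W : Set (G × ℂ)}
    (hWΩ : W ⊆ Ω) (hW : IsOpen W) {b₁ b₂ : ι → G × ℂ → ℂ}
    (s₁ : SplitsOn 𝒰 c W b₁) (s₂ : SplitsOn 𝒰 c W b₂) :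
    ∃ f : G × ℂ → ℂ, (∀ q ∈ W, Ana f q) ∧
      ∀ i, ∀ q ∈ 𝒰 i ∩ W, b₁ i q - b₂ i q = f q := by
  classical
  set f : G × ℂ → ℂ := fun q => if h : ∃ i, q ∈ 𝒰 i then b₁ h.choose q - b₂ h.choose q else 0
    with hf
  have key : ∀ i, ∀ q ∈ 𝒰 i ∩ W, b₁ i q - b₂ i q = f q := by
    rintro i q ⟨hi, hq⟩
    have h : ∃ i, q ∈ 𝒰 i := ⟨i, hi⟩
    rw [hf]
    simp only [dif_pos h]
    linear_combination s₁.2 i h.choose q ⟨⟨hi, h.choose_spec⟩, hq⟩ -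
      s₂.2 i h.choose q ⟨⟨hi, h.choose_spec⟩, hq⟩
  refine ⟨f, fun q hq => ?_, key⟩
  obtain ⟨i, hi⟩ := hc.cover q (hWΩ hq)
  refine ((s₁.1 i q ⟨hi, hq⟩).sub (s₂.1 i q ⟨hi, hq⟩)).congr ?_
  filter_upwards [(hc.open_cover i).mem_nhds hi, hW.mem_nhds hq] with q' h1 h2
  exact key i q' ⟨h1, h2⟩

lemma IsAnalyticCocycle.splitsOnRect_re (hc : IsAnalyticCocycle Ω 𝒰 c) {x₀ x x₁ y₀ y₁ : ℝ}
    (hy : y₀ ≤ y₁) (hx0 : x₀ ≤ x) (hx1 : x ≤ x₁) (h₁ : SplitsOnRect Ω 𝒰 c e x₀ x y₀ y₁)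
    (h₂ : SplitsOnRect Ω 𝒰 c e x x₁ y₀ y₁) : SplitsOnRect Ω 𝒰 c e x₀ x₁ y₀ y₁ := by
  obtain ⟨W₁, o₁, w₁, s₁, b₁, a₁⟩ := h₁
  obtain ⟨W₂, o₂, w₂, s₂, b₂, a₂⟩ := h₂
  obtain ⟨f, hf, hfe⟩ := hc.exists_difference (inter_subset_left.trans w₁) (o₁.inter o₂)
    (a₁.mono inter_subset_left) (a₂.mono inter_subset_right)
  have hL : {e} ×ˢ (Icc x x ×ℂ Icc y₀ y₁) ⊆ W₁ ∩ W₂ := by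
    rintro ⟨e', z⟩ ⟨h1, h2⟩
    rw [mem_reProdIm] at h2
    exact ⟨s₁ ⟨h1, mem_reProdIm.2 ⟨⟨hx0.trans h2.1.1, h2.1.2⟩, h2.2⟩⟩,
      s₂ ⟨h1, mem_reProdIm.2 ⟨⟨h2.1.1, h2.1.2.trans hx1⟩, h2.2⟩⟩⟩
  obtain ⟨T, hT, heT, δ, hδ, htube⟩ := exists_tube_rect (o₁.inter o₂) hL
  obtain ⟨f₁, f₂, hf1, hf2, hf12⟩ := rect_splitting (T := T) hδ hy
    (fun e' he' ζ h1 h2 h3 h4 => hf _ (htube e' he' ζ h1 h2 h3 h4 le_rfl hy))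
  have cre : Continuous fun q : G × ℂ => q.2.re := continuous_re.comp continuous_snd
  have cim : Continuous fun q : G × ℂ => q.2.im := continuous_im.comp continuous_snd
  set B := {q : G × ℂ | q.1 ∈ T} ∩ {q | y₀ - δ < q.2.im ∧ q.2.im < y₁ + δ}
  have oB : IsOpen B := (hT.preimage continuous_fst).inter
    ((isOpen_lt continuous_const cim).inter (isOpen_lt cim continuous_const))
  have oV1 : IsOpen (W₁ ∩ (B ∩ {q | q.2.re < x + δ})) :=
    o₁.inter (oB.inter (isOpen_lt cre continuous_const))
  have oV2 : IsOpen (W₂ ∩ (B ∩ {q | x - δ < q.2.re})) :=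
    o₂.inter (oB.inter (isOpen_lt continuous_const cre))
  obtain ⟨b, hb⟩ := hc.glue (f₁ := f₁) (f₂ := f₂) oV1 oV2 (a₁.mono inter_subset_left)
    (a₂.mono inter_subset_left)
    (fun q hq => hf1 q.1 hq.2.1.1 q.2 hq.2.2 hq.2.1.2.1 hq.2.1.2.2)
    (fun q hq => hf2 q.1 hq.2.1.1 q.2 hq.2.2)
    (fun i q hq => by
      rw [hfe i q ⟨hq.1, hq.2.1.1, hq.2.2.1⟩]
      exact hf12 q.1 hq.2.1.2.1.1 q.2 hq.2.2.2.2 hq.2.1.2.2 hq.2.1.2.1.2.1 hq.2.1.2.1.2.2)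
  refine ⟨_, oV1.union oV2, union_subset (inter_subset_left.trans w₁)
    (inter_subset_left.trans w₂), ?_, b, hb⟩
  rintro ⟨e', z⟩ ⟨h1, h2⟩
  rw [mem_singleton_iff] at h1
  simp only at h1
  subst h1
  rw [mem_reProdIm, mem_Icc, mem_Icc] at h2
  rcases le_total z.re x with h | h
  · exact Or.inl ⟨s₁ ⟨rfl, mem_reProdIm.2 ⟨⟨h2.1.1, h⟩, h2.2⟩⟩, ⟨heT, by grind⟩,
      lt_of_le_of_lt h (by linarith)⟩
  · exact Or.inr ⟨s₂ ⟨rfl, mem_reProdIm.2 ⟨⟨h, h2.1.2⟩, h2.2⟩⟩, ⟨heT, by grind⟩,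
      lt_of_lt_of_le (by linarith) h⟩

/-- The preimage under the multiplication of the last coordinate with `u`. -/
def rotate (u : ℂ) (q : G × ℂ) : G × ℂ := (q.1, u * q.2)

lemma continuous_rotate (u : ℂ) : Continuous (rotate u : G × ℂ → G × ℂ) := by
  unfold rotate; fun_prop

lemma analyticAt_comp_rotate {f : G × ℂ → ℂ} {u : ℂ} {q : G × ℂ} (h : Ana f (rotate u q)) :
    Ana (fun q => f (rotate u q)) q := by
  refine AnalyticAt.fun_comp (g := f) (f := rotate u) h ?_
  unfold rotate; fun_prop

lemma IsAnalyticCocycle.rotate (hc : IsAnalyticCocycle Ω 𝒰 c) (u : ℂ) :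
    IsAnalyticCocycle (rotate u ⁻¹' Ω) (fun i => rotate u ⁻¹' 𝒰 i)
      (fun i j q => c i j (rotate u q)) where
  isOpen := hc.isOpen.preimage (continuous_rotate u)
  open_cover i := (hc.open_cover i).preimage (continuous_rotate u)
  cover q hq := hc.cover _ hq
  analytic i j q hq := analyticAt_comp_rotate (hc.analytic i j _ hq)
  cocycle i j l q hq := hc.cocycle i j l _ hq

lemma SplitsOnRect.rotate {x₀ x₁ y₀ y₁ x₀' x₁' y₀' y₁' : ℝ} (h : SplitsOnRect Ω 𝒰 c e x₀ x₁ y₀ y₁)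
    (u : ℂ) (hu : ∀ ζ ∈ Icc x₀' x₁' ×ℂ Icc y₀' y₁', u * ζ ∈ Icc x₀ x₁ ×ℂ Icc y₀ y₁) :
    SplitsOnRect (rotate u ⁻¹' Ω) (fun i => rotate u ⁻¹' 𝒰 i) (fun i j q => c i j (rotate u q))
      e x₀' x₁' y₀' y₁' := by
  obtain ⟨W, hW, hΩ, hs, b, hb, hb'⟩ := h
  refine ⟨_, hW.preimage (continuous_rotate u), preimage_mono hΩ, ?_, fun i q => b i (TransversalAn.rotate u q),
    fun i q hq => analyticAt_comp_rotate (hb i _ hq), fun i j q hq => hb' i j _ hq⟩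
  rintro ⟨e', z⟩ ⟨h1, h2⟩
  exact hs ⟨h1, hu z h2⟩

lemma IsAnalyticCocycle.splitsOnRect_im (hc : IsAnalyticCocycle Ω 𝒰 c) {x₀ x₁ y₀ y y₁ : ℝ}
    (hx : x₀ ≤ x₁) (hy0 : y₀ ≤ y) (hy1 : y ≤ y₁) (h₁ : SplitsOnRect Ω 𝒰 c e x₀ x₁ y₀ y)
    (h₂ : SplitsOnRect Ω 𝒰 c e x₀ x₁ y y₁) : SplitsOnRect Ω 𝒰 c e x₀ x₁ y₀ y₁ := by
  have hI : ∀ {a b c d : ℝ}, ∀ ζ ∈ Icc a b ×ℂ Icc (-d) (-c), I * ζ ∈ Icc c d ×ℂ Icc a b := by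
    intro a b c d ζ hζ
    rw [mem_reProdIm, mem_Icc, mem_Icc] at hζ ⊢
    simp only [mul_re, mul_im, I_re, I_im]
    exact ⟨⟨by linarith, by linarith⟩, by linarith, by linarith⟩
  have r3 := ((hc.rotate I).splitsOnRect_re (by linarith) hy0 hy1 (h₁.rotate I hI)
    (h₂.rotate I hI)).rotate (x₀' := x₀) (x₁' := x₁) (y₀' := y₀) (y₁' := y₁) (-I) (by
      intro ζ hζ
      rw [mem_reProdIm, mem_Icc, mem_Icc] at hζ ⊢
      simp only [mul_re, mul_im, I_re, I_im, neg_re, neg_im]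
      exact ⟨⟨by linarith, by linarith⟩, by linarith, by linarith⟩)
  have hid : ∀ q : G × ℂ, TransversalAn.rotate I (TransversalAn.rotate (-I) q) = q := by
    rintro ⟨e, z⟩
    simp only [TransversalAn.rotate]
    rw [← mul_assoc, mul_neg, I_mul_I, neg_neg, one_mul]
  have hset : ∀ A : Set (G × ℂ), TransversalAn.rotate (-I) ⁻¹' (TransversalAn.rotate I ⁻¹' A) = A := by
    intro A
    simp only [← preimage_comp, Function.comp_def, hid, preimage_id']
  simpa only [hset, hid] using r3

/-- A property of intervals that holds locally and is compatible with subdivision holds. -/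
lemma interval_induction {p : ℝ → ℝ → Prop} {a b : ℝ} (hab : a ≤ b)
    (mono : ∀ s t s' t', s ≤ s' → t' ≤ t → p s t → p s' t')
    (glue : ∀ s t u, s ≤ t → t ≤ u → p s t → p t u → p s u)
    (loc : ∀ x ∈ Icc a b, ∃ ε > 0, p (x - ε) (x + ε)) : p a b := by
  choose! ε hε hp using loc
  obtain ⟨t, ht0, hmono, ⟨m, hm⟩, hsub⟩ := exists_monotone_Icc_subset_open_cover_Icc
    (ι := Icc a b) (c := fun x => Subtype.val ⁻¹' Ioo (x.1 - ε x) (x.1 + ε x)) hab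
    (fun x => isOpen_Ioo.preimage continuous_subtype_val)
    (fun x _ => mem_iUnion.2 ⟨x, by
      have := hε x x.2
      exact ⟨by linarith, by linarith⟩⟩)
  have hstep : ∀ i, p (t i) (t (i + 1)) := by
    intro i
    obtain ⟨x, hx⟩ := hsub i
    have hle : t i ≤ t (i + 1) := hmono (Nat.le_succ i)
    have h1 := hx (left_mem_Icc.2 hle)
    have h2 := hx (right_mem_Icc.2 hle)
    exact mono _ _ _ _ h1.1.le h2.2.le (hp x x.2)
  have hall : ∀ i, p a (t (i + 1)) := by
    intro i
    induction i with
    | zero => simpa [ht0] using hstep 0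
    | succ i ih => exact glue _ _ _ (t (i + 1)).2.1 (hmono (Nat.le_succ _)) ih (hstep (i + 1))
  have := hall m
  rwa [hm (m + 1) (Nat.le_succ m)] at this

/-- An analytic cocycle near the product of a point and a closed rectangle is a coboundary. -/
theorem IsAnalyticCocycle.splitsOnRect (hc : IsAnalyticCocycle Ω 𝒰 c) {x₀ x₁ y₀ y₁ : ℝ}
    (hx : x₀ ≤ x₁) (hy : y₀ ≤ y₁) (h : {e} ×ˢ (Icc x₀ x₁ ×ℂ Icc y₀ y₁) ⊆ Ω) :
    SplitsOnRect Ω 𝒰 c e x₀ x₁ y₀ y₁ := by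
  refine interval_induction (p := fun s t => SplitsOnRect Ω 𝒰 c e s t y₀ y₁) hx
    (fun s t s' t' h1 h2 h => h.mono h1 h2 le_rfl le_rfl)
    (fun s t u h1 h2 h3 h4 => hc.splitsOnRect_re hy h1 h2 h3 h4) ?_
  intro x hx'
  have := interval_induction (a := y₀) (b := y₁)
    (p := fun s t => ∃ ε > 0, SplitsOnRect Ω 𝒰 c e (x - ε) (x + ε) s t) hy
    (fun s t s' t' h1 h2 ⟨ε, hε, h⟩ => ⟨ε, hε, h.mono le_rfl le_rfl h1 h2⟩)
    (fun s t u h1 h2 ⟨ε, hε, h3⟩ ⟨ε', hε', h4⟩ => ⟨min ε ε', lt_min hε hε',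
      hc.splitsOnRect_im (by linarith [lt_min hε hε']) h1 h2
        (h3.mono (by linarith [min_le_left ε ε']) (by simp) le_rfl le_rfl)
        (h4.mono (by linarith [min_le_right ε ε']) (by simp) le_rfl le_rfl)⟩) ?_
  · exact this
  · intro y hy'
    obtain ⟨ε, hε, h1⟩ := hc.exists_splitsOnRect (e := e) (ζ := ⟨x, y⟩)
      (h ⟨rfl, mem_reProdIm.2 ⟨hx', hy'⟩⟩)
    exact ⟨ε, hε, ε, hε, h1⟩

/-- An analytic cocycle near the product of a point and the plane is, over a neighbourhood of the
point, a coboundary on a disc. -/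
theorem IsAnalyticCocycle.splits_disc (hc : IsAnalyticCocycle Ω 𝒰 c) (h : {e} ×ˢ univ ⊆ Ω) (R : ℝ) :
    ∃ T : Set G, IsOpen T ∧ e ∈ T ∧ ∃ b : ι → G × ℂ → ℂ,
      (∀ i, ∀ e' ∈ T, ∀ ζ : ℂ, ‖ζ‖ < R → (e', ζ) ∈ 𝒰 i → Ana (b i) (e', ζ)) ∧
      ∀ i j, ∀ e' ∈ T, ∀ ζ : ℂ, ‖ζ‖ < R → (e', ζ) ∈ 𝒰 i → (e', ζ) ∈ 𝒰 j →
        c i j (e', ζ) = b j (e', ζ) - b i (e', ζ) := by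
  rcases le_or_gt R 0 with hR | hR
  · exact ⟨univ, isOpen_univ, trivial, 0, fun i _ _ ζ h => absurd (norm_nonneg ζ) (by linarith),
      fun i j _ _ ζ h => absurd (norm_nonneg ζ) (by linarith)⟩
  obtain ⟨W, hW, -, hs, b, hb, hb'⟩ := hc.splitsOnRect (x₀ := -R) (x₁ := R) (y₀ := -R) (y₁ := R)
    (by linarith) (by linarith) (Subset.trans (prod_mono_right (subset_univ _)) h)
  obtain ⟨T, hT, heT, δ, hδ, htube⟩ := exists_tube_rect hW hs
  have key : ∀ e' ∈ T, ∀ ζ : ℂ, ‖ζ‖ < R → (e', ζ) ∈ W := by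
    intro e' he' ζ hζ
    have h1 := abs_lt.1 (lt_of_le_of_lt (abs_re_le_norm ζ) hζ)
    have h2 := abs_lt.1 (lt_of_le_of_lt (abs_im_le_norm ζ) hζ)
    exact htube e' he' ζ (by linarith) (by linarith) (by linarith) (by linarith) (by linarith)
      (by linarith)
  exact ⟨T, hT, heT, b, fun i e' he' ζ hζ hi => hb i _ ⟨hi, key e' he' ζ hζ⟩,
    fun i j e' he' ζ hζ hi hj => hb' i j _ ⟨⟨hi, hj⟩, key e' he' ζ hζ⟩⟩

end Cousin

/-! ### Local models -/

abbrev Amb (k : ℕ) : Type := (Fin k → ℂ) × ℂ × ℂ × ℂ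

abbrev Flat (k : ℕ) : Type := (Fin k → ℂ) × ℂ × ℂ

section Smooth

variable {X : Type u} {X' : Type v} [TopologicalSpace X] [HolSpace X] [TopologicalSpace X']
  [HolSpace X'] {V : Type u} {V' : Type v} [NormedAddCommGroup V] [NormedSpace ℂ V]
  [NormedAddCommGroup V'] [NormedSpace ℂ V']

lemma mem_hol_subtype {A : Set X} {f : A → ℂ} {a : A} :
    f ∈ 𝒪 a ↔ ∃ F ∈ 𝒪 (a : X), ∀ᶠ b : A in 𝓝 a, f b = F b := Iff.rfl

lemma restrict_mem_hol {A : Set X} {F : X → ℂ} {a : A} (hF : F ∈ 𝒪 (a : X)) :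
    (fun b : A => F b) ∈ 𝒪 a :=
  ⟨F, hF, Eventually.of_forall fun _ => rfl⟩

lemma IsBihol.mem_symm {ψ : OPH X X'} (h : IsBihol ψ) {y : X'}
    (hy : y ∈ ψ.target) {f : X → ℂ} : f ∈ 𝒪 (ψ.symm y) ↔ f ∘ ψ.symm ∈ 𝒪 y := by
  have h1 := h (ψ.symm y) (ψ.map_target hy) (f ∘ ψ.symm)
  rw [ψ.right_inv hy] at h1
  rw [h1]
  have he : f =ᶠ[𝓝 (ψ.symm y)] (f ∘ ψ.symm) ∘ ψ := by
    filter_upwards [ψ.open_source.mem_nhds (ψ.map_target hy)] with x hx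
    simp [ψ.left_inv hx]
  exact ⟨fun h => HolSpace.congr h he, fun h => HolSpace.congr h he.symm⟩

lemma isBihol_of {ψ : OPH X X'}
    (h1 : ∀ x ∈ ψ.source, ∀ f ∈ 𝒪 (ψ x), f ∘ ψ ∈ 𝒪 x)
    (h2 : ∀ x ∈ ψ.source, ∀ f ∈ 𝒪 x, f ∘ ψ.symm ∈ 𝒪 (ψ x)) : IsBihol ψ := by
  refine fun x hx f => ⟨h1 x hx f, fun h => ?_⟩
  refine HolSpace.congr (h2 x hx _ h) ?_
  filter_upwards [ψ.open_target.mem_nhds (ψ.map_source hx)] with y hy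
  simp [ψ.right_inv hy]

lemma IsBihol.symm {ψ : OPH X X'} (h : IsBihol ψ) : IsBihol ψ.symm :=
  fun _ hy _ => h.mem_symm hy

lemma IsBihol.trans {X'' : Type*} [TopologicalSpace X''] [HolSpace X'']
    {ψ : OPH X X'} {φ : OPH X' X''} (h : IsBihol ψ)
    (h' : IsBihol φ) : IsBihol (ψ.trans φ) := by
  intro x hx f
  rw [OpenPartialHomeomorph.trans_source] at hx
  exact (h' (ψ x) hx.2 f).trans (h x hx.1 (f ∘ φ))

lemma IsBihol.comp_mem {A : Set V'} {ψ : OPH X A} (h : IsBihol ψ) {x : X} (hx : x ∈ ψ.source) {F : V' → ℂ}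
    (hF : Ana F (ψ x : V')) : (fun y => F (ψ y)) ∈ 𝒪 x :=
  (h x hx fun a : A => F a).1 (restrict_mem_hol hF)

lemma IsBihol.exists_analytic {A : Set V'} {ψ : OPH X A} (h : IsBihol ψ) {x : X}
    (hx : x ∈ ψ.source) {f : X → ℂ} (hf : f ∈ 𝒪 x) :
    ∃ F : V' → ℂ, Ana F (ψ x : V') ∧ ∀ᶠ y in 𝓝 x, f y = F (ψ y) := by
  rw [← ψ.left_inv hx] at hf
  obtain ⟨F, hF, he⟩ := (h.mem_symm (ψ.map_source hx)).1 hf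
  refine ⟨F, hF, ?_⟩
  filter_upwards [(ψ.continuousAt hx).eventually he, ψ.open_source.mem_nhds hx] with y hy hy'
  rw [← hy, Function.comp_apply, ψ.left_inv hy']

lemma IsBihol.continuousAt {A : Set V'} {ψ : OPH X A} (h : IsBihol ψ) {x : X}
    (hx : x ∈ ψ.source) {f : X → ℂ} (hf : f ∈ 𝒪 x) : ContinuousAt f x := by
  obtain ⟨F, hF, he⟩ := h.exists_analytic hx hf
  exact (ContinuousAt.comp (g := F) (f := fun y => (ψ y : V')) hF.continuousAt
    (continuous_subtype_val.continuousAt.comp (ψ.continuousAt hx)))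
    |>.congr (he.mono fun _ h => h.symm)

lemma comp_mem_hol_of_analytic {A : Set V} {A' : Set V'} {φ : A → A'} {a : A}
    {Φ : V → V'} (hΦ : Ana Φ (a : V)) (he : ∀ᶠ b : A in 𝓝 a, (φ b : V') = Φ b)
    {f : A' → ℂ} (hf : f ∈ 𝒪 (φ a)) : f ∘ φ ∈ 𝒪 a := by
  obtain ⟨F, hF, h⟩ := hf
  have h0 : (φ a : V') = Φ a := he.self_of_nhds
  have hc : ContinuousAt φ a := by
    rw [IsInducing.subtypeVal.continuousAt_iff]
    have : ContinuousAt (fun b : A => Φ b) a :=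
      ContinuousAt.comp (f := Subtype.val) hΦ.continuousAt continuous_subtype_val.continuousAt
    exact this.congr (he.mono fun _ hb => hb.symm)
  refine ⟨F ∘ Φ, ?_, ?_⟩
  · have : Ana F (Φ a) := h0 ▸ hF
    exact this.comp hΦ
  · filter_upwards [hc.eventually h, he] with b h1 h2
    simp only [Function.comp_apply, h1, h2]

lemma comp_mem_hol_of_analytic_left {A : Set V} {φ : A → V'} {a : A}
    {Φ : V → V'} (hΦ : Ana Φ (a : V)) (he : ∀ᶠ b : A in 𝓝 a, φ b = Φ b)
    {f : V' → ℂ} (hf : f ∈ 𝒪 (φ a)) : f ∘ φ ∈ 𝒪 a := by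
  rw [he.self_of_nhds] at hf
  exact ⟨f ∘ Φ, AnalyticAt.comp hf hΦ, he.mono fun b hb => congrArg f hb⟩

lemma comp_mem_hol_of_analytic_right {A' : Set V'} {φ : V → A'} {a : V}
    {Φ : V → V'} (hΦ : Ana Φ a) (he : ∀ᶠ b in 𝓝 a, (φ b : V') = Φ b)
    {f : A' → ℂ} (hf : f ∈ 𝒪 (φ a)) : f ∘ φ ∈ 𝒪 a := by
  obtain ⟨F, hF, h⟩ := hf
  have h0 : (φ a : V') = Φ a := he.self_of_nhds
  have hc : ContinuousAt φ a := by
    rw [IsInducing.subtypeVal.continuousAt_iff]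
    exact hΦ.continuousAt.congr (he.mono fun _ hb => hb.symm)
  have hF' : Ana F (Φ a) := h0 ▸ hF
  refine (hF'.comp hΦ).congr ?_
  filter_upwards [hc.eventually h, he] with b h1 h2
  simp only [Function.comp_apply, h1, h2]

lemma SmoothAt.of_bihol {d : ℕ} {ψ : OPH X X'} (h : IsBihol ψ) {x : X}
    (hx : x ∈ ψ.source) (hs : SmoothAt d (ψ x)) : SmoothAt d x := by
  obtain ⟨φ, hφ, hb⟩ := hs
  exact ⟨ψ.trans φ, by rw [OpenPartialHomeomorph.trans_source]; exact ⟨hx, hφ⟩, h.trans hb⟩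

lemma isOpen_setOf_smoothAt (d : ℕ) : IsOpen {x : X | SmoothAt d x} := by
  rw [isOpen_iff_mem_nhds]
  rintro x ⟨φ, hφ, hb⟩
  exact mem_of_superset (φ.open_source.mem_nhds hφ) fun y hy => ⟨φ, hy, hb⟩

lemma isClosed_singularLocus (d : ℕ) : IsClosed (singularLocus d X) :=
  ⟨by simpa only [singularLocus, compl_ofPred, not_not] using isOpen_setOf_smoothAt d⟩

lemma isBihol_continuousLinearEquiv (L : V ≃L[ℂ] V') :
    IsBihol L.toHomeomorph.toOpenPartialHomeomorph := by
  refine isBihol_of (fun x _ f hf => ?_) fun x _ f hf => ?_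
  · exact AnalyticAt.comp (g := f) (f := L) hf ((L : V →L[ℂ] V').analyticAt x)
  · refine AnalyticAt.comp (g := f) (f := L.symm) ?_ ((L.symm : V' →L[ℂ] V).analyticAt (L x))
    have : L.symm (L x) = x := L.symm_apply_apply x
    exact this.symm ▸ hf

lemma smoothAt_of_flat {k : ℕ} (x : Flat k) : SmoothAt (k + 2) x := by
  have hfin : Module.finrank ℂ (Flat k) = Module.finrank ℂ (Fin (k + 2) → ℂ) := by simp
  exact ⟨_, mem_univ _, isBihol_continuousLinearEquiv (ContinuousLinearEquiv.ofFinrankEq hfin)⟩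

/-- The identification of `ℂ^k × ℂ²` with the model `x y = z`. -/
def flatModel (k : ℕ) : Flat k ≃ₜ AModel 0 k where
  toFun p := ⟨(p.1, p.2.1, p.2.2, p.2.1 * p.2.2), by simp [AModel]⟩
  invFun q := (q.1.1, q.1.2.1, q.1.2.2.1)
  left_inv p := rfl
  right_inv q := by
    have h := q.2
    simp only [AModel, mem_ofPred_eq, zero_add, pow_one] at h
    ext1
    simp only [h]
  continuous_toFun := by fun_prop
  continuous_invFun := by fun_prop

lemma isBihol_flatModel (k : ℕ) : IsBihol (flatModel k).toOpenPartialHomeomorph := by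
  refine isBihol_of (fun x _ f hf => ?_) fun x _ f hf => ?_
  · exact comp_mem_hol_of_analytic_right (φ := flatModel k)
      (Φ := fun p : Flat k => ((p.1, p.2.1, p.2.2, p.2.1 * p.2.2) : Amb k)) (by fun_prop)
      (Eventually.of_forall fun _ => rfl) hf
  · exact comp_mem_hol_of_analytic_left (φ := (flatModel k).symm)
      (Φ := fun q : Amb k => ((q.1, q.2.1, q.2.2.1) : Flat k)) (a := flatModel k x) (by fun_prop)
      (Eventually.of_forall fun _ => rfl) hf

lemma smoothAt_model_zero {k : ℕ} (q : AModel 0 k) : SmoothAt (k + 2) q :=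
  SmoothAt.of_bihol (isBihol_flatModel k).symm (mem_univ _) (smoothAt_of_flat _)

lemma exists_chart_of_smoothAt {k : ℕ} {x : X} (h : SmoothAt (k + 2) x) :
    ∃ ψ : OPH X (AModel 0 k), x ∈ ψ.source ∧ IsBihol ψ := by
  obtain ⟨φ, hφ, hb⟩ := h
  have hfin : Module.finrank ℂ (Fin (k + 2) → ℂ) = Module.finrank ℂ (Flat k) := by simp
  refine ⟨(φ.trans (ContinuousLinearEquiv.ofFinrankEq
    hfin).toHomeomorph.toOpenPartialHomeomorph).trans (flatModel k).toOpenPartialHomeomorph, ?_,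
    (hb.trans (isBihol_continuousLinearEquiv _)).trans (isBihol_flatModel k)⟩
  simp [hφ]

/-- The chart `(w, x, z)` of the model where `x ≠ 0`. -/
def modelChartX (m k : ℕ) : OPH (AModel m k) (Flat k) where
  toFun q := (q.1.1, q.1.2.1, q.1.2.2.2)
  invFun p := if h : p.2.1 = 0 then ⟨(p.1, 0, 0, 0), by simp [AModel]⟩ else
    ⟨(p.1, p.2.1, p.2.2 ^ (m + 1) / p.2.1, p.2.2), by
      simp only [AModel, mem_ofPred_eq]; field_simp⟩
  source := {q | q.1.2.1 ≠ 0}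
  target := {p | p.2.1 ≠ 0}
  map_source' q hq := hq
  map_target' p hp := by
    simp only [mem_ofPred_eq] at hp ⊢
    simp [hp]
  left_inv' q hq := by
    simp only [mem_ofPred_eq] at hq
    rw [dif_neg hq]
    ext1
    have h := q.2
    simp only [AModel, mem_ofPred_eq] at h
    simp only [← h, mul_div_cancel_left₀ _ hq]
  right_inv' p hp := by
    simp only [mem_ofPred_eq] at hp
    rw [dif_neg hp]
  open_source := isOpen_ne_fun (by fun_prop) continuous_const
  open_target := isOpen_ne_fun (by fun_prop) continuous_const
  continuousOn_toFun := Continuous.continuousOn (by fun_prop)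
  continuousOn_invFun := by
    rw [IsInducing.subtypeVal.continuousOn_iff]
    have h : ContinuousOn (fun p : Flat k => ((p.1, p.2.1, p.2.2 ^ (m + 1) / p.2.1, p.2.2) : Amb k))
        {p | p.2.1 ≠ 0} :=
      ContinuousOn.prodMk (by fun_prop) (ContinuousOn.prodMk (by fun_prop)
        (ContinuousOn.prodMk (ContinuousOn.div (by fun_prop) (by fun_prop) fun p hp => hp)
          (by fun_prop)))
    exact h.congr fun p hp => congrArg Subtype.val (dif_neg hp)

lemma isBihol_modelChartX (m k : ℕ) : IsBihol (modelChartX m k) := by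
  refine isBihol_of (fun q _ f => comp_mem_hol_of_analytic_left (φ := modelChartX m k)
      (Φ := fun q : Amb k => ((q.1, q.2.1, q.2.2.2) : Flat k)) (by fun_prop)
      (Eventually.of_forall fun _ => rfl)) fun q hq f hf => ?_
  have hq' : (modelChartX m k q).2.1 ≠ 0 := hq
  refine comp_mem_hol_of_analytic_right (φ := (modelChartX m k).symm)
    (Φ := fun p : Flat k => ((p.1, p.2.1, p.2.2 ^ (m + 1) / p.2.1, p.2.2) : Amb k))
    (a := modelChartX m k q) ?_ ?_ ?_
  · have : Ana (fun p : Flat k => p.2.2 ^ (m + 1) / p.2.1) (modelChartX m k q) :=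
      AnalyticAt.div (by fun_prop) (by fun_prop) hq'
    fun_prop
  · filter_upwards [(isOpen_ne_fun (f := fun p : Flat k => p.2.1) (by fun_prop)
      continuous_const).mem_nhds hq'] with p hp
    exact congrArg Subtype.val (dif_neg hp)
  · rwa [(modelChartX m k).left_inv hq]

/-- Exchanging the coordinates `x` and `y` of the model. -/
def modelSwap (m k : ℕ) : AModel m k ≃ₜ AModel m k where
  toFun q := ⟨(q.1.1, q.1.2.2.1, q.1.2.1, q.1.2.2.2), by have := q.2; simp_all [AModel, mul_comm]⟩
  invFun q := ⟨(q.1.1, q.1.2.2.1, q.1.2.1, q.1.2.2.2), by have := q.2; simp_all [AModel, mul_comm]⟩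
  left_inv q := rfl
  right_inv q := rfl
  continuous_toFun := by fun_prop
  continuous_invFun := by fun_prop

lemma isBihol_modelSwap (m k : ℕ) : IsBihol (modelSwap m k).toOpenPartialHomeomorph := by
  have h (q : AModel m k) (f : AModel m k → ℂ) : f ∈ 𝒪 (modelSwap m k q) → f ∘ modelSwap m k ∈ 𝒪 q :=
    comp_mem_hol_of_analytic (φ := modelSwap m k)
      (Φ := fun q : Amb k => ((q.1, q.2.2.1, q.2.1, q.2.2.2) : Amb k)) (by fun_prop)
      (Eventually.of_forall fun _ => rfl)
  exact isBihol_of (fun q _ => h q) fun q _ => h (modelSwap m k q)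

lemma smoothAt_model {m k : ℕ} {q : AModel m k} (hq : q.1.2 ≠ 0) : SmoothAt (k + 2) q := by
  have key : ∀ q : AModel m k, q.1.2.1 ≠ 0 → SmoothAt (k + 2) q := fun q hq =>
    SmoothAt.of_bihol (isBihol_modelChartX m k) hq (smoothAt_of_flat _)
  by_cases hx : q.1.2.1 = 0
  · refine SmoothAt.of_bihol (isBihol_modelSwap m k) (mem_univ _) (key _ ?_)
    intro hy
    have h := q.2
    simp only [AModel, mem_ofPred_eq, hx, zero_mul] at h
    exact hq (Prod.ext hx (Prod.ext hy (pow_eq_zero_iff (Nat.succ_ne_zero m) |>.1 h.symm)))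
  · exact key q hx

/-- A retraction-like analytic map that fixes the points of the model near a core point has the
identity as its derivative. -/
lemma fderiv_eq_id_of_fixes_model {m k : ℕ} (hm : 1 ≤ m) {w : Fin k → ℂ} {g : Amb k → Amb k}
    (hg : DifferentiableAt ℂ g (w, 0)) (h : ∀ᶠ q in 𝓝 ((w, 0) : Amb k), q ∈ AModel m k → g q = q) :
    fderiv ℂ g (w, 0) = ContinuousLinearMap.id ℂ (Amb k) := by
  have key : ∀ (γ : ℂ → Amb k) (v : Amb k), γ 0 = (w, 0) → HasDerivAt γ v 0 →
      (∀ t, γ t ∈ AModel m k) → fderiv ℂ g (w, 0) v = v := by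
    intro γ v h0 hγ hmem
    have h1 : HasDerivAt (g ∘ γ) (fderiv ℂ g (w, 0) v) 0 :=
      HasFDerivAt.comp_hasDerivAt (x := (0 : ℂ)) (h0 ▸ hg.hasFDerivAt) hγ
    have h2 : g ∘ γ =ᶠ[𝓝 0] γ := by
      have := hγ.continuousAt
      rw [ContinuousAt, h0] at this
      filter_upwards [this.eventually h] with t ht
      exact ht (hmem t)
    exact (h1.congr_of_eventuallyEq h2.symm).unique hγ
  have hw : ∀ v : Fin k → ℂ, fderiv ℂ g (w, 0) (v, 0) = (v, 0) := by
    intro v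
    refine key (fun t => (w + t • v, 0)) _ (by simp) ?_ fun t => by simp [AModel]
    refine HasDerivAt.prodMk ?_ (hasDerivAt_const _ _)
    simpa using ((hasDerivAt_id (0 : ℂ)).smul_const v).const_add w
  have hx : fderiv ℂ g (w, 0) (0, 1, 0, 0) = (0, 1, 0, 0) := by
    refine key (fun t => (w, t, 0, 0)) _ rfl ?_ fun t => by simp [AModel]
    exact (hasDerivAt_const _ _).prodMk ((hasDerivAt_id _).prodMk (hasDerivAt_const _ _))
  have hy : fderiv ℂ g (w, 0) (0, 0, 1, 0) = (0, 0, 1, 0) := by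
    refine key (fun t => (w, 0, t, 0)) _ rfl ?_ fun t => by simp [AModel]
    exact (hasDerivAt_const _ _).prodMk ((hasDerivAt_const _ _).prodMk
      ((hasDerivAt_id _).prodMk (hasDerivAt_const _ _)))
  obtain ⟨c, hc⟩ : ∃ c : ℂ, fderiv ℂ g (w, 0) (0, 1, c, 1) = (0, 1, c, 1) := by
    refine ⟨m * 0 ^ (m - 1), key (fun t => (w, t, t ^ m, t)) _ (by simp [show m ≠ 0 by omega]) ?_ fun t => ?_⟩
    · exact (hasDerivAt_const _ _).prodMk ((hasDerivAt_id _).prodMk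
        ((hasDerivAt_pow m 0).prodMk (hasDerivAt_id _)))
    · simp [AModel, pow_succ']
  refine ContinuousLinearMap.ext fun q => ?_
  have e : q = ((q.1, 0) : Amb k) + ((q.2.1 - q.2.2.2) • ((0, 1, 0, 0) : Amb k) +
      ((q.2.2.1 - q.2.2.2 * c) • ((0, 0, 1, 0) : Amb k) + q.2.2.2 • ((0, 1, c, 1) : Amb k))) := by
    ext <;> simp
  rw [ContinuousLinearMap.id_apply]
  conv_lhs => rw [e]
  conv_rhs => rw [e]
  simp only [map_add, map_smul, hw, hx, hy, hc]

lemma not_smoothAt_model {m k : ℕ} (hm : 1 ≤ m) {q : AModel m k} (hq : q.1.2 = 0) :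
    ¬ SmoothAt (k + 2) q := by
  rintro ⟨φ, hφ, hb⟩
  have hcoord : ∀ i, (fun q' => φ q' i) ∈ 𝒪 q := by
    intro i
    refine (hb q hφ fun p => p i).1 ?_
    exact (ContinuousLinearMap.proj (R := ℂ) (φ := fun _ : Fin (k + 2) => ℂ) i).analyticAt _
  choose F hF hFe using fun i => mem_hol_subtype.1 (hcoord i)
  set Ψ : Amb k → Fin (k + 2) → ℂ := fun p i => F i p with hΨ
  have hΨa : Ana Ψ (q : Amb k) := AnalyticAt.pi hF
  have hΨe : ∀ᶠ q' : AModel m k in 𝓝 q, φ q' = Ψ q' :=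
    (eventually_all.2 hFe).mono fun q' h => funext h
  have hsym : ∀ L : Amb k →L[ℂ] ℂ, Ana (fun p => L (φ.symm p)) (φ q) := by
    intro L
    refine (hb.mem_symm (φ.map_source hφ) (f := fun q' : AModel m k => L q')).1 ?_
    rw [φ.left_inv hφ]
    exact restrict_mem_hol (L.analyticAt _)
  set Φ : (Fin (k + 2) → ℂ) → Amb k := fun p => (φ.symm p : Amb k) with hΦdef
  have hΦ : Ana Φ (φ q) := by
    have s1 : ∀ i, Ana (fun p => (φ.symm p : Amb k).1 i) (φ q) := fun i =>
      hsym ((ContinuousLinearMap.proj (R := ℂ) (φ := fun _ : Fin k => ℂ) i).comp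
        (ContinuousLinearMap.fst ℂ _ _))
    have s2 := hsym ((ContinuousLinearMap.fst ℂ ℂ (ℂ × ℂ)).comp (ContinuousLinearMap.snd ℂ _ _))
    have s3 := hsym (((ContinuousLinearMap.fst ℂ ℂ ℂ).comp (ContinuousLinearMap.snd ℂ _ _)).comp
      (ContinuousLinearMap.snd ℂ _ _))
    have s4 := hsym (((ContinuousLinearMap.snd ℂ ℂ ℂ).comp (ContinuousLinearMap.snd ℂ _ _)).comp
      (ContinuousLinearMap.snd ℂ _ _))
    exact (AnalyticAt.pi s1).prod (s2.prod (s3.prod s4))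
  have hq0 : (q : Amb k) = (q.1.1, 0) := Prod.ext rfl hq
  have hval : Ψ (q : Amb k) = φ q := hΨe.self_of_nhds.symm
  have hcomp : ∀ᶠ p in 𝓝 (q : Amb k), p ∈ AModel m k → Φ (Ψ p) = p := by
    have h1 := (hΨe.and (φ.open_source.mem_nhds hφ)).filter_mono le_rfl
    rw [nhds_subtype_eq_comap, eventually_comap] at h1
    filter_upwards [h1] with p hp hpm
    obtain ⟨h2, h3⟩ := hp ⟨p, hpm⟩ rfl
    rw [hΦdef]
    simp only
    rw [← h2, φ.left_inv h3]
  have hΦ' : Ana Φ (Ψ (q : Amb k)) := hval ▸ hΦ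
  have hd := fderiv_eq_id_of_fixes_model (m := m) hm (w := q.1.1) (g := Φ ∘ Ψ)
    (by rw [← hq0]; exact (hΦ'.comp hΨa).differentiableAt) (by rw [← hq0]; exact hcomp)
  rw [← hq0, fderiv_comp _ hΦ'.differentiableAt hΨa.differentiableAt] at hd
  have hinj : Function.Injective (fderiv ℂ Ψ (q : Amb k)) := by
    intro a b hab
    have := DFunLike.congr_fun hd
    exact (this a).symm.trans (by simpa [hab] using this b)
  have := LinearMap.finrank_le_finrank_of_injective
    (f := (fderiv ℂ Ψ (q : Amb k) : Amb k →ₗ[ℂ] Fin (k + 2) → ℂ)) hinj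
  simp at this

variable {m k : ℕ} {ψ : OPH X (AModel m k)}

lemma smoothAt_iff_of_chart (hψ : IsBihol ψ) (hm : 1 ≤ m) {x : X} (hx : x ∈ ψ.source) :
    SmoothAt (k + 2) x ↔ (ψ x : Amb k).2 ≠ 0 := by
  refine ⟨fun h h0 => not_smoothAt_model hm h0 ?_, fun h => SmoothAt.of_bihol hψ hx (smoothAt_model h)⟩
  refine SmoothAt.of_bihol hψ.symm (ψ.map_source hx) ?_
  rwa [ψ.left_inv hx]

lemma mem_singularLocus_iff_of_chart (hψ : IsBihol ψ) (hm : 1 ≤ m) {x : X} (hx : x ∈ ψ.source) :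
    x ∈ Sing k X ↔ (ψ x : Amb k).2 = 0 := by
  rw [singularLocus, mem_ofPred_eq, smoothAt_iff_of_chart hψ hm hx, not_not]

lemma smoothAt_of_chart_zero {ψ : OPH X (AModel 0 k)} (hψ : IsBihol ψ) {x : X}
    (hx : x ∈ ψ.source) : SmoothAt (k + 2) x :=
  SmoothAt.of_bihol hψ hx (smoothAt_model_zero _)

end Smooth

section CoreIdeal

variable {k : ℕ}

/-- The ideal of the functions that vanish on the core `x = y = z = 0` is generated by `x, y, z`. -/
lemma exists_eq_sum_of_vanishing {F : Amb k → ℂ} {q : Amb k} (hF : Ana F q)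
    (h0 : ∀ᶠ p in 𝓝 q, p.2 = 0 → F p = 0) :
    ∃ F₁ F₂ F₃ : Amb k → ℂ, Ana F₁ q ∧ Ana F₂ q ∧ Ana F₃ q ∧
      ∀ᶠ p in 𝓝 q, F p = F₁ p * p.2.1 + F₂ p * p.2.2.1 + F₃ p * p.2.2.2 := by
  have hne {g : Amb k → ℂ} (hg : Continuous g) (h : g q ≠ 0) : ∀ᶠ p in 𝓝 q, F p = F p / g p * g p :=
    (hg.continuousAt.eventually_ne h).mono fun p hp => (div_mul_cancel₀ _ hp).symm
  by_cases hx : q.2.1 = 0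
  swap
  · exact ⟨fun p => F p / p.2.1, 0, 0, hF.div (by fun_prop) hx, analyticAt_const, analyticAt_const,
      by simpa using hne (by fun_prop) hx⟩
  by_cases hy : q.2.2.1 = 0
  swap
  · exact ⟨0, fun p => F p / p.2.2.1, 0, analyticAt_const, hF.div (by fun_prop) hy,
      analyticAt_const, by simpa using hne (by fun_prop) hy⟩
  by_cases hz : q.2.2.2 = 0
  swap
  · exact ⟨0, 0, fun p => F p / p.2.2.2, analyticAt_const, analyticAt_const,
      hF.div (by fun_prop) hz, by simpa using hne (by fun_prop) hz⟩
  obtain ⟨w, x, y, z⟩ := q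
  simp only at hx hy hz
  subst hx hy hz
  have a1 := analyticAt_dslope_zero (G := (Fin k → ℂ) × ℂ × ℂ) (e := (w, 0, 0))
    (F := fun p => F (p.1.1, p.2, p.1.2.1, p.1.2.2))
    (AnalyticAt.fun_comp (g := F) (f := fun p : ((Fin k → ℂ) × ℂ × ℂ) × ℂ =>
      ((p.1.1, p.2, p.1.2.1, p.1.2.2) : Amb k)) (x := ((w, 0, 0), 0)) hF (by fun_prop))
  have a2 := analyticAt_dslope_zero (G := (Fin k → ℂ) × ℂ) (e := (w, 0))
    (F := fun p => F (p.1.1, 0, p.2, p.1.2))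
    (AnalyticAt.fun_comp (g := F) (f := fun p : ((Fin k → ℂ) × ℂ) × ℂ =>
      ((p.1.1, 0, p.2, p.1.2) : Amb k)) (x := ((w, 0), 0)) hF (by fun_prop))
  have a3 := analyticAt_dslope_zero (G := (Fin k → ℂ)) (e := w)
    (F := fun p => F (p.1, 0, 0, p.2))
    (AnalyticAt.fun_comp (g := F) (f := fun p : (Fin k → ℂ) × ℂ =>
      ((p.1, 0, 0, p.2) : Amb k)) (x := (w, 0)) hF (by fun_prop))
  refine ⟨_, _, _,
    AnalyticAt.fun_comp (f := fun p : Amb k => ((p.1, p.2.2.1, p.2.2.2), p.2.1))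
      (x := ((w, 0, 0, 0) : Amb k)) a1 (by fun_prop),
    AnalyticAt.fun_comp (f := fun p : Amb k => ((p.1, p.2.2.2), p.2.2.1))
      (x := ((w, 0, 0, 0) : Amb k)) a2 (by fun_prop),
    AnalyticAt.fun_comp (f := fun p : Amb k => (p.1, p.2.2.2))
      (x := ((w, 0, 0, 0) : Amb k)) a3 (by fun_prop), ?_⟩
  have hc : Tendsto (fun p : Amb k => ((p.1, 0) : Amb k)) (𝓝 (w, 0, 0, 0)) (𝓝 (w, 0, 0, 0)) :=
    Continuous.tendsto' (by fun_prop) _ _ rfl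
  filter_upwards [hc.eventually h0] with p hp
  have e0 : F (p.1, 0, 0, 0) = 0 := hp rfl
  have e1 := sub_smul_dslope (fun ξ => F (p.1, ξ, p.2.2.1, p.2.2.2)) 0 p.2.1
  have e2 := sub_smul_dslope (fun ξ => F (p.1, 0, ξ, p.2.2.2)) 0 p.2.2.1
  have e3 := sub_smul_dslope (fun ξ => F (p.1, 0, 0, ξ)) 0 p.2.2.2
  simp only [sub_zero, smul_eq_mul] at e1 e2 e3
  have e4 : F p = F (p.1, p.2.1, p.2.2.1, p.2.2.2) := rfl
  linear_combination e4 - e1 - e2 - e3 + e0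

variable {X : Type u} [TopologicalSpace X] [HolSpace X] {m : ℕ}

def coreFun (ψ : OPH X (AModel m k)) : Fin 3 → X → ℂ :=
  ![fun y => (ψ y : Amb k).2.1, fun y => (ψ y : Amb k).2.2.1, fun y => (ψ y : Amb k).2.2.2]

/-- `f_0, …, f_r` generate the ideal sheaf of `S` on `V`. -/
def GeneratesIdeal {r : ℕ} (S V : Set X) (f : Fin r → X → ℂ) : Prop :=
  ∀ y ∈ V, (∀ i, MemIdeal S y (f i)) ∧ ∀ h, MemIdeal S y h →
    ∃ c : Fin r → X → ℂ, (∀ i, c i ∈ 𝒪 y) ∧ ∀ᶠ t in 𝓝 y, h t = ∑ i, c i t * f i t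

lemma coreFun_mem {ψ : OPH X (AModel m k)} (hψ : IsBihol ψ) {y : X} (hy : y ∈ ψ.source)
    (i : Fin 3) : coreFun ψ i ∈ 𝒪 y := by
  fin_cases i
  · exact hψ.comp_mem hy (F := fun p => p.2.1) (by fun_prop)
  · exact hψ.comp_mem hy (F := fun p => p.2.2.1) (by fun_prop)
  · exact hψ.comp_mem hy (F := fun p => p.2.2.2) (by fun_prop)

lemma generatesIdeal_coreFun {ψ : OPH X (AModel m k)} (hψ : IsBihol ψ)
    (hm : 1 ≤ m) : GeneratesIdeal (Sing k X) ψ.source (coreFun ψ) := by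
  intro y hy
  refine ⟨fun i => ⟨coreFun_mem hψ hy i, ?_⟩, fun h hh => ?_⟩
  · filter_upwards [ψ.open_source.mem_nhds hy] with t ht hS
    have h0 := (mem_singularLocus_iff_of_chart hψ hm ht).1 hS
    fin_cases i <;> simp [coreFun, h0]
  · obtain ⟨F, hF, hFe⟩ := hψ.exists_analytic hy hh.1
    have hvan : ∀ᶠ p in 𝓝 (ψ y : Amb k), p.2 = 0 → F p = 0 := by
      have h1 : ∀ᶠ q : AModel m k in 𝓝 (ψ y), q.1.2 = 0 → F q = 0 := by
        have hcs : Tendsto ψ.symm (𝓝 (ψ y)) (𝓝 y) := ψ.tendsto_symm hy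
        filter_upwards [hcs.eventually hFe, hcs.eventually hh.2,
          ψ.open_target.mem_nhds (ψ.map_source hy)] with q h1 h2 h3 h4
        rw [ψ.right_inv h3] at h1
        rw [← h1]
        exact h2 ((mem_singularLocus_iff_of_chart hψ hm (ψ.map_target h3)).2 (by rwa [ψ.right_inv h3]))
      rw [nhds_subtype_eq_comap, eventually_comap] at h1
      filter_upwards [h1] with p hp hp0
      exact hp ⟨p, by simp [AModel, hp0]⟩ rfl hp0
    obtain ⟨F₁, F₂, F₃, a1, a2, a3, he⟩ := exists_eq_sum_of_vanishing hF hvan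
    refine ⟨![fun t => F₁ (ψ t), fun t => F₂ (ψ t), fun t => F₃ (ψ t)], fun i => ?_, ?_⟩
    · fin_cases i <;> exact hψ.comp_mem hy ‹_›
    · have hc : Tendsto (fun t => (ψ t : Amb k)) (𝓝 y) (𝓝 (ψ y : Amb k)) :=
        (continuous_subtype_val.tendsto _).comp (ψ.continuousAt hy)
      filter_upwards [hFe, hc.eventually he] with t h1 h2
      rw [h1, h2, Fin.sum_univ_three]
      rfl

lemma generatesIdeal_one {d : ℕ} {V : Set X} (hV : IsOpen V) (h : ∀ y ∈ V, SmoothAt d y) :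
    GeneratesIdeal (singularLocus d X) V (fun _ : Fin 1 => (1 : X → ℂ)) := by
  intro y hy
  refine ⟨fun _ => ⟨one_mem _, ?_⟩, fun g hg => ⟨fun _ => g, fun _ => hg.1, ?_⟩⟩
  · filter_upwards [hV.mem_nhds hy] with t ht hS
    exact absurd (h t ht) hS
  · exact Eventually.of_forall fun t => by simp

end CoreIdeal

/-! ### Projective space -/

section Projective

open ComplexConjugate

variable {r : ℕ} {w : Fin (r + 1) → ℂ} {ℓ : ℙ r} {j : Fin (r + 1)}

/-- The line spanned by a non-zero vector (an arbitrary line for the zero vector). -/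
def line (w : Fin (r + 1) → ℂ) : ℙ r :=
  open Classical in if h : w ≠ 0 then Projectivization.mk ℂ w h else
    Projectivization.mk ℂ (fun _ => 1) (fun h => one_ne_zero (congrFun h 0))

lemma line_of_ne (h : w ≠ 0) : line w = Projectivization.mk ℂ w h :=
  dif_pos h

lemma line_smul {c : ℂ} (hc : c ≠ 0) (w : Fin (r + 1) → ℂ) : line (c • w) = line w := by
  by_cases h : w = 0
  · rw [h, smul_zero]
  · rw [line_of_ne h, line_of_ne (smul_ne_zero hc h), Projectivization.mk_eq_mk_iff']
    exact ⟨c, rfl⟩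

lemma exists_rep_line (h : w ≠ 0) :
    ∃ c : ℂ, c ≠ 0 ∧ (line w).rep = c • w := by
  rw [line_of_ne h]
  obtain ⟨a, ha⟩ := Projectivization.exists_smul_eq_mk_rep ℂ w h
  exact ⟨a, a.ne_zero, ha.symm⟩

lemma rep_line_ne (h : w ≠ 0) (j : Fin (r + 1)) :
    (line w).rep j ≠ 0 ↔ w j ≠ 0 := by
  obtain ⟨c, hc, he⟩ := exists_rep_line h
  rw [he, Pi.smul_apply, smul_eq_mul]
  simp [hc]

lemma affineCoord_line (h : w ≠ 0) (j : Fin (r + 1)) :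
    affineCoord j (line w) = fun i => w i / w j := by
  obtain ⟨c, hc, he⟩ := exists_rep_line h
  funext i
  rw [affineCoord, he, Pi.smul_apply, Pi.smul_apply, smul_eq_mul, smul_eq_mul,
    mul_div_mul_left _ _ hc]

lemma exists_rep_ne (ℓ : ℙ r) : ∃ j, ℓ.rep j ≠ 0 := by
  by_contra! h
  exact ℓ.rep_nonzero (funext h)

lemma line_rep (ℓ : ℙ r) : line ℓ.rep = ℓ := by
  rw [line_of_ne ℓ.rep_nonzero, ℓ.mk_rep]

lemma line_affineCoord (h : ℓ.rep j ≠ 0) : line (affineCoord j ℓ) = ℓ := by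
  have : affineCoord j ℓ = (ℓ.rep j)⁻¹ • ℓ.rep := by
    funext i
    rw [affineCoord, Pi.smul_apply, smul_eq_mul, div_eq_inv_mul]
  rw [this, line_smul (inv_ne_zero h), line_rep]

lemma continuousAt_line (h : w ≠ 0) : ContinuousAt line w := by
  have h1 : ContinuousOn line {w : Fin (r + 1) → ℂ | w ≠ 0} := by
    rw [continuousOn_iff_continuous_domRestrict]
    have : ({w : Fin (r + 1) → ℂ | w ≠ 0}.domRestrict line) =
        fun w : {w : Fin (r + 1) → ℂ // w ≠ 0} => Projectivization.mk ℂ w.1 w.2 :=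
      funext fun w => line_of_ne w.2
    rw [this]
    exact continuous_coinduced_rng
  exact h1.continuousAt (isOpen_ne.mem_nhds h)

lemma isOpen_projective_iff {U : Set (ℙ r)} :
    IsOpen U ↔ IsOpen {w : Fin (r + 1) → ℂ | w ≠ 0 ∧ line w ∈ U} := by
  have h1 : IsOpen U ↔ IsOpen ((fun w : {w : Fin (r + 1) → ℂ // w ≠ 0} =>
      Projectivization.mk ℂ w.1 w.2) ⁻¹' U) := isOpen_coinduced
  have hne : IsOpen {w : Fin (r + 1) → ℂ | w ≠ 0} := isOpen_ne
  rw [h1, hne.isOpenEmbedding_subtypeVal.isOpen_iff_image_isOpen]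
  have : (Subtype.val '' ((fun w : {w : Fin (r + 1) → ℂ // w ≠ 0} =>
      Projectivization.mk ℂ w.1 w.2) ⁻¹' U)) = {w : Fin (r + 1) → ℂ | w ≠ 0 ∧ line w ∈ U} := by
    ext w
    simp only [mem_image, mem_preimage, Subtype.exists, exists_and_right, exists_eq_right,
      mem_ofPred_eq]
    exact ⟨fun ⟨h, h'⟩ => ⟨h, by rwa [line_of_ne h]⟩, fun ⟨h, h'⟩ => ⟨h, by rwa [line_of_ne h] at h'⟩⟩
  exact Iff.of_eq (congrArg IsOpen this)

lemma isOpen_rep_ne (j : Fin (r + 1)) :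
    IsOpen {ℓ : ℙ r | ℓ.rep j ≠ 0} := by
  rw [isOpen_projective_iff]
  have : {w : Fin (r + 1) → ℂ | w ≠ 0 ∧
      line w ∈ {ℓ : ℙ r | ℓ.rep j ≠ 0}} = {w | w j ≠ 0} := by
    ext w
    simp only [mem_ofPred_eq]
    exact ⟨fun ⟨h, h'⟩ => (rep_line_ne h j).1 h', fun h => by
      have h0 : w ≠ 0 := fun h0 => h (by rw [h0]; rfl)
      exact ⟨h0, (rep_line_ne h0 j).2 h⟩⟩
  rw [this]
  exact isOpen_ne_fun (by fun_prop) continuous_const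

lemma continuousAt_affineCoord (h : ℓ.rep j ≠ 0) : ContinuousAt (affineCoord j) ℓ := by
  suffices hc : ContinuousOn (affineCoord j) {ℓ : ℙ r | ℓ.rep j ≠ 0} from
    hc.continuousAt ((isOpen_rep_ne j).mem_nhds h)
  rw [continuousOn_open_iff (isOpen_rep_ne j)]
  intro O hO
  rw [isOpen_projective_iff]
  have hc : ContinuousOn (fun w : Fin (r + 1) → ℂ => fun i => w i / w j) {w | w j ≠ 0} :=
    continuousOn_pi.2 fun i => ContinuousOn.div (by fun_prop) (by fun_prop) fun w hw => hw
  have hop : IsOpen {w : Fin (r + 1) → ℂ | w j ≠ 0} := isOpen_ne_fun (by fun_prop) continuous_const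
  convert (continuousOn_open_iff hop).1 hc O hO using 1
  ext w
  simp only [mem_ofPred_eq, mem_inter_iff, mem_preimage]
  constructor
  · rintro ⟨h0, h1, h2⟩
    exact ⟨(rep_line_ne h0 j).1 h1, by rwa [affineCoord_line h0] at h2⟩
  · rintro ⟨h1, h2⟩
    have h0 : w ≠ 0 := fun h0 => h1 (by rw [h0]; rfl)
    exact ⟨h0, (rep_line_ne h0 j).2 h1, by rwa [affineCoord_line h0]⟩

instance instT2SpaceProjective : T2Space (ℙ r) := by
  set H : (Fin (r + 1) → ℂ) → Fin (r + 1) → Fin (r + 1) → ℂ := fun w i j =>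
    w i * conj (w j) / ∑ l, w l * conj (w l) with hH
  have hsum : ∀ w : Fin (r + 1) → ℂ, w ≠ 0 → ∑ l, w l * conj (w l) ≠ 0 := by
    intro w hw h0
    simp only [mul_conj] at h0
    rw [← ofReal_sum, ofReal_eq_zero,
      Finset.sum_eq_zero_iff_of_nonneg fun i _ => normSq_nonneg _] at h0
    exact hw (funext fun i => normSq_eq_zero.1 (h0 i (Finset.mem_univ i)))
  have hHs : ∀ (c : ℂ) (w), c ≠ 0 → H (c • w) = H w := by
    intro c w hc
    funext i j
    have hc' : conj c ≠ 0 := (map_ne_zero _).2 hc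
    simp only [hH, Pi.smul_apply, smul_eq_mul, map_mul]
    have e1 : ∀ i j, c * w i * (conj c * conj (w j)) =
        (c * conj c) * (w i * conj (w j)) := fun i j => by ring
    simp only [e1, ← Finset.mul_sum]
    rw [mul_div_mul_left _ _ (mul_ne_zero hc hc')]
  have hline : ∀ w, w ≠ 0 → H (line w).rep = H w := by
    intro w hw
    obtain ⟨c, hc, he⟩ := exists_rep_line hw
    rw [he, hHs c w hc]
  refine T2Space.of_injective_continuous
    (f := fun ℓ : ℙ r => H ℓ.rep) ?_ ?_
  · intro ℓ ℓ' h
    simp only at h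
    obtain ⟨j, hj⟩ := exists_rep_ne ℓ
    have hc : ∀ i, H ℓ.rep i j = H ℓ'.rep i j := fun i => by rw [h]
    simp only [hH] at hc
    have n1 := hsum _ ℓ.rep_nonzero
    have n2 := hsum _ ℓ'.rep_nonzero
    set N := ∑ l, ℓ.rep l * conj (ℓ.rep l)
    set N' := ∑ l, ℓ'.rep l * conj (ℓ'.rep l)
    have hj' : conj (ℓ.rep j) ≠ 0 := (map_ne_zero _).2 hj
    have e : ℓ.rep = (N * conj (ℓ'.rep j) / (N' * conj (ℓ.rep j))) • ℓ'.rep := by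
      funext i
      have := hc i
      rw [Pi.smul_apply, smul_eq_mul]
      field_simp at this ⊢
      linear_combination this
    rw [← line_rep ℓ, e, line_smul, line_rep]
    intro h0
    rw [h0, zero_smul] at e
    exact ℓ.rep_nonzero e
  · refine continuous_coinduced_dom.2 ?_
    have : (fun ℓ : ℙ r => H ℓ.rep) ∘
        (fun w : {w : Fin (r + 1) → ℂ // w ≠ 0} => Projectivization.mk ℂ w.1 w.2) =
        fun w => H w.1 := by
      funext w
      simp only [Function.comp_apply]
      rw [← line_of_ne w.2, hline w.1 w.2]
    rw [this]
    refine continuous_pi fun i => continuous_pi fun j => ?_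
    simp only [hH]
    have hi : ∀ i, Continuous fun w : {w : Fin (r + 1) → ℂ // w ≠ 0} => w.1 i := fun i =>
      (continuous_apply i).comp continuous_subtype_val
    exact Continuous.div ((hi i).mul (continuous_conj.comp (hi j)))
      (continuous_finsetSum _ fun l _ => (hi l).mul (continuous_conj.comp (hi l)))
      fun w => hsum w.1 w.2

end Projective

/-! ### Blow-ups with a given system of generators -/

section BlowUp

/-- The product of a matrix of functions, at the point `y`, with a vector. -/
def applyAt {X : Type u} {r s : ℕ} (C : Fin s → Fin r → X → ℂ) (y : X) (t : Fin r → ℂ) :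
    Fin s → ℂ := fun i => ∑ l, C i l y * t l

lemma applyAt_smul {X : Type u} {r s : ℕ} (C : Fin s → Fin r → X → ℂ) (y : X) (c : ℂ)
    (t : Fin r → ℂ) : applyAt C y (c • t) = c • applyAt C y t := by
  funext i
  simp only [applyAt, Pi.smul_apply, smul_eq_mul, Finset.mul_sum]
  exact Finset.sum_congr rfl fun l _ => by ring

lemma rep_eq_smul_affineCoord {r : ℕ} {ℓ : ℙ r} {j : Fin (r + 1)}
    (h : ℓ.rep j ≠ 0) : ℓ.rep = ℓ.rep j • affineCoord j ℓ := by
  funext i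
  change ℓ.rep i = ℓ.rep j * (ℓ.rep i / ℓ.rep j)
  field_simp

lemma continuousAt_applyAt {X : Type u} [TopologicalSpace X] {r s : ℕ}
    {C : Fin s → Fin r → X → ℂ} {y : X} (hC : ∀ i l, ContinuousAt (C i l) y) (t : Fin r → ℂ) :
    ContinuousAt (fun q : X × (Fin r → ℂ) => applyAt C q.1 q.2) (y, t) := by
  refine continuousAt_pi.2 fun i => tendsto_finsetSum _ fun l _ => ?_
  refine Tendsto.mul ?_ ?_
  · exact ContinuousAt.comp (hC i l) continuousAt_fst
  · exact ContinuousAt.comp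
      (continuous_apply l).continuousAt continuousAt_snd

lemma continuousAt_applyAt_affineCoord {X : Type u} [TopologicalSpace X] {r s : ℕ}
    {C : Fin s → Fin (r + 1) → X → ℂ} {y : X} (hC : ∀ i l, ContinuousAt (C i l) y) {ℓ : ℙ r}
    {j : Fin (r + 1)} (hj : ℓ.rep j ≠ 0) :
    ContinuousAt (fun q : X × ℙ r => applyAt C q.1 (affineCoord j q.2)) (y, ℓ) :=
  ContinuousAt.comp (f := fun q : X × ℙ r => (q.1, affineCoord j q.2)) (x := (y, ℓ))
    (continuousAt_applyAt hC _) (continuousAt_fst.prodMk (ContinuousAt.comp (g := affineCoord j)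
      (x := (y, ℓ)) (continuousAt_affineCoord hj) continuousAt_snd))

lemma continuousAt_line_applyAt {X : Type u} [TopologicalSpace X] {r s : ℕ}
    {C : Fin (s + 1) → Fin (r + 1) → X → ℂ} {y : X} (hC : ∀ i l, ContinuousAt (C i l) y)
    {ℓ : ℙ r} (h : applyAt C y ℓ.rep ≠ 0) :
    ContinuousAt (fun q : X × ℙ r => line (applyAt C q.1 q.2.rep)) (y, ℓ) := by
  obtain ⟨j, hj⟩ := exists_rep_ne ℓ
  refine (ContinuousAt.comp (continuousAt_line (fun h0 => h (by
    rw [rep_eq_smul_affineCoord hj, applyAt_smul, h0, smul_zero])))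
    (continuousAt_applyAt_affineCoord hC hj)).congr ?_
  filter_upwards [(continuousAt_snd).eventually ((isOpen_rep_ne j).mem_nhds hj)]
    with q hq
  rw [Function.comp_apply, rep_eq_smul_affineCoord hq, applyAt_smul, line_smul hq]

lemma analyticAt_proj {V κ : Type*} [NormedAddCommGroup V] [NormedSpace ℂ V] [Fintype κ] (i : κ)
    (q : V × (κ → ℂ)) : Ana (fun q : V × (κ → ℂ) => q.2 i) q :=
  ((ContinuousLinearMap.proj i).comp
    (ContinuousLinearMap.snd ℂ V (κ → ℂ))).analyticAt q

lemma analyticAt_fst_apply {V κ : Type*} [NormedAddCommGroup V] [NormedSpace ℂ V] [Fintype κ]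
    (i : κ) (q : (κ → ℂ) × V) : Ana (fun q : (κ → ℂ) × V => q.1 i) q :=
  ((ContinuousLinearMap.proj i).comp
    (ContinuousLinearMap.fst ℂ (κ → ℂ) V)).analyticAt q

attribute [fun_prop] analyticAt_proj

/-- The graph of `[e_0 : … : e_r]` over `V \ S`. -/
def graphOver {X : Type u} (S V : Set X) {r : ℕ} (e : Fin (r + 1) → X → ℂ) : Set (X × ℙ r) :=
  {q | q.1 ∈ V ∧ q.1 ∉ S ∧ q.2 = line (fun i => e i q.1)}

variable {X' X : Type u} [TopologicalSpace X'] [HolSpace X'] [TopologicalSpace X] [HolSpace X]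

/-- `h` is near `p` an analytic function of functions on the base and of the affine coordinates of
the projective space. -/
def HolForm {r : ℕ} (β : X' → X) (g : X' → ℙ r) (p : X')
    (h : X' → ℂ) : Prop :=
  ∃ j, (g p).rep j ≠ 0 ∧ ∃ (ι : Type) (_ : Fintype ι) (a : ι → X → ℂ), (∀ i, a i ∈ 𝒪 (β p)) ∧
    ∃ F : (ι → ℂ) × (Fin (r + 1) → ℂ) → ℂ,
      Ana F (fun i => a i (β p), affineCoord j (g p)) ∧
      ∀ᶠ p' in 𝓝 p, h p' = F (fun i => a i (β p'), affineCoord j (g p'))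

lemma holForm_iff {r : ℕ} {β : X' → X} {g : X' → ℙ r} {p : X'}
    {h : X' → ℂ} : HolForm β g p h ↔
    ∃ j, (g p).rep j ≠ 0 ∧ ∃ (m : ℕ) (a : Fin m → X → ℂ), (∀ i, a i ∈ 𝒪 (β p)) ∧
      ∃ F : (Fin m → ℂ) × (Fin (r + 1) → ℂ) → ℂ,
        Ana F (fun i => a i (β p), affineCoord j (g p)) ∧
        ∀ᶠ p' in 𝓝 p, h p' = F (fun i => a i (β p'), affineCoord j (g p')) := by
  constructor
  · rintro ⟨j, hj, ι, _, a, ha, F, hF, he⟩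
    let ε := Fintype.equivFin ι
    refine ⟨j, hj, Fintype.card ι, fun i => a (ε.symm i), fun i => ha _,
      fun q => F (fun i => q.1 (ε i), q.2), ?_, ?_⟩
    · refine AnalyticAt.comp
        ?_ ?_
      · simpa using hF
      · exact (AnalyticAt.pi fun i => analyticAt_fst_apply _ _).prod (by fun_prop)
    · filter_upwards [he] with p' hp'
      simpa using hp'
  · rintro ⟨j, hj, m, a, ha, F, hF, he⟩
    exact ⟨j, hj, Fin m, inferInstance, a, ha, F, hF, he⟩

/-- `(β, g)` identifies the part of `X'` over `V` with the closure of the graph of `[e_0 : … : e_r]`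
over the complement of `S`. -/
structure BlowUpData (S V : Set X) (β : X' → X) {r : ℕ} (e : Fin (r + 1) → X → ℂ)
    (g : X' → ℙ r) : Prop where
  nhds : ∀ p, β p ∈ V → 𝓝 p = comap (fun p' => (β p', g p')) (𝓝 (β p, g p))
  inj : ∀ p q, β p ∈ V → β p = β q → g p = g q → p = q
  graph : ∀ y ∈ V, ∀ ℓ, (∃ p, β p = y ∧ g p = ℓ) ↔
    (y, ℓ) ∈ closure (graphOver S V e)
  hol : ∀ p, β p ∈ V → ∀ h, h ∈ 𝒪 p ↔ HolForm β g p h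

lemma GeneratesIdeal.ne_zero {r : ℕ} {S V : Set X} {f : Fin r → X → ℂ} (h : GeneratesIdeal S V f)
    (hS : IsClosed S) {y : X} (hy : y ∈ V) (hyS : y ∉ S) : (fun i => f i y) ≠ 0 := by
  intro h0
  have h1 : MemIdeal S y 1 := by
    refine ⟨one_mem _, ?_⟩
    filter_upwards [hS.isOpen_compl.mem_nhds hyS] with t ht hS
    exact absurd hS ht
  obtain ⟨c, -, hc⟩ := (h y hy).2 1 h1
  have := hc.self_of_nhds
  simp [fun i => congrFun h0 i] at this

lemma closure_inter_open_iff {T : Type*} [TopologicalSpace T] {A O : Set T} (hO : IsOpen O) {q : T}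
    (hq : q ∈ O) : q ∈ closure A ↔ q ∈ closure (A ∩ O) := by
  refine ⟨fun h => ?_, fun h => closure_mono inter_subset_left h⟩
  rw [inter_comm]
  exact hO.inter_closure ⟨hq, h⟩

lemma graph_localize {r : ℕ} {S V O : Set X} {e : Fin (r + 1) → X → ℂ} (hO : IsOpen O)
    (hOV : O ⊆ V) {y : X} (hy : y ∈ O) (ℓ : ℙ r) :
    (y, ℓ) ∈ closure (graphOver S V e) ↔
    (y, ℓ) ∈ closure (graphOver S O e) := by
  rw [closure_inter_open_iff (hO.prod isOpen_univ) (show (y, ℓ) ∈ O ×ˢ univ from ⟨hy, trivial⟩)]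
  have : (graphOver S V e ∩ O ×ˢ univ) = graphOver S O e := by
    ext q
    exact ⟨fun h => ⟨h.2.1, h.1.2⟩, fun h => ⟨⟨hOV h.1, h.2⟩, h.1, trivial⟩⟩
  rw [this]

section
variable {S V : Set X} {β : X' → X} {r : ℕ} {e : Fin (r + 1) → X → ℂ}
  {g : X' → ℙ r}

lemma BlowUpData.mono (h : BlowUpData S V β e g) {O : Set X} (hO : IsOpen O) (hOV : O ⊆ V) :
    BlowUpData S O β e g where
  nhds p hp := h.nhds p (hOV hp)
  inj p q hp := h.inj p q (hOV hp)
  graph y hy ℓ := by rw [h.graph y (hOV hy), graph_localize hO hOV hy]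
  hol p hp := h.hol p (hOV hp)

lemma BlowUpData.of_local (h : ∀ y ∈ V, ∃ O, IsOpen O ∧ y ∈ O ∧ O ⊆ V ∧ BlowUpData S O β e g) :
    BlowUpData S V β e g where
  nhds p hp := let ⟨_, _, h1, _, h2⟩ := h _ hp; h2.nhds p h1
  inj p q hp := let ⟨_, _, h1, _, h2⟩ := h _ hp; h2.inj p q h1
  graph y hy ℓ := by
    obtain ⟨O, hO, h1, h2, h3⟩ := h _ hy
    rw [h3.graph y h1, graph_localize hO h2 h1]
  hol p hp := let ⟨_, _, h1, _, h2⟩ := h _ hp; h2.hol p h1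

lemma BlowUpData.continuousAt (h : BlowUpData S V β e g) {p : X'} (hp : β p ∈ V) :
    ContinuousAt (fun p' => (β p', g p')) p := by
  rw [ContinuousAt, h.nhds p hp]
  exact tendsto_comap

lemma BlowUpData.eq_line (h : BlowUpData S V β e g) (hS : IsClosed S)
    (he : GeneratesIdeal S V e) (hcont : ∀ y ∈ V, ∀ h ∈ 𝒪 y, ContinuousAt h y) {p : X'}
    (hp : β p ∈ V) (hpS : β p ∉ S) : g p = line (fun i => e i (β p)) := by
  have hc :=
    ContinuousAt.comp (continuousAt_line (he.ne_zero hS hp hpS))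
      (continuousAt_pi.2 fun i => hcont _ hp _ ((he _ hp).1 i).1)
  have h1 := (h.graph _ hp _).1 ⟨p, rfl, rfl⟩
  rw [mem_closure_iff_nhdsWithin_neBot] at h1
  set A := graphOver S V e
  have t2 : Tendsto (fun q =>
      line (fun i => e i q.1)) (𝓝[A] (β p, g p)) (𝓝 (line (fun i => e i (β p)))) :=
    Tendsto.comp hc ((continuousAt_fst).mono_left nhdsWithin_le_nhds)
  refine tendsto_nhds_unique ((continuousAt_snd).mono_left nhdsWithin_le_nhds) (t2.congr' ?_)
  filter_upwards [self_mem_nhdsWithin] with q hq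
  exact hq.2.2.symm

lemma BlowUpData.neBot (h : BlowUpData S V β e g) {p : X'} (hp : β p ∈ V) :
    (𝓝[β ⁻¹' Sᶜ] p).NeBot := by
  rw [← mem_closure_iff_nhdsWithin_neBot, mem_closure_iff_nhds]
  intro U hU
  rw [h.nhds p hp, mem_comap] at hU
  obtain ⟨W, hW, hWU⟩ := hU
  obtain ⟨q, hq, hqA⟩ := mem_closure_iff_nhds.1 ((h.graph _ hp _).1 ⟨p, rfl, rfl⟩) W hW
  obtain ⟨p', h2, h3⟩ := (h.graph q.1 hqA.1 q.2).2 (subset_closure hqA)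
  refine ⟨p', hWU ?_, ?_⟩
  · change (β p', g p') ∈ W
    rw [h2, h3]; exact hq
  · change β p' ∉ S
    rw [h2]; exact hqA.2.1

lemma HolForm.transfer {s : ℕ} {D : Fin (s + 1) → Fin (r + 1) → X → ℂ}
    {g' : X' → ℙ s} {p : X'}
    (hD : ∀ i l, D i l ∈ 𝒪 (β p)) (hg : ContinuousAt g p)
    (hT : ∀ᶠ p' in 𝓝 p, applyAt D (β p') (g p').rep ≠ 0 ∧
      g' p' = line (applyAt D (β p') (g p').rep))
    {h : X' → ℂ} (hh : HolForm β g' p h) : HolForm β g p h := by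
  obtain ⟨i, hi, ι, _, a, ha, F, hF, he⟩ := hh
  obtain ⟨j, hj⟩ := exists_rep_ne (g p)
  have hco : ∀ p', (g p').rep j ≠ 0 → applyAt D (β p') (g p').rep ≠ 0 →
      g' p' = line (applyAt D (β p') (g p').rep) →
      affineCoord i (g' p') = fun s' => applyAt D (β p') (affineCoord j (g p')) s' /
        applyAt D (β p') (affineCoord j (g p')) i := fun p' h1 h2 h3 => by
    rw [h3, affineCoord_line h2]
    rw [rep_eq_smul_affineCoord h1, applyAt_smul]
    funext s'
    rw [Pi.smul_apply, Pi.smul_apply, smul_eq_mul, smul_eq_mul, mul_div_mul_left _ _ h1]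
  obtain ⟨hT0, hT1⟩ := hT.self_of_nhds
  have hden : applyAt D (β p) (affineCoord j (g p)) i ≠ 0 := by
    rw [hT1, rep_line_ne hT0, rep_eq_smul_affineCoord hj, applyAt_smul] at hi
    exact right_ne_zero_of_mul hi
  refine ⟨j, hj, ι ⊕ (Fin (s + 1) × Fin (r + 1)), inferInstance,
    Sum.elim a fun q => D q.1 q.2, ?_, fun b => F (fun t => b.1 (Sum.inl t),
      fun s' => (∑ l, b.1 (Sum.inr (s', l)) * b.2 l) / ∑ l, b.1 (Sum.inr (i, l)) * b.2 l), ?_, ?_⟩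
  · rintro (t | q)
    · exact ha t
    · exact hD q.1 q.2
  · refine AnalyticAt.comp
      ?_ ?_
    · rw [hco p hj hT0 hT1] at hF
      exact hF
    · refine (AnalyticAt.pi fun t => analyticAt_fst_apply _ _).prod (AnalyticAt.pi fun s' =>
        AnalyticAt.div ?_ ?_ hden) <;> exact Finset.analyticAt_fun_sum _ fun l _ =>
          (analyticAt_fst_apply _ _).mul (analyticAt_proj _ _)
  · filter_upwards [he, hT, hg.eventually ((isOpen_rep_ne j).mem_nhds hj)] with p' h1 h2 h3
    rw [h1, hco p' h3 h2.1 h2.2]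
    rfl

end

/-- The extension of `[e_0 : … : e_r]` to the blow-up. -/
def ratioMap (S : Set X) (β : X' → X) {r : ℕ} (e : Fin (r + 1) → X → ℂ) (p : X') :
    ℙ r :=
  @limUnder _ _ _ ⟨line 0⟩ (𝓝[β ⁻¹' Sᶜ] p) (fun p' => line (fun i => e i (β p')))

lemma BlowUpData.change {S V : Set X} {β : X' → X} {r s : ℕ} {f : Fin (r + 1) → X → ℂ}
    {g : X' → ℙ r} (h : BlowUpData S V β f g) (hS : IsClosed S)
    (hV : IsOpen V) (hf : GeneratesIdeal S V f)
    (hcont : ∀ y ∈ V, ∀ h ∈ 𝒪 y, ContinuousAt h y) {e : Fin (s + 1) → X → ℂ}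
    (he : GeneratesIdeal S V e) {C : Fin (r + 1) → Fin (s + 1) → X → ℂ}
    {D : Fin (s + 1) → Fin (r + 1) → X → ℂ} (hC : ∀ y ∈ V, ∀ i l, C i l ∈ 𝒪 y)
    (hD : ∀ y ∈ V, ∀ i l, D i l ∈ 𝒪 y)
    (hCe : ∀ y ∈ V, (fun i => f i y) = applyAt C y (fun i => e i y))
    (hDf : ∀ y ∈ V, (fun i => e i y) = applyAt D y (fun i => f i y)) :
    BlowUpData S V β e (ratioMap S β e) := by
  have hCc : ∀ y ∈ V, ∀ i l, ContinuousAt (C i l) y := fun y hy i l => hcont y hy _ (hC y hy i l)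
  have hDc : ∀ y ∈ V, ∀ i l, ContinuousAt (D i l) y := fun y hy i l => hcont y hy _ (hD y hy i l)
  have hβ : ∀ p, β p ∈ V → ContinuousAt β p := fun p hp => (h.continuousAt hp).fst
  -- on the closure of the graph the two matrices are inverse to each other
  have key : ∀ {a b : ℕ} {A : Fin (a + 1) → Fin (b + 1) → X → ℂ}
      {B : Fin (b + 1) → Fin (a + 1) → X → ℂ} {k : Fin (b + 1) → X → ℂ} {y : X}
      (_ : y ∈ V) (_ : ∀ y ∈ V, ∀ i l, ContinuousAt (A i l) y)
      (_ : ∀ y ∈ V, ∀ i l, ContinuousAt (B i l) y)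
      (_ : ∀ y ∈ V, y ∉ S → (fun i => k i y) ≠ 0)
      (_ : ∀ y ∈ V, (fun i => k i y) = applyAt B y (applyAt A y fun i => k i y))
      {ℓ : ℙ b}
      (_ : (y, ℓ) ∈ closure (graphOver S V k)),
      applyAt B y (applyAt A y ℓ.rep) = ℓ.rep := by
    intro a b A B k y hy hA hB hk hBA ℓ hℓ
    obtain ⟨j, hj⟩ := exists_rep_ne ℓ
    set G := graphOver S V k with hG
    rw [mem_closure_iff_nhdsWithin_neBot] at hℓ
    have c2 := continuousAt_applyAt_affineCoord (hA y hy) hj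
    have c3 : ContinuousAt (fun q =>
        applyAt B q.1 (applyAt A q.1 (affineCoord j q.2))) (y, ℓ) :=
      ContinuousAt.comp (f := fun q : X × ℙ b => (q.1, applyAt A q.1 (affineCoord j q.2)))
        (x := (y, ℓ)) (continuousAt_applyAt (hB y hy) _) (continuousAt_fst.prodMk c2)
    have c4 : ContinuousAt (fun q => affineCoord j q.2) (y, ℓ) :=
      ContinuousAt.comp (g := affineCoord j) (x := (y, ℓ)) (continuousAt_affineCoord hj)
        continuousAt_snd
    have e1 : applyAt B y (applyAt A y (affineCoord j ℓ)) = affineCoord j ℓ := by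
      refine tendsto_nhds_unique (c3.mono_left (nhdsWithin_le_nhds (s := G)))
        ((c4.mono_left (nhdsWithin_le_nhds (s := G))).congr' ?_)
      filter_upwards [self_mem_nhdsWithin] with q hq
      have e2 : affineCoord j q.2 = ((k j q.1)⁻¹ : ℂ) • (fun i => k i q.1) := by
        rw [hq.2.2, affineCoord_line (hk _ hq.1 hq.2.1)]
        funext i
        rw [Pi.smul_apply, smul_eq_mul, div_eq_inv_mul]
      rw [e2, applyAt_smul, applyAt_smul, ← hBA _ hq.1]
    rw [rep_eq_smul_affineCoord hj, applyAt_smul, applyAt_smul, e1]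
  have hfne : ∀ y ∈ V, y ∉ S → (fun i => f i y) ≠ 0 := fun y hy hyS => hf.ne_zero hS hy hyS
  have hene : ∀ y ∈ V, y ∉ S → (fun i => e i y) ≠ 0 := fun y hy hyS => he.ne_zero hS hy hyS
  have kf : ∀ p, β p ∈ V → applyAt C (β p) (applyAt D (β p) (g p).rep) = (g p).rep := fun p hp =>
    key (k := f) hp hDc hCc hfne (fun y hy => by rw [← hDf y hy, ← hCe y hy])
      ((h.graph _ hp _).1 ⟨p, rfl, rfl⟩)
  have hDne : ∀ p, β p ∈ V → applyAt D (β p) (g p).rep ≠ 0 := by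
    intro p hp h0
    refine (g p).rep_nonzero ((kf p hp).symm.trans ?_)
    funext i
    rw [h0]; simp [applyAt]
  have hlD : ∀ p, β p ∈ V → ContinuousAt (fun p' => line (applyAt D (β p') (g p').rep)) p :=
    fun p hp => ContinuousAt.comp (f := fun p' => (β p', g p'))
      (g := fun q => line (applyAt D q.1 q.2.rep))
      (continuousAt_line_applyAt (hDc _ hp) (hDne p hp)) (h.continuousAt hp)
  have hlim : ∀ p, β p ∈ V → Tendsto (fun p' => line (fun i => e i (β p'))) (𝓝[β ⁻¹' Sᶜ] p)
      (𝓝 (line (applyAt D (β p) (g p).rep))) := fun p hp => by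
    refine ((hlD p hp).mono_left nhdsWithin_le_nhds).congr' ?_
    filter_upwards [self_mem_nhdsWithin, mem_nhdsWithin_of_mem_nhds ((hβ p hp).preimage_mem_nhds
      (hV.mem_nhds hp))] with p' hp' hp''
    have hne := hfne _ hp'' hp'
    obtain ⟨c, hc, hce⟩ := exists_rep_line hne
    rw [(fun p hp hpS =>
    h.eq_line hS hf hcont hp hpS) p' hp'' hp', hce, applyAt_smul, line_smul hc, ← hDf _ hp'']
  have hg' : ∀ p, β p ∈ V → ratioMap S β e p = line (applyAt D (β p) (g p).rep) := fun p hp => by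
    have := h.neBot hp
    exact (hlim p hp).limUnder_eq
  have hg'C : ∀ p, β p ∈ V → applyAt C (β p) (ratioMap S β e p).rep ≠ 0 ∧
      g p = line (applyAt C (β p) (ratioMap S β e p).rep) := fun p hp => by
    obtain ⟨c, hc, hce⟩ := exists_rep_line (hDne p hp)
    rw [hg' p hp, hce, applyAt_smul, kf p hp]
    exact ⟨smul_ne_zero hc (g p).rep_nonzero, by rw [line_smul hc, line_rep]⟩
  have hcont' : ∀ p, β p ∈ V → ContinuousAt (fun p' => (β p', ratioMap S β e p')) p := fun p hp => by
    refine (hβ p hp).prodMk ?_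
    refine (hlD p hp).congr ?_
    filter_upwards [(hβ p hp).preimage_mem_nhds (hV.mem_nhds hp)] with p' hp'
    exact (hg' p' hp').symm
  refine ⟨fun p hp => ?_, fun p q hp hpq hgq => ?_, fun y hy ℓ => ⟨?_, fun hℓ => ?_⟩,
    fun p hp k => ?_⟩
  · refine le_antisymm (hcont' p hp).le_comap ?_
    rw [h.nhds p hp, ← tendsto_iff_comap]
    have c2 : Tendsto (fun p' => (β p', line (applyAt C (β p') (ratioMap S β e p').rep)))
        (comap (fun p' => (β p', ratioMap S β e p')) (𝓝 (β p, ratioMap S β e p)))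
        (𝓝 (β p, g p)) := by
      rw [(hg'C p hp).2]
      exact (continuousAt_fst.prodMk (continuousAt_line_applyAt (hCc _ hp) (hg'C p hp).1)).tendsto.comp tendsto_comap
    refine c2.congr' ?_
    filter_upwards [tendsto_comap.eventually (continuousAt_fst.eventually (hV.mem_nhds hp))] with p' hp'
    rw [(hg'C p' hp').2.symm]
  · refine h.inj p q hp hpq ?_
    rw [(hg'C p hp).2, (hg'C q (hpq ▸ hp)).2, hgq, hpq]
  · rintro ⟨p, rfl, rfl⟩
    have := h.neBot hy
    have t1 : Tendsto (fun p' => (β p', line (fun i => e i (β p')))) (𝓝[β ⁻¹' Sᶜ] p)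
        (𝓝 (β p, ratioMap S β e p)) := by
      rw [hg' p hy]
      exact ((hβ p hy).tendsto.mono_left nhdsWithin_le_nhds).prodMk_nhds (hlim p hy)
    refine mem_closure_of_tendsto t1 ?_
    filter_upwards [self_mem_nhdsWithin, mem_nhdsWithin_of_mem_nhds ((hβ p hy).preimage_mem_nhds
      (hV.mem_nhds hy))] with p' hp' hp''
    exact ⟨hp'', hp', rfl⟩
  · have k1 :=
      key hy hCc hDc hene (fun y hy => by rw [← hCe y hy, ← hDf y hy]) hℓ
    have k2 : applyAt C y ℓ.rep ≠ 0 := by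
      refine fun h0 => ℓ.rep_nonzero (k1.symm.trans ?_)
      funext i
      rw [h0]; simp [applyAt]
    have k3 : (y, line (applyAt C y ℓ.rep)) ∈ closure (graphOver S V f) := by
      refine closure_mono ?_ (mem_closure_image
        (f := fun q =>
          (q.1, line (applyAt C q.1 q.2.rep))) (continuousAt_fst.prodMk (continuousAt_line_applyAt (hCc _ hy) k2)) hℓ)
      rintro _ ⟨q, hq, rfl⟩
      refine ⟨hq.1, hq.2.1, ?_⟩
      obtain ⟨c, hc, hce⟩ := exists_rep_line (hene _ hq.1 hq.2.1)
      simp only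
      rw [hq.2.2, hce, applyAt_smul, line_smul hc, ← hCe _ hq.1]
    obtain ⟨p, hp, hgp⟩ := (h.graph y hy _).2 k3
    refine ⟨p, hp, ?_⟩
    obtain ⟨c, hc, hce⟩ := exists_rep_line k2
    rw [hg' p (by rwa [hp]), hgp, hp, hce, applyAt_smul, line_smul hc, k1, line_rep]
  · rw [h.hol p hp]
    have hev : ∀ᶠ p' in 𝓝 p, β p' ∈ V := (hβ p hp).preimage_mem_nhds (hV.mem_nhds hp)
    refine ⟨fun hk => hk.transfer (hC _ hp) (hcont' p hp).snd ?_,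
      fun hk => hk.transfer (hD _ hp) ((fun p hp => (h.continuousAt hp).snd) p hp) ?_⟩
    exacts [hev.mono hg'C, hev.mono fun p' hp' => ⟨hDne p' hp', hg' p' hp'⟩]

/-- A blow-up is described by every system of generators of the ideal. -/
theorem IsBlowUp.blowUpData {S V : Set X} {β : HolMap X' X} (h : IsBlowUp S β) (hS : IsClosed S)
    (hV : IsOpen V) {s : ℕ} {e : Fin (s + 1) → X → ℂ} (he : GeneratesIdeal S V e)
    (hcont : ∀ y ∈ V, ∀ h ∈ 𝒪 y, ContinuousAt h y) :
    BlowUpData S V β.toFun e (ratioMap S β.toFun e) := by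
  refine BlowUpData.of_local fun y hy => ?_
  obtain ⟨V₀, hV₀, hyV₀, r, f, g, hf, hemb, himg, hhol⟩ := h y
  have hdata : BlowUpData S V₀ β.toFun f g := by
    refine ⟨fun p hp => ?_, fun p q hp hpq hg => ?_, fun y' hy' ℓ => ?_, fun p hp k => ?_⟩
    · have h2 :=
        ((hV₀.preimage β.continuous_toFun).isOpenEmbedding_subtypeVal.map_nhds_eq ⟨p, hp⟩).symm
      have h3 : (fun p : β.toFun ⁻¹' V₀ => (β p, g p)) =
        (fun p' => (β.toFun p', g p')) ∘ Subtype.val := rfl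
      rw [h2, hemb.isInducing.nhds_eq_comap ⟨p, hp⟩, h3, ← comap_comap, map_comap, Subtype.range_coe, inf_eq_left, le_principal_iff]
      exact tendsto_comap.eventually (continuousAt_fst.eventually (hV₀.mem_nhds hp))
    · have hq := hpq ▸ hp
      have := hemb.injective (a₁ := ⟨p, hp⟩) (a₂ := ⟨q, hq⟩) (Prod.ext hpq hg)
      exact congrArg Subtype.val this
    · have hset : {q : X × ℙ r |
          q.1 ∈ V₀ \ S ∧ ∃ h : (fun i => f i q.1) ≠ 0, q.2 = Projectivization.mk ℂ _ h} = graphOver S V₀ f := by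
        ext q
        constructor
        · rintro ⟨h1, h2, h3⟩
          exact ⟨h1.1, h1.2, by rw [h3, line_of_ne h2]⟩
        · rintro ⟨h1, h2, h3⟩
          have h4 := GeneratesIdeal.ne_zero (f := f) hf hS h1 h2
          exact ⟨⟨h1, h2⟩, h4, by rw [h3, line_of_ne h4]⟩
      rw [hset] at himg
      have h1 := Set.ext_iff.1 himg (y', ℓ)
      rw [mem_inter_iff, and_iff_left (show (y', ℓ) ∈ V₀ ×ˢ univ from ⟨hy', trivial⟩)] at h1
      rw [← h1]
      constructor
      · rintro ⟨p, rfl, rfl⟩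
        exact ⟨p, hy', rfl⟩
      · rintro ⟨p, hp, hpe⟩
        exact ⟨p, congrArg Prod.fst hpe, congrArg Prod.snd hpe⟩
    · rw [hhol p hp k, holForm_iff]
  choose C hC hCe using fun i => (he y hy).2 _ ((hf y hyV₀).1 i)
  choose D hD hDf using fun i => (hf y hyV₀).2 _ ((he y hy).1 i)
  have hall : ∀ᶠ t in 𝓝 y, ((t ∈ V ∧ t ∈ V₀) ∧ (∀ i l, C i l ∈ 𝒪 t) ∧ (∀ i l, D i l ∈ 𝒪 t)) ∧
      (∀ i, f i t = ∑ l, C i l t * e l t) ∧ (∀ i, e i t = ∑ l, D i l t * f l t) := by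
    refine ((Filter.Eventually.and (hV.mem_nhds hy) (hV₀.mem_nhds hyV₀)).and
      ((eventually_all.2 fun i => eventually_all.2 fun l => HolSpace.eventually (hC i l)).and
      (eventually_all.2 fun i => eventually_all.2 fun l => HolSpace.eventually (hD i l)))).and
      ((eventually_all.2 hCe).and (eventually_all.2 hDf))
  obtain ⟨O, hO, hOo, hyO⟩ := eventually_nhds_iff.1 hall
  refine ⟨O, hOo, hyO, fun t ht => (hO t ht).1.1.1, ?_⟩
  refine (hdata.mono hOo fun t ht => (hO t ht).1.1.2).change hS hOo
    (fun t ht => hf t (hO t ht).1.1.2) (fun t ht => hcont t (hO t ht).1.1.1)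
    (fun t ht => he t (hO t ht).1.1.1) (C := C) (D := D) (fun t ht => (hO t ht).1.2.1)
    (fun t ht => (hO t ht).1.2.2) (fun t ht => funext (hO t ht).2.1)
    (fun t ht => funext (hO t ht).2.2)

end BlowUp

/-! ### Charts of the blow-up -/

section BlowUpChart

lemma isClosed_AModel (m k : ℕ) : IsClosed (AModel m k) :=
  isClosed_eq (by fun_prop) (by fun_prop)

/-- The affine piece `ℓ_j ≠ 0` of the blow-up of a model in the ideal generated by the components
of `ε`, with its coordinates: `T` is the blow-up map, `ξ` the ratios `ε_i / ε_j` and `back` the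
inverse of `(T, ξ)`. -/
structure BlowUpPiece (m m' k : ℕ) {N : ℕ} (ε : Amb k → Fin (N + 1) → ℂ) (j : Fin (N + 1)) where
  T : Amb k → Amb k
  ξ : Amb k → Fin (N + 1) → ℂ
  back : Amb k × (Fin (N + 1) → ℂ) → Amb k
  analytic_T : ∀ q, Ana T q
  analytic_ξ : ∀ q, Ana ξ q
  analytic_back : ∀ q, Ana back q
  maps : ∀ q ∈ AModel m' k, T q ∈ AModel m k
  back_eq : ∀ q ∈ AModel m' k, back (T q, ξ q) = q
  gen_eq : ∀ q ∈ AModel m' k, ε (T q) = ε (T q) j • ξ q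
  coord_self : ∀ q ∈ AModel m' k, ξ q j = 1
  inv : ∀ y ∈ AModel m k, ε y j ≠ 0 → back (y, fun i => ε y i / ε y j) ∈ AModel m' k ∧
    T (back (y, fun i => ε y i / ε y j)) = y ∧
    ξ (back (y, fun i => ε y i / ε y j)) = fun i => ε y i / ε y j
  dense : ∀ q ∈ AModel m' k, q ∈ closure {q' | q' ∈ AModel m' k ∧ ε (T q') j ≠ 0}

variable {m m' k N : ℕ} {ε : Amb k → Fin (N + 1) → ℂ} {j : Fin (N + 1)}

/-- The blow-up map of an affine piece as a map between the models. -/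
def BlowUpPiece.map (P : BlowUpPiece m m' k ε j) (q : AModel m' k) : AModel m k := ⟨P.T q, P.maps q q.2⟩

lemma BlowUpPiece.continuous_map (P : BlowUpPiece m m' k ε j) : Continuous P.map :=
  ((continuous_iff_continuousAt.2 fun q => (P.analytic_T q).continuousAt).comp
    continuous_subtype_val).subtype_mk _

variable {X' X : Type u} [TopologicalSpace X'] [HolSpace X'] [TopologicalSpace X] [HolSpace X]

theorem BlowUpData.exists_chart (P : BlowUpPiece m m' k ε j) {S : Set X} {ψ : OPH X (AModel m k)} (hψ : IsBihol ψ)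
    (hS : ∀ y ∈ ψ.source, y ∈ S ↔ ε (ψ y) = 0) (hSc : IsClosed S) {β : X' → X}
    {g : X' → ℙ N}
    (hgen : GeneratesIdeal S ψ.source (fun i y => ε (ψ y) i))
    (h : BlowUpData S ψ.source β (fun i y => ε (ψ y) i) g) (hnt : (P.map ⁻¹' ψ.target).Nonempty) :
    ∃ η : OPH X' (AModel m' k), IsBihol η ∧
      η.source = {p | β p ∈ ψ.source ∧ (g p).rep j ≠ 0} ∧ η.target = P.map ⁻¹' ψ.target ∧
      ∀ p ∈ η.source, ψ (β p) = P.map (η p) := by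
  classical
  have hξc : Continuous P.ξ := continuous_iff_continuousAt.2 fun q => (P.analytic_ξ q).continuousAt
  have hβ : ∀ p, β p ∈ ψ.source → ContinuousAt β p := fun p hp => (h.continuousAt hp).fst
  have hg : ∀ p, β p ∈ ψ.source → ContinuousAt g p := fun p hp => (h.continuousAt hp).snd
  set t : X' → Fin (N + 1) → ℂ := fun p => affineCoord j (g p) with ht
  have htc : ∀ p, β p ∈ ψ.source → (g p).rep j ≠ 0 → ContinuousAt t p := fun p hp hj =>
    ContinuousAt.comp (f := g) (continuousAt_affineCoord hj) (hg p hp)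
  have hψc : ∀ p, β p ∈ ψ.source → ContinuousAt (fun p => (ψ (β p) : Amb k)) p := fun p hp =>
    continuous_subtype_val.continuousAt.comp
      (ContinuousAt.comp (f := β) (ψ.continuousAt hp) (hβ p hp))
  set b : X' → Amb k := fun p => P.back (ψ (β p), t p) with hb
  have hbcont : ∀ p, β p ∈ ψ.source → (g p).rep j ≠ 0 → ContinuousAt b p := fun p hp hj =>
    ContinuousAt.comp (f := fun p => ((ψ (β p) : Amb k), t p)) (continuous_iff_continuousAt.2 fun q => (P.analytic_back q).continuousAt).continuousAt
      ((hψc p hp).prodMk (htc p hp hj))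
  have hsrc : IsOpen {p | β p ∈ ψ.source ∧ (g p).rep j ≠ 0} := by
    rw [isOpen_iff_mem_nhds]
    rintro p ⟨hp, hj⟩
    exact Filter.inter_mem ((hβ p hp).preimage_mem_nhds (ψ.open_source.mem_nhds hp))
      ((hg p hp).preimage_mem_nhds ((isOpen_rep_ne j).mem_nhds hj))
  -- the defining equations extend to the closure of the graph
  have hmain : ∀ p, β p ∈ ψ.source → (g p).rep j ≠ 0 →
      b p ∈ AModel m' k ∧ P.T (b p) = ψ (β p) ∧ P.ξ (b p) = t p := fun p hp hj => by
    have := h.neBot hp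
    have hev : ∀ᶠ p' in 𝓝[β ⁻¹' Sᶜ] p, b p' ∈ AModel m' k ∧ P.T (b p') = ψ (β p') ∧
        P.ξ (b p') = t p' := by
      filter_upwards [self_mem_nhdsWithin, mem_nhdsWithin_of_mem_nhds (hsrc.mem_nhds ⟨hp, hj⟩)]
        with p' h1 h2
      have h3 := h.eq_line hSc hgen (fun y hy k hk => hψ.continuousAt hy hk) h2.1 h1
      have h4 : ε (ψ (β p')) ≠ 0 := fun h0 => h1 ((hS _ h2.1).2 h0)
      have h5 : t p' = fun i => ε (ψ (β p')) i / ε (ψ (β p')) j := by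
        simp only [ht, h3]
        exact affineCoord_line h4 j
      simp only [hb, h5]
      exact P.inv _ (ψ (β p')).2 ((rep_line_ne h4 j).1 (h3 ▸ h2.2))
    have c0 := (hbcont p hp hj).tendsto.mono_left (nhdsWithin_le_nhds (s := β ⁻¹' Sᶜ))
    refine ⟨(isClosed_AModel m' k).mem_of_tendsto c0 (hev.mono fun _ h => h.1), ?_, ?_⟩
    · exact tendsto_nhds_unique ((P.analytic_T _).continuousAt.tendsto.comp c0)
        (((hψc p hp).tendsto.mono_left nhdsWithin_le_nhds).congr' (hev.mono fun _ h => h.2.1.symm))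
    · exact tendsto_nhds_unique ((hξc.tendsto _).comp c0)
        (((htc p hp hj).tendsto.mono_left nhdsWithin_le_nhds).congr' (hev.mono fun _ h => h.2.2.symm))
  have hξne : ∀ q ∈ AModel m' k, P.ξ q ≠ 0 := fun q hq h0 => by
    exact zero_ne_one ((congrFun h0 j).symm.trans (P.coord_self q hq))
  have hc : ∀ q, P.map q ∈ ψ.target → ContinuousAt (fun q => (ψ.symm (P.map q), line (P.ξ q))) q :=
    fun q hq => ContinuousAt.prodMk
      (ContinuousAt.comp (f := P.map) (ψ.continuousAt_symm hq) P.continuous_map.continuousAt)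
      (ContinuousAt.comp (f := fun q : AModel m' k => P.ξ q) (g := line)
        (continuousAt_line (hξne q q.2)) (hξc.comp continuous_subtype_val).continuousAt)
  have hsymm : ∀ q : AModel m' k, P.map q ∈ ψ.target →
      ∃ p, β p = ψ.symm (P.map q) ∧ g p = line (P.ξ q) := fun q hq => by
    rw [h.graph _ (ψ.map_target hq)]
    have hq' : q ∈ closure {q' : AModel m' k | ε (P.T q') j ≠ 0} := by
      rw [closure_subtype]
      refine closure_mono ?_ (P.dense q q.2)
      rintro q' ⟨h1, h2⟩
      exact ⟨⟨q', h1⟩, h2, rfl⟩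
    rw [mem_closure_iff_nhdsWithin_neBot] at hq'
    refine mem_closure_of_tendsto ((hc q hq).tendsto.mono_left
      (nhdsWithin_le_nhds (s := {q' : AModel m' k | ε (P.T q') j ≠ 0}))) ?_
    filter_upwards [self_mem_nhdsWithin, mem_nhdsWithin_of_mem_nhds
      (P.continuous_map.continuousAt.preimage_mem_nhds (ψ.open_target.mem_nhds hq))] with q' h1 h2
    have e1 : (ψ (ψ.symm (P.map q')) : Amb k) = P.T q' := by
      rw [ψ.right_inv h2]; rfl
    refine ⟨ψ.map_target h2, ?_, ?_⟩
    · change ψ.symm (P.map q') ∉ S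
      rw [hS _ (ψ.map_target h2), e1]
      exact fun h0 => h1 (congrFun h0 j)
    · change line (P.ξ q') = line (fun i => ε (ψ (ψ.symm (P.map q'))) i)
      rw [e1]
      change _ = line (ε (P.T q'))
      rw [P.gen_eq q' q'.2, line_smul h1]
  have hne : Nonempty (AModel m' k) := ⟨⟨0, by simp [AModel]⟩⟩
  let η₀ : X' → AModel m' k := fun p => if hp : b p ∈ AModel m' k then ⟨b p, hp⟩ else hne.some
  have hη₀ : ∀ p, β p ∈ ψ.source → (g p).rep j ≠ 0 → (η₀ p : Amb k) = b p := fun p hp hj => by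
    simp only [η₀, dif_pos (hmain p hp hj).1]
  have hmap : ∀ p, β p ∈ ψ.source → (g p).rep j ≠ 0 → P.map (η₀ p) = ψ (β p) := fun p hp hj => by
    refine Subtype.ext ?_
    change P.T (η₀ p) = _
    rw [hη₀ p hp hj, (hmain p hp hj).2.1]
  have hX : Nonempty X' := ⟨(hsymm _ hnt.some_mem).choose⟩
  let inv : AModel m' k → X' := fun q =>
    if hq : P.map q ∈ ψ.target then (hsymm q hq).choose else hX.some
  have hinv : ∀ q, P.map q ∈ ψ.target → β (inv q) = ψ.symm (P.map q) ∧ g (inv q) = line (P.ξ q) := fun q hq => by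
    simp only [inv, dif_pos hq]
    exact (hsymm q hq).choose_spec
  have hinvs : ∀ q, P.map q ∈ ψ.target → β (inv q) ∈ ψ.source ∧ (g (inv q)).rep j ≠ 0 := fun q hq => by
    obtain ⟨h1, h2⟩ := hinv q hq
    rw [h1, h2, rep_line_ne (hξne q q.2), P.coord_self q q.2]
    exact ⟨ψ.map_target hq, one_ne_zero⟩
  have hright : ∀ q, P.map q ∈ ψ.target → η₀ (inv q) = q := fun q hq => by
    obtain ⟨h1, h2⟩ := hinv q hq
    obtain ⟨h3, h4⟩ := hinvs q hq
    refine Subtype.ext ?_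
    rw [hη₀ _ h3 h4]
    simp only [hb, ht]
    rw [h1, h2, affineCoord_line (hξne q q.2), ψ.right_inv hq, P.coord_self q q.2]
    simp
    exact P.back_eq q q.2
  have htgt : ∀ p, β p ∈ ψ.source → (g p).rep j ≠ 0 → P.map (η₀ p) ∈ ψ.target := fun p hp hj => by
    rw [hmap p hp hj]
    exact ψ.map_source hp
  have hleft : ∀ p, β p ∈ ψ.source → (g p).rep j ≠ 0 → inv (η₀ p) = p := fun p hp hj => by
    have hq := htgt p hp hj
    obtain ⟨h1, h2⟩ := hinv _ hq
    refine h.inj _ _ (hinvs _ hq).1 ?_ ?_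
    · rw [h1, hmap p hp hj, ψ.left_inv hp]
    · rw [h2, hη₀ p hp hj, (hmain p hp hj).2.2]
      exact line_affineCoord hj
  have hcinv : ∀ q, P.map q ∈ ψ.target → ContinuousAt inv q := fun q hq => by
    rw [ContinuousAt, h.nhds _ (hinvs q hq).1, tendsto_comap_iff, (hinv q hq).1, (hinv q hq).2]
    refine (hc q hq).tendsto.congr' ?_
    filter_upwards [P.continuous_map.continuousAt.preimage_mem_nhds (ψ.open_target.mem_nhds hq)]
      with q' hq'
    exact Prod.ext (hinv q' hq').1.symm (hinv q' hq').2.symm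
  let η : OPH X' (AModel m' k) :=
    { toFun := η₀
      invFun := inv
      source := {p | β p ∈ ψ.source ∧ (g p).rep j ≠ 0}
      target := P.map ⁻¹' ψ.target
      map_source' := fun p hp => htgt p hp.1 hp.2
      map_target' := hinvs
      left_inv' := fun p hp => hleft p hp.1 hp.2
      right_inv' := hright
      open_source := hsrc
      open_target := ψ.open_target.preimage P.continuous_map
      continuousOn_toFun := fun p hp => by
        refine ContinuousAt.continuousWithinAt ?_
        rw [IsInducing.subtypeVal.continuousAt_iff]
        refine (hbcont p hp.1 hp.2).congr ?_
        filter_upwards [hsrc.mem_nhds hp] with p' hp'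
        exact (hη₀ p' hp'.1 hp'.2).symm
      continuousOn_invFun := fun q hq => (hcinv q hq).continuousWithinAt }
  refine ⟨η, isBihol_of (fun p hp f hf => ?_) (fun p hp f hf => ?_), rfl, rfl,
    fun p hp => (hmap p hp.1 hp.2).symm⟩
  · obtain ⟨F, hF, hfe⟩ := hf
    have hF' : Ana F (b p) := hη₀ p hp.1 hp.2 ▸ hF
    have hηc := η.continuousAt hp
    rw [h.hol p hp.1]
    let mk : ((Fin k ⊕ Fin 3 → ℂ) × (Fin (N + 1) → ℂ)) →L[ℂ] Amb k × (Fin (N + 1) → ℂ) :=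
      LinearMap.toContinuousLinearMap
        { toFun := fun c => ((fun i => c.1 (Sum.inl i), c.1 (Sum.inr 0), c.1 (Sum.inr 1),
            c.1 (Sum.inr 2)), c.2)
          map_add' := fun c d => rfl
          map_smul' := fun c d => rfl }
    refine ⟨j, hp.2, Fin k ⊕ Fin 3, inferInstance,
      Sum.elim (fun i y => (ψ y : Amb k).1 i) (coreFun ψ), ?_, fun c => F (P.back (mk c)), ?_, ?_⟩
    · rintro (i | i)
      · exact hψ.comp_mem hp.1
          (((ContinuousLinearMap.proj i).comp
          (ContinuousLinearMap.fst ℂ (Fin k → ℂ) (ℂ × ℂ × ℂ))).analyticAt _)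
      · exact coreFun_mem hψ hp.1 i
    · exact AnalyticAt.comp hF'
        ((P.analytic_back _).comp (mk.analyticAt _))
    · filter_upwards [hηc.eventually hfe, hsrc.mem_nhds hp] with p' h1 h2
      exact h1.trans (congrArg F (hη₀ p' h2.1 h2.2))
  · rw [h.hol p hp.1] at hf
    obtain ⟨j', hj', ι, _, a, ha, F, hF, he⟩ := hf
    choose A hA hAe using fun i => hψ.exists_analytic hp.1 (ha i)
    set q : AModel m' k := η p with hq
    have hqt := η.map_source hp
    have hTq : P.T q = ψ (β p) := congrArg Subtype.val (hmap p hp.1 hp.2)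
    have hξq : line (P.ξ q) = g p := by
      rw [← (hinv q hqt).2]; exact congrArg g (η.left_inv hp)
    have hξj : P.ξ q j' ≠ 0 := by
      rw [← hξq, rep_line_ne (hξne q q.2)] at hj'
      exact hj'
    refine ⟨fun q => F (fun i => A i (P.T q), fun s => P.ξ q s / P.ξ q j'), ?_, ?_⟩
    · refine AnalyticAt.comp
        ?_ ?_
      · rw [← hξq, affineCoord_line (hξne q q.2)] at hF
        convert hF using 2
        funext i
        rw [hTq, (hAe i).self_of_nhds]
      · have hξs : ∀ s, Ana (fun q => P.ξ q s) (q : Amb k) := fun s =>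
          ((ContinuousLinearMap.proj (R := ℂ) (φ := fun _ => ℂ) s).analyticAt _).comp
            (P.analytic_ξ q)
        refine AnalyticAt.prod (AnalyticAt.pi fun i => ?_)
          (AnalyticAt.pi fun s => (hξs s).div (hξs j') hξj)
        refine AnalyticAt.comp ?_ (P.analytic_T _)
        rw [hTq]
        exact hA i
    · have hsc := η.tendsto_symm hp
      filter_upwards [hsc.eventually he, η.open_target.mem_nhds hqt,
        hsc.eventually ((hβ p hp.1).tendsto.eventually (eventually_all.2 hAe))] with q' h1 h2 h3
      have h2' := h2
      have e1 : β (η.symm q') = ψ.symm (P.map q') := (hinv q' h2').1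
      have e2 : g (η.symm q') = line (P.ξ q') := (hinv q' h2').2
      rw [Function.comp_apply, h1, e2, affineCoord_line (hξne q' q'.2)]
      congr 2
      funext i
      rw [h3 i, e1, ψ.right_inv h2']
      rfl

end BlowUpChart

/-! ### The affine pieces of the blow-up of the core -/

section Pieces

/-- The functions `x, y, z` on the ambient space of the models. -/
def coreGen (k : ℕ) (q : Amb k) : Fin 3 → ℂ := ![q.2.1, q.2.2.1, q.2.2.2]

lemma coreGen_eq_zero {k : ℕ} {q : Amb k} : coreGen k q = 0 ↔ q.2 = 0 := by
  simp [coreGen, funext_iff, Fin.forall_fin_succ, Prod.ext_iff]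

lemma mem_closure_of_curve {V : Type*} [TopologicalSpace V] {A : Set V} (c : ℂ → V)
    (hc : ContinuousAt c 0) (h : ∀ᶠ s in 𝓝[≠] (0 : ℂ), c s ∈ A) : c 0 ∈ closure A :=
  mem_closure_of_tendsto (hc.tendsto.mono_left (nhdsWithin_le_nhds)) h

lemma analyticAt_vec3 {V : Type*} [NormedAddCommGroup V] [NormedSpace ℂ V] {f g h : V → ℂ} {q : V}
    (hf : Ana f q) (hg : Ana g q) (hh : Ana h q) :
    Ana (fun q => ![f q, g q, h q]) q := by
  refine AnalyticAt.pi fun i => ?_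
  fin_cases i
  exacts [hf, hg, hh]

lemma eventually_add_ne (x : ℂ) : ∀ᶠ s in 𝓝[≠] (0 : ℂ), x + s ≠ 0 := by
  by_cases hx : x = 0
  · filter_upwards [self_mem_nhdsWithin] with s hs
    rw [hx, zero_add]; exact hs
  · refine Eventually.filter_mono nhdsWithin_le_nhds ?_
    have : ContinuousAt (fun s => x + s) 0 := by fun_prop
    exact this.eventually_ne (by simpa using hx)

/-- The piece of the blow-up of the core of `A_(m+1)` where `x` generates the ideal. -/
def pieceX (m k : ℕ) : BlowUpPiece (m + 1) 0 k (coreGen k) 0 where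
  T q := (q.1, q.2.1, q.2.1 ^ (m + 1) * q.2.2.1 ^ (m + 2), q.2.1 * q.2.2.1)
  ξ q := ![1, q.2.1 ^ m * q.2.2.1 ^ (m + 2), q.2.2.1]
  back q := (q.1.1, q.1.2.1, q.2 2, q.1.2.1 * q.2 2)
  analytic_T q := by fun_prop
  analytic_ξ q := analyticAt_vec3 (by fun_prop) (by fun_prop) (by fun_prop)
  analytic_back q := by fun_prop
  maps q _ := by
    simp only [AModel, mem_ofPred_eq]; ring
  back_eq q hq := by
    simp only [AModel, mem_ofPred_eq, zero_add, pow_one] at hq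
    simp [hq]
  gen_eq q _ := by
    funext i
    fin_cases i <;> simp [coreGen] <;> ring
  coord_self q _ := rfl
  inv y hy hj := by
    simp only [AModel, mem_ofPred_eq] at hy
    obtain ⟨w, x, y, z⟩ := y
    simp only [coreGen, Matrix.cons_val_zero] at hj hy
    have e : x ^ (m + 1) * (z / x) ^ (m + 2) = y := by
      rw [div_pow]
      field_simp
      linear_combination (-x ^ (m + 1)) * hy
    refine ⟨by simp [AModel, coreGen], ?_, ?_⟩
    · simp only [coreGen, Matrix.cons_val, e]
      field_simp
    · funext i
      fin_cases i
      · simp [coreGen, hj]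
      · simp only [coreGen, Matrix.cons_val, Fin.mk_one, Fin.isValue]
        rw [← e]
        field_simp
        ring
      · simp [coreGen]
  dense q hq := by
    simp only [AModel, mem_ofPred_eq, zero_add, pow_one] at hq
    have h := mem_closure_of_curve (A := {q' | q' ∈ AModel 0 k ∧ coreGen k (q'.1, q'.2.1,
      q'.2.1 ^ (m + 1) * q'.2.2.1 ^ (m + 2), q'.2.1 * q'.2.2.1) 0 ≠ 0})
      (fun s : ℂ => ((q.1, q.2.1 + s, q.2.2.1, (q.2.1 + s) * q.2.2.1) : Amb k)) (by fun_prop) (by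
        filter_upwards [eventually_add_ne q.2.1] with s hs
        exact ⟨by simp [AModel], by simpa [coreGen] using hs⟩)
    simpa [hq] using h

/-- The piece of the blow-up of the core of `A_(m+1)` where `y` generates the ideal. -/
def pieceY (m k : ℕ) : BlowUpPiece (m + 1) 0 k (coreGen k) 1 where
  T q := (q.1, q.2.1 ^ (m + 2) * q.2.2.1 ^ (m + 1), q.2.2.1, q.2.1 * q.2.2.1)
  ξ q := ![q.2.1 ^ (m + 2) * q.2.2.1 ^ m, 1, q.2.1]
  back q := (q.1.1, q.2 2, q.1.2.2.1, q.2 2 * q.1.2.2.1)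
  analytic_T q := by fun_prop
  analytic_ξ q := analyticAt_vec3 (by fun_prop) (by fun_prop) (by fun_prop)
  analytic_back q := by fun_prop
  maps q _ := by
    simp only [AModel, mem_ofPred_eq]; ring
  back_eq q hq := by
    simp only [AModel, mem_ofPred_eq, zero_add, pow_one] at hq
    simp [hq]
  gen_eq q _ := by
    funext i
    fin_cases i <;> simp [coreGen] <;> ring
  coord_self q _ := rfl
  inv y hy hj := by
    simp only [AModel, mem_ofPred_eq] at hy
    obtain ⟨w, x, y, z⟩ := y
    simp only [coreGen, Matrix.cons_val] at hj hy
    have e : (z / y) ^ (m + 2) * y ^ (m + 1) = x := by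
      rw [div_pow]
      field_simp
      linear_combination (-y ^ (m + 1)) * hy
    refine ⟨by simp [AModel, coreGen], ?_, ?_⟩
    · simp only [coreGen, Matrix.cons_val, e]
      field_simp
    · funext i
      fin_cases i
      · simp only [coreGen, Matrix.cons_val, Fin.zero_eta, Fin.isValue]
        rw [← e]
        field_simp
        ring
      · simp [coreGen, hj]
      · simp [coreGen]
  dense q hq := by
    simp only [AModel, mem_ofPred_eq, zero_add, pow_one] at hq
    have h := mem_closure_of_curve (A := {q' | q' ∈ AModel 0 k ∧ coreGen k (q'.1,
      q'.2.1 ^ (m + 2) * q'.2.2.1 ^ (m + 1), q'.2.2.1, q'.2.1 * q'.2.2.1) 1 ≠ 0})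
      (fun s : ℂ => ((q.1, q.2.1, q.2.2.1 + s, q.2.1 * (q.2.2.1 + s)) : Amb k)) (by fun_prop) (by
        filter_upwards [eventually_add_ne q.2.2.1] with s hs
        exact ⟨by simp [AModel], by simpa [coreGen] using hs⟩)
    simpa [hq] using h

/-- The piece of the blow-up of the core of `A_(m+2)` where `z` generates the ideal. -/
def pieceZ (m k : ℕ) : BlowUpPiece (m + 2) m k (coreGen k) 2 where
  T q := (q.1, q.2.1 * q.2.2.2, q.2.2.1 * q.2.2.2, q.2.2.2)
  ξ q := ![q.2.1, q.2.2.1, 1]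
  back q := (q.1.1, q.2 0, q.2 1, q.1.2.2.2)
  analytic_T q := by fun_prop
  analytic_ξ q := analyticAt_vec3 (by fun_prop) (by fun_prop) (by fun_prop)
  analytic_back q := by fun_prop
  maps q hq := by
    simp only [AModel, mem_ofPred_eq] at hq ⊢
    linear_combination q.2.2.2 ^ 2 * hq
  back_eq q hq := by simp
  gen_eq q _ := by
    funext i
    fin_cases i <;> simp [coreGen, mul_comm]
  coord_self q _ := rfl
  inv y hy hj := by
    simp only [AModel, mem_ofPred_eq] at hy
    obtain ⟨w, x, y, z⟩ := y
    simp only [coreGen, Matrix.cons_val] at hj hy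
    refine ⟨?_, ?_, ?_⟩
    · simp only [AModel, coreGen, Matrix.cons_val, mem_ofPred_eq]
      field_simp
      linear_combination hy
    · simp [coreGen, hj]
    · funext i
      fin_cases i <;> simp [coreGen, hj]
  dense q hq := by
    simp only [AModel, mem_ofPred_eq] at hq
    obtain ⟨w, x, y, z⟩ := q
    simp only at hq ⊢
    set A : Set (Amb k) := {q' | q' ∈ AModel m k ∧ coreGen k (q'.1, q'.2.1 * q'.2.2.2,
      q'.2.2.1 * q'.2.2.2, q'.2.2.2) 2 ≠ 0}
    by_cases hz : z = 0
    · have hxy : x * y = 0 := by rw [hq, hz]; simp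
      have hcv : ∀ c : ℂ → ℂ × ℂ × ℂ, Continuous c →
          (∀ s, (c s).1 * (c s).2.1 = (c s).2.2 ^ (m + 1)) → (∀ s, s ≠ 0 → (c s).2.2 ≠ 0) →
          (w, c 0) ∈ closure A := fun c hc h1 h2 =>
        mem_closure_of_curve (fun s => (w, c s)) (by fun_prop) (by
          filter_upwards [self_mem_nhdsWithin] with s hs
          exact ⟨h1 s, h2 s hs⟩)
      by_cases hx : x = 0
      · by_cases hy : y = 0
        · simpa [hx, hy, hz] using hcv (fun s => (s ^ (m + 1), s ^ (m + 1), s ^ 2)) (by fun_prop)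
            (fun s => by ring) fun s hs => pow_ne_zero 2 hs
        · simpa [hx, hz] using hcv (fun s => (s ^ (m + 1) / y, y, s)) (by fun_prop)
            (fun s => by field_simp) fun s hs => hs
      · have hy : y = 0 := (mul_eq_zero.1 hxy).resolve_left hx
        simpa [hy, hz] using hcv (fun s => (x, s ^ (m + 1) / x, s)) (by fun_prop)
          (fun s => by field_simp) fun s hs => hs
    · exact subset_closure ⟨hq, by simpa [coreGen] using hz⟩

/-- The blow-up of a smooth model in the unit ideal. -/
def pieceOne (k : ℕ) : BlowUpPiece 0 0 k (fun _ (_ : Fin 1) => (1 : ℂ)) 0 where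
  T q := q
  ξ _ := fun _ => 1
  back q := q.1
  analytic_T _ := analyticAt_id
  analytic_ξ _ := analyticAt_const
  analytic_back _ := by fun_prop
  maps _ hq := hq
  back_eq _ _ := rfl
  gen_eq _ _ := by funext; simp
  coord_self _ _ := rfl
  inv y hy _ := ⟨hy, rfl, by simp⟩
  dense q hq := subset_closure ⟨hq, one_ne_zero⟩

end Pieces

section Toric

/-- The toric charts `(w, a, b) ↦ (w, a^(i+1) b^i, a^(m-i) b^(m+1-i), a b)` of the resolution of the
model `A_m`, for `i ≤ m`. -/
def tor (m i : ℕ) {k : ℕ} (q : Flat k) : AModel m k :=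
  if h : i ≤ m then ⟨(q.1, q.2.1 ^ (i + 1) * q.2.2 ^ i, q.2.1 ^ (m - i) * q.2.2 ^ (m - i + 1),
    q.2.1 * q.2.2), by
      obtain ⟨j, rfl⟩ := Nat.exists_eq_add_of_le h
      simp only [AModel, mem_ofPred_eq, Nat.add_sub_cancel_left]; ring⟩
  else ⟨0, by simp [AModel]⟩

lemma tor_coe {m i k : ℕ} (h : i ≤ m) (q : Flat k) : (tor m i q : Amb k) =
    (q.1, q.2.1 ^ (i + 1) * q.2.2 ^ i, q.2.1 ^ (m - i) * q.2.2 ^ (m - i + 1), q.2.1 * q.2.2) := by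
  rw [tor, dif_pos h]

variable {Y Z : Type u} [TopologicalSpace Y] [HolSpace Y] [TopologicalSpace Z] [HolSpace Z]

/-- A toric chart of `Z` over a chart `ψ` of `Y`. -/
structure IsToricChart {m k : ℕ} (ψ : OPH Y (AModel m k)) (ρ : Z → Y) (i : ℕ)
    (θ : OPH Z (Flat k)) : Prop where
  bihol : IsBihol θ
  maps : ∀ p ∈ θ.source, ρ p ∈ ψ.source
  target : θ.target = tor m i ⁻¹' ψ.target
  comm : ∀ p ∈ θ.source, ψ (ρ p) = tor m i (θ p)

lemma IsToricChart.of_piece {Y₁ : Type u} [TopologicalSpace Y₁] [HolSpace Y₁] {m m' k i i' N : ℕ}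
    {ε : Amb k → Fin (N + 1) → ℂ} {j : Fin (N + 1)} (P : BlowUpPiece m m' k ε j)
    {ψ : OPH Y (AModel m k)} {β : Y₁ → Y}
    {η : OPH Y₁ (AModel m' k)} (hmaps : ∀ p ∈ η.source, β p ∈ ψ.source)
    (htgt : η.target = P.map ⁻¹' ψ.target) (hcomm : ∀ p ∈ η.source, ψ (β p) = P.map (η p))
    {ρ : Z → Y₁} {θ : OPH Z (Flat k)} (hθ : IsToricChart η ρ i' θ)
    (hP : ∀ q : Flat k, P.map (tor m' i' q) = tor m i q) :
    IsToricChart ψ (fun p => β (ρ p)) i θ where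
  bihol := hθ.bihol
  maps p hp := hmaps _ (hθ.maps p hp)
  target := by
    rw [hθ.target, htgt, ← preimage_comp]
    congr 1
    exact funext hP
  comm p hp := by rw [hcomm _ (hθ.maps p hp), hθ.comm p hp, hP]

end Toric

/-! ### The resolution -/

section Resolution

variable {X' X : Type u} [TopologicalSpace X'] [HolSpace X'] [TopologicalSpace X] [HolSpace X]
  {m k : ℕ} {β : HolMap X' X}
  {d : ℕ} {Z Y : Type u} [TopologicalSpace Z] [HolSpace Z] [TopologicalSpace Y] [HolSpace Y]
  {ρ : HolMap Z Y}

def chartGen (ψ : OPH X (AModel m k)) (i : Fin 3) (y : X) : ℂ :=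
  coreGen k (ψ y) i

lemma chartGen_eq (ψ : OPH X (AModel m k)) : chartGen ψ = coreFun ψ := by
  funext i y
  fin_cases i <;> rfl

lemma IsBlowUp.coreData (h : IsBlowUp (Sing k X) β) (hm : 1 ≤ m)
    {ψ : OPH X (AModel m k)} (hψ : IsBihol ψ) :
    GeneratesIdeal (Sing k X) ψ.source (chartGen ψ) ∧
    BlowUpData (Sing k X) ψ.source β.toFun (chartGen ψ)
      (ratioMap (Sing k X) β.toFun (chartGen ψ)) := by
  have hg := chartGen_eq ψ ▸ generatesIdeal_coreFun hψ hm
  exact ⟨hg, h.blowUpData (isClosed_singularLocus _) ψ.open_source hg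
    fun y hy k hk => hψ.continuousAt hy hk⟩

lemma IsBlowUp.exists_core_chart (h : IsBlowUp (Sing k X) β)
    (hm : 1 ≤ m) {ψ : OPH X (AModel m k)} (hψ : IsBihol ψ)
    (hcore : ∃ q ∈ ψ.target, q.1.2 = 0) {m' : ℕ} {j : Fin 3}
    (P : BlowUpPiece m m' k (coreGen k) j) (hP : ∀ w, P.T (w, 0) = (w, 0)) :
    ∃ η : OPH X' (AModel m' k), IsBihol η ∧
      η.source = {p | β p ∈ ψ.source ∧
        (ratioMap (Sing k X) β.toFun (chartGen ψ) p).rep j ≠ 0} ∧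
      η.target = P.map ⁻¹' ψ.target ∧ (∀ p ∈ η.source, ψ (β p) = P.map (η p)) ∧
      ∃ q ∈ η.target, q.1.2 = 0 := by
  obtain ⟨hg, hd⟩ := h.coreData hm hψ
  obtain ⟨q, hq, hq0⟩ := hcore
  have hmem : (q.1.1, 0) ∈ AModel m' k := by simp [AModel]
  have hnt : P.map ⟨(q.1.1, 0), hmem⟩ ∈ ψ.target := by
    rwa [show P.map ⟨(q.1.1, 0), hmem⟩ = q from Subtype.ext ((hP _).trans (Prod.ext rfl hq0.symm))]
  obtain ⟨η, h1, h2, h3, h4⟩ := hd.exists_chart P hψ (fun y hy => by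
    rw [mem_singularLocus_iff_of_chart hψ hm hy, coreGen_eq_zero])
    (isClosed_singularLocus _) hg ⟨_, hnt⟩
  exact ⟨η, h1, h2, h3, h4, ⟨(q.1.1, 0), hmem⟩, by rw [h3]; exact hnt, rfl⟩

lemma IsBlowUp.exists_smooth_chart (h : IsBlowUp (Sing k X) β)
    {ψ : OPH X (AModel 0 k)} (hψ : IsBihol ψ) (hnt : ψ.target.Nonempty) :
    ∃ η : OPH X' (AModel 0 k), IsBihol η ∧
      η.source = β.toFun ⁻¹' ψ.source ∧ η.target = ψ.target ∧ ∀ p ∈ η.source, ψ (β p) = η p := by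
  have hg :=
    generatesIdeal_one ψ.open_source fun y hy => smoothAt_of_chart_zero hψ hy
  obtain ⟨η, h1, h2, h3, h4⟩ := BlowUpData.exists_chart (pieceOne k) hψ (fun y hy => by
    exact ⟨fun hS => absurd (smoothAt_of_chart_zero hψ hy) hS,
      fun h0 => absurd (congrFun h0 0) one_ne_zero⟩)
    (isClosed_singularLocus _) hg (h.blowUpData (isClosed_singularLocus _) ψ.open_source hg
    fun y hy k hk => hψ.continuousAt hy hk) hnt
  refine ⟨η, h1, ?_, h3, h4⟩
  rw [h2]
  ext p
  refine ⟨fun hp => hp.1, fun hp => ⟨hp, ?_⟩⟩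
  obtain ⟨j, hj⟩ := exists_rep_ne
    (ratioMap (Sing k X) β.toFun (fun _ => (1 : X → ℂ)) p)
  rwa [Fin.fin_one_eq_zero j] at hj

lemma IsBlowUp.rep_ne (h : IsBlowUp (Sing k X) β)
    {ψ : OPH X (AModel 1 k)} (hψ : IsBihol ψ) {p : X'} (hp : β p ∈ ψ.source) :
    (ratioMap (Sing k X) β.toFun (chartGen ψ) p).rep 0 ≠ 0 ∨
    (ratioMap (Sing k X) β.toFun (chartGen ψ) p).rep 1 ≠ 0 := by
  obtain ⟨hg, hd⟩ := h.coreData le_rfl hψ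
  set g := ratioMap (Sing k X) β.toFun (chartGen ψ)
  by_contra! hcon
  obtain ⟨h0, h1⟩ := hcon
  have h2 : (g p).rep 2 ≠ 0 := fun h2 =>
    (g p).rep_nonzero (funext fun i => by fin_cases i <;> assumption)
  have hgc : ContinuousAt g p := (hd.continuousAt hp).snd
  have := hd.neBot hp
  have c : ∀ i, Tendsto (fun p => affineCoord 2 (g p) i)
      (𝓝[β.toFun ⁻¹' (Sing k X)ᶜ] p) (𝓝 (affineCoord 2 (g p) i)) := fun i =>
    ((continuous_apply i).continuousAt.tendsto.comp (ContinuousAt.comp (continuousAt_affineCoord h2) hgc).tendsto).mono_left nhdsWithin_le_nhds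
  have hev : ∀ᶠ p' in 𝓝[β.toFun ⁻¹' (Sing k X)ᶜ] p,
      affineCoord 2 (g p') 0 * affineCoord 2 (g p') 1 = 1 := by
    filter_upwards [self_mem_nhdsWithin, mem_nhdsWithin_of_mem_nhds
      (β.continuous_toFun.continuousAt.preimage_mem_nhds (ψ.open_source.mem_nhds hp)),
      mem_nhdsWithin_of_mem_nhds (hgc.preimage_mem_nhds ((isOpen_rep_ne 2).mem_nhds h2))]
      with p' e1 e2 e3
    have e4 : g p' = line (fun i => chartGen ψ i (β.toFun p')) :=
      hd.eq_line (isClosed_singularLocus _) hg (fun y hy k hk => hψ.continuousAt hy hk) e2 e1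
    have e5 :=
      hg.ne_zero (isClosed_singularLocus _) e2 e1
    have e6 := (rep_line_ne e5 2).1 (e4 ▸ e3)
    rw [e4, affineCoord_line e5]
    field_simp
    exact (ψ (β.toFun p')).2
  have hlim := tendsto_nhds_unique (((c 0).mul (c 1)).congr' hev) tendsto_const_nhds
  have : affineCoord 2 (g p) 0 = 0 := by simp [affineCoord, h0]
  rw [this, zero_mul] at hlim
  exact zero_ne_one hlim

lemma IsBlowUp.t2Space {S : Set X} (h : IsBlowUp S β) [T2Space X] :
    T2Space X' := by
  refine ⟨fun p q hpq => ?_⟩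
  by_cases hβ : β p = β q
  · obtain ⟨V, hV, hxV, r, f, g, -, hemb, -, -⟩ := h (β p)
    have hopen := hV.preimage β.continuous_toFun
    have := hemb.t2Space
    have hq := hβ ▸ hxV
    obtain ⟨u, v, hu, hv, h1, h2, h3⟩ := t2_separation
      (show (⟨p, hxV⟩ : β.toFun ⁻¹' V) ≠ ⟨q, hq⟩ from fun h => hpq (congrArg Subtype.val h))
    exact ⟨Subtype.val '' u, Subtype.val '' v, hopen.isOpenMap_subtype_val u hu,
      hopen.isOpenMap_subtype_val v hv, ⟨_, h1, rfl⟩, ⟨_, h2, rfl⟩, (disjoint_image_iff Subtype.val_injective).2 h3⟩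
  · obtain ⟨u, v, hu, hv, h1, h2, h3⟩ := t2_separation hβ
    exact ⟨β.toFun ⁻¹' u, β.toFun ⁻¹' v, hu.preimage β.continuous_toFun,
      hv.preimage β.continuous_toFun, h1, h2, h3.preimage _⟩

lemma IsBlowUpResolution.t2Space (h : IsBlowUpResolution d Z Y ρ) (hY : T2Space Y) : T2Space Z := by
  induction h with
  | smooth h => exact hY
  | step Y₁ Y ρ β h hβ hρ ih => exact ih hβ.t2Space

lemma IsBlowUp.injective_of_smooth (h : IsBlowUp (Sing k X) β)
    {p : X'} (hp : SmoothAt (k + 2) (β p)) :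
    SmoothAt (k + 2) p ∧ ∀ q, β q = β p → q = p := by
  obtain ⟨ψ, hψ, hb⟩ := exists_chart_of_smoothAt hp
  obtain ⟨η, h1, h2, h3, h4⟩ := h.exists_smooth_chart hb ⟨_, ψ.map_source hψ⟩
  have hpη : p ∈ η.source := by rw [h2]; exact hψ
  refine ⟨smoothAt_of_chart_zero h1 hpη, fun q hq => ?_⟩
  have hqη : q ∈ η.source := by
    rw [h2, mem_preimage, show β.toFun q = _ from hq]; exact hψ
  refine η.injOn hqη hpη ?_
  rw [← h4 q hqη, ← h4 p hpη, hq]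

lemma IsBlowUpResolution.injective (h : IsBlowUpResolution d Z Y ρ) (hd : d = k + 2) : ∀ p q : Z, ρ p = ρ q → ρ p ∉ singularLocus d Y → p = q := by
  subst hd
  induction h with
  | smooth h => exact fun p q hpq _ => hpq
  | step Y₁ Y ρ β h hβ hρ ih =>
    intro p q hpq hp
    obtain ⟨h1, h2⟩ := hβ.injective_of_smooth (not_not.1 hp)
    exact ih p q (h2 (ρ q) hpq.symm).symm (fun hs => hs h1)

/-- The toric charts of the resolution over a chart of type `A_m`. -/
theorem IsBlowUpResolution.exists_toric (h : IsBlowUpResolution d Z Y ρ) (hd : d = k + 2) : ∀ (m : ℕ) (ψ : OPH Y (AModel m k)), IsBihol ψ →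
      (∃ q ∈ ψ.target, q.1.2 = 0) → ∃ θ : ℕ → OPH Z (Flat k),
        (∀ i ≤ m, IsToricChart ψ ρ.toFun i (θ i)) ∧
        ∀ p, ρ p ∈ ψ.source → ∃ i ≤ m, p ∈ (θ i).source := by
  subst hd
  induction h with
  | smooth h =>
    intro m ψ hψ hcore
    obtain ⟨q, hq, hq0⟩ := hcore
    have hm : m = 0 := by
      by_contra hm
      have := (mem_singularLocus_iff_of_chart hψ (Nat.one_le_iff_ne_zero.2 hm)
        (ψ.map_target hq)).2 (by rw [ψ.right_inv hq]; exact hq0)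
      rw [h] at this
      exact this
    subst hm
    have e1 : ∀ q : Flat k, (tor 0 0 q : AModel 0 k) = flatModel k q := fun q => by
      refine Subtype.ext ?_
      rw [tor_coe le_rfl]
      simp [flatModel]
    set θ := ψ.trans (flatModel k).symm.toOpenPartialHomeomorph with hθ
    have hs : θ.source = ψ.source := by
      rw [hθ, OpenPartialHomeomorph.trans_source]
      simp
    refine ⟨fun _ => θ, fun i hi => ?_, fun p hp => ⟨0, le_rfl, by rw [hs]; exact hp⟩⟩
    obtain rfl : i = 0 := Nat.le_zero.1 hi
    refine ⟨hψ.trans (isBihol_flatModel k).symm, fun p hp => by rw [hs] at hp; exact hp, ?_, ?_⟩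
    · rw [hθ, OpenPartialHomeomorph.trans_target]
      ext q
      simp [e1]
    · intro p hp
      rw [e1]
      change ψ p = flatModel k ((flatModel k).symm (ψ p))
      rw [Homeomorph.apply_symm_apply]
  | step Y₁ Y ρ β hne hβ hρ ih =>
    intro m ψ hψ hcore
    rcases m with _ | m
    · obtain ⟨q, hq, hq0⟩ := hcore
      obtain ⟨η, h1, h2, h3, h4⟩ := hβ.exists_smooth_chart hψ ⟨q, hq⟩
      obtain ⟨θ, hθ, hcov⟩ := ih 0 η h1 ⟨q, by rw [h3]; exact hq, hq0⟩
      exact ⟨θ, fun i hi => (hθ i hi).of_piece (pieceOne k) (fun p hp => by rw [h2] at hp; exact hp) h3 h4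
        fun q => rfl, fun p hp => hcov p (by rw [h2]; exact hp)⟩
    · have hm : 1 ≤ m + 1 := by omega
      obtain ⟨ηx, x1, x2, x3, x4, x5⟩ := hβ.exists_core_chart hm hψ hcore (pieceX m k)
        (fun w => by simp [pieceX])
      obtain ⟨ηy, y1, y2, y3, y4, y5⟩ := hβ.exists_core_chart hm hψ hcore (pieceY m k)
        (fun w => by simp [pieceY])
      obtain ⟨θx, hθx, cx⟩ := ih 0 ηx x1 x5
      obtain ⟨θy, hθy, cy⟩ := ih 0 ηy y1 y5
      simp only [Nat.le_zero, exists_eq_left, x2, y2] at cx cy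
      have tx : IsToricChart ψ (β.comp ρ).toFun 0 (θx 0) :=
        (hθx 0 le_rfl).of_piece (pieceX m k) (fun p hp => by rw [x2] at hp; exact hp.1) x3 x4
          fun q => Subtype.ext (by
            rw [tor_coe (Nat.zero_le _)]
            simp [BlowUpPiece.map, pieceX, tor_coe (le_refl 0)])
      have ty : IsToricChart ψ (β.comp ρ).toFun (m + 1) (θy 0) :=
        (hθy 0 le_rfl).of_piece (pieceY m k) (fun p hp => by rw [y2] at hp; exact hp.1) y3 y4
          fun q => Subtype.ext (by
            rw [tor_coe le_rfl]
            simp [BlowUpPiece.map, pieceY, tor_coe (le_refl 0)])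
      rcases m with _ | m
      · refine ⟨fun i => if i = 0 then θx 0 else θy 0, fun i hi => ?_, fun p hp => ?_⟩
        · by_cases h0 : i = 0
          · subst h0; simpa using tx
          · obtain rfl : i = 1 := by omega
            simpa using ty
        · rcases hβ.rep_ne hψ hp with h0 | h0
          · exact ⟨0, by omega, by simpa using cx p ⟨hp, h0⟩⟩
          · exact ⟨1, by omega, by simpa using cy p ⟨hp, h0⟩⟩
      · obtain ⟨ηz, z1, z2, z3, z4, z5⟩ := hβ.exists_core_chart hm hψ hcore (pieceZ m k)
          (fun w => by simp [pieceZ])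
        obtain ⟨θz, hθz, covz⟩ := ih m ηz z1 z5
        have tz : ∀ i ≤ m, IsToricChart ψ (β.comp ρ).toFun (i + 1) (θz i) := fun i hi =>
          (hθz i hi).of_piece (pieceZ m k) (fun p hp => by rw [z2] at hp; exact hp.1) z3 z4
            fun q => Subtype.ext (by
              obtain ⟨j, rfl⟩ := Nat.exists_eq_add_of_le hi
              rw [tor_coe (by omega)]
              have e1 : i + j - i = j := by omega
              have e2 : i + j + 1 + 1 - (i + 1) = j + 1 := by omega
              simp only [BlowUpPiece.map, pieceZ, tor_coe (show i ≤ i + j by omega), e1, e2]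
              refine Prod.ext rfl (Prod.ext ?_ (Prod.ext ?_ rfl)) <;> simp only <;> ring)
        refine ⟨fun i => if i = 0 then θx 0 else if i = m + 2 then θy 0 else θz (i - 1),
          fun i hi => ?_, fun p hp => ?_⟩
        · by_cases h0 : i = 0
          · subst h0; simpa using tx
          · by_cases h2 : i = m + 2
            · subst h2; simpa using ty
            · simp only [if_neg h0, if_neg h2]
              have := tz (i - 1) (by omega)
              rwa [Nat.sub_add_cancel (by omega)] at this
        · obtain ⟨j, hj⟩ := exists_rep_ne
            (ratioMap (Sing k Y) β.toFun (chartGen ψ) (ρ p))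
          fin_cases j
          · exact ⟨0, by omega, by simpa using cx p ⟨hp, hj⟩⟩
          · exact ⟨m + 2, by omega, by simpa using cy p ⟨hp, hj⟩⟩
          · obtain ⟨i, hi, hpi⟩ := covz p (by rw [z2]; exact ⟨hp, hj⟩)
            refine ⟨i + 1, by omega, ?_⟩
            have h1 : i ≠ m + 1 := by omega
            simpa [h1] using hpi

end Resolution

/-! ### Geometry of the toric charts -/

section ToricCover

variable {Y Z : Type u} [TopologicalSpace Y] [HolSpace Y] [TopologicalSpace Z] [HolSpace Z]
  {n k : ℕ}

/-- The toric charts over a chart `ψ` of type `A_n`; `ρ` is injective over the regular points. -/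
structure IsToricCover (ψ : OPH Y (AModel n k)) (ρ : Z → Y)
    (θ : ℕ → OPH Z (Flat k)) : Prop where
  chart : ∀ i ≤ n, IsToricChart ψ ρ i (θ i)
  cover : ∀ p, ρ p ∈ ψ.source → ∃ i ≤ n, p ∈ (θ i).source
  inj : ∀ p q, ρ p = ρ q → ρ p ∈ ψ.source → (ψ (ρ p)).1.2 ≠ 0 → p = q

/-- The point of the core of the model over `w`. -/
def corePt (n : ℕ) {k : ℕ} (w : Fin k → ℂ) : AModel n k := ⟨(w, 0), by simp [AModel]⟩

lemma continuous_corePt (n k : ℕ) : Continuous (corePt n : (Fin k → ℂ) → AModel n k) :=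
  Continuous.subtype_mk (by fun_prop) _

/-- The points of the fibres of the exceptional components, in homogeneous coordinates. -/
def pt (θ : ℕ → OPH Z (Flat k)) (l : ℕ) (q : Flat k) : Z :=
  open Classical in if q.2.2 ≠ 0 then (θ l).symm (q.1, q.2.1 / q.2.2, 0)
  else (θ (l - 1)).symm (q.1, 0, q.2.2 / q.2.1)

lemma tor_a {i : ℕ} (h1 : 1 ≤ i) (hn : i ≤ n) (w : Fin k → ℂ) (a : ℂ) :
    tor n i (w, a, 0) = corePt n w := by
  refine Subtype.ext ?_
  rw [tor_coe hn]
  simp [corePt, show i ≠ 0 by omega]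

lemma tor_b {i : ℕ} (hn : i < n) (w : Fin k → ℂ) (b : ℂ) : tor n i (w, 0, b) = corePt n w := by
  refine Subtype.ext ?_
  rw [tor_coe hn.le]
  simp [corePt, show n - i ≠ 0 by omega]

lemma pt_of_right {θ : ℕ → OPH Z (Flat k)} {l : ℕ} {w : Fin k → ℂ} {x y : ℂ}
    (hy : y ≠ 0) : pt θ l (w, x, y) = (θ l).symm (w, x / y, 0) := by
  rw [pt, if_pos hy]

lemma pt_smul {θ : ℕ → OPH Z (Flat k)} {l : ℕ} {w : Fin k → ℂ} {x y c : ℂ} (hc : c ≠ 0) :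
    pt θ l (w, c * x, c * y) = pt θ l (w, x, y) := by
  by_cases hy : y = 0
  · simp [pt, hy]
  · rw [pt_of_right hy, pt_of_right (mul_ne_zero hc hy), mul_div_mul_left _ _ hc]

namespace IsToricCover

variable {ψ : OPH Y (AModel n k)} {ρ : Z → Y}
  {θ : ℕ → OPH Z (Flat k)} (h : IsToricCover ψ ρ θ)
include h

lemma mem_target {i : ℕ} (hi : i ≤ n) {q : Flat k} : q ∈ (θ i).target ↔ tor n i q ∈ ψ.target := by
  rw [(h.chart i hi).target, mem_preimage]

lemma map_symm {i : ℕ} (hi : i ≤ n) {q : Flat k} (hq : q ∈ (θ i).target) :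
    ρ ((θ i).symm q) ∈ ψ.source ∧ ψ (ρ ((θ i).symm q)) = tor n i q := by
  have h1 := (θ i).map_target hq
  refine ⟨(h.chart i hi).maps _ h1, ?_⟩
  rw [(h.chart i hi).comm _ h1, (θ i).right_inv hq]

lemma target_a {i : ℕ} (h1 : 1 ≤ i) (hi : i ≤ n) {w : Fin k → ℂ} (hw : corePt n w ∈ ψ.target)
    (a : ℂ) : ((w, a, 0) : Flat k) ∈ (θ i).target := by
  rw [h.mem_target hi, tor_a h1 hi]; exact hw

lemma target_b {i : ℕ} (hi : i < n) {w : Fin k → ℂ} (hw : corePt n w ∈ ψ.target)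
    (b : ℂ) : ((w, 0, b) : Flat k) ∈ (θ i).target := by
  rw [h.mem_target hi.le, tor_b hi]; exact hw

lemma dense_generic {i : ℕ} (hi : i ≤ n) {p : Z} (hp : p ∈ (θ i).source) {A : Set Z}
    (hA : A ∈ 𝓝 p) : ∃ c : ℂ → Z, Tendsto c (𝓝[≠] 0) (𝓝 p) ∧ ∀ᶠ s in 𝓝[≠] (0 : ℂ),
      c s ∈ (θ i).source ∩ A ∧ (θ i (c s)).2.1 ≠ 0 ∧ (θ i (c s)).2.2 ≠ 0 := by
  set q := θ i p with hq
  let d : ℂ → Flat k := fun s => (q.1, q.2.1 + s, q.2.2 + s)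
  have hd : Tendsto d (𝓝 0) (𝓝 q) := Continuous.tendsto' (by fun_prop) _ _ (by simp [d])
  have hc := ((θ i).tendsto_symm hp).comp hd
  refine ⟨fun s => (θ i).symm (d s), hc.mono_left nhdsWithin_le_nhds, ?_⟩
  filter_upwards [eventually_add_ne q.2.1, eventually_add_ne q.2.2,
    nhdsWithin_le_nhds (hd.eventually ((θ i).open_target.mem_nhds ((θ i).map_source hp))),
    nhdsWithin_le_nhds (hc.eventually hA)] with s h1 h2 h3 h4
  rw [(θ i).right_inv h3]
  exact ⟨⟨(θ i).map_target h3, h4⟩, h1, h2⟩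

lemma transition [T2Space Z] {i : ℕ} (hi : i + 1 ≤ n) {w : Fin k → ℂ} {a b : ℂ} (hb : b ≠ 0)
    (ht : ((w, a, b) : Flat k) ∈ (θ i).target) :
    ((w, b⁻¹, a * b ^ 2) : Flat k) ∈ (θ (i + 1)).target ∧
      (θ i).symm (w, a, b) = (θ (i + 1)).symm (w, b⁻¹, a * b ^ 2) := by
  have htor : ∀ a : ℂ, tor n (i + 1) ((w, b⁻¹, a * b ^ 2) : Flat k) = tor n i (w, a, b) := fun a => by
    refine Subtype.ext ?_
    rw [tor_coe hi, tor_coe (by omega)]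
    obtain ⟨j, rfl⟩ := Nat.exists_eq_add_of_le hi
    have e1 : i + 1 + j - (i + 1) = j := by omega
    have e2 : i + 1 + j - i = j + 1 := by omega
    rw [e1, e2]
    refine Prod.ext rfl (Prod.ext ?_ (Prod.ext ?_ ?_)) <;> simp <;>
      field_simp <;> ring
  have ht' : ∀ a : ℂ, (w, a, b) ∈ (θ i).target →
      (w, b⁻¹, a * b ^ 2) ∈ (θ (i + 1)).target := fun a ha => by
    rw [h.mem_target hi, htor, ← h.mem_target (by omega)]; exact ha
  refine ⟨ht' a ht, ?_⟩
  have hgen : ∀ a : ℂ, a ≠ 0 → (w, a, b) ∈ (θ i).target →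
      (θ i).symm (w, a, b) = (θ (i + 1)).symm (w, b⁻¹, a * b ^ 2) := fun a ha hta => by
    obtain ⟨m1, m2⟩ := h.map_symm (by omega) hta
    obtain ⟨m3, m4⟩ := h.map_symm hi (ht' a hta)
    refine h.inj _ _ (ψ.injOn m1 m3 (by rw [m2, m4, htor])) m1 ?_
    rw [m2, tor_coe (by omega)]
    intro h0
    have := congrArg (fun t => t.2.2) h0
    simp at this
    tauto
  have lim : ∀ {j} {d : ℂ → Flat k}, Continuous d → d 0 ∈ (θ j).target →
      Tendsto (fun s => (θ j).symm (d s)) (𝓝[≠] 0) (𝓝 ((θ j).symm (d 0))) := fun hd h0 =>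
    (((θ _).continuousAt_symm h0).tendsto.comp hd.continuousAt).mono_left nhdsWithin_le_nhds
  have cd : Continuous fun s => (w, a + s, b) := by fun_prop
  have c1 := lim cd (by simpa using ht)
  have c2 := lim (j := i + 1) (d := fun s => (w, b⁻¹, (a + s) * b ^ 2)) (by fun_prop)
    (by simpa using ht' a ht)
  simp at c1 c2
  refine tendsto_nhds_unique c1 (c2.congr' ?_)
  filter_upwards [eventually_add_ne a, nhdsWithin_le_nhds ((cd.tendsto' 0 _ (by simp)).eventually ((θ i).open_target.mem_nhds ht))] with s h1 h2
  exact (hgen _ h1 h2).symm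

lemma fst_eq {i : ℕ} (hi : i ≤ n) {p : Z} (hp : p ∈ (θ i).source) :
    (θ i p).1 = (ψ (ρ p)).1.1 := by
  rw [(h.chart i hi).comm p hp, tor_coe hi]

lemma overlap {i d : ℕ} (hd : i + d + 1 ≤ n) {p : Z} (hp : p ∈ (θ i).source)
    (hp' : p ∈ (θ (i + d + 1)).source) :
    (θ (i + d + 1) p).2.1 * ((θ i p).2.1 ^ d * (θ i p).2.2 ^ (d + 1)) = 1 := by
  obtain ⟨c, hc, hev⟩ := h.dense_generic (by omega) hp ((θ (i + d + 1)).open_source.mem_nhds hp')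
  have t1 := ((θ i).continuousAt hp).tendsto.comp hc
  have f2 := t1.snd_nhds.snd_nhds
  have f3 := (((θ (i + d + 1)).continuousAt hp').tendsto.comp hc).snd_nhds.fst_nhds
  refine tendsto_nhds_unique (f3.mul ((t1.snd_nhds.fst_nhds.pow d).mul (f2.pow (d + 1))))
    (tendsto_const_nhds.congr' ?_)
  filter_upwards [hev] with s hs
  obtain ⟨⟨s1, s2⟩, s3, s4⟩ := hs
  have e' := congrArg Subtype.val (((h.chart i (by omega)).comm _ s1).symm.trans ((h.chart _ hd).comm _ s2))
  rw [tor_coe (by omega), tor_coe hd] at e'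
  have e1 := congrArg (fun t => t.2.1) e'
  have e2 := congrArg (fun t => t.2.2.2) e'
  simp only at e1 e2
  set a := (θ i (c s)).2.1
  set b := (θ i (c s)).2.2
  set a' := (θ (i + d + 1) (c s)).2.1
  set b' := (θ (i + d + 1) (c s)).2.2
  refine mul_left_cancel₀ (mul_ne_zero s3 (pow_ne_zero i (mul_ne_zero s3 s4))) ?_
  calc a * (a * b) ^ i * 1 = a ^ (i + 1) * b ^ i := by ring
    _ = a' * (a' * b') ^ (i + d + 1) := by rw [e1]; ring
    _ = a * (a * b) ^ i * (a' * (a ^ d * b ^ (d + 1))) := by rw [← e2]; ring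

lemma pt_of_left [T2Space Z] {l : ℕ} (h1 : 1 ≤ l) (hl : l ≤ n) {w : Fin k → ℂ}
    (hw : corePt n w ∈ ψ.target) {x y : ℂ} (hx : x ≠ 0) :
    pt θ l (w, x, y) = (θ (l - 1)).symm (w, 0, y / x) := by
  by_cases hy : y = 0
  · rw [pt, if_neg (by simpa using hy)]
  · rw [pt_of_right hy]
    obtain ⟨j, rfl⟩ := Nat.exists_eq_add_of_le' h1
    rw [Nat.add_sub_cancel, (h.transition hl (div_ne_zero hy hx)
      (h.target_b (by omega) hw _)).2, inv_div, zero_mul]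

lemma pt_mem_right {l : ℕ} (h1 : 1 ≤ l) (hl : l ≤ n) {w : Fin k → ℂ}
    (hw : corePt n w ∈ ψ.target) {x y : ℂ} (hy : y ≠ 0) :
    pt θ l (w, x, y) ∈ (θ l).source ∧ θ l (pt θ l (w, x, y)) = (w, x / y, 0) := by
  have ht := h.target_a h1 hl hw (x / y)
  rw [pt_of_right hy]
  exact ⟨(θ l).map_target ht, (θ l).right_inv ht⟩

lemma pt_mem_left [T2Space Z] {l : ℕ} (h1 : 1 ≤ l) (hl : l ≤ n) {w : Fin k → ℂ}
    (hw : corePt n w ∈ ψ.target) {x y : ℂ} (hx : x ≠ 0) :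
    pt θ l (w, x, y) ∈ (θ (l - 1)).source ∧ θ (l - 1) (pt θ l (w, x, y)) = (w, 0, y / x) := by
  have ht := h.target_b (i := l - 1) (by omega) hw (y / x)
  rw [h.pt_of_left h1 hl hw hx]
  exact ⟨(θ (l - 1)).map_target ht, (θ (l - 1)).right_inv ht⟩

lemma map_pt [T2Space Z] {l : ℕ} (h1 : 1 ≤ l) (hl : l ≤ n) {q : Flat k}
    (hw : corePt n q.1 ∈ ψ.target) (hq : q.2 ≠ 0) :
    ρ (pt θ l q) ∈ ψ.source ∧ ψ (ρ (pt θ l q)) = corePt n q.1 := by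
  obtain ⟨w, x, y⟩ := q
  by_cases hy : y = 0
  · have hx : x ≠ 0 := fun hx => hq (by simp [hx, hy])
    obtain ⟨m1, m2⟩ := h.pt_mem_left h1 hl hw hx
    have hc := h.chart (l - 1) (by omega)
    exact ⟨hc.maps _ m1, by rw [hc.comm _ m1, m2, tor_b (by omega)]⟩
  · obtain ⟨m1, m2⟩ := h.pt_mem_right h1 hl hw hy
    have hc := h.chart l hl
    exact ⟨hc.maps _ m1, by rw [hc.comm _ m1, m2, tor_a h1 hl]⟩

lemma continuousAt_pt [T2Space Z] {l : ℕ} (h1 : 1 ≤ l) (hl : l ≤ n) {q : Flat k}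
    (hw : corePt n q.1 ∈ ψ.target) (hq : q.2 ≠ 0) : ContinuousAt (pt θ l) q := by
  obtain ⟨w, x, y⟩ := q
  by_cases hy : y = 0
  · have hx : x ≠ 0 := fun hx => hq (by simp [hx, hy])
    have c1 : ContinuousAt (fun q => ((q.1, 0, q.2.2 / q.2.1) : Flat k)) (w, x, y) :=
      (AnalyticAt.prod (by fun_prop) (AnalyticAt.prod (by fun_prop)
        (AnalyticAt.div (by fun_prop) (by fun_prop) hx)) : Ana _ _).continuousAt
    refine (((θ (l - 1)).continuousAt_symm (h.target_b (i := l - 1) (by omega) hw (y / x))).comp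
      (x := (w, x, y)) c1).congr ?_
    have hev2 :=
      ((continuous_corePt n k).comp continuous_fst).continuousAt.eventually
        (ψ.open_target.mem_nhds hw)
    filter_upwards [(by fun_prop : ContinuousAt (fun q => q.2.1) (w, x, y)).eventually_ne hx, hev2] with q e1 e2
    exact (h.pt_of_left h1 hl e2 e1).symm
  · have c1 : ContinuousAt (fun q => ((q.1, q.2.1 / q.2.2, 0) : Flat k)) (w, x, y) :=
      (AnalyticAt.prod (by fun_prop) (AnalyticAt.prod (AnalyticAt.div (by fun_prop) (by fun_prop)
        hy) (by fun_prop)) : Ana _ _).continuousAt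
    refine (((θ l).continuousAt_symm (h.target_a h1 hl hw (x / y))).comp
      (x := (w, x, y)) c1).congr ?_
    filter_upwards [(by fun_prop : ContinuousAt (fun q => q.2.2) (w, x, y)).eventually_ne hy] with q e1
    exact (pt_of_right e1).symm

lemma exists_pt [T2Space Z] (hn : 1 ≤ n) {i : ℕ} (hi : i ≤ n) {p : Z} (hp : p ∈ (θ i).source)
    (h0 : (ψ (ρ p)).1.2 = 0) :
    ((θ i p).2.1 = 0 ∧ i < n ∧ p = pt θ (i + 1) ((ψ (ρ p)).1.1, 1, (θ i p).2.2)) ∨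
    ((θ i p).2.2 = 0 ∧ 1 ≤ i ∧ p = pt θ i ((ψ (ρ p)).1.1, (θ i p).2.1, 1)) := by
  have hw : corePt n (ψ (ρ p)).1.1 ∈ ψ.target := by
    have : corePt n (ψ (ρ p)).1.1 = ψ (ρ p) := Subtype.ext (Prod.ext rfl h0.symm)
    rw [this]
    exact ψ.map_source ((h.chart i hi).maps p hp)
  have e := congrArg Subtype.val ((h.chart i hi).comm p hp)
  rw [tor_coe hi] at e
  have e0 := (congrArg Prod.snd e).symm
  rw [h0] at e0
  have ez := congrArg (·.2.2) e0
  have hfst := h.fst_eq hi hp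
  by_cases hb : (θ i p).2.2 = 0 ∧ 1 ≤ i
  · refine Or.inr ⟨hb.1, hb.2, ?_⟩
    rw [pt_of_right one_ne_zero, div_one, ← hfst]
    rw [show ((θ i p).1, (θ i p).2.1, (0 : ℂ)) = θ i p by rw [← hb.1], (θ i).left_inv hp]
  · have ha : (θ i p).2.1 = 0 := by
      by_cases hb0 : (θ i p).2.2 = 0
      · obtain rfl : i = 0 := by by_contra hi0; exact hb ⟨hb0, by omega⟩
        simpa using congrArg Prod.fst e0
      · exact (mul_eq_zero.1 ez).resolve_right hb0
    have hin : i < n := by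
      refine lt_of_le_of_ne hi ?_
      rintro rfl
      exact hb ⟨by simpa using (congrArg (·.2.1) e0), hn⟩
    refine Or.inl ⟨ha, hin, ?_⟩
    rw [h.pt_of_left (l := i + 1) (by omega) hin hw one_ne_zero, div_one, ← hfst, Nat.add_sub_cancel]
    rw [show ((θ i p).1, (0 : ℂ), (θ i p).2.2) = θ i p by rw [← ha], (θ i).left_inv hp]

/-- The homogeneous coordinates of a point of the exceptional fibres are unique up to the
intersections of consecutive components. -/
lemma pt_eq_pt [T2Space Z] {l l' : ℕ} (h1 : 1 ≤ l) (hll : l ≤ l') (hl' : l' ≤ n) {q q' : Flat k}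
    (hw : corePt n q.1 ∈ ψ.target) (hw' : corePt n q'.1 ∈ ψ.target) (hq : q.2 ≠ 0) (hq' : q'.2 ≠ 0)
    (he : pt θ l q = pt θ l' q') : q.1 = q'.1 ∧ ((l = l' ∧ q.2.1 * q'.2.2 = q.2.2 * q'.2.1) ∨
      (l' = l + 1 ∧ q.2.1 = 0 ∧ q'.2.2 = 0)) := by
  have hfst : q.1 = q'.1 := by
    have e1 := (h.map_pt h1 (hll.trans hl') hw hq).2
    rw [he, (h.map_pt (h1.trans hll) hl' hw' hq').2] at e1
    exact (congrArg (fun t => t.1.1) e1).symm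
  refine ⟨hfst, ?_⟩
  obtain ⟨w, x, y⟩ := q
  obtain ⟨w', x', y'⟩ := q'
  have hov : ∀ {p p' : Z} {i j : ℕ} {a b a' b' : ℂ} {v v' : Fin k → ℂ}, p = p' → i < j → j ≤ n →
      (p ∈ (θ i).source ∧ θ i p = (v, a, b)) → (p' ∈ (θ j).source ∧ θ j p' = (v', a', b')) →
      b ≠ 0 := by
    rintro p _ i j a b a' b' v v' rfl hij hj ⟨m1, m2⟩ ⟨m3, m4⟩ rfl
    obtain ⟨d, rfl⟩ := Nat.exists_eq_add_of_lt hij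
    have := h.overlap hj m1 m3
    simp [m2] at this
  have hxy : y = 0 → x ≠ 0 := fun hy hx => hq (by simp [hx, hy])
  have hxy' : y' = 0 → x' ≠ 0 := fun hy hx => hq' (by simp [hx, hy])
  have hl := hll.trans hl'
  have h1' := h1.trans hll
  have mx := h.pt_mem_left h1 hl hw (x := x) (y := y)
  have my := h.pt_mem_right h1 hl hw (x := x) (y := y)
  have mx' := h.pt_mem_left h1' hl' hw' (x := x') (y := y')
  have my' := h.pt_mem_right h1' hl' hw' (x := x') (y := y')
  simp only
  rcases hll.lt_or_eq with hlt | rfl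
  · by_cases hy : y = 0
    · refine absurd (by rw [hy, zero_div]) (?_ : y / x ≠ 0)
      by_cases hy' : y' = 0
      · exact hov he (by omega) (by omega) (mx (hxy hy)) (mx' (hxy' hy'))
      · exact hov he (by omega) hl' (mx (hxy hy)) (my' hy')
    · by_cases hx' : x' = 0
      · exact absurd rfl (hov he hlt hl' (my hy) (my' fun hy' => hxy' hy' hx'))
      · by_cases hl1 : l' = l + 1
        · subst hl1
          have m4 := (mx' hx').2
          rw [Nat.add_sub_cancel, ← he, (my hy).2] at m4
          exact Or.inr ⟨rfl, (div_eq_zero_iff.1 (congrArg (fun t => t.2.1) m4)).resolve_right hy,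
            (div_eq_zero_iff.1 (congrArg (fun t => t.2.2) m4).symm).resolve_right hx'⟩
        · exact absurd rfl (hov he (by omega) (by omega) (my hy) (mx' hx'))
  · refine Or.inl ⟨rfl, ?_⟩
    by_cases hy : y = 0 <;> by_cases hy' : y' = 0
    · rw [hy, hy']; ring
    · exact absurd (by rw [hy, zero_div]) (hov he (by omega) hl' (mx (hxy hy)) (my' hy'))
    · exact absurd (by rw [hy', zero_div]) (hov he.symm (by omega) hl (mx' (hxy' hy')) (my hy))
    · have m4 := (my' hy').2
      rw [← he, (my hy).2] at m4
      have e1 := congrArg (fun t => t.2.1) m4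
      rw [div_eq_div_iff hy hy'] at e1
      rw [e1, mul_comm]

lemma pt_node [T2Space Z] {l : ℕ} (hl : l + 1 ≤ n) {w : Fin k → ℂ}
    (hw : corePt n w ∈ ψ.target) : pt θ l (w, 0, 1) = pt θ (l + 1) (w, 1, 0) := by
  rw [pt_of_right one_ne_zero, h.pt_of_left (by omega) hl hw one_ne_zero]
  simp

end IsToricCover
end ToricCover

/-! ### Arrows of the orbifold -/

section Arrows

/-- An equivariant analytic function of one variable is divisible by a power of the variable. -/
lemma exists_eq_pow_mul_of_equivariant {g : ℂ → ℂ} (hg : Ana g 0) {n : ℕ}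
    (heq : ∀ ζ : ℂ, ζ ^ (n + 1) = 1 → ∀ᶠ v in 𝓝 0, g (ζ * v) = ζ⁻¹ * g v) :
    ∃ h : ℂ → ℂ, Ana h 0 ∧ ∀ᶠ v in 𝓝 0, g v = v ^ n * h v := by
  by_cases h0 : ∀ᶠ v in 𝓝 0, g v = 0
  · exact ⟨0, analyticAt_const, h0.mono fun v hv => by simp [hv]⟩
  obtain ⟨j, h, hh, hne, he⟩ := hg.exists_eventuallyEq_pow_smul_nonzero_iff.2 h0
  simp only [sub_zero, smul_eq_mul] at he
  have hn : n ≤ j := by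
    set ζ : ℂ := exp (2 * Real.pi * I / ((n + 1 : ℕ) : ℂ)) with hζ
    have hprim : IsPrimitiveRoot ζ (n + 1) := isPrimitiveRoot_exp (n + 1) (by omega)
    have hζ0 : ζ ≠ 0 := exp_ne_zero _
    have t0 : Tendsto (fun v : ℂ => ζ * v) (𝓝 0) (𝓝 0) :=
      Continuous.tendsto' (by fun_prop) _ _ (by simp)
    have e1 : ∀ᶠ v in 𝓝[≠] (0 : ℂ), ζ ^ j * h (ζ * v) = ζ⁻¹ * h v := by
      filter_upwards [self_mem_nhdsWithin, nhdsWithin_le_nhds he,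
        nhdsWithin_le_nhds (t0.eventually he), nhdsWithin_le_nhds (heq ζ hprim.pow_eq_one)]
        with v v0 v1 v2 v3
      rw [v1, v2] at v3
      refine mul_left_cancel₀ (pow_ne_zero j v0) ?_
      linear_combination v3
    have c1 : Tendsto (fun v => ζ ^ j * h (ζ * v)) (𝓝[≠] 0) (𝓝 (ζ ^ j * h 0)) :=
      (tendsto_const_nhds.mul (hh.continuousAt.tendsto.comp t0)).mono_left nhdsWithin_le_nhds
    have c2 : Tendsto (fun v => ζ⁻¹ * h v) (𝓝[≠] 0) (𝓝 (ζ⁻¹ * h 0)) :=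
      (tendsto_const_nhds.mul hh.continuousAt.tendsto).mono_left nhdsWithin_le_nhds
    have e2 := mul_right_cancel₀ hne (tendsto_nhds_unique (c1.congr' e1) c2)
    exact Nat.le_of_succ_le_succ (Nat.le_of_dvd (by omega) (hprim.dvd_of_pow_eq_one (j + 1) (by
      rw [pow_succ, e2, inv_mul_cancel₀ hζ0])))
  refine ⟨fun v => v ^ (j - n) * h v, (by fun_prop : Ana (fun v : ℂ => v ^ (j - n)) 0).mul hh,
    he.mono fun v hv => ?_⟩
  rw [hv, ← mul_assoc, ← pow_add, Nat.add_sub_cancel' hn]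

variable {n k : ℕ} {Y : Type u} [TopologicalSpace Y] [HolSpace Y]

lemma quotMap_core (w : Fin k → ℂ) : quotMap n k (w, 0, 0) = corePt n w :=
  Subtype.ext (by simp [quotMap, corePt])

lemma continuous_quotMap (n k : ℕ) : Continuous (quotMap n k) :=
  Continuous.subtype_mk (by fun_prop) _

lemma AChart.isOpen_dom (a : AChart n k Y) : IsOpen a.dom :=
  a.ψ.open_target.preimage (continuous_quotMap n k)

lemma AChart.χ_mem (a : AChart n k Y) {p : Flat k} (hp : p ∈ a.dom) : a.χ p ∈ a.ψ.source :=
  a.ψ.map_target hp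

lemma AChart.ψ_χ (a : AChart n k Y) {p : Flat k} (hp : p ∈ a.dom) : a.ψ (a.χ p) = quotMap n k p :=
  a.ψ.right_inv hp

variable {a b : AChart n k Y} {t : Y}

lemma AChart.corePt_eq (ht : t ∈ a.ψ.source) (hS : t ∈ Sing k Y) :
    corePt n (a.ψ t).1.1 = a.ψ t :=
  Subtype.ext (Prod.ext rfl ((a.core t ht).1 hS).symm)

lemma AChart.quotMap_lift (ht : t ∈ a.ψ.source) (hS : t ∈ Sing k Y) :
    quotMap n k (a.lift t) = a.ψ t := by
  rw [AChart.lift, quotMap_core, AChart.corePt_eq ht hS]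

lemma AChart.lift_mem_dom (ht : t ∈ a.ψ.source) (hS : t ∈ Sing k Y) :
    a.lift t ∈ a.dom := by
  change quotMap n k (a.lift t) ∈ a.ψ.target
  rw [AChart.quotMap_lift ht hS]
  exact a.ψ.map_source ht

lemma AChart.χ_lift (ht : t ∈ a.ψ.source) (hS : t ∈ Sing k Y) :
    a.χ (a.lift t) = t := by
  rw [AChart.χ, AChart.quotMap_lift ht hS, a.ψ.left_inv ht]

lemma AChart.χ_core_mem {w : Fin k → ℂ} (h : (w, 0, 0) ∈ a.dom) :
    a.χ (w, 0, 0) ∈ Sing k Y := by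
  rw [a.core _ (a.χ_mem h), a.ψ_χ h, quotMap_core]
  rfl

lemma eq_core_of_quotMap {q : Flat k} (h : (quotMap n k q).1.2 = 0) : q = (q.1, 0, 0) := by
  have h1 : q.2.1 ^ (n + 1) = 0 := congrArg Prod.fst h
  have h2 : q.2.2 ^ (n + 1) = 0 := congrArg (·.2.1) h
  exact Prod.ext rfl (Prod.ext (eq_zero_of_pow_eq_zero h1) (eq_zero_of_pow_eq_zero h2))

lemma IsArrow.core {p : Flat k} {φ : Flat k → Flat k} (h : IsArrow a b p φ) (hp : p.2 = 0) :
    φ p = ((φ p).1, 0, 0) := by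
  have hp' : p = (p.1, 0, 0) := Prod.ext rfl hp
  have hS : b.χ (φ p) ∈ Sing k Y := by
    rw [h.comm.self_of_nhds, hp']
    exact AChart.χ_core_mem (hp' ▸ h.source)
  refine eq_core_of_quotMap (n := n) ?_
  rw [← b.ψ_χ h.target]
  exact (b.core _ (b.χ_mem h.target)).1 hS

lemma IsArrow.mem_source {φ : Flat k → Flat k} (ht : t ∈ a.ψ.source)
    (hS : t ∈ Sing k Y) (h : IsArrow a b (a.lift t) φ) : t ∈ b.ψ.source := by
  have e := h.comm.self_of_nhds
  rw [AChart.χ_lift ht hS] at e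
  rw [← e]
  exact b.χ_mem h.target

lemma IsArrow.map_lift {φ : Flat k → Flat k} (ht : t ∈ a.ψ.source)
    (hS : t ∈ Sing k Y) (h : IsArrow a b (a.lift t) φ) :
    φ (a.lift t) = b.lift t := by
  have e := h.comm.self_of_nhds
  rw [AChart.χ_lift ht hS] at e
  have h1 := h.core (p := a.lift t) rfl
  have h2 := b.ψ_χ h.target
  rw [e, h1, quotMap_core] at h2
  rw [h1]
  change _ = ((b.ψ t).1.1, (0 : ℂ), (0 : ℂ))
  rw [h2]
  rfl

lemma IsArrow.eventually {p : Flat k} {φ : Flat k → Flat k} (h : IsArrow a b p φ) :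
    ∀ᶠ x in 𝓝 p, IsArrow a b x φ := by
  have h1 : ∀ᶠ x in 𝓝 p, x ∈ a.dom := a.isOpen_dom.mem_nhds h.source
  have h2 : ∀ᶠ x in 𝓝 p, φ x ∈ b.dom :=
    h.analytic.continuousAt.eventually (b.isOpen_dom.mem_nhds h.target)
  have h3 : ∀ᶠ x in 𝓝 p, (fderiv ℂ φ x).IsInvertible := by
    obtain ⟨L, hL⟩ := h.invertible
    exact h.analytic.fderiv.continuousAt.eventually (hL ▸ L.nhds)
  filter_upwards [h1, h2, h3, h.analytic.eventually_analyticAt, h.comm.eventually_nhds]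
    with x e1 e2 e3 e4 e5
  exact ⟨e1, e2, e4, e3, e5⟩

/-- The derivative of an arrow preserves the tangent spaces of the fixed loci. -/
lemma IsArrow.fderiv_core {w : Fin k → ℂ} {φ : Flat k → Flat k} (h : IsArrow a b (w, 0, 0) φ)
    (v : Fin k → ℂ) : (fderiv ℂ φ (w, 0, 0) (v, 0, 0)).2 = 0 := by
  have hd : HasFDerivAt φ (fderiv ℂ φ (w, 0, 0)) (w, 0, 0) :=
    h.analytic.differentiableAt.hasFDerivAt
  have hc : HasDerivAt (fun s : ℂ => ((w + s • v, 0, 0) : Flat k)) (v, 0, 0) 0 := by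
    refine HasDerivAt.prodMk ?_ ((hasDerivAt_const _ _).prodMk (hasDerivAt_const _ _))
    have := ((hasDerivAt_id (0 : ℂ)).smul_const v).const_add w
    simpa using this
  have hcomp : HasDerivAt (fun s : ℂ => (φ (w + s • v, 0, 0)).2)
      (fderiv ℂ φ (w, 0, 0) (v, 0, 0)).2 0 := by
    have h1 : HasFDerivAt φ (fderiv ℂ φ (w, 0, 0)) (w + (0 : ℂ) • v, 0, 0) := by simpa using hd
    exact hasFDerivAt_snd.comp_hasDerivAt (0 : ℂ) (h1.comp_hasDerivAt (0 : ℂ) hc)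
  have hev : ∀ᶠ s in 𝓝 (0 : ℂ), (φ (w + s • v, 0, 0)).2 = 0 := by
    have ht : Tendsto (fun s : ℂ => ((w + s • v, 0, 0) : Flat k)) (𝓝 0) (𝓝 (w, 0, 0)) :=
      Continuous.tendsto' (by fun_prop) _ _ (by simp)
    filter_upwards [ht.eventually h.eventually] with s hs
    rw [hs.core rfl]
    rfl
  exact (hcomp.congr_of_eventuallyEq (f₁ := fun _ => 0) (hev.mono fun s hs => hs.symm)).unique
    (hasDerivAt_const _ _)

lemma fderiv_normal {φ : Flat k → Flat k} (p : Flat k) (x y : ℂ) :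
    (fderiv ℂ φ p (0, x, y)).2 = ((normalDeriv φ p 0 0) * x + (normalDeriv φ p 0 1) * y,
      (normalDeriv φ p 1 0) * x + (normalDeriv φ p 1 1) * y) := by
  have : ((0, x, y) : Flat k) = x • (0, 1, 0) + y • (0, 0, 1) := by simp
  rw [this, map_add, map_smul, map_smul]
  refine Prod.ext ?_ ?_ <;> simp [normalDeriv, mul_comm]

lemma IsArrow.det_ne_zero {w : Fin k → ℂ} {φ : Flat k → Flat k} (h : IsArrow a b (w, 0, 0) φ) :
    (normalDeriv φ (w, 0, 0)).det ≠ 0 := by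
  obtain ⟨L, hL⟩ := h.invertible
  intro h0
  obtain ⟨v, hv, hv0⟩ := Matrix.exists_mulVec_eq_zero_iff.2 h0
  have hL' : ∀ x, L x = fderiv ℂ φ (w, 0, 0) x := fun x => by rw [← hL]; rfl
  have e0 := congrFun hv0 0
  have e1 := congrFun hv0 1
  simp only [Matrix.mulVec, dotProduct, Fin.sum_univ_two, Pi.zero_apply] at e0 e1
  have h1 : (L (0, v 0, v 1)).2 = 0 := by
    rw [hL', fderiv_normal]
    exact Prod.ext e0 e1
  let T : (Fin k → ℂ) →ₗ[ℂ] (Fin k → ℂ) := LinearMap.fst ℂ _ _ ∘ₗ L.toLinearMap ∘ₗ LinearMap.inl ℂ _ _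
  have hT : Function.Injective T := by
    rw [← LinearMap.ker_eq_bot, LinearMap.ker_eq_bot']
    intro x hx
    have : L (x, 0, 0) = 0 := Prod.ext hx (by rw [hL']; exact h.fderiv_core x)
    have h2 : ((x, 0, 0) : Flat k) = 0 := L.injective (by rw [this, map_zero])
    exact congrArg Prod.fst h2
  obtain ⟨x, hx⟩ := LinearMap.surjective_of_injective hT (L (0, v 0, v 1)).1
  have h3 : L (x, 0, 0) = L (0, v 0, v 1) :=
    Prod.ext hx (by rw [h1, hL']; exact h.fderiv_core x)
  have h4 := congrArg Prod.snd (L.injective h3)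
  refine hv (funext fun i => ?_)
  fin_cases i
  exacts [(congrArg Prod.fst h4).symm, (congrArg Prod.snd h4).symm]

/-- The form of a function of two variables that is equivariant along an axis. -/
lemma exists_local_form {f : ℂ × ℂ → ℂ} (hf : Ana f 0) {n : ℕ} (hn : 1 ≤ n)
    (heq : ∀ ζ : ℂ, ζ ^ (n + 1) = 1 → ∀ᶠ v in 𝓝 0, f (0, ζ * v) = ζ⁻¹ * f (0, v)) :
    ∃ (F : ℂ × ℂ → ℂ) (η : ℂ → ℂ), ContinuousAt F 0 ∧ ContinuousAt η 0 ∧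
      F 0 = fderiv ℂ f 0 (1, 0) ∧ 0 ^ (n - 1) * η 0 = fderiv ℂ f 0 (0, 1) ∧
      ∀ᶠ q in 𝓝 (0 : ℂ × ℂ), f q = q.1 * F q + q.2 ^ n * η q.2 := by
  have hi2 : Ana (fun v : ℂ => ((0, v) : ℂ × ℂ)) 0 := by fun_prop
  have hg : Ana (fun v => f (0, v)) 0 :=
    AnalyticAt.comp (f := fun v : ℂ => ((0, v) : ℂ × ℂ)) (g := f) hf hi2
  obtain ⟨η, hη, hηe⟩ := exists_eq_pow_mul_of_equivariant hg heq
  have hsw : Ana (fun q : ℂ × ℂ => f (q.2, q.1) - f (0, q.1)) (0, 0) :=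
    (AnalyticAt.comp (f := fun q : ℂ × ℂ => (q.2, q.1)) (g := f) (x := (0, 0)) hf
      (by fun_prop)).sub (AnalyticAt.comp (f := fun q : ℂ × ℂ => ((0, q.1) : ℂ × ℂ)) (g := f)
      (x := (0, 0)) hf (by fun_prop))
  obtain ⟨F₁, hF₁, hF₁e⟩ := exists_eq_mul_of_analyticAt hsw
    (Eventually.of_forall fun y => by simp)
  have hFd : HasFDerivAt f (fderiv ℂ f 0) 0 := hf.differentiableAt.hasFDerivAt
  have tsw : Tendsto (fun q : ℂ × ℂ => (q.2, q.1)) (𝓝 0) (𝓝 (0, 0)) :=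
    Continuous.tendsto' (by fun_prop) _ _ rfl
  have t2 : Tendsto (fun q : ℂ × ℂ => q.2) (𝓝 0) (𝓝 0) := Continuous.tendsto' (by fun_prop) _ _ rfl
  have hform : ∀ᶠ q in 𝓝 (0 : ℂ × ℂ), f q = q.1 * F₁ (q.2, q.1) + q.2 ^ n * η q.2 := by
    filter_upwards [tsw.eventually hF₁e, t2.eventually hηe] with q e1 e2
    have e3 : f (q.1, q.2) - f (0, q.2) = q.1 * F₁ (q.2, q.1) := e1
    change f (q.1, q.2) = _
    linear_combination e3 + e2
  have d1 : HasDerivAt (fun s : ℂ => f (s, 0)) (fderiv ℂ f 0 (1, 0)) 0 :=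
    HasFDerivAt.comp_hasDerivAt (f := fun s : ℂ => ((s, 0) : ℂ × ℂ)) (0 : ℂ) hFd
      ((hasDerivAt_id _).prodMk (hasDerivAt_const _ _))
  have d2 : HasDerivAt (fun s : ℂ => f (0, s)) (fderiv ℂ f 0 (0, 1)) 0 :=
    HasFDerivAt.comp_hasDerivAt (f := fun s : ℂ => ((0, s) : ℂ × ℂ)) (0 : ℂ) hFd
      ((hasDerivAt_const _ _).prodMk (hasDerivAt_id _))
  refine ⟨fun q => F₁ (q.2, q.1), η, hF₁.continuousAt.tendsto.comp tsw, hη.continuousAt, ?_, ?_,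
    hform⟩
  · have tu : Tendsto (fun s : ℂ => ((s, 0) : ℂ × ℂ)) (𝓝 0) (𝓝 0) :=
      Continuous.tendsto' (by fun_prop) _ _ rfl
    have hh : Ana (fun s : ℂ => F₁ (0, s)) 0 :=
      AnalyticAt.comp (f := fun s : ℂ => ((0, s) : ℂ × ℂ)) (g := F₁) hF₁ (by fun_prop)
    have d3 := (hasDerivAt_id (0 : ℂ)).mul hh.differentiableAt.hasDerivAt
    have hn0 : n ≠ 0 := by omega
    have d4 : HasDerivAt (fun s : ℂ => f (s, 0)) _ 0 := d3.congr_of_eventuallyEq (by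
      filter_upwards [tu.eventually hform] with s hs
      simpa [hn0] using hs)
    simpa using d4.unique d1
  · have d3 := (hasDerivAt_pow n (0 : ℂ)).mul hη.differentiableAt.hasDerivAt
    have d4 : HasDerivAt (fun s : ℂ => f (0, s)) _ 0 := d3.congr_of_eventuallyEq hηe
    rw [← d4.unique d2]
    rcases eq_or_ne n 1 with rfl | h1
    · simp
    · have h2 : n - 1 ≠ 0 := by omega
      have h3 : n ≠ 0 := by omega
      simp [h2, h3]

lemma IsArrow.local_form {w : Fin k → ℂ} {φ : Flat k → Flat k} (h : IsArrow a b (w, 0, 0) φ)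
    (hn : 1 ≤ n) (heq : ∀ ζ : ℂ, ζ ^ (n + 1) = 1 → ∀ᶠ x in 𝓝 ((w, 0, 0) : Flat k),
      φ (rootAct ζ x) = rootAct ζ (φ x)) :
    ∃ (F G : ℂ × ℂ → ℂ) (η ε : ℂ → ℂ), ContinuousAt F 0 ∧ ContinuousAt G 0 ∧ ContinuousAt η 0 ∧
      ContinuousAt ε 0 ∧ normalDeriv φ (w, 0, 0) =
        !![F 0, 0 ^ (n - 1) * η 0; 0 ^ (n - 1) * ε 0, G 0] ∧
      ∀ᶠ q in 𝓝 (0 : ℂ × ℂ), (φ (w, q)).2 =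
        (q.1 * F q + q.2 ^ n * η q.2, q.2 * G q + q.1 ^ n * ε q.1) := by
  have hφd : HasFDerivAt φ (fderiv ℂ φ (w, 0, 0)) (w, 0) :=
    h.analytic.differentiableAt.hasFDerivAt
  have hF : Ana (fun q : ℂ × ℂ => (φ (w, q)).2) 0 := by
    exact AnalyticAt.comp (g := Prod.snd) (f := fun q : ℂ × ℂ => φ (w, q)) analyticAt_snd
      (AnalyticAt.comp (g := φ) (f := fun q : ℂ × ℂ => ((w, q) : Flat k)) h.analytic
        (by fun_prop))
  have hFd : HasFDerivAt (fun q : ℂ × ℂ => (φ (w, q)).2) _ 0 :=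
    (hasFDerivAt_snd (p := φ (w, 0))).comp (0 : ℂ × ℂ) (hφd.comp (0 : ℂ × ℂ)
      ((hasFDerivAt_const w 0).prodMk (hasFDerivAt_id 0)))
  have hF1 : Ana (fun q : ℂ × ℂ => (φ (w, q)).2.1) 0 := analyticAt_fst.comp hF
  have hF1d : HasFDerivAt (fun q : ℂ × ℂ => (φ (w, q)).2.1) _ 0 :=
    (hasFDerivAt_fst (p := (φ (w, 0)).2)).comp (0 : ℂ × ℂ) hFd
  have hG : Ana (fun q : ℂ × ℂ => (φ (w, q.2, q.1)).2.2) 0 := by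
    exact AnalyticAt.comp (g := fun q : ℂ × ℂ => (φ (w, q)).2.2) (f := fun q : ℂ × ℂ => (q.2, q.1))
      (analyticAt_snd.comp hF) (by fun_prop)
  have hGd : HasFDerivAt (fun q : ℂ × ℂ => (φ (w, q.2, q.1)).2.2) _ 0 :=
    HasFDerivAt.comp (f := fun q : ℂ × ℂ => (q.2, q.1)) (0 : ℂ × ℂ)
      ((hasFDerivAt_snd (p := (φ (w, 0)).2)).comp (0 : ℂ × ℂ) hFd)
      ((hasFDerivAt_snd (p := (0 : ℂ × ℂ))).prodMk hasFDerivAt_fst)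
  obtain ⟨F, η, c1, c2, e1, e2, e3⟩ := exists_local_form hF1 hn (fun ζ hζ => by
    have ht : Tendsto (fun v : ℂ => ((w, 0, v) : Flat k)) (𝓝 0) (𝓝 (w, 0, 0)) :=
      Continuous.tendsto' (by fun_prop) _ _ rfl
    filter_upwards [ht.eventually (heq ζ⁻¹ (by rw [inv_pow, hζ, inv_one]))] with v hv
    simpa [rootAct] using congrArg (fun t : Flat k => t.2.1) hv)
  obtain ⟨G, ε, c3, c4, e4, e5, e6⟩ := exists_local_form hG hn (fun ζ hζ => by
    have ht : Tendsto (fun v : ℂ => ((w, v, 0) : Flat k)) (𝓝 0) (𝓝 (w, 0, 0)) :=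
      Continuous.tendsto' (by fun_prop) _ _ rfl
    filter_upwards [ht.eventually (heq ζ hζ)] with v hv
    simpa [rootAct] using congrArg (fun t : Flat k => t.2.2) hv)
  have tsw : Tendsto (fun q : ℂ × ℂ => (q.2, q.1)) (𝓝 0) (𝓝 0) :=
    Continuous.tendsto' (by fun_prop) _ _ rfl
  refine ⟨F, fun q => G (q.2, q.1), η, ε, c1, c3.tendsto.comp tsw, c2, c4, ?_, ?_⟩
  · rw [hF1d.fderiv] at e1 e2
    rw [hGd.fderiv] at e4 e5
    rw [e1, e2, e5]
    change _ = !![_, _; _, G 0]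
    rw [e4]
    rfl
  · filter_upwards [e3, tsw.eventually e6] with q h1 h2
    exact Prod.ext h1 h2

end Arrows

/-! ### Change of charts -/

section ChartChange

variable {n k : ℕ} {Y Z : Type u} [TopologicalSpace Y] [HolSpace Y] [TopologicalSpace Z]
  [HolSpace Z] {a b : AChart n k Y} {ρ : Z → Y} {θ θ' : ℕ → OPH Z (Flat k)}

/-- The function `z` of a chart, pulled back to the resolution. -/
def zfun (a : AChart n k Y) (ρ : Z → Y) (p : Z) : ℂ := (a.ψ (ρ p)).1.2.2.2

lemma zero_pow_mul_eq (m j : ℕ) : (0 : ℂ) ^ ((m + 1) * j) = 0 ^ j := by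
  rcases j with _ | j
  · simp
  · rw [zero_pow (by positivity), zero_pow (by omega)]

/-- The comparison of two charts along a curve that approaches a general point of an exceptional
component. -/
lemma chart_change_curve [T2Space Z] (hθ : IsToricCover a.ψ ρ θ) (hθ' : IsToricCover b.ψ ρ θ')
    {w w' : Fin k → ℂ} {φ : Flat k → Flat k} (h : IsArrow a b (w, 0, 0) φ)
    (hw' : φ (w, 0, 0) = (w', 0, 0)) {F G : ℂ × ℂ → ℂ} {η ε : ℂ → ℂ} (hF : ContinuousAt F 0)
    (hG : ContinuousAt G 0) (hη : ContinuousAt η 0) (hε : ContinuousAt ε 0)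
    (hform : ∀ᶠ q in 𝓝 (0 : ℂ × ℂ), (φ (w, q)).2 =
      (q.1 * F q + q.2 ^ n * η q.2, q.2 * G q + q.1 ^ n * ε q.1))
    {l j : ℕ} (hl : n = l + 1 + j) {A : ℂ} (hA : A ≠ 0)
    (hX : F 0 + 0 ^ j * η 0 / A ^ (n + 1) ≠ 0) (hW : G 0 + 0 ^ l * ε 0 * A ^ (n + 1) ≠ 0) :
    pt θ (l + 1) (w, A ^ (n + 1), 1) = pt θ' (l + 1)
      (w', (F 0 + 0 ^ j * η 0 / A ^ (n + 1)) ^ (j + 1) * A ^ (n + 1),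
        (G 0 + 0 ^ l * ε 0 * A ^ (n + 1)) ^ (l + 1)) ∧
    Tendsto (fun T : ℂ => zfun b ρ ((θ (l + 1)).symm (w, A ^ (n + 1), T ^ (n + 1))) / T ^ (n + 1))
      (𝓝[≠] 0) (𝓝 ((F 0 + 0 ^ j * η 0 / A ^ (n + 1)) * (G 0 + 0 ^ l * ε 0 * A ^ (n + 1)) *
        A ^ (n + 1))) := by
  set X := F 0 + 0 ^ j * η 0 / A ^ (n + 1) with hXd
  set W := G 0 + 0 ^ l * ε 0 * A ^ (n + 1) with hWd
  let U : ℂ → ℂ := fun T => A ^ (l + 2) * T ^ (l + 1)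
  let V : ℂ → ℂ := fun T => A ^ j * T ^ (j + 1)
  let Φ : ℂ → ℂ := fun T => A ^ (l + 2) * F (U T, V T) + A ^ (n * j) * T ^ ((n + 1) * j) * η (V T)
  let Γ : ℂ → ℂ := fun T =>
    A ^ j * G (U T, V T) + A ^ ((l + 2) * n) * T ^ ((n + 1) * l) * ε (U T)
  have tU : Tendsto U (𝓝 0) (𝓝 0) := Continuous.tendsto' (by fun_prop) _ _ (by simp [U])
  have tV : Tendsto V (𝓝 0) (𝓝 0) := Continuous.tendsto' (by fun_prop) _ _ (by simp [V])
  have tUV : Tendsto (fun T => (U T, V T)) (𝓝 0) (𝓝 0) := tU.prodMk_nhds tV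
  have tpow : ∀ m : ℕ, Tendsto (fun T : ℂ => T ^ m) (𝓝 0) (𝓝 (0 ^ m)) := fun m =>
    (continuous_pow m).tendsto 0
  have hΦ0 : A ^ (l + 2) * F 0 + A ^ (n * j) * 0 ^ ((n + 1) * j) * η 0 = A ^ (l + 2) * X := by
    rw [zero_pow_mul_eq, hXd]
    rcases j with _ | j
    · obtain rfl : n = l + 1 := hl
      field_simp
      simp
    · simp
  have hΓ0 : A ^ j * G 0 + A ^ ((l + 2) * n) * 0 ^ ((n + 1) * l) * ε 0 = A ^ j * W := by
    rw [zero_pow_mul_eq, hWd]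
    rcases l with _ | l
    · obtain rfl : n = 0 + 1 + j := hl
      simp only [pow_zero]
      ring
    · simp
  have tΦ : Tendsto Φ (𝓝 0) (𝓝 (A ^ (l + 2) * X)) := by
    rw [← hΦ0]
    exact (tendsto_const_nhds.mul (hF.tendsto.comp tUV)).add
      ((tendsto_const_nhds.mul (tpow _)).mul (hη.tendsto.comp tV))
  have tΓ : Tendsto Γ (𝓝 0) (𝓝 (A ^ j * W)) := by
    rw [← hΓ0]
    exact (tendsto_const_nhds.mul (hG.tendsto.comp tUV)).add
      ((tendsto_const_nhds.mul (tpow _)).mul (hε.tendsto.comp tU))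
  have nΦ : A ^ (l + 2) * X ≠ 0 := mul_ne_zero (pow_ne_zero _ hA) hX
  have nΓ : A ^ j * W ≠ 0 := mul_ne_zero (pow_ne_zero _ hA) hW
  have hln : l + 1 ≤ n := by omega
  have hwt : corePt n w ∈ a.ψ.target := quotMap_core (n := n) w ▸ h.source
  have hwt' : corePt n w' ∈ b.ψ.target := quotMap_core (n := n) w' ▸ hw' ▸ h.target
  -- the curve in the two toric charts
  let q : ℂ → Flat k := fun T => (w, A ^ (n + 1), T ^ (n + 1))
  let q' : ℂ → Flat k := fun T => ((φ (w, U T, V T)).1, Φ T ^ (j + 1) / Γ T ^ (l + 1),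
    T ^ (n + 1) * (Γ T ^ (l + 2) / Φ T ^ j))
  have t0 : Tendsto (fun T => ((w, U T, V T) : Flat k)) (𝓝 0) (𝓝 (w, 0, 0)) :=
    tendsto_const_nhds.prodMk_nhds tUV
  have tφ : Tendsto (fun T => φ (w, U T, V T)) (𝓝 0) (𝓝 (w', 0, 0)) := by
    rw [← hw']
    exact h.analytic.continuousAt.tendsto.comp t0
  have tq : Tendsto q (𝓝 0) (𝓝 (w, A ^ (n + 1), 0)) :=
    Continuous.tendsto' (by fun_prop) _ _ (by simp [q])
  have hlim : (A ^ (l + 2) * X) ^ (j + 1) / (A ^ j * W) ^ (l + 1) =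
      X ^ (j + 1) * A ^ (n + 1) / W ^ (l + 1) := by
    rw [hl]
    field_simp
    ring
  have tq' : Tendsto q' (𝓝 0) (𝓝 (w', X ^ (j + 1) * A ^ (n + 1) / W ^ (l + 1), 0)) := by
    rw [← hlim]
    refine tφ.fst_nhds.prodMk_nhds (Tendsto.prodMk_nhds
      ((tΦ.pow _).div (tΓ.pow _) (pow_ne_zero _ nΓ)) ?_)
    have := (tpow (n + 1)).mul ((tΓ.pow (l + 2)).div (tΦ.pow j) (pow_ne_zero _ nΦ))
    simpa using this
  have mq := hθ.target_a (Nat.le_add_left 1 l) hln hwt (A ^ (n + 1))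
  have mq' := hθ'.target_a (Nat.le_add_left 1 l) hln hwt' (X ^ (j + 1) * A ^ (n + 1) / W ^ (l + 1))
  have hnl : n - (l + 1) = j := by omega
  have hev : ∀ᶠ T in 𝓝[≠] (0 : ℂ), (θ (l + 1)).symm (q T) = (θ' (l + 1)).symm (q' T) ∧
      zfun b ρ ((θ (l + 1)).symm (q T)) = Φ T * Γ T * T ^ (n + 1) := by
    filter_upwards [self_mem_nhdsWithin,
      nhdsWithin_le_nhds (tq.eventually ((θ (l + 1)).open_target.mem_nhds mq)),
      nhdsWithin_le_nhds (tq'.eventually ((θ' (l + 1)).open_target.mem_nhds mq')),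
      nhdsWithin_le_nhds (tΦ.eventually_ne nΦ), nhdsWithin_le_nhds (tΓ.eventually_ne nΓ),
      nhdsWithin_le_nhds (tUV.eventually hform), nhdsWithin_le_nhds (t0.eventually h.eventually)]
      with T hT h1 h2 h3 h4 h5 h6
    have hT0 : T ≠ 0 := hT
    have hFu : (φ (w, U T, V T)).2 = (T ^ (l + 1) * Φ T, T ^ (j + 1) * Γ T) := by
      rw [h5]
      refine Prod.ext ?_ ?_ <;> simp only [U, V, Φ, Γ] <;> rw [hl] <;> ring
    have e1 : tor n (l + 1) (q T) = quotMap n k (w, U T, V T) := by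
      refine Subtype.ext ?_
      rw [tor_coe hln, hnl]
      simp only [q, quotMap, U, V]
      refine Prod.ext rfl (Prod.ext ?_ (Prod.ext ?_ ?_)) <;> simp only [hl] <;> ring
    have e2 : tor n (l + 1) (q' T) = quotMap n k (φ (w, U T, V T)) := by
      refine Subtype.ext ?_
      rw [tor_coe hln, hnl]
      simp only [q', quotMap, hFu]
      have g1 := pow_ne_zero (l + 1) h4
      have g2 := pow_ne_zero j h3
      refine Prod.ext rfl (Prod.ext ?_ (Prod.ext ?_ ?_))
      iterate 2
        · simp only
          rw [hl, div_pow, mul_pow, div_pow, div_mul_eq_mul_div, div_eq_iff (pow_ne_zero _ g1)]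
          field_simp
          ring
      · simp only [hl]
        field_simp
        ring
    obtain ⟨m1, m2⟩ := hθ.map_symm hln h1
    obtain ⟨m3, m4⟩ := hθ'.map_symm hln h2
    have e3 : ρ ((θ (l + 1)).symm (q T)) = a.χ (w, U T, V T) := by
      rw [AChart.χ, ← e1, ← m2, a.ψ.left_inv m1]
    have e4 : ρ ((θ' (l + 1)).symm (q' T)) = b.χ (φ (w, U T, V T)) := by
      rw [AChart.χ, ← e2, ← m4, b.ψ.left_inv m3]
    have e5 := h6.comm.self_of_nhds
    refine ⟨hθ.inj _ _ (by rw [e3, e4, e5]) m1 ?_, ?_⟩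
    · rw [m2, tor_coe hln]
      intro h0
      have := congrArg (fun t : ℂ × ℂ × ℂ => t.2.2) h0
      simp only [q, Prod.snd_zero, mul_eq_zero] at this
      exact this.elim (pow_ne_zero _ hA) (pow_ne_zero _ hT0)
    · rw [zfun, e3, ← e5, b.ψ_χ h6.target]
      simp only [quotMap, hFu]
      rw [hl]
      ring
  refine ⟨?_, ?_⟩
  · rw [pt_of_right one_ne_zero, div_one, pt_of_right (pow_ne_zero _ hW)]
    have c1 := (((θ (l + 1)).continuousAt_symm mq).tendsto.comp tq).mono_left
      (nhdsWithin_le_nhds (s := {0}ᶜ))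
    have c2 := (((θ' (l + 1)).continuousAt_symm mq').tendsto.comp tq').mono_left
      (nhdsWithin_le_nhds (s := {0}ᶜ))
    exact tendsto_nhds_unique c1 (c2.congr' (hev.mono fun T hT => hT.1.symm))
  · have hlim2 : X * W * A ^ (n + 1) = A ^ (l + 2) * X * (A ^ j * W) := by rw [hl]; ring
    rw [hlim2]
    refine ((tΦ.mul tΓ).mono_left nhdsWithin_le_nhds).congr' ?_
    filter_upwards [hev, self_mem_nhdsWithin] with T hT hT0
    have : T ^ (n + 1) ≠ 0 := pow_ne_zero _ hT0
    rw [hT.2]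
    field_simp

end ChartChange

/-! ### Functionals on the ideal and the change of charts -/

section Normal

variable {Z : Type u} [TopologicalSpace Z] [HolSpace Z] {A : Set Z} {p : Z}

lemma MemIdeal.congr {h h' : Z → ℂ} (hh : MemIdeal A p h) (he : h =ᶠ[𝓝 p] h') :
    MemIdeal A p h' := by
  refine ⟨HolSpace.congr hh.1 he, ?_⟩
  filter_upwards [hh.2, he] with y h1 h2 h3
  rw [← h2, h1 h3]

lemma MemIdeal.mul {f h : Z → ℂ} (hf : f ∈ 𝒪 p) (hh : MemIdeal A p h) : MemIdeal A p (f * h) := by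
  refine ⟨mul_mem hf hh.1, hh.2.mono fun y hy hyA => ?_⟩
  rw [Pi.mul_apply, hy hyA, mul_zero]

lemma normalFib_congr {l : (Z → ℂ) → ℂ} (hl : l ∈ normalFib A p) {h h' : Z → ℂ}
    (hh : MemIdeal A p h) (he : h =ᶠ[𝓝 p] h') : l h = l h' := by
  classical
  have hh' := hh.congr he
  have hd : MemIdeal A p (h - h') := ⟨sub_mem hh.1 hh'.1, by
    filter_upwards [hh.2, hh'.2] with y h1 h2 h3
    simp [h1 h3, h2 h3]⟩
  set f : Z → ℂ := fun y => if h y = h' y then 0 else 1 with hf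
  have hf0 : (0 : Z → ℂ) =ᶠ[𝓝 p] f := he.mono fun y hy => by simp [hf, hy]
  have hfm : f ∈ 𝒪 p := HolSpace.congr (zero_mem _) hf0
  have e1 : f * (h - h') = h - h' := by
    funext y
    by_cases hy : h y = h' y <;> simp [hf, hy]
  have e2 := hl.2.2 f (h - h') hfm hd
  rw [e1, ← hf0.self_of_nhds, Pi.zero_apply, zero_mul] at e2
  have e3 := hl.2.1 (h - h') h' hd hh'
  rw [sub_add_cancel, e2, zero_add] at e3
  exact e3

lemma normalFib_mul {l : (Z → ℂ) → ℂ} (hl : l ∈ normalFib A p) {f h g : Z → ℂ} (hf : f ∈ 𝒪 p)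
    (hh : MemIdeal A p h) (he : ∀ᶠ y in 𝓝 p, g y = f y * h y) : l g = f p * l h := by
  rw [← hl.2.2 f h hf hh]
  exact (normalFib_congr hl (hh.mul hf) (he.mono fun y hy => hy.symm)).symm

lemma exists_eq_mul_snd {k : ℕ} {F : Flat k → ℂ} {w : Fin k → ℂ} {a : ℂ}
    (hF : Ana F (w, a, 0))
    (h0 : ∀ᶠ q : Flat k in 𝓝 (w, a, 0), q.2.2 = 0 → F q = 0) :
    ∃ F₁ : Flat k → ℂ, Ana F₁ (w, a, 0) ∧
      ∀ᶠ q : Flat k in 𝓝 (w, a, 0), F q = q.2.2 * F₁ q := by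
  let e : ((Fin k → ℂ) × ℂ) × ℂ → Flat k := fun q => (q.1.1, q.1.2, q.2)
  let e' : Flat k → ((Fin k → ℂ) × ℂ) × ℂ := fun q => ((q.1, q.2.1), q.2.2)
  have he : Ana e ((w, a), 0) := by fun_prop
  have he' : Ana e' (w, a, 0) := by fun_prop
  obtain ⟨F₁, h1, h2⟩ := exists_eq_mul_of_analyticAt (F := F ∘ e) (e := (w, a))
    (AnalyticAt.comp (g := F) (f := e) hF he) (by
      have ht : Tendsto (fun y : (Fin k → ℂ) × ℂ => e (y, 0)) (𝓝 (w, a)) (𝓝 (w, a, 0)) :=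
        Continuous.tendsto' (by fun_prop) _ _ rfl
      exact (ht.eventually h0).mono fun y hy => hy rfl)
  refine ⟨F₁ ∘ e', AnalyticAt.comp (g := F₁) (f := e') h1 he', ?_⟩
  exact (he'.continuousAt.tendsto.eventually h2).mono fun q hq => hq

lemma exists_eq_mul_fst {k : ℕ} {F : Flat k → ℂ} {w : Fin k → ℂ} {b : ℂ}
    (hF : Ana F (w, 0, b))
    (h0 : ∀ᶠ q : Flat k in 𝓝 (w, 0, b), q.2.1 = 0 → F q = 0) :
    ∃ F₁ : Flat k → ℂ, Ana F₁ (w, 0, b) ∧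
      ∀ᶠ q : Flat k in 𝓝 (w, 0, b), F q = q.2.1 * F₁ q := by
  let e : Flat k → Flat k := fun q => (q.1, q.2.2, q.2.1)
  have he : ∀ q, Ana e q := fun q => by fun_prop
  have ht : ∀ x y : ℂ, Tendsto e (𝓝 (w, x, y)) (𝓝 (w, y, x)) := fun x y =>
    (he (w, x, y)).continuousAt.tendsto
  obtain ⟨F₁, h1, h2⟩ := exists_eq_mul_snd (F := F ∘ e) (w := w) (a := b)
    (AnalyticAt.comp (g := F) (f := e) (x := (w, b, 0)) hF (he _)) ((ht _ _).eventually h0)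
  exact ⟨F₁ ∘ e, AnalyticAt.comp (g := F₁) (f := e) (x := (w, 0, b)) h1 (he _),
    ((ht _ _).eventually h2).mono fun q hq => hq⟩

lemma IsBihol.mem_coord {k : ℕ} {θ : OPH Z (Flat k)} (h : IsBihol θ)
    (hp : p ∈ θ.source) : (fun y => (θ y).2.1) ∈ 𝒪 p ∧ (fun y => (θ y).2.2) ∈ 𝒪 p :=
  ⟨(h p hp fun q => q.2.1).1 (by fun_prop : Ana (fun q : Flat k => q.2.1) _),
    (h p hp fun q => q.2.2).1 (by fun_prop : Ana (fun q : Flat k => q.2.2) _)⟩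

end Normal

section ChartChange

variable {n k : ℕ} {Y Z : Type u} [TopologicalSpace Y] [HolSpace Y] [TopologicalSpace Z]
  [HolSpace Z] {a b : AChart n k Y} {ρ : HolMap Z Y} {θ θ' : ℕ → OPH Z (Flat k)}

lemma zfun_mem {p : Z} (hp : ρ p ∈ b.ψ.source) : zfun b ρ.toFun ∈ 𝒪 p :=
  ρ.hol p (fun y => (b.ψ y).1.2.2.2) (b.bihol.comp_mem hp (F := fun q => q.2.2.2) (by fun_prop))

lemma zfun_eq_zero {p : Z} (hp : ρ p ∈ b.ψ.source) (hS : ρ p ∈ Sing k Y) :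
    zfun b ρ.toFun p = 0 := by
  have := (b.core _ hp).1 hS
  exact congrArg (fun t : ℂ × ℂ × ℂ => t.2.2) this

lemma IsToricCover.zfun_eq (hθ : IsToricCover a.ψ ρ.toFun θ) {i : ℕ} (hi : i ≤ n) {p : Z}
    (hp : p ∈ (θ i).source) : zfun a ρ.toFun p = (θ i p).2.1 * (θ i p).2.2 := by
  rw [zfun, (hθ.chart i hi).comm p hp, tor_coe hi]

/-- The factor by which an arrow acts on the line bundle `K`. -/
def normalJ (n : ℕ) (D : Matrix (Fin 2) (Fin 2) ℂ) : ℂ := if n = 1 then D.det else D 0 0 * D 1 1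

lemma dense_linear_ne {p q : ℂ} (h : p ≠ 0 ∨ q ≠ 0) :
    Dense {v : ℂ × ℂ | p * v.1 + q * v.2 ≠ 0} := by
  set L : ℂ × ℂ →ₗ[ℂ] ℂ := p • LinearMap.fst ℂ ℂ ℂ + q • LinearMap.snd ℂ ℂ ℂ with hL
  have : {v : ℂ × ℂ | p * v.1 + q * v.2 ≠ 0} = (LinearMap.ker L : Set (ℂ × ℂ))ᶜ := by
    ext v; simp [hL]
  rw [this, ← interior_eq_empty_iff_dense_compl, ← not_nonempty_iff_eq_empty]
  intro hi
  have htop := Submodule.eq_top_of_nonempty_interior' _ hi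
  have h1 : ((1, 0) : ℂ × ℂ) ∈ LinearMap.ker L := htop ▸ trivial
  have h2 : ((0, 1) : ℂ × ℂ) ∈ LinearMap.ker L := htop ▸ trivial
  simp [hL] at h1 h2
  exact h.elim (· h1) (· h2)

/-- The change of charts on the exceptional fibre over a point and its effect on normal vectors. -/
theorem exists_chart_change [T2Space Z] (hn : 1 ≤ n) (hθ : IsToricCover a.ψ ρ.toFun θ)
    (hθ' : IsToricCover b.ψ ρ.toFun θ') {w w' : Fin k → ℂ} {φ : Flat k → Flat k}
    (h : IsArrow a b (w, 0, 0) φ) (hw' : φ (w, 0, 0) = (w', 0, 0))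
    (heq : ∀ ζ : ℂ, ζ ^ (n + 1) = 1 → ∀ᶠ x in 𝓝 ((w, 0, 0) : Flat k),
      φ (rootAct ζ x) = rootAct ζ (φ x)) :
    ∃ α δ η ε : ℂ, normalJ n (normalDeriv φ (w, 0, 0)) = α * δ - 0 ^ (n - 1) * (η * ε) ∧
      (n ≠ 1 → α ≠ 0 ∧ δ ≠ 0) ∧ α * δ - 0 ^ (n - 1) * (η * ε) ≠ 0 ∧
      (∀ l j, n = l + 1 + j → ∀ x y : ℂ, (x ≠ 0 ∨ y ≠ 0) →
        (α ^ (j + 1) * x + 0 ^ j * η * y ≠ 0 ∨ 0 ^ l * ε * x + δ ^ (l + 1) * y ≠ 0) ∧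
        pt θ (l + 1) (w, x, y) = pt θ' (l + 1)
          (w', α ^ (j + 1) * x + 0 ^ j * η * y, 0 ^ l * ε * x + δ ^ (l + 1) * y)) ∧
      ∀ l j, n = l + 1 + j → ∀ x : ℂ, x ≠ 0 → α + 0 ^ j * η / x ≠ 0 → δ + 0 ^ l * ε * x ≠ 0 →
        ∀ A : Set Z, (∀ p ∈ A, ρ p ∈ Sing k Y) →
        (∀ᶠ p in 𝓝 (pt θ (l + 1) (w, x, 1)), (θ (l + 1) p).2.2 = 0 → p ∈ A) →
        ∀ c ∈ normalFib A (pt θ (l + 1) (w, x, 1)), c (zfun b ρ.toFun) =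
          (α + 0 ^ j * η / x) * (δ + 0 ^ l * ε * x) * c (zfun a ρ.toFun) := by
  obtain ⟨F, G, η, ε, hF, hG, hη, hε, hD, hform⟩ := h.local_form hn heq
  have hdet := h.det_ne_zero
  have hwt : corePt n w ∈ a.ψ.target := by
    have := h.source
    rwa [AChart.dom, mem_preimage, quotMap_core] at this
  have hwt' : corePt n w' ∈ b.ψ.target := by
    have := h.target
    rwa [hw', AChart.dom, mem_preimage, quotMap_core] at this
  have hJ : normalJ n (normalDeriv φ (w, 0, 0)) = F 0 * G 0 - 0 ^ (n - 1) * (η 0 * ε 0) := by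
    rw [normalJ, hD]
    by_cases h1 : n = 1
    · simp [h1, Matrix.det_fin_two]
    · have : n - 1 ≠ 0 := by omega
      simp [h1, this]
  have hJ0 : F 0 * G 0 - 0 ^ (n - 1) * (η 0 * ε 0) ≠ 0 := by
    rw [hD, Matrix.det_fin_two] at hdet
    by_cases h1 : n = 1
    · simpa [h1] using hdet
    · have : n - 1 ≠ 0 := by omega
      simpa [this] using hdet
  have hFG : n ≠ 1 → F 0 ≠ 0 ∧ G 0 ≠ 0 := by
    intro h1
    have : n - 1 ≠ 0 := by omega
    simpa [this] using hJ0
  have hXp : ∀ (j : ℕ) (x : ℂ), x ≠ 0 → (F 0 + 0 ^ j * η 0 / x) ^ (j + 1) * x =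
      F 0 ^ (j + 1) * x + 0 ^ j * η 0 := by
    intro j x hx
    rcases j with _ | j
    · simp only [pow_zero, one_mul, zero_add, pow_one]
      field_simp
    · simp
  have hWp : ∀ (l : ℕ) (x : ℂ), (G 0 + 0 ^ l * ε 0 * x) ^ (l + 1) =
      0 ^ l * ε 0 * x + G 0 ^ (l + 1) := by
    intro l x
    rcases l with _ | l
    · simp [add_comm]
    · simp
  have hD0 : ∀ l j, n = l + 1 + j →
      F 0 ^ (j + 1) * G 0 ^ (l + 1) - 0 ^ j * η 0 * (0 ^ l * ε 0) ≠ 0 := by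
    intro l j hl
    by_cases h1 : n = 1
    · obtain ⟨rfl, rfl⟩ : l = 0 ∧ j = 0 := by omega
      simpa [h1] using hJ0
    · have h0 : (0 : ℂ) ^ j * 0 ^ l = 0 := by rw [← pow_add, zero_pow (by omega)]
      rw [mul_mul_mul_comm, h0, zero_mul, sub_zero]
      exact mul_ne_zero (pow_ne_zero _ (hFG h1).1) (pow_ne_zero _ (hFG h1).2)
  have hMne : ∀ l j, n = l + 1 + j → ∀ x y : ℂ, (x ≠ 0 ∨ y ≠ 0) →
      (F 0 ^ (j + 1) * x + 0 ^ j * η 0 * y ≠ 0 ∨ 0 ^ l * ε 0 * x + G 0 ^ (l + 1) * y ≠ 0) := by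
    intro l j hl x y hxy
    by_contra! hcon
    obtain ⟨e1, e2⟩ := hcon
    exact hxy.elim
      (· ((mul_eq_zero.1 (show _ * x = 0 by
        linear_combination G 0 ^ (l + 1) * e1 - 0 ^ j * η 0 * e2)).resolve_left (hD0 l j hl)))
      (· ((mul_eq_zero.1 (show _ * y = 0 by
        linear_combination F 0 ^ (j + 1) * e2 - 0 ^ l * ε 0 * e1)).resolve_left (hD0 l j hl)))
  refine ⟨F 0, G 0, η 0, ε 0, hJ, hFG, hJ0, fun l j hl x y hxy => ⟨hMne l j hl x y hxy, ?_⟩, ?_⟩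
  · -- the general points are dense
    have hgen : ∀ v : ℂ × ℂ, v.1 ≠ 0 → v.2 ≠ 0 → F 0 ^ (j + 1) * v.1 + 0 ^ j * η 0 * v.2 ≠ 0 →
        0 ^ l * ε 0 * v.1 + G 0 ^ (l + 1) * v.2 ≠ 0 →
        pt θ (l + 1) (w, v) = pt θ' (l + 1) (w', F 0 ^ (j + 1) * v.1 + 0 ^ j * η 0 * v.2,
          0 ^ l * ε 0 * v.1 + G 0 ^ (l + 1) * v.2) := by
      rintro ⟨x, y⟩ hx hy hX hW
      simp only at hx hy hX hW ⊢
      have hxy0 : x / y ≠ 0 := div_ne_zero hx hy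
      obtain ⟨A, hA⟩ := IsAlgClosed.exists_pow_nat_eq (x / y) (Nat.succ_pos n)
      have hA0 : A ≠ 0 := by
        rintro rfl
        rw [zero_pow (Nat.succ_ne_zero n)] at hA
        exact hxy0 hA.symm
      have e1 : F 0 ^ (j + 1) * x + 0 ^ j * η 0 * y =
          y * ((F 0 + 0 ^ j * η 0 / (x / y)) ^ (j + 1) * (x / y)) := by
        rw [hXp j _ hxy0]
        field_simp
      have e2 : 0 ^ l * ε 0 * x + G 0 ^ (l + 1) * y =
          y * (G 0 + 0 ^ l * ε 0 * (x / y)) ^ (l + 1) := by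
        rw [hWp]
        field_simp
      rw [e1] at hX
      rw [e2] at hW
      have hX' : F 0 + 0 ^ j * η 0 / (x / y) ≠ 0 := fun h0 => hX (by rw [h0]; simp)
      have hW' : G 0 + 0 ^ l * ε 0 * (x / y) ≠ 0 := fun h0 => hW (by rw [h0]; simp)
      have hcv := (chart_change_curve hθ hθ' h hw' hF hG hη hε hform hl hA0
        (by rw [hA]; exact hX') (by rw [hA]; exact hW')).1
      rw [hA] at hcv
      have e3 : pt θ (l + 1) (w, x, y) = pt θ (l + 1) (w, x / y, 1) := by
        rw [← pt_smul hy (x := x / y) (y := 1), mul_one, mul_div_cancel₀ _ hy]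
      rw [e3, hcv, e1, e2, pt_smul hy]
    have hx0 : F 0 ^ (j + 1) ≠ 0 ∨ (0 : ℂ) ^ j * η 0 ≠ 0 := by
      by_contra! h
      exact hD0 l j hl (by rw [h.1, h.2]; ring)
    have hy0 : (0 : ℂ) ^ l * ε 0 ≠ 0 ∨ G 0 ^ (l + 1) ≠ 0 := by
      by_contra! h
      exact hD0 l j hl (by rw [h.1, h.2]; ring)
    have op : ∀ p q : ℂ, IsOpen {v : ℂ × ℂ | p * v.1 + q * v.2 ≠ 0} := fun p q =>
      isOpen_ne_fun (by fun_prop) continuous_const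
    have hdense := (((dense_linear_ne (p := 1) (q := 0) (by simp)).inter_of_isOpen_right
      (dense_linear_ne (p := 0) (q := 1) (by simp)) (op _ _)).inter_of_isOpen_right
      (dense_linear_ne hx0) (op _ _)).inter_of_isOpen_right
      (dense_linear_ne hy0) (op _ _)
    have hmem := hdense (x, y)
    rw [mem_closure_iff_nhdsWithin_neBot] at hmem
    have hv : ((x, y) : ℂ × ℂ) ≠ 0 := fun h0 =>
      hxy.elim (· (congrArg Prod.fst h0)) (· (congrArg Prod.snd h0))
    have hMv : ((F 0 ^ (j + 1) * x + 0 ^ j * η 0 * y, 0 ^ l * ε 0 * x + G 0 ^ (l + 1) * y) : ℂ × ℂ)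
        ≠ 0 := fun h0 => (hMne l j hl x y hxy).elim (· (congrArg Prod.fst h0))
          (· (congrArg Prod.snd h0))
    have t1 : Tendsto (fun v : ℂ × ℂ => pt θ (l + 1) (w, v)) (𝓝 (x, y))
        (𝓝 (pt θ (l + 1) (w, x, y))) :=
      (hθ.continuousAt_pt (Nat.le_add_left 1 l) (by omega) (q := (w, x, y)) hwt hv).tendsto.comp
        (Continuous.tendsto' (by fun_prop) _ _ rfl)
    have t2 : Tendsto (fun v : ℂ × ℂ => pt θ' (l + 1) (w', F 0 ^ (j + 1) * v.1 + 0 ^ j * η 0 * v.2,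
        0 ^ l * ε 0 * v.1 + G 0 ^ (l + 1) * v.2)) (𝓝 (x, y)) (𝓝 (pt θ' (l + 1) (w',
          F 0 ^ (j + 1) * x + 0 ^ j * η 0 * y, 0 ^ l * ε 0 * x + G 0 ^ (l + 1) * y))) :=
      (hθ'.continuousAt_pt (Nat.le_add_left 1 l) (by omega) (q := (w', F 0 ^ (j + 1) * x +
        0 ^ j * η 0 * y, 0 ^ l * ε 0 * x + G 0 ^ (l + 1) * y)) hwt' hMv).tendsto.comp
        (Continuous.tendsto' (by fun_prop) _ _ rfl)
    refine @tendsto_nhds_unique _ _ _ _ _ _ _ _ hmem (t1.mono_left nhdsWithin_le_nhds)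
      ((t2.mono_left nhdsWithin_le_nhds).congr' ?_)
    filter_upwards [self_mem_nhdsWithin] with v hv'
    obtain ⟨⟨⟨v1, v2⟩, v3⟩, v4⟩ := hv'
    exact (hgen v (by simpa using v1) (by simpa using v2) v3 v4).symm
  · intro l j hl x hx hX hW A hAS hA c hc
    have hln : l + 1 ≤ n := by omega
    obtain ⟨R, hR⟩ := IsAlgClosed.exists_pow_nat_eq x (Nat.succ_pos n)
    have hR0 : R ≠ 0 := by
      rintro rfl
      rw [zero_pow (Nat.succ_ne_zero n)] at hR
      exact hx hR.symm
    have hcv := (chart_change_curve hθ hθ' h hw' hF hG hη hε hform hl hR0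
      (by rw [hR]; exact hX) (by rw [hR]; exact hW)).2
    rw [hR] at hcv
    set p := pt θ (l + 1) (w, x, 1) with hp
    obtain ⟨m1, m2⟩ := hθ.pt_mem_right (Nat.le_add_left 1 l) hln hwt one_ne_zero (x := x)
    rw [div_one, ← hp] at m2
    rw [← hp] at m1
    have hps : ρ p ∈ a.ψ.source := (hθ.chart _ hln).maps p m1
    have hpS : ρ p ∈ Sing k Y := by
      rw [a.core _ hps, (hθ.chart _ hln).comm p m1, m2, tor_a (Nat.le_add_left 1 l) hln]
      rfl
    have hpb : ρ p ∈ b.ψ.source := by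
      have e1 : ρ p = a.χ (w, 0, 0) := by
        rw [AChart.χ, quotMap_core, ← tor_a (Nat.le_add_left 1 l) hln w x, ← m2,
          ← (hθ.chart _ hln).comm p m1, a.ψ.left_inv hps]
      rw [e1, ← h.comm.self_of_nhds]
      exact b.χ_mem h.target
    obtain ⟨hα, hβ⟩ := (hθ.chart _ hln).bihol.mem_coord m1
    have hβI : MemIdeal A p (fun y => (θ (l + 1) y).2.2) := by
      refine ⟨hβ, ?_⟩
      have hev : ∀ᶠ y in 𝓝 p, (θ (l + 1) y).2.1 ≠ 0 :=
        ((θ (l + 1)).continuousAt m1).snd.fst.eventually_ne (by rw [m2]; exact hx)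
      filter_upwards [(θ (l + 1)).open_source.mem_nhds m1, hev] with y h1 h2 h3
      have h4 := zfun_eq_zero ((hθ.chart _ hln).maps y h1) (hAS y h3)
      rw [hθ.zfun_eq hln h1] at h4
      exact (mul_eq_zero.1 h4).resolve_left h2
    have hza : c (zfun a ρ.toFun) = x * c (fun y => (θ (l + 1) y).2.2) := by
      have := normalFib_mul hc hα hβI (g := zfun a ρ.toFun) (by
        filter_upwards [(θ (l + 1)).open_source.mem_nhds m1] with y hy
        exact hθ.zfun_eq hln hy)
      rwa [m2] at this
    have hsymm : Tendsto (θ (l + 1)).symm (𝓝 (w, x, 0)) (𝓝 p) := by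
      rw [← m2]; exact (θ (l + 1)).tendsto_symm m1
    have hzb : Ana (zfun b ρ.toFun ∘ (θ (l + 1)).symm) (w, x, 0) := by
      have h1 := ((hθ.chart _ hln).bihol.mem_symm ((θ (l + 1)).map_source m1)
        (f := zfun b ρ.toFun)).1 (by rw [(θ (l + 1)).left_inv m1]; exact zfun_mem hpb)
      rwa [m2] at h1
    have mt : ((w, x, 0) : Flat k) ∈ (θ (l + 1)).target := m2 ▸ (θ (l + 1)).map_source m1
    obtain ⟨ξ, hξ, hξe⟩ := exists_eq_mul_snd hzb (by
      have hb : ∀ᶠ y in 𝓝 p, ρ y ∈ b.ψ.source :=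
        ρ.continuous_toFun.continuousAt.eventually (b.ψ.open_source.mem_nhds hpb)
      filter_upwards [hsymm.eventually hA, hsymm.eventually hb,
        (θ (l + 1)).open_target.mem_nhds mt] with q h1 h2 h3 h4
      rw [(θ (l + 1)).right_inv h3] at h1
      exact zfun_eq_zero h2 (hAS _ (h1 h4)))
    have hξm : (fun y => ξ (θ (l + 1) y)) ∈ 𝒪 p :=
      ((hθ.chart _ hln).bihol p m1 ξ).1 (by
        change Ana _ _
        rw [m2]; exact hξ)
    have hzb' : c (zfun b ρ.toFun) = ξ (w, x, 0) * c (fun y => (θ (l + 1) y).2.2) := by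
      have := normalFib_mul hc hξm hβI (g := zfun b ρ.toFun) (by
        have ht : Tendsto (θ (l + 1)) (𝓝 p) (𝓝 (w, x, 0)) := by
          rw [← m2]; exact ((θ (l + 1)).continuousAt m1).tendsto
        filter_upwards [ht.eventually hξe, (θ (l + 1)).open_source.mem_nhds m1] with y h1 h2
        rw [Function.comp_apply, (θ (l + 1)).left_inv h2] at h1
        rw [h1, mul_comm])
      rwa [m2] at this
    have tT : Tendsto (fun T : ℂ => ((w, x, T ^ (n + 1)) : Flat k)) (𝓝[≠] 0) (𝓝 (w, x, 0)) :=
      (Continuous.tendsto' (by fun_prop) _ _ (by simp)).mono_left nhdsWithin_le_nhds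
    have hlim : Tendsto (fun T : ℂ => ξ (w, x, T ^ (n + 1))) (𝓝[≠] 0) (𝓝 (ξ (w, x, 0))) :=
      hξ.continuousAt.tendsto.comp tT
    have hval := tendsto_nhds_unique hlim (hcv.congr' (by
      filter_upwards [tT.eventually hξe, self_mem_nhdsWithin] with T h1 h2
      have : T ^ (n + 1) ≠ 0 := pow_ne_zero _ h2
      rw [Function.comp_apply] at h1
      rw [h1]
      rw [mul_div_cancel_left₀ _ this]))
    rw [hza, hzb', hval]
    ring

end ChartChange

/-! ### The irreducible components of the exceptional divisor -/

section Components

variable {Y Z : Type u} [TopologicalSpace Y] [HolSpace Y] [TopologicalSpace Z] [HolSpace Z]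
  {n k : ℕ}

/-- A subset that is a coordinate hyperplane in a chart is regular. -/
lemma smoothAt_of_slice {θ : OPH Z (Flat k)} (hb : IsBihol θ) {A : Set Z} {p : Z}
    (hp : p ∈ θ.source) (hpA : p ∈ A) (h : ∀ᶠ q in 𝓝 p, q ∈ A ↔ (θ q).2.2 = 0) :
    SmoothAt (k + 1) (⟨p, hpA⟩ : A) := by
  obtain ⟨V, hV, hVo, hpV⟩ := eventually_nhds_iff.1 h
  have hmem : ∀ v : (Fin k → ℂ) × ℂ, ((v.1, v.2, 0) : Flat k) ∈ θ.target →
      θ.symm (v.1, v.2, 0) ∈ V → θ.symm (v.1, v.2, 0) ∈ A := fun v hv hv' => by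
    rw [hV _ hv', θ.right_inv hv]
  have hval : ∀ q : A, (q : Z) ∈ θ.source → (q : Z) ∈ V →
      ((θ q).1, (θ q).2.1, (0 : ℂ)) = θ q := fun q _ hq =>
    Prod.ext rfl (Prod.ext rfl ((hV _ hq).1 q.2).symm)
  have hc : Continuous fun v : (Fin k → ℂ) × ℂ => ((v.1, v.2, 0) : Flat k) := by fun_prop
  classical
  let T : Set ((Fin k → ℂ) × ℂ) :=
    (fun v : (Fin k → ℂ) × ℂ => ((v.1, v.2, 0) : Flat k)) ⁻¹' (θ.symm.source ∩ θ.symm ⁻¹' V)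
  let ψ : OPH A ((Fin k → ℂ) × ℂ) :=
    { toFun := fun q => ((θ q).1, (θ q).2.1)
      invFun := fun v => if h : θ.symm (v.1, v.2, 0) ∈ A then ⟨_, h⟩ else ⟨p, hpA⟩
      source := Subtype.val ⁻¹' (θ.source ∩ V)
      target := T
      map_source' := by
        rintro q ⟨h1, h2⟩
        change ((θ q).1, (θ q).2.1, (0 : ℂ)) ∈ θ.symm.source ∩ θ.symm ⁻¹' V
        rw [hval q h1 h2]
        refine ⟨θ.map_source h1, ?_⟩
        rw [mem_preimage, θ.left_inv h1]
        exact h2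
      map_target' := by
        rintro v ⟨h1, h2⟩
        rw [dif_pos (hmem v h1 h2)]
        exact ⟨θ.map_target h1, h2⟩
      left_inv' := by
        rintro q ⟨h1, h2⟩
        have e : θ.symm ((θ q).1, (θ q).2.1, 0) = q := by rw [hval q h1 h2, θ.left_inv h1]
        simp only
        rw [dif_pos (by rw [e]; exact q.2)]
        exact Subtype.ext e
      right_inv' := by
        rintro v ⟨h1, h2⟩
        rw [dif_pos (hmem v h1 h2)]
        simp only
        rw [θ.right_inv h1]
      open_source := (θ.open_source.inter hVo).preimage continuous_subtype_val
      open_target := (θ.symm.isOpen_inter_preimage hVo).preimage hc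
      continuousOn_toFun := by
        intro q hq
        have h1 : ContinuousAt (fun q : A => θ q) q :=
          ContinuousAt.comp (g := θ) (θ.continuousAt hq.1) continuous_subtype_val.continuousAt
        exact (h1.fst.prodMk h1.snd.fst).continuousWithinAt
      continuousOn_invFun := by
        rw [continuousOn_iff_continuous_domRestrict, continuous_induced_rng]
        have h1 : ContinuousOn (fun v : (Fin k → ℂ) × ℂ => θ.symm (v.1, v.2, 0)) T :=
          θ.symm.continuousOn.comp hc.continuousOn fun v hv => hv.1
        rw [continuousOn_iff_continuous_domRestrict] at h1
        refine h1.congr fun v => ?_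
        simp only [Function.comp_apply, Set.domRestrict_apply]
        rw [dif_pos (hmem v v.2.1 v.2.2)] }
  have hψ : IsBihol ψ := by
    refine isBihol_of (fun q hq f hf => ?_) fun q hq f hf => ?_
    · have h1 : Ana (fun v : Flat k => f (v.1, v.2.1)) (θ q) :=
        AnalyticAt.comp (g := f) (f := fun v : Flat k => (v.1, v.2.1)) hf (by fun_prop)
      exact ⟨fun z => f ((θ z).1, (θ z).2.1), (hb q hq.1 _).1 h1, Eventually.of_forall fun _ => rfl⟩
    · obtain ⟨F, hF, he⟩ := hf
      have hv : ψ q ∈ ψ.target := ψ.map_source hq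
      have e : (((ψ q).1, (ψ q).2, 0) : Flat k) = θ q := hval q hq.1 hq.2
      have h1 : Ana (F ∘ θ.symm) (θ q) :=
        (hb.mem_symm (θ.map_source hq.1)).1 (by rw [θ.left_inv hq.1]; exact hF)
      have h2 : Ana (fun v : (Fin k → ℂ) × ℂ => F (θ.symm (v.1, v.2, 0))) (ψ q) :=
        AnalyticAt.comp (g := F ∘ θ.symm) (f := fun v : (Fin k → ℂ) × ℂ => ((v.1, v.2, 0) : Flat k))
          (by rw [e]; exact h1) (by fun_prop)
      refine AnalyticAt.congr h2 ?_
      filter_upwards [(ψ.tendsto_symm hq).eventually he, ψ.open_target.mem_nhds hv] with v hv1 hv2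
      rw [Function.comp_apply, hv1]
      change _ = F (Subtype.val (dite _ _ _))
      rw [dif_pos (hmem v hv2.1 hv2.2)]
  have hfin : Module.finrank ℂ ((Fin k → ℂ) × ℂ) = Module.finrank ℂ (Fin (k + 1) → ℂ) := by simp
  exact ⟨_, by simpa using ⟨hp, hpV⟩,
    hψ.trans (isBihol_continuousLinearEquiv (ContinuousLinearEquiv.ofFinrankEq hfin))⟩

/-- A set over a connected base that is locally over the base preconnected and surjective. -/
lemma isPreconnected_of_fibration {S : Set Y} (hS : IsPreconnected S) {R : Set Z} (f : Z → Y)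
    (hf : ∀ p ∈ R, f p ∈ S) (h : ∀ s ∈ S, ∃ V : Set Y, IsOpen V ∧ s ∈ V ∧
      IsPreconnected (R ∩ f ⁻¹' V) ∧ ∀ t ∈ V ∩ S, ∃ p ∈ R, f p = t) : IsPreconnected R := by
  rintro U U' hU hU' hR ⟨p, hp, hpU⟩ ⟨p', hp', hpU'⟩
  by_contra hne
  have key : ∀ U U' : Set Z, IsOpen U → IsOpen U' → R ⊆ U ∪ U' → ¬ (R ∩ (U ∩ U')).Nonempty →
      ∃ W : Set Y, IsOpen W ∧ W ∩ S = f '' (R ∩ U) := by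
    intro U U' hU hU' hR hne
    refine ⟨⋃ V ∈ {V : Set Y | IsOpen V ∧ V ∩ S ⊆ f '' (R ∩ U)}, V,
      isOpen_biUnion fun V hV => hV.1, ?_⟩
    refine Subset.antisymm ?_ ?_
    · rintro t ⟨ht, htS⟩
      obtain ⟨V, hV, htV⟩ := mem_iUnion₂.1 ht
      exact hV.2 ⟨htV, htS⟩
    · rintro _ ⟨q, hq, rfl⟩
      refine ⟨?_, hf q hq.1⟩
      obtain ⟨V, hV, hqV, hpre, hsurj⟩ := h (f q) (hf q hq.1)
      refine mem_biUnion ⟨hV, ?_⟩ hqV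
      rintro t ⟨htV, htS⟩
      obtain ⟨r, hr, rfl⟩ := hsurj t ⟨htV, htS⟩
      refine ⟨r, ⟨hr, ?_⟩, rfl⟩
      by_contra hrU
      obtain ⟨z, hz1, hz2⟩ := hpre U U' hU hU' (inter_subset_left.trans hR) ⟨q, ⟨hq.1, hqV⟩, hq.2⟩
        ⟨r, ⟨hr, htV⟩, (hR hr).resolve_left hrU⟩
      exact hne ⟨z, hz1.1, hz2⟩
  obtain ⟨W, hW, hWe⟩ := key U U' hU hU' hR hne
  obtain ⟨W', hW', hWe'⟩ := key U' U hU' hU (by rwa [union_comm]) (by rwa [inter_comm U'])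
  have hfp := hWe.ge ⟨p, ⟨hp, hpU⟩, rfl⟩
  have hfp' := hWe'.ge ⟨p', ⟨hp', hpU'⟩, rfl⟩
  obtain ⟨s, hsS, hsW⟩ := hS W W' hW hW' (by
    intro t ht
    obtain ⟨V, hV, htV, -, hsurj⟩ := h t ht
    obtain ⟨r, hr, rfl⟩ := hsurj t ⟨htV, ht⟩
    exact (hR hr).imp (fun h1 => (hWe.ge ⟨r, ⟨hr, h1⟩, rfl⟩).1)
      fun h1 => (hWe'.ge ⟨r, ⟨hr, h1⟩, rfl⟩).1) ⟨f p, hfp.2, hfp.1⟩ ⟨f p', hfp'.2, hfp'.1⟩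
  obtain ⟨q, hq, rfl⟩ := hWe.le ⟨hsW.1, hsS⟩
  obtain ⟨q', hq', he⟩ := hWe'.le ⟨hsW.2, hsS⟩
  obtain ⟨V, hV, hqV, hpre, -⟩ := h (f q) hsS
  obtain ⟨z, hz1, hz2⟩ := hpre U U' hU hU' (inter_subset_left.trans hR) ⟨q, ⟨hq.1, hqV⟩, hq.2⟩
    ⟨q', ⟨hq'.1, by rw [mem_preimage, he]; exact hqV⟩, hq'.2⟩
  exact hne ⟨z, hz1.1, hz2⟩

/-- Toric charts over all charts in `𝒜` that meet the singular locus, with compatible numberings of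
the exceptional curves. -/
structure IsToricAtlas (ρ : HolMap Z Y) (𝒜 : Set (AChart n k Y))
    (Θ : AChart n k Y → ℕ → OPH Z (Flat k)) : Prop where
  cover : ∀ y ∈ Sing k Y, ∃ a ∈ 𝒜, y ∈ a.ψ.source
  toric : ∀ a ∈ 𝒜, ∀ y ∈ Sing k Y, y ∈ a.ψ.source →
    IsToricCover a.ψ ρ.toFun (Θ a)
  change : ∀ a ∈ 𝒜, ∀ b ∈ 𝒜, ∀ y ∈ Sing k Y, y ∈ a.ψ.source → y ∈ b.ψ.source →
    ∀ l, 1 ≤ l → l ≤ n → ∀ v : ℂ × ℂ, v ≠ 0 →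
      ∃ v' : ℂ × ℂ, v' ≠ 0 ∧ pt (Θ a) l ((a.ψ y).1.1, v) = pt (Θ b) l ((b.ψ y).1.1, v')

/-- The exceptional component with number `l`. -/
def toricComp (ρ : HolMap Z Y) (𝒜 : Set (AChart n k Y))
    (Θ : AChart n k Y → ℕ → OPH Z (Flat k)) (l : ℕ) : Set Z :=
  {p | ρ p ∈ Sing k Y ∧ ∃ a ∈ 𝒜, ρ p ∈ a.ψ.source ∧
    ∃ v : ℂ × ℂ, v ≠ 0 ∧ p = pt (Θ a) l ((a.ψ (ρ p)).1.1, v)}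

lemma AChart.corePt_mem {a : AChart n k Y} {t : Y} (ht : t ∈ a.ψ.source)
    (hS : t ∈ Sing k Y) : corePt n (a.ψ t).1.1 ∈ a.ψ.target := by
  rw [AChart.corePt_eq ht hS]
  exact a.ψ.map_source ht

lemma AChart.symm_corePt_mem (a : AChart n k Y) {w : Fin k → ℂ} (hw : corePt n w ∈ a.ψ.target) :
    a.ψ.symm (corePt n w) ∈ Sing k Y := by
  rw [a.core _ (a.ψ.map_target hw), a.ψ.right_inv hw]
  rfl

namespace IsToricAtlas

variable [T2Space Z] {ρ : HolMap Z Y} {𝒜 : Set (AChart n k Y)}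
  {Θ : AChart n k Y → ℕ → OPH Z (Flat k)} (h : IsToricAtlas ρ 𝒜 Θ)
include h

lemma exists_of_mem {l : ℕ} (h1 : 1 ≤ l) (hl : l ≤ n) {p : Z} (hp : p ∈ toricComp ρ 𝒜 Θ l)
    {a : AChart n k Y} (ha : a ∈ 𝒜) (hpa : ρ p ∈ a.ψ.source) :
    ∃ v : ℂ × ℂ, v ≠ 0 ∧ p = pt (Θ a) l ((a.ψ (ρ p)).1.1, v) := by
  obtain ⟨hS, b, hb, hpb, v, hv, he⟩ := hp
  obtain ⟨v', hv', he'⟩ := h.change b hb a ha (ρ p) hS hpb hpa l h1 hl v hv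
  exact ⟨v', hv', he.trans he'⟩

lemma pt_mem {l : ℕ} (h1 : 1 ≤ l) (hl : l ≤ n) {a : AChart n k Y} (ha : a ∈ 𝒜) {w : Fin k → ℂ}
    (hw : corePt n w ∈ a.ψ.target) {v : ℂ × ℂ} (hv : v ≠ 0) :
    pt (Θ a) l (w, v) ∈ toricComp ρ 𝒜 Θ l := by
  have hS := a.symm_corePt_mem hw
  have hT := h.toric a ha _ hS (a.ψ.map_target hw)
  obtain ⟨m1, m2⟩ := hT.map_pt h1 hl (q := (w, v)) hw hv
  refine ⟨(a.core _ m1).2 (by rw [m2]; rfl), a, ha, m1, v, hv, ?_⟩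
  rw [m2]
  rfl

lemma mem_comp_iff {l : ℕ} (h1 : 1 ≤ l) (hl : l ≤ n) {a : AChart n k Y} (ha : a ∈ 𝒜) {p : Z}
    (hS : ρ p ∈ Sing k Y) (hpa : ρ p ∈ a.ψ.source) {i : ℕ} (hi : i ≤ n)
    (hp : p ∈ (Θ a i).source) : p ∈ toricComp ρ 𝒜 Θ l ↔
      (i + 1 = l ∧ (Θ a i p).2.1 = 0) ∨ (i = l ∧ (Θ a i p).2.2 = 0) := by
  have hT := h.toric a ha _ hS hpa
  have hw := AChart.corePt_mem hpa hS
  have h0 := (a.core _ hpa).1 hS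
  have hcase := hT.exists_pt (h1.trans hl) hi hp h0
  constructor
  · intro hm
    obtain ⟨v, hv, he⟩ := h.exists_of_mem h1 hl hm ha hpa
    rcases hcase with ⟨c1, c2, c3⟩ | ⟨c1, c2, c3⟩
    · have e := he.symm.trans c3
      rcases le_total l (i + 1) with hle | hle
      · rcases (hT.pt_eq_pt h1 hle (by omega) hw hw hv (by simp) e).2 with h2 | h2
        · exact Or.inl ⟨h2.1.symm, c1⟩
        · exact Or.inr ⟨by omega, h2.2.2⟩
      · rcases (hT.pt_eq_pt (by omega) hle hl hw hw (by simp) hv e.symm).2 with h2 | h2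
        · exact Or.inl ⟨h2.1, c1⟩
        · exact absurd h2.2.1 one_ne_zero
    · have e := he.symm.trans c3
      rcases le_total l i with hle | hle
      · rcases (hT.pt_eq_pt h1 hle hi hw hw hv (by simp) e).2 with h2 | h2
        · exact Or.inr ⟨h2.1.symm, c1⟩
        · exact absurd h2.2.2 one_ne_zero
      · rcases (hT.pt_eq_pt c2 hle hl hw hw (by simp) hv e.symm).2 with h2 | h2
        · exact Or.inr ⟨h2.1, c1⟩
        · exact Or.inl ⟨h2.1.symm, h2.2.1⟩
  · intro hm
    rcases hcase with ⟨c1, c2, c3⟩ | ⟨c1, c2, c3⟩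
    · rcases hm with ⟨m1, m2⟩ | ⟨m1, m2⟩
      · rw [c3, ← m1]
        exact h.pt_mem (by omega) (by omega) ha hw (by simp)
      · rw [c3, m2, ← hT.pt_node (by omega) hw, m1]
        exact h.pt_mem h1 hl ha hw (by simp)
    · rcases hm with ⟨m1, m2⟩ | ⟨m1, m2⟩
      · rw [c3, m2, hT.pt_node (by omega) hw, m1]
        exact h.pt_mem h1 hl ha hw (by simp)
      · rw [c3, ← m1]
        exact h.pt_mem c2 hi ha hw (by simp)

lemma exists_mem_comp (hn : 1 ≤ n) {p : Z} (hS : ρ p ∈ Sing k Y) :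
    ∃ l, 1 ≤ l ∧ l ≤ n ∧ p ∈ toricComp ρ 𝒜 Θ l := by
  obtain ⟨a, ha, hpa⟩ := h.cover _ hS
  have hT := h.toric a ha _ hS hpa
  obtain ⟨i, hi, hp⟩ := hT.cover p hpa
  rcases hT.exists_pt hn hi hp ((a.core _ hpa).1 hS) with ⟨c1, c2, -⟩ | ⟨c1, c2, -⟩
  · exact ⟨i + 1, by omega, by omega,
      (h.mem_comp_iff (by omega) (by omega) ha hS hpa hi hp).2 (Or.inl ⟨rfl, c1⟩)⟩
  · exact ⟨i, c2, hi, (h.mem_comp_iff c2 hi ha hS hpa hi hp).2 (Or.inr ⟨rfl, c1⟩)⟩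

lemma comp_closed {l : ℕ} (h1 : 1 ≤ l) (hl : l ≤ n) {p : Z}
    (hS : ρ p ∈ Sing k Y) (hp : p ∈ closure (toricComp ρ 𝒜 Θ l)) :
    p ∈ toricComp ρ 𝒜 Θ l := by
  obtain ⟨a, ha, hpa⟩ := h.cover _ hS
  have hT := h.toric a ha _ hS hpa
  obtain ⟨i, hi, hpi⟩ := hT.cover p hpa
  rw [h.mem_comp_iff h1 hl ha hS hpa hi hpi]
  rw [mem_closure_iff_nhdsWithin_neBot] at hp
  have hev : ∀ᶠ q in 𝓝[toricComp ρ 𝒜 Θ l] p,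
      (i + 1 = l ∧ (Θ a i q).2.1 = 0) ∨ (i = l ∧ (Θ a i q).2.2 = 0) := by
    filter_upwards [self_mem_nhdsWithin, nhdsWithin_le_nhds ((Θ a i).open_source.mem_nhds hpi)]
      with q hq hqs
    exact (h.mem_comp_iff h1 hl ha hq.1 ((hT.chart i hi).maps q hqs) hi hqs).1 hq
  have ht : Tendsto (Θ a i) (𝓝[toricComp ρ 𝒜 Θ l] p) (𝓝 (Θ a i p)) :=
    ((Θ a i).continuousAt hpi).tendsto.mono_left nhdsWithin_le_nhds
  by_cases e1 : i + 1 = l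
  · refine Or.inl ⟨e1, @tendsto_nhds_unique _ _ _ _ _ _ _ _ hp ht.snd_nhds.fst_nhds
      (tendsto_const_nhds.congr' ?_)⟩
    exact hev.mono fun q hq => (hq.elim And.right fun hq => by omega).symm
  · by_cases e2 : i = l
    · refine Or.inr ⟨e2, @tendsto_nhds_unique _ _ _ _ _ _ _ _ hp ht.snd_nhds.snd_nhds
        (tendsto_const_nhds.congr' ?_)⟩
      exact hev.mono fun q hq => (hq.elim (fun hq => absurd hq.1 e1) And.right).symm
    · obtain ⟨q, hq⟩ := @Eventually.exists _ _ _ hp hev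
      exact (hq.elim (e1 ·.1) (e2 ·.1)).elim

end IsToricAtlas
/-- The generic points of the component with number `l`. -/
def genericComp (ρ : HolMap Z Y) (𝒜 : Set (AChart n k Y))
    (Θ : AChart n k Y → ℕ → OPH Z (Flat k)) (l : ℕ) : Set Z :=
  {p | ρ p ∈ Sing k Y ∧ ∃ a ∈ 𝒜, ρ p ∈ a.ψ.source ∧
    ∃ x : ℂ, x ≠ 0 ∧ p = pt (Θ a) l ((a.ψ (ρ p)).1.1, x, 1)}

lemma isPreconnected_compl_zero : IsPreconnected {x : ℂ | x ≠ 0} :=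
  (isConnected_compl_singleton_of_one_lt_rank (E := ℂ)
    (by rw [rank_real_complex]; exact Nat.one_lt_ofNat) 0).isPreconnected

namespace IsToricAtlas

variable [T2Space Z] {ρ : HolMap Z Y} {𝒜 : Set (AChart n k Y)}
  {Θ : AChart n k Y → ℕ → OPH Z (Flat k)} (h : IsToricAtlas ρ 𝒜 Θ)

lemma generic_subset (l : ℕ) : genericComp ρ 𝒜 Θ l ⊆ toricComp ρ 𝒜 Θ l := by
  rintro p ⟨hS, a, ha, hpa, x, hx, he⟩
  exact ⟨hS, a, ha, hpa, (x, 1), by simp, he⟩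

include h

lemma mem_closure_generic {l : ℕ} (h1 : 1 ≤ l) (hl : l ≤ n) {a : AChart n k Y} (ha : a ∈ 𝒜)
    {w : Fin k → ℂ} (hw : corePt n w ∈ a.ψ.target) {v : ℂ × ℂ} (hv : v ≠ 0) :
    pt (Θ a) l (w, v) ∈ closure ((fun x : ℂ => pt (Θ a) l (w, x, 1)) '' {x | x ≠ 0}) := by
  have hT := h.toric a ha _ (a.symm_corePt_mem hw) (a.ψ.map_target hw)
  have hc : ContinuousAt (fun s : ℂ => pt (Θ a) l (w, v.1 + s, v.2 + s)) 0 := by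
    refine ContinuousAt.comp (g := pt (Θ a) l) (f := fun s : ℂ => ((w, v.1 + s, v.2 + s) : Flat k))
      ?_ (by fun_prop)
    simp only [add_zero]
    exact hT.continuousAt_pt h1 hl hw hv
  have := mem_closure_of_curve (A := (fun x : ℂ => pt (Θ a) l (w, x, 1)) '' {x | x ≠ 0}) _ hc (by
    filter_upwards [eventually_add_ne v.1, eventually_add_ne v.2] with s e1 e2
    refine ⟨(v.1 + s) / (v.2 + s), div_ne_zero e1 e2, ?_⟩
    simp only
    rw [pt_of_right e2, pt_of_right one_ne_zero, div_one])
  simpa using this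

lemma generic_of_pt {l : ℕ} (h1 : 1 ≤ l) (hl : l ≤ n) {a : AChart n k Y} (ha : a ∈ 𝒜)
    {w : Fin k → ℂ} (hw : corePt n w ∈ a.ψ.target) {x : ℂ} (hx : x ≠ 0) :
    pt (Θ a) l (w, x, 1) ∈ genericComp ρ 𝒜 Θ l ∧
      a.ψ (ρ (pt (Θ a) l (w, x, 1))) = corePt n w := by
  have hT := h.toric a ha _ (a.symm_corePt_mem hw) (a.ψ.map_target hw)
  obtain ⟨m1, m2⟩ := hT.map_pt h1 hl (q := (w, x, 1)) hw (by simp)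
  refine ⟨⟨(a.core _ m1).2 (by rw [m2]; rfl), a, ha, m1, x, hx, ?_⟩, m2⟩
  rw [m2]
  rfl

lemma comp_subset_closure {l : ℕ} (h1 : 1 ≤ l) (hl : l ≤ n) :
    toricComp ρ 𝒜 Θ l ⊆ closure (genericComp ρ 𝒜 Θ l) := by
  rintro p ⟨hS, a, ha, hpa, v, hv, he⟩
  rw [he]
  refine closure_mono ?_ (h.mem_closure_generic h1 hl ha (AChart.corePt_mem hpa hS) hv)
  rintro _ ⟨x, hx, rfl⟩
  exact (h.generic_of_pt h1 hl ha (AChart.corePt_mem hpa hS) hx).1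

lemma generic_regular {l : ℕ} (h1 : 1 ≤ l) (hl : l ≤ n) :
    genericComp ρ 𝒜 Θ l ⊆ regLocus (ρ.toFun ⁻¹' Sing k Y) := by
  rintro p ⟨hS, a, ha, hpa, x, hx, he⟩
  have hT := h.toric a ha _ hS hpa
  obtain ⟨m1, m2⟩ := hT.pt_mem_right h1 hl (AChart.corePt_mem hpa hS) (x := x) one_ne_zero
  rw [← he] at m1 m2
  refine ⟨hS, k + 1, smoothAt_of_slice (hT.chart l hl).bihol m1 hS ?_⟩
  have hne : ∀ᶠ q in 𝓝 p, (Θ a l q).2.1 ≠ 0 := by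
    refine ((Θ a l).continuousAt m1).snd.fst.eventually_ne ?_
    simpa [m2] using hx
  filter_upwards [hne, (Θ a l).open_source.mem_nhds m1] with q hq hqs
  have hqa := (hT.chart l hl).maps q hqs
  constructor
  · intro hqS
    exact (hT.exists_pt (h1.trans hl) hl hqs ((a.core _ hqa).1 hqS)).elim
      (fun c => absurd c.1 hq) fun c => c.1
  · intro hb
    refine (a.core _ hqa).2 ?_
    rw [(hT.chart l hl).comm q hqs]
    rw [show Θ a l q = ((Θ a l q).1, (Θ a l q).2.1, 0) from Prod.ext rfl (Prod.ext rfl hb),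
      tor_a h1 hl]
    rfl

lemma generic_isPreconnected (hconn : IsPreconnected (Sing k Y)) {l : ℕ}
    (h1 : 1 ≤ l) (hl : l ≤ n) : IsPreconnected (genericComp ρ 𝒜 Θ l) := by
  refine isPreconnected_of_fibration hconn ρ.toFun (fun p hp => hp.1) fun s hs => ?_
  obtain ⟨a, ha, hsa⟩ := h.cover s hs
  have hT := h.toric a ha s hs hsa
  have hws := AChart.corePt_mem hsa hs
  obtain ⟨r, hr, hball⟩ := Metric.isOpen_iff.1
    (a.ψ.open_target.preimage (continuous_corePt n k)) _ hws
  set B := Metric.ball (a.ψ s).1.1 r with hB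
  have hfst : Continuous fun q : AModel n k => q.1.1 := by fun_prop
  refine ⟨a.ψ.source ∩ a.ψ ⁻¹' ((fun q : AModel n k => q.1.1) ⁻¹' B),
    a.ψ.isOpen_inter_preimage (Metric.isOpen_ball.preimage hfst),
    ⟨hsa, Metric.mem_ball_self hr⟩, ?_, ?_⟩
  · set P := (fun q : (Fin k → ℂ) × ℂ => pt (Θ a) l (q.1, q.2, 1)) '' (B ×ˢ {x | x ≠ 0}) with hP
    have hPc : IsPreconnected P := by
      refine ((convex_ball _ _).isPreconnected.prod isPreconnected_compl_zero).image _ ?_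
      intro q hq
      refine ContinuousAt.continuousWithinAt (ContinuousAt.comp (g := pt (Θ a) l)
        (f := fun q : (Fin k → ℂ) × ℂ => ((q.1, q.2, 1) : Flat k)) ?_ (by fun_prop))
      exact hT.continuousAt_pt h1 hl (hball hq.1) (by simp)
    refine hPc.subset_closure ?_ ?_
    · rintro _ ⟨⟨w, x⟩, ⟨hw, hx⟩, rfl⟩
      obtain ⟨g1, g2⟩ := h.generic_of_pt h1 hl ha (hball hw) hx
      have g3 := (hT.map_pt h1 hl (q := (w, x, 1)) (hball hw) (by simp)).1
      refine ⟨g1, g3, ?_⟩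
      rw [mem_preimage, mem_preimage]
      erw [g2]
      exact hw
    · rintro p ⟨hp, hpa, hpB⟩
      obtain ⟨v, hv, he⟩ := h.exists_of_mem h1 hl (generic_subset l hp) ha hpa
      rw [he]
      refine closure_mono ?_ (h.mem_closure_generic h1 hl ha (AChart.corePt_mem hpa hp.1) hv)
      rintro _ ⟨x, hx, rfl⟩
      exact ⟨(_, x), ⟨hpB, hx⟩, rfl⟩
  · rintro t ⟨⟨hta, htB⟩, htS⟩
    have hw := AChart.corePt_mem hta htS
    obtain ⟨g1, g2⟩ := h.generic_of_pt h1 hl ha hw one_ne_zero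
    exact ⟨_, g1, a.ψ.injOn (hT.map_pt h1 hl (q := ((a.ψ t).1.1, 1, 1)) hw (by simp)).1 hta
      (g2.trans (AChart.corePt_eq hta htS))⟩

theorem exists_numbering (hconn : IsConnected (Sing k Y)) {E : Fin n → Set Z}
    (hE : IsExceptionalChain ρ (Sing k Y) E) :
    ∃ e : Fin n → ℕ, Function.Injective e ∧
      ∀ i, 1 ≤ e i ∧ e i ≤ n ∧ E i = toricComp ρ 𝒜 Θ (e i) := by
  set R := regLocus (ρ.toFun ⁻¹' Sing k Y) with hR
  have hRS : ∀ p ∈ R, ρ p ∈ Sing k Y := fun p hp => hp.1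
  have hne : ∀ i : Fin n, (genericComp ρ 𝒜 Θ (i + 1)).Nonempty := by
    intro i
    obtain ⟨s, hs⟩ := hconn.nonempty
    obtain ⟨a, ha, hsa⟩ := h.cover s hs
    exact ⟨_, (h.generic_of_pt (by omega) (by omega) ha (AChart.corePt_mem hsa hs)
      one_ne_zero).1⟩
  choose x hx using hne
  set C : Fin n → Set Z := fun i => ρ.toFun ⁻¹' Sing k Y ∩
    closure (connectedComponentIn R (x i)) with hC
  have hgen : ∀ i : Fin n, genericComp ρ 𝒜 Θ (i + 1) ⊆ connectedComponentIn R (x i) := fun i =>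
    (h.generic_isPreconnected hconn.isPreconnected (by omega) (by omega)).subset_connectedComponentIn
      (hx i) (h.generic_regular (by omega) (by omega))
  have hcc : ∀ i : Fin n, ∀ p ∈ R, p ∈ toricComp ρ 𝒜 Θ (i + 1) →
      connectedComponentIn R p = connectedComponentIn R (x i) := by
    intro i p hp hpi
    have hpre : IsPreconnected (insert p (genericComp ρ 𝒜 Θ (i + 1))) :=
      (h.generic_isPreconnected hconn.isPreconnected (by omega) (by omega)).subset_closure
        (subset_insert _ _)
        (insert_subset (h.comp_subset_closure (by omega) (by omega) hpi) subset_closure)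
    exact connectedComponentIn_eq (hpre.subset_connectedComponentIn (mem_insert _ _)
      (insert_subset hp (h.generic_regular (by omega) (by omega)))
      (mem_insert_of_mem _ (hx i)))
  have hidx : ∀ p ∈ R, ∃ i : Fin n, p ∈ toricComp ρ 𝒜 Θ (i + 1) := by
    intro p hp
    obtain ⟨i, -⟩ : ρ.toFun ⁻¹' Sing k Y ∩ closure (connectedComponentIn R p) ∈ range E :=
      hE.range_eq ▸ ⟨p, hp, rfl⟩
    obtain ⟨l, h1, hl, hpl⟩ := h.exists_mem_comp i.pos (hRS p hp)
    exact ⟨⟨l - 1, by omega⟩, by simpa [show l - 1 + 1 = l by omega] using hpl⟩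
  have hrange : Set.range C = Set.range E := by
    rw [hE.range_eq]
    ext D
    constructor
    · rintro ⟨i, rfl⟩
      exact ⟨x i, h.generic_regular (by omega) (by omega) (hx i), rfl⟩
    · rintro ⟨p, hp, rfl⟩
      obtain ⟨i, hi⟩ := hidx p hp
      exact ⟨i, by simp only [hC]; rw [← hcc i p hp hi]⟩
  have hEC : ∀ i, E i ∈ Set.range C := fun i => hrange ▸ mem_range_self i
  choose g hg using hEC
  have hginj : Function.Injective g := fun i j hij => hE.injective (by rw [← hg, ← hg, hij])
  have hgsurj : Function.Surjective g := Finite.surjective_of_injective hginj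
  have hCinj : Function.Injective C := by
    intro i j hij
    obtain ⟨i', rfl⟩ := hgsurj i
    obtain ⟨j', rfl⟩ := hgsurj j
    rw [hg, hg] at hij
    rw [hE.injective hij]
  have hsub : ∀ i, connectedComponentIn R (x i) ⊆ toricComp ρ 𝒜 Θ (i + 1) := by
    intro i q hq
    have hqR := connectedComponentIn_subset _ _ hq
    obtain ⟨j, hj⟩ := hidx q hqR
    have : C i = C j := by simp only [hC]; rw [connectedComponentIn_eq hq, hcc j q hqR hj]
    rwa [hCinj this]
  refine ⟨fun i => g i + 1, fun i j hij => hginj (Fin.ext (by simpa using hij)), fun i =>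
    ⟨Nat.le_add_left _ _, (g i).2, ?_⟩⟩
  rw [← hg]
  refine Subset.antisymm ?_ fun p hp => ⟨hp.1, ?_⟩
  · rintro p ⟨hpS, hp⟩
    exact h.comp_closed (Nat.le_add_left _ _) (g i).2 hpS (closure_mono (hsub _) hp)
  · exact closure_mono (hgen _) (h.comp_subset_closure (Nat.le_add_left _ _) (g i).2 hp)

lemma comp_inter {l m : ℕ} (h1 : 1 ≤ l) (hl : l ≤ m) (hm : m ≤ n)
    (hne : (toricComp ρ 𝒜 Θ l ∩ toricComp ρ 𝒜 Θ m).Nonempty) : m ≤ l + 1 := by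
  obtain ⟨p, hp, hp'⟩ := hne
  obtain ⟨a, ha, hpa⟩ := h.cover _ hp.1
  have hT := h.toric a ha _ hp.1 hpa
  obtain ⟨v, hv, e⟩ := h.exists_of_mem h1 (hl.trans hm) hp ha hpa
  obtain ⟨v', hv', e'⟩ := h.exists_of_mem (h1.trans hl) hm hp' ha hpa
  have hw := AChart.corePt_mem hpa hp.1
  rcases (hT.pt_eq_pt h1 hl hm hw hw hv hv' (e.symm.trans e')).2 with h2 | h2 <;> omega

/-- The unions of consecutive components are the unions over the intervals of the toric
numbering. -/
theorem exists_interval (hconn : IsConnected (Sing k Y)) {E : Fin n → Set Z}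
    (hE : IsExceptionalChain ρ (Sing k Y) E) {μ ν : Fin n} (hμν : μ ≤ ν) :
    ∃ m₁ m₂ : ℕ, 1 ≤ m₁ ∧ m₁ ≤ m₂ ∧ m₂ ≤ n ∧
      ∀ p, p ∈ chainUnion E μ ν ↔ ∃ l, m₁ ≤ l ∧ l ≤ m₂ ∧ p ∈ toricComp ρ 𝒜 Θ l := by
  obtain ⟨e, hinj, he⟩ := h.exists_numbering hconn hE
  have hadj : ∀ i j : Fin n, (j : ℕ) = i + 1 → e j = e i + 1 ∨ e i = e j + 1 := by
    intro i j hij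
    have hm := hE.meet i j (by rw [hij]; push_cast; simp)
    rw [(he i).2.2, (he j).2.2] at hm
    have hne : e i ≠ e j := fun h0 => by rw [hinj h0] at hij; omega
    rcases le_total (e i) (e j) with hle | hle
    · have := h.comp_inter (he i).1 hle (he j).2.1 hm
      omega
    · rw [inter_comm] at hm
      have := h.comp_inter (he j).1 hle (he i).2.1 hm
      omega
  have key : ∀ d : ℕ, ∀ hd : (μ : ℕ) + d < n, ∃ m₁ m₂ : ℕ, 1 ≤ m₁ ∧ m₁ ≤ m₂ ∧ m₂ ≤ n ∧
      ∀ l, (m₁ ≤ l ∧ l ≤ m₂) ↔ ∃ i : Fin n, μ ≤ i ∧ (i : ℕ) ≤ μ + d ∧ e i = l := by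
    intro d
    induction d with
    | zero =>
      intro hd
      refine ⟨e μ, e μ, (he μ).1, le_rfl, (he μ).2.1, fun l => ⟨fun hl => ⟨μ, le_rfl, by simp,
        by omega⟩, ?_⟩⟩
      rintro ⟨i, h1, h2, rfl⟩
      simp [show i = μ by omega]
    | succ d ih =>
      intro hd
      obtain ⟨m₁, m₂, h1, h2, h3, h4⟩ := ih (by omega)
      set i : Fin n := ⟨μ + d, by omega⟩
      set j : Fin n := ⟨μ + (d + 1), hd⟩
      have hi := (h4 (e i)).2 ⟨i, by simp [i, Fin.le_def], by simp [i], rfl⟩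
      have hj : ¬ (m₁ ≤ e j ∧ e j ≤ m₂) := by
        rw [h4]
        rintro ⟨i', -, g2, g3⟩
        simp [hinj g3, j] at g2
      have hstep : ∀ l, (∃ i : Fin n, μ ≤ i ∧ (i : ℕ) ≤ μ + (d + 1) ∧ e i = l) ↔
          (m₁ ≤ l ∧ l ≤ m₂) ∨ l = e j := by
        intro l
        rw [h4]
        constructor
        · rintro ⟨i', g1, g2, g3⟩
          by_cases hle : (i' : ℕ) ≤ μ + d
          · exact Or.inl ⟨i', g1, hle, g3⟩
          · right
            rw [← g3, show i' = j from Fin.ext (by simp only [j]; omega)]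
        · rintro (⟨i', g1, g2, g3⟩ | rfl)
          · exact ⟨i', g1, by omega, g3⟩
          · exact ⟨j, by simp [j, Fin.le_def], le_rfl, rfl⟩
      have hjr := he j
      rcases hadj i j (by simp only [i, j]; omega) with hc | hc
      · exact ⟨m₁, m₂ + 1, h1, by omega, by omega, fun l => by rw [hstep]; omega⟩
      · exact ⟨m₁ - 1, m₂, by omega, by omega, h3, fun l => by rw [hstep]; omega⟩
  obtain ⟨m₁, m₂, h1, h2, h3, h4⟩ := key (ν - μ) (by omega)
  refine ⟨m₁, m₂, h1, h2, h3, fun p => ?_⟩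
  simp only [chainUnion, mem_iUnion, mem_Icc, exists_prop]
  constructor
  · rintro ⟨i, ⟨g1, g2⟩, g3⟩
    have := (h4 (e i)).2 ⟨i, g1, by omega, rfl⟩
    exact ⟨e i, this.1, this.2, (he i).2.2 ▸ g3⟩
  · rintro ⟨l, g1, g2, g3⟩
    obtain ⟨i, k1, k2, rfl⟩ := (h4 l).1 ⟨g1, g2⟩
    exact ⟨i, ⟨k1, by omega⟩, by rw [(he i).2.2]; exact g3⟩

end IsToricAtlas
end Components

/-! ### Local equations and the normal sheaf -/

section LocalEquation

variable {k : ℕ} {F : Flat k → ℂ} {q₀ : Flat k}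

lemma exists_eq_mul {g : Flat k → ℂ} (hg : Ana g q₀) (hF : Ana F q₀)
    (h : g q₀ = 0 → ∃ F₁ : Flat k → ℂ, Ana F₁ q₀ ∧ ∀ᶠ q in 𝓝 q₀, F q = g q * F₁ q) :
    ∃ F₁ : Flat k → ℂ, Ana F₁ q₀ ∧ ∀ᶠ q in 𝓝 q₀, F q = g q * F₁ q := by
  by_cases h0 : g q₀ = 0
  · exact h h0
  · exact ⟨fun q => F q / g q, hF.div hg h0,
      (hg.continuousAt.eventually_ne h0).mono fun q hq => (mul_div_cancel₀ _ hq).symm⟩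

lemma exists_eq_mul_a (hF : Ana F q₀) (h0 : ∀ᶠ q : Flat k in 𝓝 q₀, q.2.1 = 0 → F q = 0) :
    ∃ F₁ : Flat k → ℂ, Ana F₁ q₀ ∧ ∀ᶠ q : Flat k in 𝓝 q₀, F q = q.2.1 * F₁ q :=
  exists_eq_mul (g := fun q => q.2.1) (by fun_prop) hF fun ha => by
    obtain ⟨w, a, b⟩ := q₀
    obtain rfl : a = 0 := ha
    exact exists_eq_mul_fst hF h0

lemma exists_eq_mul_b (hF : Ana F q₀) (h0 : ∀ᶠ q : Flat k in 𝓝 q₀, q.2.2 = 0 → F q = 0) :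
    ∃ F₁ : Flat k → ℂ, Ana F₁ q₀ ∧ ∀ᶠ q : Flat k in 𝓝 q₀, F q = q.2.2 * F₁ q :=
  exists_eq_mul (g := fun q => q.2.2) (by fun_prop) hF fun hb => by
    obtain ⟨w, a, b⟩ := q₀
    obtain rfl : b = 0 := hb
    exact exists_eq_mul_snd hF h0

lemma exists_eq_mul_ab (hF : Ana F q₀)
    (h0 : ∀ᶠ q : Flat k in 𝓝 q₀, q.2.1 * q.2.2 = 0 → F q = 0) :
    ∃ F₁ : Flat k → ℂ, Ana F₁ q₀ ∧
      ∀ᶠ q : Flat k in 𝓝 q₀, F q = q.2.1 * q.2.2 * F₁ q := by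
  obtain ⟨F₁, h1, e1⟩ := exists_eq_mul_a hF (h0.mono fun q hq ha => hq (by rw [ha, zero_mul]))
  obtain ⟨F₂, h2, e2⟩ := exists_eq_mul_b h1 (by
    filter_upwards [h1.eventually_analyticAt, e1.eventually_nhds, h0.eventually_nhds]
      with q g1 g2 g3 hb
    have hc : Tendsto (fun s : ℂ => ((q.1, q.2.1 + s, q.2.2) : Flat k)) (𝓝[≠] 0) (𝓝 q) :=
      (Continuous.tendsto' (by fun_prop) _ _ (by simp)).mono_left nhdsWithin_le_nhds
    refine tendsto_nhds_unique (g1.continuousAt.tendsto.comp hc) (tendsto_const_nhds.congr' ?_)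
    filter_upwards [hc.eventually g2, hc.eventually g3, eventually_add_ne q.2.1] with s k1 k2 k3
    have k4 := k2 (by simp [hb])
    rw [k1] at k4
    exact ((mul_eq_zero.1 k4).resolve_left k3).symm)
  refine ⟨F₂, h2, ?_⟩
  filter_upwards [e1, e2] with q g1 g2
  rw [g1, g2, mul_assoc]

variable {Z : Type u} [TopologicalSpace Z] [HolSpace Z]

/-- The function `e` generates the ideal of `X` near `x` and is not a zero divisor. -/
structure IsLocalEq (X : Set Z) (x : Z) (e : Z → ℂ) : Prop where
  mem : ∀ᶠ y in 𝓝 x, MemIdeal X y e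
  dense : ∀ᶠ y in 𝓝 x, y ∈ closure {t | e t ≠ 0}
  gen : ∀ᶠ y in 𝓝 x, ∀ h, MemIdeal X y h → ∃ c ∈ 𝒪 y, ∀ᶠ t in 𝓝 y, h t = c t * e t

section

variable {θ : OPH Z (Flat k)} (hb : IsBihol θ) {X : Set Z} {x : Z} (hx : x ∈ θ.source)
include hb hx

lemma isLocalEq_of_chart (g : Flat k → ℂ) (hg : ∀ q, Ana g q)
    (hX : ∀ᶠ q in 𝓝 x, q ∈ X ↔ g (θ q) = 0)
    (hdense : ∀ q : Flat k, q ∈ closure {t | g t ≠ 0})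
    (hdiv : ∀ (F : Flat k → ℂ) (q₀ : Flat k), Ana F q₀ →
      (∀ᶠ q : Flat k in 𝓝 q₀, g q = 0 → F q = 0) →
      ∃ F₁ : Flat k → ℂ, Ana F₁ q₀ ∧ ∀ᶠ q : Flat k in 𝓝 q₀, F q = g q * F₁ q) :
    IsLocalEq X x fun q => g (θ q) := by
  have hs := θ.open_source.eventually_mem hx
  refine ⟨?_, ?_, ?_⟩
  · filter_upwards [hs, hX.eventually_nhds] with y hy hyX
    exact ⟨(hb y hy g).1 (hg _), hyX.mono fun t ht h => ht.1 h⟩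
  · filter_upwards [hs] with y hy
    have h1 := hdense (θ y)
    rw [mem_closure_iff_frequently] at h1 ⊢
    have h2 : Tendsto θ.symm (𝓝 (θ y)) (𝓝 y) := θ.tendsto_symm hy
    refine h2.frequently ((h1.and_eventually
      (θ.open_target.eventually_mem (θ.map_source hy))).mono fun q hq => ?_)
    simpa [θ.right_inv hq.2] using hq.1
  · filter_upwards [hs, hX.eventually_nhds] with y hy hyX h hh
    have h1 : Ana (h ∘ θ.symm) (θ y) :=
      (hb.mem_symm (θ.map_source hy)).1 ((θ.left_inv hy).symm ▸ hh.1)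
    obtain ⟨F₁, h2, h3⟩ := hdiv _ _ h1 (by
      have ht : Tendsto θ.symm (𝓝 (θ y)) (𝓝 y) := θ.tendsto_symm hy
      filter_upwards [ht.eventually hh.2, ht.eventually hyX,
        θ.open_target.eventually_mem (θ.map_source hy)] with q k1 k2 k3 k4
      rw [θ.right_inv k3] at k2
      exact k1 (k2.2 k4))
    refine ⟨fun t => F₁ (θ t), (hb y hy F₁).1 h2, ?_⟩
    filter_upwards [(θ.continuousAt hy).eventually h3, θ.open_source.eventually_mem hy] with t k1 k2
    rw [Function.comp_apply, θ.left_inv k2] at k1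
    rw [k1, mul_comm]

lemma isLocalEq_a (hX : ∀ᶠ q in 𝓝 x, q ∈ X ↔ (θ q).2.1 = 0) :
    IsLocalEq X x fun q => (θ q).2.1 := by
  refine isLocalEq_of_chart hb hx (fun q => q.2.1) (fun q => by fun_prop) hX (fun q => ?_)
    fun F q₀ => exists_eq_mul_a
  have := mem_closure_of_curve (A := {t : Flat k | t.2.1 ≠ 0})
    (fun s : ℂ => ((q.1, q.2.1 + s, q.2.2) : Flat k)) (by fun_prop) (eventually_add_ne q.2.1)
  simpa using this

lemma isLocalEq_b (hX : ∀ᶠ q in 𝓝 x, q ∈ X ↔ (θ q).2.2 = 0) :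
    IsLocalEq X x fun q => (θ q).2.2 := by
  refine isLocalEq_of_chart hb hx (fun q => q.2.2) (fun q => by fun_prop) hX (fun q => ?_)
    fun F q₀ => exists_eq_mul_b
  have := mem_closure_of_curve (A := {t : Flat k | t.2.2 ≠ 0})
    (fun s : ℂ => ((q.1, q.2.1, q.2.2 + s) : Flat k)) (by fun_prop) (eventually_add_ne q.2.2)
  simpa using this

lemma isLocalEq_ab (hX : ∀ᶠ q in 𝓝 x, q ∈ X ↔ (θ q).2.1 * (θ q).2.2 = 0) :
    IsLocalEq X x fun q => (θ q).2.1 * (θ q).2.2 := by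
  refine isLocalEq_of_chart hb hx (fun q => q.2.1 * q.2.2) (fun q => by fun_prop) hX (fun q => ?_)
    fun F q₀ => exists_eq_mul_ab
  have := mem_closure_of_curve (A := {t : Flat k | t.2.1 * t.2.2 ≠ 0})
    (fun s : ℂ => ((q.1, q.2.1 + s, q.2.2 + s) : Flat k)) (by fun_prop) (by
      filter_upwards [eventually_add_ne q.2.1, eventually_add_ne q.2.2] with s h1 h2
      exact mul_ne_zero h1 h2)
  simpa using this

end

variable {X : Set Z} {x : X} {e u z : Z → ℂ}

/-- A section of the normal sheaf is determined by its value on a multiple of the local equation. -/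
lemma IsLocalEq.eq_zero (he : IsLocalEq X x e) (hu : u ∈ 𝒪 (x : Z))
    (hz : ∀ᶠ y in 𝓝 (x : Z), z y = u y * e y) (hne : ∃ᶠ y : X in 𝓝 x, u y ≠ 0)
    (hcont : ∀ f : X → ℂ, f ∈ 𝒪 x → ContinuousAt f x)
    {σ : ∀ y : X, (normalSheaf X).Fib y} (hσ : (normalSheaf X).Hol x σ)
    (h0 : ∀ᶠ y in 𝓝 x, (σ y).1 z = 0) : σ x = 0 := by
  have hval := continuous_subtype_val.continuousAt (x := x)
  have e0 : (σ x).1 e = 0 := by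
    by_contra hne0
    have h1 : ∀ᶠ y in 𝓝 x, (σ y).1 e ≠ 0 :=
      (hcont _ (hσ e he.mem.self_of_nhds)).eventually_ne hne0
    obtain ⟨y, hy, g1, g2, g3, g4, g5⟩ := (hne.and_eventually (h1.and (h0.and
      ((hval.eventually he.mem).and ((hval.eventually hz.eventually_nhds).and
        (hval.eventually (HolSpace.eventually hu))))))).exists
    have := normalFib_mul (σ y).2 g5 g3 g4
    rw [g2] at this
    exact (mul_ne_zero hy g1) this.symm
  refine Subtype.ext (funext fun h => ?_)
  by_cases hh : MemIdeal X (x : Z) h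
  · obtain ⟨c, hc, hce⟩ := he.gen.self_of_nhds h hh
    rw [normalFib_mul (σ x).2 hc he.mem.self_of_nhds hce, e0, mul_zero]
    rfl
  · rw [(σ x).2.1 h hh]
    rfl

/-- Sections of the normal sheaf with given value on a multiple of the local equation. -/
lemma IsLocalEq.exists_section (he : IsLocalEq X x e)
    (hZ : ∀ᶠ y in 𝓝 (x : Z), ∀ f : Z → ℂ, f ∈ 𝒪 y → ContinuousAt f y) (hu : u ∈ 𝒪 (x : Z))
    (hz : ∀ᶠ y in 𝓝 (x : Z), z y = u y * e y) {f g : X → ℂ} (hg : g ∈ 𝒪 x)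
    (hfg : ∀ᶠ y : X in 𝓝 x, f y = u y * g y) :
    ∃ σ, ∀ᶠ y in 𝓝 x, (normalSheaf X).Hol y σ ∧ (σ y).1 z = f y := by
  have hval := continuous_subtype_val.continuousAt (x := x)
  obtain ⟨V, hV, hVo, hxV⟩ := eventually_nhds_iff.1
    (he.mem.and (he.dense.and (he.gen.and hZ)))
  have huniq : ∀ y ∈ V, ∀ c c' : Z → ℂ, c ∈ 𝒪 y → c' ∈ 𝒪 y →
      (∀ᶠ t in 𝓝 y, c t * e t = c' t * e t) → c y = c' y := by
    intro y hy c c' hc hc' hcc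
    obtain ⟨-, v2, -, v4⟩ := hV y hy
    by_contra hne
    have h1 : ∀ᶠ t in 𝓝 y, c t - c' t ≠ 0 :=
      ((v4 c hc).sub (v4 c' hc')).eventually_ne (sub_ne_zero.2 hne)
    obtain ⟨t, ht, k1, k2⟩ := ((mem_closure_iff_frequently.1 v2).and_eventually
      (h1.and hcc)).exists
    exact k1 (sub_eq_zero.2 (mul_right_cancel₀ ht k2))
  choose! q hq using fun y (hy : y ∈ V) => (hV y hy).2.2.1
  classical
  have hmem : ∀ y : X, (y : Z) ∈ V →
      (fun h => if MemIdeal X (y : Z) h then q y h y * g y else 0) ∈ normalFib X (y : Z) := by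
    intro y hy
    refine ⟨fun h hh => if_neg hh, fun h h' hh hh' => ?_, fun c h hc hh => ?_⟩
    · have hs : MemIdeal X (y : Z) (h + h') := ⟨add_mem hh.1 hh'.1, by
        filter_upwards [hh.2, hh'.2] with t k1 k2 k3
        simp [k1 k3, k2 k3]⟩
      obtain ⟨a1, a2⟩ := hq y hy h hh
      obtain ⟨b1, b2⟩ := hq y hy h' hh'
      obtain ⟨c1, c2⟩ := hq y hy _ hs
      simp only [if_pos hh, if_pos hh', if_pos hs]
      have := huniq y hy _ (q y h + q y h') c1 (add_mem a1 b1) (by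
        filter_upwards [a2, b2, c2] with t k1 k2 k3
        rw [← k3, Pi.add_apply, Pi.add_apply, k1, k2, add_mul])
      rw [this, Pi.add_apply, add_mul]
    · have hs : MemIdeal X (y : Z) (c * h) := hh.mul hc
      obtain ⟨a1, a2⟩ := hq y hy h hh
      obtain ⟨c1, c2⟩ := hq y hy _ hs
      simp only [if_pos hh, if_pos hs]
      have := huniq y hy _ (c * q y h) c1 (mul_mem hc a1) (by
        filter_upwards [a2, c2] with t k1 k3
        rw [← k3, Pi.mul_apply, Pi.mul_apply, k1, mul_assoc])
      rw [this, Pi.mul_apply, mul_assoc]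
  set σ : ∀ y : X, (normalSheaf X).Fib y := fun y =>
    if hy : (y : Z) ∈ V then ⟨_, hmem y hy⟩ else 0 with hσ
  have hσv : ∀ y : X, ∀ hy : (y : Z) ∈ V, ∀ h c : Z → ℂ, MemIdeal X (y : Z) h → c ∈ 𝒪 (y : Z) →
      (∀ᶠ t in 𝓝 (y : Z), h t = c t * e t) → (σ y).1 h = c y * g y := by
    intro y hy h c hh hc hce
    have hσy : σ y = ⟨_, hmem y hy⟩ := dif_pos hy
    rw [hσy]
    change (if MemIdeal X (y : Z) h then q y h y * g y else 0) = _
    obtain ⟨a1, a2⟩ := hq y hy h hh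
    rw [if_pos hh, huniq y hy _ c a1 hc (by filter_upwards [a2, hce] with t k1 k2; rw [← k1, k2])]
  have hVx : ∀ᶠ y : X in 𝓝 x, (y : Z) ∈ V := hval.eventually (hVo.mem_nhds hxV)
  refine ⟨σ, ?_⟩
  filter_upwards [hVx, HolSpace.eventually hg, hfg, hval.eventually (HolSpace.eventually hu),
    hval.eventually hz.eventually_nhds] with x k0 k1 k2 k3 k4
  have hval := continuous_subtype_val.continuousAt (x := x)
  refine ⟨fun h hh => ?_, ?_⟩
  · obtain ⟨c, hc, hce⟩ := (hV x k0).2.2.1 h hh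
    have hcr : (fun y : X => c y) ∈ 𝒪 x := ⟨c, hc, Eventually.of_forall fun _ => rfl⟩
    refine HolSpace.congr (mul_mem hcr k1) ?_
    have hev : ∀ᶠ y in 𝓝 (x : Z), MemIdeal X y h := by
      filter_upwards [HolSpace.eventually hh.1, hh.2.eventually_nhds] with y k1 k2
      exact ⟨k1, k2⟩
    filter_upwards [hval.eventually (hVo.mem_nhds k0), hval.eventually hev,
      hval.eventually (HolSpace.eventually hc), hval.eventually hce.eventually_nhds]
      with y k1 k2 k3 k4
    exact (hσv y k1 h c k2 k3 k4).symm
  · have hm : MemIdeal X (x : Z) z :=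
      ((hV x k0).1.mul k3).congr (k4.mono fun t ht => ht.symm)
    rw [hσv x k0 z u hm k3 k4, k2]

end LocalEquation

/-! ### Chains of projective lines over a chart of the base -/

/-- A description of `π : X → S` over a chart `κ` of `S` as a chain of `ℙ¹`-bundles, numbered from
`m₁` to `m₂`, with homogeneous coordinates `P l (w, x, y)` on the line with number `l`; the sections
of the sheaf `F` are, by means of the functionals `ζ`, the holomorphic functions that vanish on the
two end sections. -/
structure ChainModel {X S : Type u} [TopologicalSpace X] [HolSpace X] [TopologicalSpace S]
    [HolSpace S] (π : HolMap X S) (F : ValSheaf X) (k m₁ m₂ : ℕ) where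
  κ : OPH S (Fin k → ℂ)
  P : ℕ → Flat k → X
  ζ : ∀ x, F.Fib x →ₗ[ℂ] ℂ
  bihol : IsBihol κ
  le : m₁ ≤ m₂
  map_P : ∀ l, m₁ ≤ l → l ≤ m₂ → ∀ w ∈ κ.target, ∀ v : ℂ × ℂ, v ≠ 0 → π (P l (w, v)) = κ.symm w
  smul_P : ∀ l, m₁ ≤ l → l ≤ m₂ → ∀ w ∈ κ.target, ∀ (x y c : ℂ), c ≠ 0 →
    P l (w, c * x, c * y) = P l (w, x, y)
  node_P : ∀ l, m₁ ≤ l → l + 1 ≤ m₂ → ∀ w ∈ κ.target, P l (w, 0, 1) = P (l + 1) (w, 1, 0)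
  exists_P : ∀ x, π x ∈ κ.source → ∃ l, m₁ ≤ l ∧ l ≤ m₂ ∧ ∃ v : ℂ × ℂ, v ≠ 0 ∧
    x = P l (κ (π x), v)
  P_eq : ∀ l l', m₁ ≤ l → l ≤ l' → l' ≤ m₂ → ∀ w ∈ κ.target, ∀ v v' : ℂ × ℂ, v ≠ 0 → v' ≠ 0 →
    P l (w, v) = P l' (w, v') →
      (l = l' ∧ v.1 * v'.2 = v.2 * v'.1) ∨ (l' = l + 1 ∧ v.1 = 0 ∧ v'.2 = 0)
  continuousAt_P : ∀ l, m₁ ≤ l → l ≤ m₂ → ∀ w ∈ κ.target, ∀ v : ℂ × ℂ, v ≠ 0 →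
    ContinuousAt (P l) (w, v)
  hol_iff : ∀ x, π x ∈ κ.source → ∀ f : X → ℂ, f ∈ 𝒪 x ↔ ∀ l, m₁ ≤ l → l ≤ m₂ →
    ∀ v : ℂ × ℂ, v ≠ 0 → x = P l (κ (π x), v) → Ana (fun q => f (P l q)) (κ (π x), v)
  ζ_hol : ∀ x, π x ∈ κ.source → ∀ σ, F.Hol x σ → (fun y => ζ y (σ y)) ∈ 𝒪 x
  ζ_start : ∀ w ∈ κ.target, ∀ c, ζ (P m₁ (w, 1, 0)) c = 0
  ζ_end : ∀ w ∈ κ.target, ∀ c, ζ (P m₂ (w, 0, 1)) c = 0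
  eq_zero : ∀ x, π x ∈ κ.source → ∀ σ, F.Hol x σ → (∀ᶠ y in 𝓝 x, ζ y (σ y) = 0) → σ x = 0
  exists_section : ∀ x, π x ∈ κ.source → ∀ f : X → ℂ, f ∈ 𝒪 x →
    (∀ᶠ y in 𝓝 x, y = P m₁ (κ (π y), 1, 0) → f y = 0) →
    (∀ᶠ y in 𝓝 x, y = P m₂ (κ (π y), 0, 1) → f y = 0) →
    ∃ σ, ∀ᶠ y in 𝓝 x, F.Hol y σ ∧ ζ y (σ y) = f y

section BaseChart

variable {Y : Type u} [TopologicalSpace Y] [HolSpace Y] {n k : ℕ}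

/-- The chart of the singular locus given by a chart of `Y`. -/
def AChart.base (a : AChart n k Y) (s₀ : Sing k Y) :
    OPH (Sing k Y) (Fin k → ℂ) where
  toFun t := (a.ψ t).1.1
  invFun w := open Classical in
    if h : corePt n w ∈ a.ψ.target then ⟨a.ψ.symm (corePt n w), a.symm_corePt_mem h⟩ else s₀
  source := Subtype.val ⁻¹' a.ψ.source
  target := corePt n ⁻¹' a.ψ.target
  map_source' t ht := AChart.corePt_mem ht t.2
  map_target' w hw := by
    rw [dif_pos (show corePt n w ∈ a.ψ.target from hw)]
    exact a.ψ.map_target hw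
  left_inv' t ht := by
    have h1 := AChart.corePt_mem ht t.2
    rw [dif_pos h1]
    exact Subtype.ext ((congrArg a.ψ.symm (AChart.corePt_eq ht t.2)).trans (a.ψ.left_inv ht))
  right_inv' w hw := by
    simp only [dif_pos (show corePt n w ∈ a.ψ.target from hw), a.ψ.right_inv hw]
    rfl
  open_source := a.ψ.open_source.preimage continuous_subtype_val
  open_target := a.ψ.open_target.preimage (continuous_corePt n k)
  continuousOn_toFun := by
    intro t ht
    have h1 : ContinuousAt (fun t : Sing k Y => a.ψ t) t :=
      ContinuousAt.comp (g := a.ψ) (a.ψ.continuousAt ht) continuous_subtype_val.continuousAt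
    exact (continuous_fst.comp continuous_subtype_val).continuousAt.comp h1 |>.continuousWithinAt
  continuousOn_invFun := by
    classical
    rw [continuousOn_iff_continuous_domRestrict, continuous_induced_rng]
    have h1 : ContinuousOn (fun w : Fin k → ℂ => a.ψ.symm (corePt n w))
        (corePt n ⁻¹' a.ψ.target) :=
      a.ψ.symm.continuousOn.comp (continuous_corePt n k).continuousOn fun w hw => hw
    rw [continuousOn_iff_continuous_domRestrict] at h1
    refine h1.congr fun w => ?_
    simp only [Function.comp_apply, Set.domRestrict_apply]
    rw [dif_pos (show corePt n w ∈ a.ψ.target from w.2)]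

lemma AChart.base_symm (a : AChart n k Y) (s₀ : Sing k Y) {w : Fin k → ℂ}
    (hw : corePt n w ∈ a.ψ.target) : ((a.base s₀).symm w : Y) = a.ψ.symm (corePt n w) := by
  classical
  change Subtype.val (dite (corePt n w ∈ a.ψ.target) _ _) = _
  rw [dif_pos hw]

lemma AChart.isBihol_base (a : AChart n k Y) (s₀ : Sing k Y) :
    IsBihol (a.base s₀) := by
  refine isBihol_of (fun t ht f hf => ?_) fun t ht f hf => ?_
  · refine ⟨fun y => f (a.ψ y).1.1, a.bihol.comp_mem (F := fun q => f q.1) ht ?_,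
      Eventually.of_forall fun _ => rfl⟩
    exact AnalyticAt.comp (g := f) (f := Prod.fst) hf analyticAt_fst
  · obtain ⟨F, hF, he⟩ := hf
    obtain ⟨G, hG, hFG⟩ := a.bihol.exists_analytic (x := (t : Y)) ht hF
    have ht' : a.base s₀ t ∈ (a.base s₀).target := (a.base s₀).map_source ht
    have e0 : (((a.base s₀ t), 0) : Amb k) = a.ψ t :=
      congrArg Subtype.val (AChart.corePt_eq ht t.2)
    have h1 : Ana (fun w : Fin k → ℂ => G (w, 0)) (a.base s₀ t) :=
      AnalyticAt.comp (g := G) (f := fun w : Fin k → ℂ => ((w, 0) : Amb k))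
        (e0 ▸ hG) (by fun_prop)
    refine AnalyticAt.congr h1 ?_
    have h2 : Tendsto (a.base s₀).symm (𝓝 (a.base s₀ t)) (𝓝 t) := (a.base s₀).tendsto_symm ht
    filter_upwards [h2.eventually he,
      h2.eventually (continuous_subtype_val.continuousAt.eventually hFG),
      (a.base s₀).open_target.eventually_mem ht'] with w k1 k2 k3
    rw [Function.comp_apply, k1, k2, a.base_symm s₀ k3, a.ψ.right_inv k3]
    rfl

end BaseChart

section Toric

variable {Y Z : Type u} [TopologicalSpace Y] [HolSpace Y] [TopologicalSpace Z] [HolSpace Z]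
  [T2Space Z] {n k : ℕ} {ψ : OPH Y (AModel n k)} {ρ : Z → Y}
  {θ : ℕ → OPH Z (Flat k)}

namespace IsToricCover

variable (hT : IsToricCover ψ ρ θ)
include hT

lemma analyticAt_pt {l : ℕ} (h1 : 1 ≤ l) (hl : l ≤ n) {q : Flat k}
    (hw : corePt n q.1 ∈ ψ.target) (hq : q.2 ≠ 0) {F : Z → ℂ} (hF : F ∈ 𝒪 (pt θ l q)) :
    Ana (fun q => F (pt θ l q)) q := by
  obtain ⟨w, x, y⟩ := q
  by_cases hy : y = 0
  · have hx : x ≠ 0 := fun hx => hq (by simp [hx, hy])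
    have ht := hT.target_b (i := l - 1) (by omega) hw (y / x)
    have h2 : Ana (F ∘ (θ (l - 1)).symm) (w, 0, y / x) := by
      refine ((hT.chart (l - 1) (by omega)).bihol.mem_symm ht (f := F)).1 ?_
      rwa [← hT.pt_of_left h1 hl hw hx]
    have h3 : Ana (fun q : Flat k => ((q.1, 0, q.2.2 / q.2.1) : Flat k)) (w, x, y) :=
      AnalyticAt.prod (by fun_prop) (AnalyticAt.prod (by fun_prop)
        (AnalyticAt.div (by fun_prop) (by fun_prop) hx))
    refine (AnalyticAt.comp (g := F ∘ (θ (l - 1)).symm)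
      (f := fun q : Flat k => ((q.1, 0, q.2.2 / q.2.1) : Flat k)) h2 h3).congr ?_
    have e1 : ∀ᶠ q : Flat k in 𝓝 (w, x, y), q.2.1 ≠ 0 :=
      (by fun_prop : ContinuousAt (fun q : Flat k => q.2.1) (w, x, y)).eventually_ne hx
    have e2 : ∀ᶠ q : Flat k in 𝓝 (w, x, y), corePt n q.1 ∈ ψ.target :=
      ((continuous_corePt n k).comp continuous_fst).continuousAt.eventually
        (ψ.open_target.mem_nhds hw)
    filter_upwards [e1, e2] with q k1 k2
    change F ((θ (l - 1)).symm _) = F (pt θ l (q.1, q.2.1, q.2.2))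
    rw [hT.pt_of_left h1 hl k2 k1]
  · have ht := hT.target_a h1 hl hw (x / y)
    have h2 : Ana (F ∘ (θ l).symm) (w, x / y, 0) := by
      refine ((hT.chart l hl).bihol.mem_symm ht (f := F)).1 ?_
      rwa [← pt_of_right hy]
    have h3 : Ana (fun q : Flat k => ((q.1, q.2.1 / q.2.2, 0) : Flat k)) (w, x, y) :=
      AnalyticAt.prod (by fun_prop) (AnalyticAt.prod
        (AnalyticAt.div (by fun_prop) (by fun_prop) hy) (by fun_prop))
    refine (AnalyticAt.comp (g := F ∘ (θ l).symm)
      (f := fun q : Flat k => ((q.1, q.2.1 / q.2.2, 0) : Flat k)) h2 h3).congr ?_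
    have e1 : ∀ᶠ q : Flat k in 𝓝 (w, x, y), q.2.2 ≠ 0 :=
      (by fun_prop : ContinuousAt (fun q : Flat k => q.2.2) (w, x, y)).eventually_ne hy
    filter_upwards [e1] with q k1
    change F ((θ l).symm _) = F (pt θ l (q.1, q.2.1, q.2.2))
    rw [pt_of_right k1]

lemma corePt_mem_of_a {i : ℕ} (hi : i < n) {q : Z} (hq : q ∈ (θ i).source)
    (h0 : (θ i q).2.1 = 0) : corePt n (θ i q).1 ∈ ψ.target ∧ ψ (ρ q) = corePt n (θ i q).1 ∧
      q = pt θ (i + 1) ((θ i q).1, 1, (θ i q).2.2) := by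
  have e : θ i q = ((θ i q).1, 0, (θ i q).2.2) := Prod.ext rfl (Prod.ext h0 rfl)
  have h1 := (hT.chart i hi.le).comm q hq
  rw [e, tor_b hi] at h1
  have h2 : corePt n (θ i q).1 ∈ ψ.target := h1 ▸ ψ.map_source ((hT.chart i hi.le).maps q hq)
  refine ⟨h2, h1, ?_⟩
  rw [hT.pt_of_left (Nat.le_add_left 1 i) hi h2 one_ne_zero, div_one, Nat.add_sub_cancel, ← e,
    (θ i).left_inv hq]

lemma corePt_mem_of_b {i : ℕ} (h1 : 1 ≤ i) (hi : i ≤ n) {q : Z} (hq : q ∈ (θ i).source)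
    (h0 : (θ i q).2.2 = 0) : corePt n (θ i q).1 ∈ ψ.target ∧ ψ (ρ q) = corePt n (θ i q).1 ∧
      q = pt θ i ((θ i q).1, (θ i q).2.1, 1) := by
  have e : θ i q = ((θ i q).1, (θ i q).2.1, 0) := Prod.ext rfl (Prod.ext rfl h0)
  have h3 := (hT.chart i hi).comm q hq
  rw [e, tor_a h1 hi] at h3
  have h2 : corePt n (θ i q).1 ∈ ψ.target := h3 ▸ ψ.map_source ((hT.chart i hi).maps q hq)
  refine ⟨h2, h3, ?_⟩
  rw [pt_of_right one_ne_zero, div_one, ← e, (θ i).left_inv hq]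

end IsToricCover

end Toric

section Model

variable {Y Z : Type u} [TopologicalSpace Y] [HolSpace Y] [TopologicalSpace Z] [HolSpace Z]
  [T2Space Z] {n k : ℕ} {ρ : HolMap Z Y} {𝒜 : Set (AChart n k Y)}
  {Θ : AChart n k Y → ℕ → OPH Z (Flat k)} {m₁ m₂ : ℕ} {X : Set Z}

/-- `X` is the union of the components with numbers from `m₁` to `m₂`. -/
structure IsChain (ρ : HolMap Z Y) (𝒜 : Set (AChart n k Y))
    (Θ : AChart n k Y → ℕ → OPH Z (Flat k)) (m₁ m₂ : ℕ) (X : Set Z) : Prop where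
  atlas : IsToricAtlas ρ 𝒜 Θ
  one_le : 1 ≤ m₁
  le : m₁ ≤ m₂
  le_n : m₂ ≤ n
  mem_iff : ∀ p, p ∈ X ↔ ∃ l, m₁ ≤ l ∧ l ≤ m₂ ∧ p ∈ toricComp ρ 𝒜 Θ l

namespace IsChain

variable (h : IsChain ρ 𝒜 Θ m₁ m₂ X) {a : AChart n k Y} (ha : a ∈ 𝒜)
  (hT : IsToricCover a.ψ ρ.toFun (Θ a))
include h ha hT

lemma mem_chart {i : ℕ} (hi : i ≤ n) {q : Z} (hq : q ∈ (Θ a i).source) :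
    q ∈ X ↔ (m₁ ≤ i + 1 ∧ i + 1 ≤ m₂ ∧ (Θ a i q).2.1 = 0) ∨
      (m₁ ≤ i ∧ i ≤ m₂ ∧ (Θ a i q).2.2 = 0) := by
  have h1 := h.one_le
  have h2 := h.le_n
  have hqa := (hT.chart i hi).maps q hq
  rw [h.mem_iff]
  constructor
  · rintro ⟨l, g1, g2, g3⟩
    have := (h.atlas.mem_comp_iff (by omega) (by omega) ha g3.1 hqa hi hq).1 g3
    grind
  · have hS (e : a.ψ (ρ q) = corePt n (Θ a i q).1) : ρ q ∈ Sing k Y :=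
      (a.core _ hqa).2 (by rw [e]; rfl)
    rintro (⟨g1, g2, g3⟩ | ⟨g1, g2, g3⟩)
    · exact ⟨i + 1, g1, g2, (h.atlas.mem_comp_iff (by omega) (by omega) ha
        (hS (hT.corePt_mem_of_a (by omega) hq g3).2.1) hqa hi hq).2 (Or.inl ⟨rfl, g3⟩)⟩
    · exact ⟨i, g1, g2, (h.atlas.mem_comp_iff (by omega) (by omega) ha
        (hS (hT.corePt_mem_of_b (by omega) hi hq g3).2.1) hqa hi hq).2 (Or.inr ⟨rfl, g3⟩)⟩

/-- The three local forms of `X` in a toric chart. -/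
lemma local_form {i : ℕ} (hi : i ≤ n) {x : Z} (hx : x ∈ (Θ a i).source) (hxX : x ∈ X) :
    (m₁ ≤ i + 1 ∧ i + 1 ≤ m₂ ∧ (∀ᶠ q in 𝓝 x, q ∈ X ↔ (Θ a i q).2.1 = 0) ∧
      (i + 1 = m₁ ∨ (Θ a i x).2.2 ≠ 0)) ∨
    (m₁ ≤ i ∧ i ≤ m₂ ∧ (∀ᶠ q in 𝓝 x, q ∈ X ↔ (Θ a i q).2.2 = 0) ∧
      (i = m₂ ∨ (Θ a i x).2.1 ≠ 0)) ∨
    (m₁ ≤ i ∧ i + 1 ≤ m₂ ∧ (∀ᶠ q in 𝓝 x, q ∈ X ↔ (Θ a i q).2.1 * (Θ a i q).2.2 = 0) ∧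
      (Θ a i x).2.1 = 0 ∧ (Θ a i x).2.2 = 0) := by
  have hle := h.le
  have hs := (Θ a i).open_source.eventually_mem hx
  have hc := (Θ a i).continuousAt hx
  have hx' := (h.mem_chart ha hT hi hx).1 hxX
  by_cases hlo : i + 1 = m₁
  · left
    refine ⟨by omega, by omega, ?_, Or.inl hlo⟩
    filter_upwards [hs] with q hq
    rw [h.mem_chart ha hT hi hq]
    grind
  by_cases hup : i = m₂
  · right; left
    refine ⟨by omega, by omega, ?_, Or.inl hup⟩
    filter_upwards [hs] with q hq
    rw [h.mem_chart ha hT hi hq]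
    grind
  have hb1 : m₁ ≤ i := by omega
  have hb2 : i + 1 ≤ m₂ := by omega
  have hmem : ∀ᶠ q in 𝓝 x, q ∈ X ↔ (Θ a i q).2.1 * (Θ a i q).2.2 = 0 := by
    filter_upwards [hs] with q hq
    rw [h.mem_chart ha hT hi hq, mul_eq_zero]
    grind
  by_cases ha0 : (Θ a i x).2.1 = 0
  · by_cases hb0 : (Θ a i x).2.2 = 0
    · exact Or.inr (Or.inr ⟨hb1, hb2, hmem, ha0, hb0⟩)
    · left
      refine ⟨by omega, hb2, ?_, Or.inr hb0⟩
      filter_upwards [hmem, hc.snd.snd.eventually_ne hb0] with q g1 g2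
      rw [g1, mul_eq_zero, or_iff_left g2]
  · right; left
    refine ⟨hb1, by omega, ?_, Or.inr ha0⟩
    filter_upwards [hmem, hc.snd.fst.eventually_ne ha0] with q g1 g2
    rw [g1, mul_eq_zero, or_iff_right g2]

end IsChain
lemma eventually_subtype {Z : Type*} [TopologicalSpace Z] {X : Set Z} {x : X} {p : X → Prop}
    (h : ∀ᶠ y in 𝓝 x, p y) : ∀ᶠ z in 𝓝 (x : Z), ∀ hz : z ∈ X, p ⟨z, hz⟩ := by
  rw [nhds_subtype_eq_comap] at h
  exact (eventually_comap.1 h).mono fun z hz hzX => hz ⟨z, hzX⟩ rfl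

lemma IsBihol.continuousAt_flat {Z : Type u} [TopologicalSpace Z] [HolSpace Z] {k : ℕ}
    {θ : OPH Z (Flat k)} (hb : IsBihol θ) {x : Z} (hx : x ∈ θ.source) {f : Z → ℂ}
    (hf : f ∈ 𝒪 x) : Ana (f ∘ θ.symm) (θ x) ∧ ContinuousAt f x := by
  have h1 : Ana (f ∘ θ.symm) (θ x) := by
    have := (hb.mem_symm (θ.map_source hx) (f := f)).1 (by rw [θ.left_inv hx]; exact hf)
    exact this
  have h2 : ContinuousAt ((f ∘ θ.symm) ∘ θ) x := h1.continuousAt.comp (θ.continuousAt hx)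
  refine ⟨h1, h2.congr ?_⟩
  filter_upwards [θ.open_source.eventually_mem hx] with y hy
  simp [θ.left_inv hy]

/-- The homogeneous coordinates as points of `X`. -/
def chainPt (x₀ : X) (θ : ℕ → OPH Z (Flat k)) (l : ℕ) (q : Flat k) : X :=
  open Classical in if h : pt θ l q ∈ X then ⟨pt θ l q, h⟩ else x₀

lemma chainPt_coe {x₀ : X} {θ : ℕ → OPH Z (Flat k)} {l : ℕ} {q : Flat k}
    (h : pt θ l q ∈ X) : (chainPt x₀ θ l q : Z) = pt θ l q := by
  rw [chainPt, dif_pos h]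

/-- The value of a normal vector on the coordinate `z`. -/
def zetaFun (ρ : HolMap Z Y) (a : AChart n k Y) (x : X) : (normalSheaf X).Fib x →ₗ[ℂ] ℂ where
  toFun c := c.1 (zfun a ρ.toFun)
  map_add' _ _ := rfl
  map_smul' _ _ := rfl

namespace IsChain

variable (h : IsChain ρ 𝒜 Θ m₁ m₂ X) {a : AChart n k Y} (ha : a ∈ 𝒜)
  (hT : IsToricCover a.ψ ρ.toFun (Θ a)) {x₀ : X}
include h ha hT

omit hT in
lemma pt_mem {l : ℕ} (h1 : m₁ ≤ l) (h2 : l ≤ m₂) {w : Fin k → ℂ} (hw : corePt n w ∈ a.ψ.target)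
    {v : ℂ × ℂ} (hv : v ≠ 0) : pt (Θ a) l (w, v) ∈ X :=
  (h.mem_iff _).2 ⟨l, h1, h2, h.atlas.pt_mem (h.one_le.trans h1) (h2.trans h.le_n) ha hw hv⟩

omit hT in
lemma coe_chainPt {l : ℕ} (h1 : m₁ ≤ l) (h2 : l ≤ m₂) {w : Fin k → ℂ}
    (hw : corePt n w ∈ a.ψ.target) {v : ℂ × ℂ} (hv : v ≠ 0) :
    (chainPt x₀ (Θ a) l (w, v) : Z) = pt (Θ a) l (w, v) :=
  chainPt_coe (h.pt_mem ha h1 h2 hw hv)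

omit hT in
lemma eventually_coe {l : ℕ} (h1 : m₁ ≤ l) (h2 : l ≤ m₂) {w : Fin k → ℂ}
    (hw : corePt n w ∈ a.ψ.target) {v : ℂ × ℂ} (hv : v ≠ 0) :
    ∀ᶠ q in 𝓝 ((w, v) : Flat k), (chainPt x₀ (Θ a) l q : Z) = pt (Θ a) l q := by
  have e1 : ∀ᶠ q : Flat k in 𝓝 (w, v), corePt n q.1 ∈ a.ψ.target :=
    ((continuous_corePt n k).comp continuous_fst).continuousAt.eventually
      (a.ψ.open_target.mem_nhds hw)
  have e2 : ∀ᶠ q : Flat k in 𝓝 (w, v), q.2 ≠ 0 :=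
    continuous_snd.continuousAt.eventually_ne hv
  filter_upwards [e1, e2] with q k1 k2
  exact h.coe_chainPt ha h1 h2 k1 k2

lemma continuousAt_chainPt {l : ℕ} (h1 : m₁ ≤ l) (h2 : l ≤ m₂) {w : Fin k → ℂ}
    (hw : corePt n w ∈ a.ψ.target) {v : ℂ × ℂ} (hv : v ≠ 0) :
    ContinuousAt (chainPt x₀ (Θ a) l) (w, v) := by
  rw [IsInducing.subtypeVal.continuousAt_iff]
  exact (hT.continuousAt_pt (h.one_le.trans h1) (h2.trans h.le_n) (q := (w, v)) hw hv).congr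
    ((h.eventually_coe ha h1 h2 hw hv).mono fun q hq => hq.symm)

lemma chainPt_of_a {i : ℕ} (h1 : m₁ ≤ i + 1) (h2 : i + 1 ≤ m₂) {y : X} (hy : (y : Z) ∈ (Θ a i).source)
    (h0 : (Θ a i y).2.1 = 0) : y = chainPt x₀ (Θ a) (i + 1) ((Θ a i y).1, 1, (Θ a i y).2.2) := by
  have h3 := h.le_n
  obtain ⟨g1, -, g2⟩ := hT.corePt_mem_of_a (by omega) hy h0
  refine Subtype.ext (g2.trans (h.coe_chainPt ha h1 h2 g1 ?_).symm)
  exact fun h => one_ne_zero (congrArg Prod.fst h)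

lemma chainPt_of_b {i : ℕ} (h1 : m₁ ≤ i) (h2 : i ≤ m₂) {y : X} (hy : (y : Z) ∈ (Θ a i).source)
    (h0 : (Θ a i y).2.2 = 0) : y = chainPt x₀ (Θ a) i ((Θ a i y).1, (Θ a i y).2.1, 1) := by
  obtain ⟨g1, -, g2⟩ := hT.corePt_mem_of_b (h.one_le.trans h1) (h2.trans h.le_n) hy h0
  refine Subtype.ext (g2.trans (h.coe_chainPt ha h1 h2 g1 ?_).symm)
  exact fun h => one_ne_zero (congrArg Prod.snd h)

/-- A function on `X` is holomorphic if it is so on the lines. -/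
lemma mem_hol_iff {x : X} (hxa : ρ x ∈ a.ψ.source) (f : X → ℂ) : f ∈ 𝒪 x ↔ ∀ l, m₁ ≤ l → l ≤ m₂ →
    ∀ v : ℂ × ℂ, v ≠ 0 → x = chainPt x₀ (Θ a) l ((a.ψ (ρ x)).1.1, v) →
      Ana (fun q => f (chainPt x₀ (Θ a) l q)) ((a.ψ (ρ x)).1.1, v) := by
  have hxS : ρ x ∈ Sing k Y := by
    obtain ⟨l, -, -, hl⟩ := (h.mem_iff x).1 x.2
    exact hl.1
  have hwx := AChart.corePt_mem hxa hxS
  have hval := continuous_subtype_val.continuousAt (x := x)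
  constructor
  · rintro ⟨F, hF, he⟩ l h1 h2 v hv hx
    have e := h.coe_chainPt (x₀ := x₀) ha h1 h2 hwx hv
    rw [← hx] at e
    have h3 : Ana (fun q => F (pt (Θ a) l q)) ((a.ψ (ρ x)).1.1, v) :=
      hT.analyticAt_pt (h.one_le.trans h1) (h2.trans h.le_n) hwx hv (by rw [← e]; exact hF)
    refine h3.congr ?_
    have hc : Tendsto (chainPt x₀ (Θ a) l) (𝓝 ((a.ψ (ρ x)).1.1, v)) (𝓝 x) := by
      have := (h.continuousAt_chainPt (x₀ := x₀) ha hT h1 h2 hwx hv).tendsto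
      rwa [← hx] at this
    filter_upwards [hc.eventually he, h.eventually_coe (x₀ := x₀) ha h1 h2 hwx hv] with q k1 k2
    rw [k1, k2]
  · intro hall
    obtain ⟨i, hi, hxi⟩ := hT.cover x hxa
    have hb := (hT.chart i hi).bihol
    have hfst : (Θ a i x).1 = (a.ψ (ρ x)).1.1 := hT.fst_eq hi hxi
    have hsrc : ∀ᶠ y : X in 𝓝 x, (y : Z) ∈ (Θ a i).source :=
      hval.eventually ((Θ a i).open_source.mem_nhds hxi)
    have gA : m₁ ≤ i + 1 → i + 1 ≤ m₂ → (Θ a i x).2.1 = 0 → Ana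
        (fun q : Flat k => f (chainPt x₀ (Θ a) (i + 1) (q.1, 1, q.2.2))) (Θ a i x) := by
      intro h1 h2 h0
      have e := h.chainPt_of_a (x₀ := x₀) ha hT h1 h2 hxi h0
      rw [hfst] at e
      have := hall (i + 1) h1 h2 (1, (Θ a i x).2.2)
        (fun h => one_ne_zero (congrArg Prod.fst h)) e
      rw [← hfst] at this
      exact AnalyticAt.comp (g := fun q => f (chainPt x₀ (Θ a) (i + 1) q))
        (f := fun q : Flat k => ((q.1, 1, q.2.2) : Flat k)) this (by fun_prop)
    have gB : m₁ ≤ i → i ≤ m₂ → (Θ a i x).2.2 = 0 → Ana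
        (fun q : Flat k => f (chainPt x₀ (Θ a) i (q.1, q.2.1, 1))) (Θ a i x) := by
      intro h1 h2 h0
      have e := h.chainPt_of_b (x₀ := x₀) ha hT h1 h2 hxi h0
      rw [hfst] at e
      have := hall i h1 h2 ((Θ a i x).2.1, 1)
        (fun h => one_ne_zero (congrArg Prod.snd h)) e
      rw [← hfst] at this
      exact AnalyticAt.comp (g := fun q => f (chainPt x₀ (Θ a) i q))
        (f := fun q : Flat k => ((q.1, q.2.1, 1) : Flat k)) this (by fun_prop)
    rcases h.local_form ha hT hi hxi x.2 with ⟨h1, h2, h3, -⟩ | ⟨h1, h2, h3, -⟩ | ⟨h1, h2, h3, h4, h5⟩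
    · refine ⟨_, (hb x hxi _).1 (gA h1 h2 (h3.self_of_nhds.1 x.2)), ?_⟩
      filter_upwards [hval.eventually h3, hsrc] with y k1 k2
      rw [Function.comp_apply, ← h.chainPt_of_a ha hT h1 h2 k2 (k1.1 y.2)]
    · refine ⟨_, (hb x hxi _).1 (gB h1 h2 (h3.self_of_nhds.1 x.2)), ?_⟩
      filter_upwards [hval.eventually h3, hsrc] with y k1 k2
      rw [Function.comp_apply, ← h.chainPt_of_b ha hT h1 h2 k2 (k1.1 y.2)]
    · have g3 : Ana (fun q : Flat k => f (chainPt x₀ (Θ a) i (q.1, 0, 1))) (Θ a i x) := by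
        have := gB h1 (by omega) h5
        refine AnalyticAt.comp (g := fun q : Flat k => f (chainPt x₀ (Θ a) i (q.1, q.2.1, 1)))
          (f := fun q : Flat k => ((q.1, 0, 0) : Flat k)) ?_ (by fun_prop)
        have e : Θ a i x = ((Θ a i x).1, 0, 0) := Prod.ext rfl (Prod.ext h4 h5)
        rw [← e]
        exact this
      refine ⟨_, (hb x hxi _).1 (((gA (by omega) h2 h4).add (gB h1 (by omega) h5)).sub g3), ?_⟩
      filter_upwards [hval.eventually h3, hsrc] with y k1 k2
      simp only [Function.comp_apply, Pi.add_apply, Pi.sub_apply]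
      have hn := h.le_n
      have hnode : ∀ w, corePt n w ∈ a.ψ.target →
          chainPt x₀ (Θ a) i (w, 0, 1) = chainPt x₀ (Θ a) (i + 1) (w, 1, 0) := by
        intro w hw
        refine Subtype.ext ?_
        rw [h.coe_chainPt ha h1 (by omega) hw (by simp), h.coe_chainPt ha (by omega) h2 hw (by simp)]
        exact hT.pt_node (by omega) hw
      rcases mul_eq_zero.1 (k1.1 y.2) with h0 | h0
      · rw [← h.chainPt_of_a ha hT (by omega) h2 k2 h0, h0]
        ring
      · have hw := (hT.corePt_mem_of_b (h.one_le.trans h1) hi k2 h0).1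
        rw [← h.chainPt_of_b ha hT h1 (by omega) k2 h0, h0, hnode _ hw]
        ring

lemma exists_local_eq {x : X} (hxa : ρ x ∈ a.ψ.source) : ∃ e u : Z → ℂ, IsLocalEq X x e ∧
    u ∈ 𝒪 (x : Z) ∧ (∀ᶠ y in 𝓝 (x : Z), zfun a ρ.toFun y = u y * e y) ∧
    (∃ᶠ y : X in 𝓝 x, u y ≠ 0) ∧ ∀ f : X → ℂ, f ∈ 𝒪 x →
      (∀ᶠ y : X in 𝓝 x, y = chainPt x₀ (Θ a) m₁ ((a.ψ (ρ y)).1.1, 1, 0) → f y = 0) →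
      (∀ᶠ y : X in 𝓝 x, y = chainPt x₀ (Θ a) m₂ ((a.ψ (ρ y)).1.1, 0, 1) → f y = 0) →
      ∃ g ∈ 𝒪 x, ∀ᶠ y : X in 𝓝 x, f y = u y * g y := by
  have hval := continuous_subtype_val.continuousAt (x := x)
  obtain ⟨i, hi, hxi⟩ := hT.cover x hxa
  set θ := Θ a i with hθ
  have hb : IsBihol θ := (hT.chart i hi).bihol
  have hs := θ.open_source.eventually_mem hxi
  have hz : ∀ᶠ y in 𝓝 (x : Z), zfun a ρ.toFun y = (θ y).2.1 * (θ y).2.2 :=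
    hs.mono fun y hy => hT.zfun_eq hi hy
  have tsymm : Tendsto θ.symm (𝓝 (θ x)) (𝓝 (x : Z)) := θ.tendsto_symm hxi
  have hdiv : ∀ (d : Flat k → Flat k) (c : Flat k → ℂ), (∀ q, Ana d q) →
      (∀ q, d (d q) = d q) → (∀ q, c (d q) = c q) → (∀ᶠ y in 𝓝 (x : Z), y ∈ X ↔ d (θ y) = θ y) →
      (∀ H, Ana H (θ x) → (∀ᶠ q in 𝓝 (θ x), c q = 0 → H q = 0) →
        ∃ H₁, Ana H₁ (θ x) ∧ ∀ᶠ q in 𝓝 (θ x), H q = c q * H₁ q) →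
      ∀ f : X → ℂ, f ∈ 𝒪 x → (∀ᶠ y : X in 𝓝 x, c (θ y) = 0 → f y = 0) →
      ∃ g ∈ 𝒪 x, ∀ᶠ y : X in 𝓝 x, f y = c (θ y) * g y := by
    rintro d c hd hdd hcd hX hmul f ⟨F, hF, he⟩ h0
    have hdx := (hX.self_of_nhds).1 x.2
    have hG := (hb.continuousAt_flat hxi hF).1
    have td : Tendsto d (𝓝 (θ x)) (𝓝 (θ x)) := by
      simpa only [ContinuousAt, hdx] using (hd (θ x)).continuousAt
    have tX := tsymm.comp td
    obtain ⟨H, h1, h2⟩ := hmul (fun q => F (θ.symm (d q)))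
      (AnalyticAt.comp (g := F ∘ θ.symm) (f := d) (by rwa [hdx]) (hd _)) (by
        filter_upwards [tX.eventually (eventually_subtype h0), tX.eventually hX,
          tX.eventually (eventually_subtype he),
          td.eventually (θ.open_target.eventually_mem (θ.map_source hxi))] with q k1 k2 k3 k4 k5
        simp only [Function.comp_apply, θ.right_inv k4, hdd, iff_true] at k1 k2 k3
        rw [← k3 k2, k1 k2 (by rw [hcd, k5])])
    refine ⟨fun y => H (θ y), ⟨_, (hb x hxi H).1 h1, Eventually.of_forall fun _ => rfl⟩, ?_⟩
    filter_upwards [he, hval.eventually hs, hval.eventually hX,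
      hval.eventually ((θ.continuousAt hxi).eventually h2)] with y k1 k2 k3 k4
    rw [← k4, k3.1 y.2, θ.left_inv k2, k1]
  have hfreq : ∀ (d : Flat k → ℂ → Flat k) (p : Flat k → Prop), (∀ q, Continuous (d q)) →
      d (θ x) 0 = θ x → (∀ᶠ s in 𝓝[≠] (0 : ℂ), p (d (θ x) s)) →
      (∀ᶠ y in 𝓝 (x : Z), ∀ s, θ y = d (θ x) s → y ∈ X) → ∃ᶠ y : X in 𝓝 x, p (θ y) := by
    intro d p hd hd0 hp hX
    rw [nhds_subtype_eq_comap, frequently_comap]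
    have ht : Tendsto (fun s => d (θ x) s) (𝓝[≠] 0) (𝓝 (θ x)) :=
      ((hd _).tendsto' _ _ hd0).mono_left nhdsWithin_le_nhds
    refine (tsymm.comp ht).frequently (Eventually.frequently ?_)
    filter_upwards [hp, (tsymm.comp ht).eventually hX,
      ht.eventually (θ.open_target.eventually_mem (θ.map_source hxi))] with s k1 k2 k3
    have k4 : θ (θ.symm (d (θ x) s)) = d (θ x) s := θ.right_inv k3
    exact ⟨⟨_, k2 s k4⟩, rfl, by simpa [k4] using k1⟩
  rcases h.local_form ha hT hi hxi x.2 with ⟨h1, h2, h3, h4⟩ | ⟨h1, h2, h3, h4⟩ | ⟨h1, h2, h3, h4, h5⟩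
  · have hx0 : (θ x).2.1 = 0 := h3.self_of_nhds.1 x.2
    refine ⟨_, fun y => (θ y).2.2, isLocalEq_a hb hxi h3, (hb.mem_coord hxi).2,
      hz.mono fun y hy => by rw [hy, mul_comm],
      hfreq (fun q s => (q.1, q.2.1, q.2.2 + s)) (fun q => q.2.2 ≠ 0) (fun q => by fun_prop)
        (by simp) (eventually_add_ne _) (h3.mono fun y hy s hs => hy.2 (by rw [hs]; exact hx0)),
      fun f hf hst _ => hdiv (fun q => (q.1, 0, q.2.2)) (fun q => q.2.2) (fun q => by fun_prop)
        (fun _ => rfl) (fun _ => rfl)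
        (h3.mono fun y hy => hy.trans ⟨fun e => Prod.ext rfl (Prod.ext e.symm rfl),
          fun e => (congrArg (·.2.1) e).symm⟩)
        (fun _ => exists_eq_mul_b) f hf ?_⟩
    rcases h4 with h4 | h4
    · filter_upwards [hst, hval.eventually h3, hval.eventually hs] with y k1 k2 k3 k4
      refine k1 ((h.chainPt_of_a (x₀ := x₀) ha hT h1 h2 k3 (k2.1 y.2)).trans ?_)
      rw [← hθ, k4, h4, show (θ y).1 = _ from hT.fst_eq hi k3]
    · filter_upwards [hval.eventually ((θ.continuousAt hxi).snd.snd.eventually_ne h4)]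
        with y k1 k2
      exact absurd k2 k1
  · have hx0 : (θ x).2.2 = 0 := h3.self_of_nhds.1 x.2
    refine ⟨_, fun y => (θ y).2.1, isLocalEq_b hb hxi h3, (hb.mem_coord hxi).1,
      hz, hfreq (fun q s => (q.1, q.2.1 + s, q.2.2)) (fun q => q.2.1 ≠ 0) (fun q => by fun_prop)
        (by simp) (eventually_add_ne _) (h3.mono fun y hy s hs => hy.2 (by rw [hs]; exact hx0)),
      fun f hf _ hst => hdiv (fun q => (q.1, q.2.1, 0)) (fun q => q.2.1) (fun q => by fun_prop)
        (fun _ => rfl) (fun _ => rfl)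
        (h3.mono fun y hy => hy.trans ⟨fun e => Prod.ext rfl (Prod.ext rfl e.symm),
          fun e => (congrArg (·.2.2) e).symm⟩)
        (fun _ => exists_eq_mul_a) f hf ?_⟩
    rcases h4 with h4 | h4
    · filter_upwards [hst, hval.eventually h3, hval.eventually hs] with y k1 k2 k3 k4
      refine k1 ((h.chainPt_of_b (x₀ := x₀) ha hT h1 h2 k3 (k2.1 y.2)).trans ?_)
      rw [← hθ, k4, h4, show (θ y).1 = _ from hT.fst_eq hi k3]
    · filter_upwards [hval.eventually ((θ.continuousAt hxi).snd.fst.eventually_ne h4)]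
        with y k1 k2
      exact absurd k2 k1
  · exact ⟨_, 1, isLocalEq_ab hb hxi h3, one_mem _, hz.mono fun y hy => by simp [hy],
      Eventually.frequently (Eventually.of_forall fun y => one_ne_zero),
      fun f hf _ _ => ⟨f, hf, Eventually.of_forall fun y => by simp⟩⟩

/-- The chain model of `X` over a chart. -/
def model {S₀ : Sing k Y} (hS₀ : (S₀ : Y) ∈ a.ψ.source)
    (π : HolMap X (Sing k Y)) (hπ : ∀ x, ((π x : Sing k Y) : Y) = ρ x) :
    ChainModel π (normalSheaf X) k m₁ m₂ :=
  let x₀ : X := ⟨_, h.pt_mem ha le_rfl h.le (AChart.corePt_mem hS₀ S₀.2)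
    (show ((1, 0) : ℂ × ℂ) ≠ 0 by simp)⟩
  have hκ : ∀ x : X, a.base S₀ (π x) = (a.ψ (ρ x)).1.1 := fun x => by
    rw [← hπ x]; rfl
  have hsrc : ∀ x : X, π x ∈ (a.base S₀).source → ρ x ∈ a.ψ.source := fun x hx => by
    rw [← hπ x]; exact hx
  { κ := a.base S₀
    P := chainPt x₀ (Θ a)
    ζ := zetaFun ρ a
    bihol := a.isBihol_base S₀
    le := h.le
    map_P := by
      intro l h1 h2 w hw v hv
      obtain ⟨g1, g2⟩ := hT.map_pt (h.one_le.trans h1) (h2.trans h.le_n) (q := (w, v)) hw hv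
      refine Subtype.ext ?_
      rw [hπ, h.coe_chainPt ha h1 h2 hw hv, a.base_symm S₀ hw]
      rw [← a.ψ.left_inv g1]
      exact congrArg _ g2
    smul_P := by
      intro l h1 h2 w hw x y c hc
      have e : pt (Θ a) l (w, c * x, c * y) = pt (Θ a) l (w, x, y) := pt_smul hc
      rw [chainPt, chainPt]
      split_ifs with k1 k2 k2
      · exact Subtype.ext e
      · exact absurd (e ▸ k1) k2
      · exact absurd (e ▸ k2) k1
      · rfl
    node_P := by
      intro l h1 h2 w hw
      have hn := h.le_n
      refine Subtype.ext ?_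
      rw [h.coe_chainPt ha h1 (by omega) hw (by simp), h.coe_chainPt ha (by omega) h2 hw (by simp)]
      exact hT.pt_node (by omega) hw
    exists_P := by
      intro x hx
      obtain ⟨l, h1, h2, h3⟩ := (h.mem_iff x).1 x.2
      obtain ⟨v, hv, he⟩ := h.atlas.exists_of_mem (h.one_le.trans h1) (h2.trans h.le_n) h3 ha
        (hsrc x hx)
      refine ⟨l, h1, h2, v, hv, Subtype.ext ?_⟩
      rw [hκ, h.coe_chainPt ha h1 h2 (AChart.corePt_mem (hsrc x hx) h3.1) hv]
      exact he
    P_eq := by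
      intro l l' h1 h2 h3 w hw v v' hv hv' he
      have := congrArg Subtype.val he
      rw [h.coe_chainPt ha h1 (h2.trans h3) hw hv, h.coe_chainPt ha (h1.trans h2) h3 hw hv'] at this
      exact (hT.pt_eq_pt (h.one_le.trans h1) h2 (h3.trans h.le_n)
        (q := (w, v)) (q' := (w, v')) hw hw hv hv' this).2
    continuousAt_P := fun l h1 h2 w hw v hv => h.continuousAt_chainPt ha hT h1 h2 hw hv
    hol_iff := by
      intro x hx f
      rw [hκ]
      exact h.mem_hol_iff ha hT (hsrc x hx) f
    ζ_hol := by
      intro x hx σ hσ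
      refine hσ _ ⟨zfun_mem (hsrc x hx), ?_⟩
      have := ρ.continuous_toFun.continuousAt.eventually (a.ψ.open_source.eventually_mem (hsrc x hx))
      filter_upwards [this] with y hy hyX
      obtain ⟨l, -, -, hl⟩ := (h.mem_iff y).1 hyX
      exact zfun_eq_zero hy hl.1
    ζ_start := by
      intro w hw c
      have h1 := h.one_le
      have hn := h.le.trans h.le_n
      obtain ⟨g1, g2⟩ := hT.pt_mem_left h1 hn hw (x := 1) (y := 0) one_ne_zero
      rw [← h.coe_chainPt (x₀ := x₀) ha le_rfl h.le hw (by simp)] at g1 g2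
      have hi : m₁ - 1 ≤ n := by omega
      have hs := (Θ a (m₁ - 1)).open_source.eventually_mem g1
      obtain ⟨ma, mb⟩ := (hT.chart _ hi).bihol.mem_coord g1
      refine (normalFib_mul c.2 mb ⟨ma, hs.mono fun q hq hqX => ?_⟩ (hs.mono fun q hq =>
        (hT.zfun_eq hi hq).trans (mul_comm _ _))).trans (by rw [g2]; simp)
      rcases (h.mem_chart ha hT hi hq).1 hqX with k1 | k1
      exacts [k1.2.2, by omega]
    ζ_end := by
      intro w hw c
      obtain ⟨g1, g2⟩ := hT.pt_mem_right (h.one_le.trans h.le) h.le_n hw (x := 0) (y := 1)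
        one_ne_zero
      rw [← h.coe_chainPt (x₀ := x₀) ha h.le le_rfl hw (by simp)] at g1 g2
      have hs := (Θ a m₂).open_source.eventually_mem g1
      obtain ⟨ma, mb⟩ := (hT.chart _ h.le_n).bihol.mem_coord g1
      refine (normalFib_mul c.2 ma ⟨mb, hs.mono fun q hq hqX => ?_⟩ (hs.mono fun q hq =>
        hT.zfun_eq h.le_n hq)).trans (by rw [g2]; simp)
      rcases (h.mem_chart ha hT h.le_n hq).1 hqX with k1 | k1
      exacts [by omega, k1.2.2]
    eq_zero := by
      intro x hx σ hσ h0
      obtain ⟨e, u, h1, h2, h3, h4, -⟩ := h.exists_local_eq (x₀ := x₀) ha hT (hsrc x hx)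
      obtain ⟨i, hi, hxi⟩ := hT.cover x (hsrc x hx)
      refine h1.eq_zero h2 h3 h4 ?_ hσ h0
      rintro f ⟨F, hF, he⟩
      exact (((hT.chart i hi).bihol.continuousAt_flat hxi hF).2.comp
        continuous_subtype_val.continuousAt).congr (he.mono fun y hy => hy.symm)
    exists_section := by
      intro x hx f hf hst hen
      obtain ⟨e, u, h1, h2, h3, -, h5⟩ := h.exists_local_eq (x₀ := x₀) ha hT (hsrc x hx)
      obtain ⟨i, hi, hxi⟩ := hT.cover x (hsrc x hx)
      obtain ⟨g, hg, hfg⟩ := h5 f hf (hst.mono fun y hy => by rwa [hκ] at hy)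
        (hen.mono fun y hy => by rwa [hκ] at hy)
      refine h1.exists_section ?_ h2 h3 hg hfg
      filter_upwards [(Θ a i).open_source.eventually_mem hxi] with y hy f hf
      exact ((hT.chart i hi).bihol.continuousAt_flat hy hf).2 }

end IsChain
end Model

/-! ### Functions and cocycles on chains of projective lines -/

lemma exists_scale {v v' : ℂ × ℂ} (hv : v ≠ 0) (hv' : v' ≠ 0) (h : v.1 * v'.2 = v.2 * v'.1) :
    ∃ c : ℂ, c ≠ 0 ∧ v' = (c * v.1, c * v.2) := by
  obtain ⟨x, y⟩ := v
  obtain ⟨x', y'⟩ := v'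
  simp only at h
  by_cases hx : x = 0
  · have hy : y ≠ 0 := fun hy => hv (by simp [hx, hy])
    have hx' : x' = 0 := by simpa [hx, hy] using h
    have hy' : y' ≠ 0 := fun hy' => hv' (by simp [hx', hy'])
    exact ⟨y' / y, div_ne_zero hy' hy, Prod.ext (by simp [hx, hx']) (by simp [hy])⟩
  · have hx' : x' ≠ 0 := fun hx' => hv' (by simpa [hx', hx] using h)
    refine ⟨x' / x, div_ne_zero hx' hx, Prod.ext (by simp [hx]) ?_⟩
    simp only
    field_simp
    linear_combination h

/-- A function that is entire in both affine coordinates of the projective line is constant. -/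
lemma eq_of_entire {f g : ℂ → ℂ} (hf : ∀ a, Ana f a) (hg : ∀ b, Ana g b)
    (h : ∀ a, a ≠ 0 → f a = g a⁻¹) : f 0 = g 0 := by
  have cf : Continuous f := continuous_iff_continuousAt.2 fun a => (hf a).continuousAt
  have cg : Continuous g := continuous_iff_continuousAt.2 fun a => (hg a).continuousAt
  obtain ⟨A, hA⟩ := (isCompact_closedBall (0 : ℂ) 1).exists_bound_of_continuousOn cf.continuousOn
  obtain ⟨B, hB⟩ := (isCompact_closedBall (0 : ℂ) 1).exists_bound_of_continuousOn cg.continuousOn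
  have hbd : Bornology.IsBounded (range f) := by
    rw [isBounded_iff_forall_norm_le]
    refine ⟨max A B, ?_⟩
    rintro _ ⟨a, rfl⟩
    by_cases ha : ‖a‖ ≤ 1
    · exact (hA a (by simpa using ha)).trans (le_max_left _ _)
    · push Not at ha
      have ha0 : a ≠ 0 := fun h0 => by rw [h0, norm_zero] at ha; linarith
      rw [h a ha0]
      refine (hB _ ?_).trans (le_max_right _ _)
      simp only [mem_closedBall_zero_iff, norm_inv]
      exact inv_le_one_of_one_le₀ ha.le
  have hd : Differentiable ℂ f := fun a => (hf a).differentiableAt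
  have hconst : ∀ b, b ≠ 0 → g b = f 0 := fun b hb => by
    rw [hd.apply_eq_apply_of_bounded hbd 0 b⁻¹, h _ (inv_ne_zero hb), inv_inv]
  refine tendsto_nhds_unique (f := g) (l := 𝓝[≠] 0) (tendsto_const_nhds.congr' ?_)
    (cg.continuousAt.tendsto.mono_left nhdsWithin_le_nhds)
  filter_upwards [self_mem_nhdsWithin] with b hb
  exact (hconst b hb).symm

namespace ChainModel

variable {X S : Type u} [TopologicalSpace X] [HolSpace X] [TopologicalSpace S] [HolSpace S]
  {π : HolMap X S} {F : ValSheaf X} {k m₁ m₂ : ℕ} (M : ChainModel π F k m₁ m₂)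

/-- Functions on the lines that agree at the nodes define a function on the chain. -/
lemma glue (g : ℕ → Flat k → ℂ)
    (hs : ∀ l, m₁ ≤ l → l ≤ m₂ → ∀ w ∈ M.κ.target, ∀ x y c : ℂ, c ≠ 0 →
      g l (w, c * x, c * y) = g l (w, x, y))
    (hnode : ∀ l, m₁ ≤ l → l + 1 ≤ m₂ → ∀ w ∈ M.κ.target, g l (w, 0, 1) = g (l + 1) (w, 1, 0)) :
    ∃ G : X → ℂ, ∀ l, m₁ ≤ l → l ≤ m₂ → ∀ w ∈ M.κ.target, ∀ v : ℂ × ℂ, v ≠ 0 →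
      G (M.P l (w, v)) = g l (w, v) := by
  choose! L i1 i2 V hV hLV using M.exists_P
  refine ⟨fun x => g (L x) (M.κ (π x), V x), fun l h1 h2 w hw v hv => ?_⟩
  have hπ := M.map_P l h1 h2 w hw v hv
  have hκ : M.κ (π (M.P l (w, v))) = w := by rw [hπ, M.κ.right_inv hw]
  have hS : π (M.P l (w, v)) ∈ M.κ.source := by rw [hπ]; exact M.κ.map_target hw
  have k4 := hLV _ hS
  simp only [hκ] at k4 ⊢
  have key : ∀ l l' (v v' : ℂ × ℂ), m₁ ≤ l → l ≤ l' → l' ≤ m₂ → v ≠ 0 → v' ≠ 0 →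
      M.P l (w, v) = M.P l' (w, v') → g l (w, v) = g l' (w, v') := by
    intro l l' v v' i1 i2 i3 hv hv' he
    rcases M.P_eq l l' i1 i2 i3 w hw v v' hv hv' he with ⟨rfl, h⟩ | ⟨rfl, h, h'⟩
    · obtain ⟨c, hc, rfl⟩ := exists_scale hv hv' h
      exact (hs l i1 i3 w hw _ _ c hc).symm
    · obtain ⟨x, y⟩ := v
      obtain ⟨x', y'⟩ := v'
      simp only at h h'
      subst h h'
      have e1 := hs l i1 (by omega) w hw 0 1 y (fun h => hv (by simp [h]))
      have e2 := hs (l + 1) (by omega) i3 w hw 1 0 x' (fun h => hv' (by simp [h]))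
      simp only [mul_zero, mul_one] at e1 e2
      rw [e1, e2, hnode l i1 i3 w hw]
  rcases le_total l (L (M.P l (w, v))) with hle | hle
  · exact (key _ _ _ _ h1 hle (i2 _ hS) hv (hV _ hS) k4).symm
  · exact key _ _ _ _ (i1 _ hS) hle h2 (hV _ hS) hv k4.symm

/-- A function that is holomorphic on a fibre has the same values at the two ends. -/
lemma eq_ends {w : Fin k → ℂ} (hw : w ∈ M.κ.target) {g : X → ℂ}
    (hg : ∀ l, m₁ ≤ l → l ≤ m₂ → ∀ v : ℂ × ℂ, v ≠ 0 →
      Ana (fun v => g (M.P l (w, v))) v) :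
    g (M.P m₁ (w, 1, 0)) = g (M.P m₂ (w, 0, 1)) := by
  have hline : ∀ l, m₁ ≤ l → l ≤ m₂ → g (M.P l (w, 0, 1)) = g (M.P l (w, 1, 0)) := by
    intro l h1 h2
    refine eq_of_entire (f := fun a => g (M.P l (w, a, 1))) (g := fun b => g (M.P l (w, 1, b)))
      (fun a => ?_) (fun b => ?_) fun a ha => ?_
    · exact AnalyticAt.comp (g := fun v : ℂ × ℂ => g (M.P l (w, v))) (f := fun a : ℂ => (a, 1))
        (hg l h1 h2 (a, 1) (by simp)) (by fun_prop)
    · exact AnalyticAt.comp (g := fun v : ℂ × ℂ => g (M.P l (w, v))) (f := fun b : ℂ => (1, b))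
        (hg l h1 h2 (1, b) (by simp)) (by fun_prop)
    · have := M.smul_P l h1 h2 w hw 1 a⁻¹ a ha
      rw [mul_one, mul_inv_cancel₀ ha] at this
      rw [this]
  have key : ∀ d, m₁ + d ≤ m₂ → g (M.P m₁ (w, 1, 0)) = g (M.P (m₁ + d) (w, 0, 1)) := by
    intro d
    induction d with
    | zero => exact fun h => (hline m₁ le_rfl h).symm
    | succ d ih =>
      intro h
      rw [ih (by omega), M.node_P (m₁ + d) (by omega) h w hw]
      exact (hline (m₁ + (d + 1)) (by omega) h).symm
  have := key (m₂ - m₁) (by have := M.le; omega)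
  rwa [Nat.add_sub_cancel' M.le] at this

variable {M} {l : ℕ} {w : Fin k → ℂ} {v : ℂ × ℂ} {f : X → ℂ}

lemma κ_map_P (h1 : m₁ ≤ l) (h2 : l ≤ m₂) (hw : w ∈ M.κ.target) (hv : v ≠ 0) :
    π (M.P l (w, v)) ∈ M.κ.source ∧ M.κ (π (M.P l (w, v))) = w := by
  rw [M.map_P l h1 h2 w hw v hv]
  exact ⟨M.κ.map_target hw, M.κ.right_inv hw⟩

lemma analyticAt_of_mem (h1 : m₁ ≤ l) (h2 : l ≤ m₂) (hw : w ∈ M.κ.target) (hv : v ≠ 0)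
    (hf : f ∈ 𝒪 (M.P l (w, v))) :
    Ana (fun q => f (M.P l q)) (w, v) := by
  obtain ⟨g1, g2⟩ := κ_map_P h1 h2 hw hv
  have := (M.hol_iff _ g1 f).1 hf l h1 h2 v hv (by rw [g2])
  rwa [g2] at this

lemma analyticAt_fibre (h1 : m₁ ≤ l) (h2 : l ≤ m₂) (hw : w ∈ M.κ.target) (hv : v ≠ 0)
    (hf : f ∈ 𝒪 (M.P l (w, v))) :
    Ana (fun v => f (M.P l (w, v))) v :=
  AnalyticAt.comp (g := fun q => f (M.P l q)) (f := fun v : ℂ × ℂ => ((w, v) : Flat k))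
    (analyticAt_of_mem h1 h2 hw hv hf) (by fun_prop)

lemma tendsto_fibre (h1 : m₁ ≤ l) (h2 : l ≤ m₂) (hw : w ∈ M.κ.target) (hv : v ≠ 0) :
    Tendsto (fun v => M.P l (w, v)) (𝓝 v) (𝓝 (M.P l (w, v))) :=
  (M.continuousAt_P l h1 h2 w hw v hv).tendsto.comp
    (Continuous.tendsto' (by fun_prop : Continuous fun v : ℂ × ℂ => ((w, v) : Flat k)) _ _ rfl)

variable (M)

/-- A splitting of the cocycle `ζ c` on the fibre over `t`, with the difference `r` of its values at
the ends. -/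
def IsRes (c : X → X → ∀ x, F.Fib x) (t : S) (r : ℂ) : Prop :=
  ∃ (𝒰 : X → Set X) (B : X → X → ℂ), (∀ p, π p = t → IsOpen (𝒰 p) ∧ p ∈ 𝒰 p) ∧
    (∀ p, π p = t → ∀ l, m₁ ≤ l → l ≤ m₂ → ∀ v : ℂ × ℂ, v ≠ 0 → M.P l (M.κ t, v) ∈ 𝒰 p →
      Ana (fun v => B p (M.P l (M.κ t, v))) v) ∧
    (∀ p q, π p = t → π q = t → ∀ x ∈ 𝒰 p ∩ 𝒰 q, π x = t → M.ζ x (c p q x) = B q x - B p x) ∧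
    r = B (M.P m₂ (M.κ t, 0, 1)) (M.P m₂ (M.κ t, 0, 1)) -
      B (M.P m₁ (M.κ t, 1, 0)) (M.P m₁ (M.κ t, 1, 0))

variable {M} {c c' : X → X → ∀ x, F.Fib x} {t : S} {r r' : ℂ}

lemma IsRes.add (h : M.IsRes c t r) (h' : M.IsRes c' t r') : M.IsRes (c + c') t (r + r') := by
  obtain ⟨𝒰, B, h1, h2, h3, rfl⟩ := h
  obtain ⟨𝒱, B', h1', h2', h3', rfl⟩ := h'
  refine ⟨fun p => 𝒰 p ∩ 𝒱 p, B + B', fun p hp => ⟨(h1 p hp).1.inter (h1' p hp).1, (h1 p hp).2,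
    (h1' p hp).2⟩, fun p hp l i1 i2 v hv hm => (h2 p hp l i1 i2 v hv hm.1).add
      (h2' p hp l i1 i2 v hv hm.2), fun p q hp hq x hx ht => ?_, ?_⟩
  · simp only [Pi.add_apply, map_add, h3 p q hp hq x ⟨hx.1.1, hx.2.1⟩ ht,
      h3' p q hp hq x ⟨hx.1.2, hx.2.2⟩ ht]
    ring
  · simp only [Pi.add_apply]
    ring

lemma IsRes.smul (h : M.IsRes c t r) (f : S → ℂ) :
    M.IsRes (fun p q x => f (π x) • c p q x) t (f t * r) := by
  obtain ⟨𝒰, B, h1, h2, h3, rfl⟩ := h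
  refine ⟨𝒰, fun p x => f t * B p x, h1, fun p hp l i1 i2 v hv hm =>
    analyticAt_const.mul (h2 p hp l i1 i2 v hv hm), fun p q hp hq x hx ht => ?_, ?_⟩
  · rw [map_smul, h3 p q hp hq x hx ht, ht, smul_eq_mul, mul_sub]
  · rw [mul_sub]

lemma IsRes.unique (ht : t ∈ M.κ.source) (h : M.IsRes c t r) (h' : M.IsRes c t r') : r = r' := by
  obtain ⟨𝒰, B, h1, h2, h3, rfl⟩ := h
  obtain ⟨𝒱, B', h1', h2', h3', rfl⟩ := h'
  have hw := M.κ.map_source ht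
  have hπ : ∀ l, m₁ ≤ l → l ≤ m₂ → ∀ v : ℂ × ℂ, v ≠ 0 → π (M.P l (M.κ t, v)) = t := by
    intro l i1 i2 v hv
    rw [M.map_P l i1 i2 _ hw v hv, M.κ.left_inv ht]
  have := M.eq_ends hw (g := fun x => B x x - B' x x) fun l i1 i2 v hv => by
    have hp := hπ l i1 i2 v hv
    refine ((h2 _ hp l i1 i2 v hv (h1 _ hp).2).sub
      (h2' _ hp l i1 i2 v hv (h1' _ hp).2)).congr ?_
    filter_upwards [(tendsto_fibre i1 i2 hw hv).eventually ((h1 _ hp).1.mem_nhds (h1 _ hp).2),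
      (tendsto_fibre i1 i2 hw hv).eventually ((h1' _ hp).1.mem_nhds (h1' _ hp).2),
      continuousAt_id.eventually_ne hv] with v' k1 k2 k3
    have hx := hπ l i1 i2 v' k3
    have e1 := h3 _ _ hp hx _ ⟨k1, (h1 _ hx).2⟩ hx
    have e2 := h3' _ _ hp hx _ ⟨k2, (h1' _ hx).2⟩ hx
    simp only [Pi.sub_apply]
    linear_combination e1 - e2
  linear_combination -this

lemma isRes_of_splitting {V : Set S} (htV : t ∈ V) (ht : t ∈ M.κ.source) {𝒰 : X → Set X}
    (h𝒰 : ∀ p, π p ∈ V → IsOpen (𝒰 p) ∧ p ∈ 𝒰 p) {B : X → X → ℂ}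
    (hB : ∀ p, π p ∈ V → ∀ x ∈ 𝒰 p, π x ∈ V → B p ∈ 𝒪 x)
    (hc : ∀ p q, π p ∈ V → π q ∈ V → ∀ x ∈ 𝒰 p ∩ 𝒰 q, π x ∈ V →
      M.ζ x (c p q x) = B q x - B p x) :
    M.IsRes c t (B (M.P m₂ (M.κ t, 0, 1)) (M.P m₂ (M.κ t, 0, 1)) -
      B (M.P m₁ (M.κ t, 1, 0)) (M.P m₁ (M.κ t, 1, 0))) := by
  have hV : ∀ {p}, π p = t → π p ∈ V := fun hp => by rw [hp]; exact htV
  have hw := M.κ.map_source ht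
  refine ⟨𝒰, B, fun p hp => h𝒰 p (hV hp), fun p hp l i1 i2 v hv hm => ?_,
    fun p q hp hq x hx hxt => hc p q (hV hp) (hV hq) x hx (hV hxt), rfl⟩
  refine analyticAt_fibre i1 i2 hw hv (hB p (hV hp) _ hm (hV ?_))
  rw [M.map_P l i1 i2 _ hw v hv, M.κ.left_inv ht]

lemma isRes_zero_of_isCoboundary {U : Set S} (htU : t ∈ U) (ht : t ∈ M.κ.source)
    (h : IsCoboundary F (π.toFun ⁻¹' U) c) : M.IsRes c t 0 := by
  obtain ⟨𝒰, h𝒰, b, h1, h2⟩ := h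
  have hw := M.κ.map_source ht
  have := isRes_of_splitting (M := M) (V := U ∩ M.κ.source) (B := fun p x => M.ζ x (b p x))
    (c := c) ⟨htU, ht⟩ ht (fun p hp => ⟨(h𝒰 p hp.1).1, (h𝒰 p hp.1).2.1⟩)
    (fun p hp x hx hxV => M.ζ_hol x hxV.2 _ (h1 p hp.1 x hx))
    (fun p q hp hq x hx _ => by rw [h2 p hp.1 q hq.1 x hx, map_sub])
  rwa [M.ζ_end _ hw, M.ζ_start _ hw, sub_zero] at this

lemma eq_of_ζ {x : X} (hx : π x ∈ M.κ.source) {σ τ : ∀ x, F.Fib x} (hσ : F.Hol x σ)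
    (hτ : F.Hol x τ) (h : ∀ᶠ y in 𝓝 x, M.ζ y (σ y) = M.ζ y (τ y)) : σ x = τ x := by
  have h1 := F.hol_add hσ (F.hol_smul (-1) (neg_mem (one_mem _)) hτ)
  have h2 := M.eq_zero x hx _ h1 (h.mono fun y hy => by simp [hy])
  simpa [sub_eq_zero, ← sub_eq_add_neg] using h2

/-- Holomorphic functions that vanish on the end sections are values of sections. -/
lemma exists_section_on {O : Set X} (hO : IsOpen O) (hOκ : ∀ x ∈ O, π x ∈ M.κ.source) {f : X → ℂ}
    (hf : ∀ x ∈ O, f ∈ 𝒪 x) (h0 : ∀ x ∈ O, x = M.P m₁ (M.κ (π x), 1, 0) → f x = 0)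
    (h1 : ∀ x ∈ O, x = M.P m₂ (M.κ (π x), 0, 1) → f x = 0) :
    ∃ σ : ∀ x, F.Fib x, ∀ x ∈ O, F.Hol x σ ∧ M.ζ x (σ x) = f x := by
  choose! σ hσ using fun x hx => M.exists_section x (hOκ x hx) f (hf x hx)
    ((hO.eventually_mem hx).mono fun y hy => h0 y hy)
    ((hO.eventually_mem hx).mono fun y hy => h1 y hy)
  refine ⟨fun x => σ x x, fun x hx => ⟨F.hol_congr (hσ x hx).self_of_nhds.1 ?_,
    (hσ x hx).self_of_nhds.2⟩⟩
  filter_upwards [(hσ x hx).eventually_nhds, hO.eventually_mem hx] with y k1 k2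
  refine eq_of_ζ (hOκ y k2) k1.self_of_nhds.1 (hσ y k2).self_of_nhds.1 ?_
  filter_upwards [k1, hσ y k2] with z e1 e2
  rw [e1.2, e2.2]

/-- A cocycle of holomorphic functions on `π⁻¹(U)`. -/
structure IsHolCocycle (π : HolMap X S) (U : Set S) (𝒰 : X → Set X) (u : X → X → X → ℂ) : Prop where
  isOpen : IsOpen U
  cover : IsNhdCover (π.toFun ⁻¹' U) 𝒰
  hol : ∀ p q, π p ∈ U → π q ∈ U → ∀ x ∈ 𝒰 p ∩ 𝒰 q, u p q ∈ 𝒪 x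
  cocycle : ∀ p q r, π p ∈ U → π q ∈ U → π r ∈ U → ∀ x ∈ 𝒰 p ∩ 𝒰 q ∩ 𝒰 r,
    u p q x + u q r x = u p r x

variable {U : Set S} {𝒰 : X → Set X} {u : X → X → X → ℂ} {s : S}

lemma splits_line (h : IsHolCocycle π U 𝒰 u) (hs : s ∈ U) (hs' : s ∈ M.κ.source) {l : ℕ}
    (i1 : m₁ ≤ l) (i2 : l ≤ m₂) {γ : ℂ → ℂ × ℂ} (hγ : ∀ a, Ana γ a) (hγ0 : ∀ a, γ a ≠ 0) :
    ∃ T ⊆ M.κ.target ∩ M.κ.symm ⁻¹' U, IsOpen T ∧ M.κ s ∈ T ∧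
      ∃ b : X → (Fin k → ℂ) × ℂ → ℂ,
      (∀ p, π p ∈ U → ∀ w ∈ T, ∀ a, ‖a‖ < 2 → M.P l (w, γ a) ∈ 𝒰 p → Ana (b p) (w, a)) ∧
      ∀ p q, π p ∈ U → π q ∈ U → ∀ w ∈ T, ∀ a, ‖a‖ < 2 → M.P l (w, γ a) ∈ 𝒰 p ∩ 𝒰 q →
        u p q (M.P l (w, γ a)) = b q (w, a) - b p (w, a) := by
  set T₀ := M.κ.target ∩ M.κ.symm ⁻¹' U with hT₀
  have hT₀o : IsOpen T₀ := M.κ.symm.isOpen_inter_preimage h.isOpen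
  have hma : ∀ q, Ana (fun q : (Fin k → ℂ) × ℂ => ((q.1, γ q.2) : Flat k)) q :=
    fun q => analyticAt_fst.prod ((hγ _).comp analyticAt_snd)
  have hcont : ContinuousOn (fun q : (Fin k → ℂ) × ℂ => M.P l (q.1, γ q.2)) (T₀ ×ˢ univ) :=
    fun q hq => (ContinuousAt.comp (g := M.P l) (f := fun q : (Fin k → ℂ) × ℂ =>
      ((q.1, γ q.2) : Flat k)) (M.continuousAt_P l i1 i2 q.1 hq.1.1 _ (hγ0 _))
      (hma q).continuousAt).continuousWithinAt
  have hπ : ∀ q : (Fin k → ℂ) × ℂ, q ∈ T₀ ×ˢ (univ : Set ℂ) → π (M.P l (q.1, γ q.2)) ∈ U := by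
    intro q hq
    rw [M.map_P l i1 i2 q.1 hq.1.1 _ (hγ0 _)]
    exact hq.1.2
  have hc : IsAnalyticCocycle (ι := {p // π p ∈ U}) (T₀ ×ˢ univ)
      (fun p => T₀ ×ˢ univ ∩ (fun q : (Fin k → ℂ) × ℂ => M.P l (q.1, γ q.2)) ⁻¹' 𝒰 p)
      (fun p q z => u p q (M.P l (z.1, γ z.2))) :=
    { isOpen := hT₀o.prod isOpen_univ
      open_cover := fun p => hcont.isOpen_inter_preimage (hT₀o.prod isOpen_univ) (h.cover p p.2).1
      cover := fun q hq => ⟨⟨_, hπ q hq⟩, hq, (h.cover _ (hπ q hq)).2.1⟩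
      analytic := fun p p' q hq => by
        exact AnalyticAt.comp (g := fun z => u p p' (M.P l z)) (f := fun q : (Fin k → ℂ) × ℂ =>
          ((q.1, γ q.2) : Flat k)) (analyticAt_of_mem i1 i2 hq.2.1.1 (hγ0 _)
            (h.hol p p' p.2 p'.2 _ ⟨hq.1.1.2, hq.1.2.2⟩)) (hma q)
      cocycle := fun p p' p'' q hq => h.cocycle p p' p'' p.2 p'.2 p''.2 _
        ⟨⟨hq.1.1.1.2, hq.1.1.2.2⟩, hq.1.2.2⟩ }
  have hs0 : M.κ s ∈ T₀ := ⟨M.κ.map_source hs', by rw [mem_preimage, M.κ.left_inv hs']; exact hs⟩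
  obtain ⟨T, hT, hsT, b, hb1, hb2⟩ := hc.splits_disc (e := M.κ s)
    (by rintro ⟨w, a⟩ ⟨hw, -⟩; exact ⟨by rw [hw]; exact hs0, trivial⟩) 2
  classical
  refine ⟨T ∩ T₀, inter_subset_right, hT.inter hT₀o, ⟨hsT, hs0⟩,
    fun p z => if hp : π p ∈ U then b ⟨p, hp⟩ z else 0, fun p hp w hw a ha hm => ?_,
    fun p q hp hq w hw a ha hm => ?_⟩
  · simp only [dif_pos hp]
    exact hb1 ⟨p, hp⟩ w hw.1 a ha ⟨⟨hw.2, trivial⟩, hm⟩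
  · simp only [dif_pos hp, dif_pos hq]
    exact hb2 ⟨p, hp⟩ ⟨q, hq⟩ w hw.1 a ha ⟨⟨hw.2, trivial⟩, hm.1⟩ ⟨⟨hw.2, trivial⟩, hm.2⟩

lemma splits_proj (h : IsHolCocycle π U 𝒰 u) (hs : s ∈ U) (hs' : s ∈ M.κ.source) {l : ℕ}
    (i1 : m₁ ≤ l) (i2 : l ≤ m₂) :
    ∃ T ⊆ M.κ.target ∩ M.κ.symm ⁻¹' U, IsOpen T ∧ M.κ s ∈ T ∧ ∃ g : X → Flat k → ℂ,
      (∀ p w x y c, c ≠ 0 → g p (w, c * x, c * y) = g p (w, x, y)) ∧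
      (∀ p, π p ∈ U → ∀ w ∈ T, ∀ v : ℂ × ℂ, v ≠ 0 → M.P l (w, v) ∈ 𝒰 p →
        Ana (g p) (w, v)) ∧
      ∀ p q, π p ∈ U → π q ∈ U → ∀ w ∈ T, ∀ v : ℂ × ℂ, v ≠ 0 → M.P l (w, v) ∈ 𝒰 p ∩ 𝒰 q →
        u p q (M.P l (w, v)) = g q (w, v) - g p (w, v) := by
  obtain ⟨T₁, hT₁s, hT₁, hs₁, b₁, hb₁, hb₁'⟩ := splits_line h hs hs' i1 i2
    (γ := fun a => (a, 1)) (fun a => by fun_prop) (by simp)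
  obtain ⟨T₂, hT₂s, hT₂, hs₂, b₂, hb₂, hb₂'⟩ := splits_line h hs hs' i1 i2
    (γ := fun a => (1, a)) (fun a => by fun_prop) (by simp)
  have hκ : ∀ {w}, w ∈ T₁ → w ∈ M.κ.target := fun hw => (hT₁s hw).1
  have hP₁ : ∀ {w}, w ∈ T₁ → ∀ x y : ℂ, y ≠ 0 → M.P l (w, x, y) = M.P l (w, x / y, 1) := by
    intro w hw x y hy
    have := M.smul_P l i1 i2 w (hκ hw) (x / y) 1 y hy
    rwa [mul_div_cancel₀ _ hy, mul_one] at this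
  have hP₂ : ∀ {w}, w ∈ T₁ → ∀ x y : ℂ, x ≠ 0 → M.P l (w, x, y) = M.P l (w, 1, y / x) := by
    intro w hw x y hx
    have := M.smul_P l i1 i2 w (hκ hw) 1 (y / x) x hx
    rwa [mul_div_cancel₀ _ hx, mul_one] at this
  have hP₃ : ∀ {w}, w ∈ T₁ → ∀ a : ℂ, a ≠ 0 → M.P l (w, 1, a⁻¹) = M.P l (w, a, 1) := by
    intro w hw a ha
    rw [hP₂ hw a 1 ha, one_div]
  have hU : ∀ {w}, w ∈ T₁ → ∀ v : ℂ × ℂ, v ≠ 0 → π (M.P l (w, v)) ∈ U := by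
    intro w hw v hv
    rw [M.map_P l i1 i2 w (hκ hw) v hv]
    exact (hT₁s hw).2
  set f : (Fin k → ℂ) × ℂ → ℂ := fun q =>
    b₁ (M.P l (q.1, q.2, 1)) q - b₂ (M.P l (q.1, q.2, 1)) (q.1, q.2⁻¹) with hf
  have hA : ∀ {a : ℂ}, 1 / 2 < ‖a‖ → a ≠ 0 ∧ ‖a⁻¹‖ < 2 := fun h =>
    ⟨norm_pos_iff.1 (by linarith), by rw [norm_inv]; exact inv_lt_of_inv_lt₀ (by linarith) (by linarith)⟩
  have hfp : ∀ p, π p ∈ U → ∀ w ∈ T₁ ∩ T₂, ∀ a : ℂ, 1 / 2 < ‖a‖ → ‖a‖ < 2 →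
      M.P l (w, a, 1) ∈ 𝒰 p → f (w, a) = b₁ p (w, a) - b₂ p (w, a⁻¹) := by
    intro p hp w hw a h1 h2 hm
    obtain ⟨ha, hinv⟩ := hA h1
    have hq := hU hw.1 (a, 1) (by simp)
    have hm' : M.P l (w, a, 1) ∈ 𝒰 p ∩ 𝒰 (M.P l (w, a, 1)) := ⟨hm, (h.cover _ hq).2.1⟩
    have e1 := hb₁' p _ hp hq w hw.1 a h2 hm'
    have e2 := hb₂' p _ hp hq w hw.2 a⁻¹ hinv (by rw [hP₃ hw.1 a ha]; exact hm')
    rw [hP₃ hw.1 a ha] at e2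
    simp only [hf]
    linear_combination e2 - e1
  obtain ⟨f₁, f₂, hf₁, hf₂, hff⟩ := laurent_splitting (T := T₁ ∩ T₂) (f := f) (by
    intro w hw a h1 h2
    obtain ⟨ha, hinv⟩ := hA h1
    have hp := hU hw.1 (a, 1) (by simp)
    set p := M.P l (w, a, 1) with hpd
    have hpm : p ∈ 𝒰 p := (h.cover _ hp).2.1
    have a1 := hb₁ p hp w hw.1 a h2 hpm
    have a2 := hb₂ p hp w hw.2 a⁻¹ hinv (by rw [hP₃ hw.1 a ha]; exact hpm)
    have a3 : Ana (fun q : (Fin k → ℂ) × ℂ => (q.1, q.2⁻¹)) (w, a) :=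
      analyticAt_fst.prod (analyticAt_snd.inv ha)
    refine (a1.sub (AnalyticAt.comp (g := b₂ p)
      (f := fun q : (Fin k → ℂ) × ℂ => (q.1, q.2⁻¹)) a2 a3)).congr ?_
    have hc : Tendsto (fun q : (Fin k → ℂ) × ℂ => M.P l (q.1, q.2, 1)) (𝓝 (w, a)) (𝓝 p) :=
      (M.continuousAt_P l i1 i2 w (hκ hw.1) (a, 1) (by simp)).tendsto.comp
        (Continuous.tendsto' (by fun_prop) _ _ rfl)
    have hn : Tendsto (fun q : (Fin k → ℂ) × ℂ => ‖q.2‖) (𝓝 (w, a)) (𝓝 ‖a‖) :=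
      Continuous.tendsto' (by fun_prop) _ _ rfl
    filter_upwards [hc.eventually ((h.cover _ hp).1.mem_nhds hpm), hn.eventually_const_lt h1,
      hn.eventually_lt_const h2, continuous_fst.continuousAt.eventually
        ((hT₁.inter hT₂).mem_nhds hw)] with q k1 k2 k3 k4
    exact (hfp p hp q.1 k4 q.2 k2 k3 k1).symm)
  classical
  set g : X → Flat k → ℂ := fun p q =>
    if ‖q.2.1‖ ≤ ‖q.2.2‖ then b₁ p (q.1, q.2.1 / q.2.2) - f₁ (q.1, q.2.1 / q.2.2)
    else b₂ p (q.1, q.2.2 / q.2.1) + f₂ (q.1, q.2.2 / q.2.1) with hg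
  refine ⟨T₁ ∩ T₂, inter_subset_left.trans hT₁s, hT₁.inter hT₂, ⟨hs₁, hs₂⟩, g, ?_, ?_, ?_⟩
  · intro p w x y c hc
    have hc' : 0 < ‖c‖ := norm_pos_iff.2 hc
    simp only [hg, norm_mul, mul_div_mul_left _ _ hc, mul_le_mul_iff_right₀ hc']
  · rintro p hp w hw ⟨x, y⟩ hv hm
    have hTe : ∀ᶠ q : Flat k in 𝓝 (w, x, y), q.1 ∈ T₁ ∩ T₂ :=
      continuous_fst.continuousAt.eventually ((hT₁.inter hT₂).mem_nhds hw)
    have hPe : ∀ᶠ q : Flat k in 𝓝 (w, x, y), M.P l q ∈ 𝒰 p :=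
      (M.continuousAt_P l i1 i2 w (hκ hw.1) _ hv).eventually ((h.cover _ hp).1.mem_nhds hm)
    by_cases hlt : ‖x‖ < 3 / 2 * ‖y‖
    · have hy : y ≠ 0 := norm_pos_iff.1 (by linarith [norm_nonneg x])
      have hlt' : ∀ᶠ q : Flat k in 𝓝 (w, x, y), ‖q.2.1‖ < 3 / 2 * ‖q.2.2‖ :=
        ContinuousAt.eventually_lt (by fun_prop) (by fun_prop) hlt
      have hn : ‖x / y‖ < 3 / 2 := by
        rw [norm_div, div_lt_iff₀ (norm_pos_iff.2 hy)]; exact hlt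
      have ad : Ana (fun q : Flat k => (q.1, q.2.1 / q.2.2)) (w, x, y) :=
        analyticAt_fst.prod (AnalyticAt.div (by fun_prop) (by fun_prop) hy)
      have a1 := hb₁ p hp w hw.1 (x / y) (by linarith) (by rw [← hP₁ hw.1 x y hy]; exact hm)
      refine (AnalyticAt.comp (g := fun z => b₁ p z - f₁ z)
        (f := fun q : Flat k => (q.1, q.2.1 / q.2.2)) (a1.sub (hf₁ w hw _ hn)) ad).congr ?_
      filter_upwards [hTe, hPe, hlt'] with q k1 k2 k3
      simp only [hg, Function.comp_apply]
      split_ifs with k4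
      · rfl
      · push Not at k4
        have hyp : 0 < ‖q.2.2‖ := by linarith [norm_nonneg q.2.1]
        have hy' := norm_pos_iff.1 hyp
        have n1 : 1 < ‖q.2.1 / q.2.2‖ := by rw [norm_div, one_lt_div hyp]; exact k4
        have n2 : ‖q.2.1 / q.2.2‖ < 3 / 2 := by rw [norm_div, div_lt_iff₀ hyp]; exact k3
        have e1 := hff q.1 k1 (q.2.1 / q.2.2) (by linarith) n2
        rw [hfp p hp q.1 k1 _ (by linarith) (by linarith) (by
          rw [← hP₁ k1.1 _ _ hy']; exact k2), inv_div] at e1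
        linear_combination e1
    · have hx : x ≠ 0 := fun h0 => by
        rw [h0, norm_zero] at hlt
        have : ‖y‖ ≤ 0 := by linarith
        exact hv (by rw [h0, norm_le_zero_iff.1 this]; rfl)
      have hxp := norm_pos_iff.2 hx
      have hlt0 : ‖y‖ < ‖x‖ := by linarith [norm_nonneg y]
      have hlt' : ∀ᶠ q : Flat k in 𝓝 (w, x, y), ‖q.2.2‖ < ‖q.2.1‖ :=
        ContinuousAt.eventually_lt (by fun_prop) (by fun_prop) hlt0
      have hn : ‖y / x‖ < 1 := by rw [norm_div, div_lt_one hxp]; exact hlt0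
      have ad : Ana (fun q : Flat k => (q.1, q.2.2 / q.2.1)) (w, x, y) :=
        analyticAt_fst.prod (AnalyticAt.div (by fun_prop) (by fun_prop) hx)
      have a1 := hb₂ p hp w hw.2 (y / x) (by linarith) (by rw [← hP₂ hw.1 x y hx]; exact hm)
      refine (AnalyticAt.comp (g := fun z => b₂ p z + f₂ z)
        (f := fun q : Flat k => (q.1, q.2.2 / q.2.1))
        (a1.add (hf₂ w hw _ (by linarith))) ad).congr ?_
      filter_upwards [hlt'] with q k1
      simp only [hg, Function.comp_apply, if_neg (not_le.2 k1)]
  · rintro p q hp hq w hw ⟨x, y⟩ hv hm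
    by_cases hle : ‖x‖ ≤ ‖y‖
    · have hy : y ≠ 0 := fun h0 => by
        rw [h0, norm_zero] at hle
        exact hv (by rw [h0, norm_le_zero_iff.1 hle]; rfl)
      have hn : ‖x / y‖ ≤ 1 := by rw [norm_div, div_le_one (norm_pos_iff.2 hy)]; exact hle
      rw [hP₁ hw.1 x y hy] at hm ⊢
      simp only [hg, if_pos hle]
      rw [hb₁' p q hp hq w hw.1 (x / y) (by linarith) hm]
      ring
    · have hlt := not_le.1 hle
      have hx : x ≠ 0 := norm_pos_iff.1 (by linarith [norm_nonneg y])
      have hn : ‖y / x‖ < 1 := by rw [norm_div, div_lt_one (norm_pos_iff.2 hx)]; exact hlt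
      rw [hP₂ hw.1 x y hx] at hm ⊢
      simp only [hg, if_neg hle]
      rw [hb₂' p q hp hq w hw.2 (y / x) (by linarith) hm]
      ring

variable {U : Set S} {𝒰 : X → Set X} {u : X → X → X → ℂ} {s : S}

/-- Splittings on the lines, adjusted such that they agree at the nodes. -/
lemma splits_lines (h : IsHolCocycle π U 𝒰 u) (hs : s ∈ U) (hs' : s ∈ M.κ.source) (m : ℕ)
    (i1 : m₁ ≤ m) (i2 : m ≤ m₂) :
    ∃ T ⊆ M.κ.target ∩ M.κ.symm ⁻¹' U, IsOpen T ∧ M.κ s ∈ T ∧ ∃ g : ℕ → X → Flat k → ℂ,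
      (∀ l, m₁ ≤ l → l ≤ m → ∀ p w x y c, c ≠ 0 → g l p (w, c * x, c * y) = g l p (w, x, y)) ∧
      (∀ l, m₁ ≤ l → l ≤ m → ∀ p, π p ∈ U → ∀ w ∈ T, ∀ v : ℂ × ℂ, v ≠ 0 → M.P l (w, v) ∈ 𝒰 p →
        Ana (g l p) (w, v)) ∧
      (∀ l, m₁ ≤ l → l ≤ m → ∀ p q, π p ∈ U → π q ∈ U → ∀ w ∈ T, ∀ v : ℂ × ℂ, v ≠ 0 →
        M.P l (w, v) ∈ 𝒰 p ∩ 𝒰 q → u p q (M.P l (w, v)) = g l q (w, v) - g l p (w, v)) ∧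
      ∀ l, m₁ ≤ l → l + 1 ≤ m → ∀ p, π p ∈ U → ∀ w ∈ T, M.P l (w, 0, 1) ∈ 𝒰 p →
        g l p (w, 0, 1) = g (l + 1) p (w, 1, 0) := by
  induction m, i1 using Nat.le_induction with
  | base =>
    obtain ⟨T, hT, hTo, hsT, g, g1, g2, g3⟩ := splits_proj h hs hs' le_rfl i2
    refine ⟨T, hT, hTo, hsT, fun _ => g, fun l j1 j2 => g1, fun l j1 j2 => ?_, fun l j1 j2 => ?_,
      fun l j1 j2 => by omega⟩
    · rwa [le_antisymm j2 j1]
    · rwa [le_antisymm j2 j1]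
  | succ m j1 ih =>
    obtain ⟨T, hT, hTo, hsT, g, g1, g2, g3, g4⟩ := ih (by omega)
    obtain ⟨T', hT', hTo', hsT', g', g1', g2', g3'⟩ := splits_proj h hs hs' (j1.trans m.le_succ) i2
    have hU : ∀ {w}, w ∈ T → π (M.P m (w, 0, 1)) ∈ U := fun {w} hw => by
      rw [M.map_P m j1 (by omega) w (hT hw).1 _ (by simp)]
      exact (hT hw).2
    have hN : ∀ {w}, w ∈ T → M.P m (w, 0, 1) = M.P (m + 1) (w, 1, 0) := fun {w} hw =>
      M.node_P m j1 i2 w (hT hw).1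
    set d : X → (Fin k → ℂ) → ℂ := fun p w => g' p (w, 1, 0) - g m p (w, 0, 1) with hd
    have hdp : ∀ p q, π p ∈ U → π q ∈ U → ∀ w ∈ T ∩ T', M.P m (w, 0, 1) ∈ 𝒰 p ∩ 𝒰 q →
        d p w = d q w := by
      intro p q hp hq w hw hm
      have e1 := g3 m j1 le_rfl p q hp hq w hw.1 (0, 1) (by simp) hm
      have e2 := g3' p q hp hq w hw.2 (1, 0) (by simp) (by rwa [← hN hw.1])
      rw [← hN hw.1, e1] at e2
      simp only [hd]
      linear_combination e2
    have hda : ∀ w ∈ T ∩ T', Ana (fun w => d (M.P m (w, 0, 1)) w) w := by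
      intro w hw
      have hp := hU hw.1
      have hm := (h.cover _ hp).2.1
      have e1 : Ana (d (M.P m (w, 0, 1))) w := by
        refine AnalyticAt.sub ?_ ?_
        · exact AnalyticAt.comp (g := g' _) (f := fun w => ((w, 1, 0) : Flat k))
            (g2' _ hp w hw.2 (1, 0) (by simp) (by rwa [← hN hw.1])) (by fun_prop)
        · exact AnalyticAt.comp (g := g m _) (f := fun w => ((w, 0, 1) : Flat k))
            (g2 m j1 le_rfl _ hp w hw.1 (0, 1) (by simp) hm) (by fun_prop)
      refine e1.congr ?_
      have hc : ContinuousAt (fun w => M.P m (w, 0, 1)) w := ContinuousAt.comp (g := M.P m)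
        (M.continuousAt_P m j1 (by omega) w (hT hw.1).1 _ (by simp)) (by fun_prop)
      filter_upwards [hc.eventually ((h.cover _ hp).1.eventually_mem hm),
        (hTo.inter hTo').eventually_mem hw] with w' k1 k2
      exact hdp _ _ hp (hU k2.1) w' k2 ⟨k1, (h.cover _ (hU k2.1)).2.1⟩
    refine ⟨T ∩ T', inter_subset_left.trans hT, hTo.inter hTo', ⟨hsT, hsT'⟩,
      fun l p q => if l ≤ m then g l p q else g' p q - d (M.P m (q.1, 0, 1)) q.1, ?_, ?_, ?_, ?_⟩
    · intro l k1 k2 p w x y c hc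
      by_cases hl : l ≤ m
      · simp only [if_pos hl, g1 l k1 hl p w x y c hc]
      · simp only [if_neg hl, g1' p w x y c hc]
    · intro l k1 k2 p hp w hw v hv hm
      by_cases hl : l ≤ m
      · simp only [if_pos hl]
        exact g2 l k1 hl p hp w hw.1 v hv hm
      · simp only [if_neg hl]
        obtain rfl : l = m + 1 := by omega
        exact (g2' p hp w hw.2 v hv hm).sub (AnalyticAt.comp
          (g := fun w => d (M.P m (w, 0, 1)) w) (f := Prod.fst) (hda w hw) analyticAt_fst)
    · intro l k1 k2 p q hp hq w hw v hv hm
      by_cases hl : l ≤ m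
      · simp only [if_pos hl]
        exact g3 l k1 hl p q hp hq w hw.1 v hv hm
      · simp only [if_neg hl]
        obtain rfl : l = m + 1 := by omega
        rw [g3' p q hp hq w hw.2 v hv hm]
        ring
    · intro l k1 k2 p hp w hw hm
      by_cases hl : l + 1 ≤ m
      · simp only [if_pos hl, if_pos (show l ≤ m by omega)]
        exact g4 l k1 hl p hp w hw.1 hm
      · obtain rfl : l = m := by omega
        simp only [le_refl, if_true, if_neg hl]
        rw [hdp _ p (hU hw.1) hp w hw ⟨(h.cover _ (hU hw.1)).2.1, hm⟩]
        simp only [hd]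
        ring

/-- A cocycle of holomorphic functions splits locally over the base. -/
lemma exists_splitting (M : ChainModel π F k m₁ m₂) (h : IsHolCocycle π U 𝒰 u) (hs : s ∈ U)
    (hs' : s ∈ M.κ.source) :
    ∃ V ⊆ U ∩ M.κ.source, IsOpen V ∧ s ∈ V ∧ ∃ B : X → X → ℂ,
      (∀ p, π p ∈ V → ∀ x ∈ 𝒰 p, π x ∈ V → B p ∈ 𝒪 x) ∧
      ∀ p q, π p ∈ V → π q ∈ V → ∀ x ∈ 𝒰 p ∩ 𝒰 q, π x ∈ V → u p q x = B q x - B p x := by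
  obtain ⟨T, hT, hTo, hsT, g, g1, g2, g3, g4⟩ := splits_lines h hs hs' m₂ M.le le_rfl
  have hVU : M.κ.source ∩ M.κ ⁻¹' T ⊆ U ∩ M.κ.source := fun t ht => ⟨by
    have := (hT ht.2).2
    rwa [mem_preimage, M.κ.left_inv ht.1] at this, ht.1⟩
  classical
  choose! B hB using fun p (hp : π p ∈ U) => M.glue
    (fun l q => if q.1 ∈ T ∧ M.P l q ∈ 𝒰 p then g l p q else 0)
    (fun l j1 j2 w hw x y c hc => by
      simp only [M.smul_P l j1 j2 w hw x y c hc, g1 l j1 j2 p w x y c hc])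
    (fun l j1 j2 w hw => by
      simp only [← M.node_P l j1 j2 w hw]
      split_ifs with hc
      · exact g4 l j1 j2 p hp w hc.1 hc.2
      · rfl)
  refine ⟨_, hVU, M.κ.isOpen_inter_preimage hTo, ⟨hs', hsT⟩, B, fun p hp x hx hxV => ?_,
    fun p q hp hq x hx hxV => ?_⟩
  · rw [M.hol_iff x hxV.1]
    intro l j1 j2 v hv he
    have hw := (hT hxV.2).1
    refine (g2 l j1 j2 p (hVU hp).1 _ hxV.2 v hv (by rwa [← he])).congr ?_
    filter_upwards [(M.continuousAt_P l j1 j2 _ hw v hv).eventually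
      (((h.cover p (hVU hp).1).1).eventually_mem (by rwa [← he])),
      (hTo.preimage continuous_fst).eventually_mem (show (M.κ (π x), v).1 ∈ T from hxV.2),
      (continuous_snd.continuousAt (x := (M.κ (π x), v))).eventually_ne hv] with q k1 k2 k3
    rw [hB p (hVU hp).1 l j1 j2 q.1 (hT k2).1 q.2 k3, if_pos ⟨k2, k1⟩]
  · obtain ⟨l, j1, j2, v, hv, he⟩ := M.exists_P x hxV.1
    have hw := (hT hxV.2).1
    rw [he] at hx ⊢
    rw [hB p (hVU hp).1 l j1 j2 _ hw v hv, hB q (hVU hq).1 l j1 j2 _ hw v hv,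
      if_pos ⟨hxV.2, hx.2⟩, if_pos ⟨hxV.2, hx.1⟩]
    exact g3 l j1 j2 p q (hVU hp).1 (hVU hq).1 _ hxV.2 v hv hx

variable {V : Set S} {B : X → X → ℂ} {c : X → X → ∀ x, F.Fib x} {t : S}

/-- A splitting over `V` of the functions given by a cochain `c` of `F`. -/
structure IsSplitting (M : ChainModel π F k m₁ m₂) (V : Set S) (c : X → X → ∀ x, F.Fib x)
    (𝒰 : X → Set X) (B : X → X → ℂ) : Prop where
  sub : V ⊆ M.κ.source
  cover : IsNhdCover (π.toFun ⁻¹' V) 𝒰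
  hol_c : ∀ p q, π p ∈ V → π q ∈ V → ∀ x ∈ 𝒰 p ∩ 𝒰 q, F.Hol x (c p q)
  hol : ∀ p, π p ∈ V → ∀ x ∈ 𝒰 p, B p ∈ 𝒪 x
  split : ∀ p q, π p ∈ V → π q ∈ V → ∀ x ∈ 𝒰 p ∩ 𝒰 q, M.ζ x (c p q x) = B q x - B p x

lemma exists_isSplitting (M : ChainModel π F k m₁ m₂) (hU : IsOpen U)
    (hc : IsCocycle F (π.toFun ⁻¹' U) c) (hs : s ∈ U) (hs' : s ∈ M.κ.source) :
    ∃ V ⊆ U, IsOpen V ∧ s ∈ V ∧ ∃ 𝒰 B, M.IsSplitting V c 𝒰 B := by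
  have hUo := hU.inter M.κ.open_source
  obtain ⟨𝒰, h𝒰, h1, h2⟩ := hc.mono (hUo.preimage π.continuous_toFun)
    (preimage_mono inter_subset_left)
  obtain ⟨V, hV, hVo, hsV, B, hB, hB'⟩ := M.exists_splitting (u := fun p q x => M.ζ x (c p q x))
    { isOpen := hUo
      cover := h𝒰
      hol := fun p q hp hq x hx =>
        M.ζ_hol x ((h𝒰 p hp).2.2 hx.1).2 _ (h1 p hp q hq x hx)
      cocycle := fun p q r hp hq hr x hx => by
        rw [← map_add, h2 p hp q hq r hr x hx] } ⟨hs, hs'⟩ hs'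
  have hV' : V ⊆ U ∩ M.κ.source := hV.trans inter_subset_left
  refine ⟨V, fun t ht => (hV' ht).1, hVo, hsV, fun p => 𝒰 p ∩ π.toFun ⁻¹' V, B,
    { sub := fun t ht => (hV' ht).2
      cover := fun p hp => ⟨(h𝒰 p (hV' hp)).1.inter (hVo.preimage π.continuous_toFun),
        ⟨(h𝒰 p (hV' hp)).2.1, hp⟩, inter_subset_right⟩
      hol_c := fun p q hp hq x hx => h1 p (hV' hp) q (hV' hq) x ⟨hx.1.1, hx.2.1⟩
      hol := fun p hp x hx => hB p hp x hx.1 hx.2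
      split := fun p q hp hq x hx => hB' p q hp hq x ⟨hx.1.1, hx.2.1⟩ hx.1.2 }⟩

namespace IsSplitting

lemma isRes (h : M.IsSplitting V c 𝒰 B) (ht : t ∈ V) :
    M.IsRes c t (B (M.P m₂ (M.κ t, 0, 1)) (M.P m₂ (M.κ t, 0, 1)) -
      B (M.P m₁ (M.κ t, 1, 0)) (M.P m₁ (M.κ t, 1, 0))) :=
  isRes_of_splitting ht (h.sub ht) (fun p hp => ⟨(h.cover p hp).1, (h.cover p hp).2.1⟩)
    (fun p hp x hx _ => h.hol p hp x hx) fun p q hp hq x hx _ => h.split p q hp hq x hx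

lemma apply_eq (h : M.IsSplitting V c 𝒰 B) {p x : X} (hp : π p ∈ V) (hx : x ∈ 𝒰 p)
    (h0 : ∀ c, M.ζ x c = 0) : B p x = B x x := by
  have hxV := (h.cover p hp).2.2 hx
  have := h.split p x hp hxV x ⟨hx, (h.cover x hxV).2.1⟩
  rw [h0] at this
  linear_combination this

lemma mem_hol (h : M.IsSplitting V c 𝒰 B) (hV : IsOpen V) (ht : t ∈ V) {l : ℕ} (i1 : m₁ ≤ l)
    (i2 : l ≤ m₂) {v : ℂ × ℂ} (hv : v ≠ 0) (h0 : ∀ w ∈ M.κ.target, ∀ c, M.ζ (M.P l (w, v)) c = 0) :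
    (fun t => B (M.P l (M.κ t, v)) (M.P l (M.κ t, v))) ∈ 𝒪 t := by
  have hw := M.κ.map_source (h.sub ht)
  have hp : π (M.P l (M.κ t, v)) ∈ V := by
    rwa [M.map_P l i1 i2 _ hw v hv, M.κ.left_inv (h.sub ht)]
  have e1 : Ana (fun w => B (M.P l (M.κ t, v)) (M.P l (w, v))) (M.κ t) :=
    AnalyticAt.comp (g := fun q => B (M.P l (M.κ t, v)) (M.P l q))
      (f := fun w => ((w, v) : Flat k)) (analyticAt_of_mem i1 i2 hw hv
        (h.hol _ hp _ (h.cover _ hp).2.1)) (by fun_prop)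
  refine HolSpace.congr ((M.bihol t (h.sub ht) _).1 e1) ?_
  have hc : ContinuousAt (fun t => M.P l (M.κ t, v)) t := ContinuousAt.comp (g := M.P l)
    (M.continuousAt_P l i1 i2 _ hw _ hv)
    ((M.κ.continuousAt (h.sub ht)).prodMk continuousAt_const)
  filter_upwards [hc.eventually ((h.cover _ hp).1.eventually_mem (h.cover _ hp).2.1),
    hV.eventually_mem ht] with t' k1 k2
  exact h.apply_eq hp k1 (h0 _ (M.κ.map_source (h.sub k2)))

lemma isCoboundary (h : M.IsSplitting V c 𝒰 B) (hV : IsOpen V) (h0 : ∀ t ∈ V, M.IsRes c t 0) :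
    IsCoboundary F (π.toFun ⁻¹' V) c := by
  set β : S → ℂ := fun t => B (M.P m₁ (M.κ t, 1, 0)) (M.P m₁ (M.κ t, 1, 0)) with hβ
  have hβ' : ∀ t ∈ V, B (M.P m₂ (M.κ t, 0, 1)) (M.P m₂ (M.κ t, 0, 1)) = β t := fun t ht =>
    sub_eq_zero.1 ((h.isRes ht).unique (h.sub ht) (h0 t ht))
  have hsub := fun p hp => (h.cover p hp).2.2
  choose! b hb using fun p hp => M.exists_section_on (f := fun x => B p x - β (π x)) (h.cover p hp).1
    (fun x hx => h.sub (hsub p hp hx))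
    (fun x hx => sub_mem (h.hol p hp x hx) (π.hol x β
      (h.mem_hol hV (hsub p hp hx) le_rfl M.le (by simp) M.ζ_start)))
    (fun x hx he => by
      have hw := M.κ.map_source (h.sub (hsub p hp hx))
      simp only [hβ, ← he]
      rw [h.apply_eq hp hx (by rw [he]; exact M.ζ_start _ hw), sub_self])
    (fun x hx he => by
      have hw := M.κ.map_source (h.sub (hsub p hp hx))
      simp only [← hβ' _ (hsub p hp hx), ← he]
      rw [h.apply_eq hp hx (by rw [he]; exact M.ζ_end _ hw), sub_self])
  refine ⟨𝒰, h.cover, b, fun p hp x hx => (hb p hp x hx).1, fun p hp q hq x hx => ?_⟩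
  have e1 := F.hol_add (hb q hq x hx.2).1
    (F.hol_smul (-1) (neg_mem (one_mem _)) (hb p hp x hx.1).1)
  have := eq_of_ζ (M := M) (h.sub ((h.cover p hp).2.2 hx.1)) (h.hol_c p q hp hq x hx) e1 (by
    filter_upwards [((h.cover p hp).1.inter (h.cover q hq).1).eventually_mem hx] with y hy
    rw [h.split p q hp hq y hy]
    simp only [Pi.add_apply, map_add, map_smul, (hb q hq y hy.2).2, (hb p hp y hy.1).2,
      Pi.neg_apply, Pi.one_apply, smul_eq_mul]
    ring)
  rw [this, sub_eq_add_neg]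
  simp

end IsSplitting

lemma start_ne_end {w : Fin k → ℂ} (hw : w ∈ M.κ.target) : M.P m₁ (w, 1, 0) ≠ M.P m₂ (w, 0, 1) := by
  intro he
  rcases M.P_eq m₁ m₂ le_rfl M.le le_rfl w hw _ _ (by simp) (by simp) he with ⟨-, h⟩ | ⟨-, h, -⟩ <;> simp at h

lemma isOpen_ne_section [T2Space X] (hV : IsOpen V) (hVκ : V ⊆ M.κ.source) {l : ℕ} (i1 : m₁ ≤ l)
    (i2 : l ≤ m₂) {v : ℂ × ℂ} (hv : v ≠ 0) :
    IsOpen {x | π x ∈ V ∧ x ≠ M.P l (M.κ (π x), v)} := by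
  have hc : ContinuousOn (fun x => (x, M.P l (M.κ (π x), v))) (π.toFun ⁻¹' V) := fun x hx => by
    have e1 : ContinuousAt (fun x => M.κ (π x)) x :=
      ContinuousAt.comp (g := M.κ) (M.κ.continuousAt (hVκ hx)) π.continuous_toFun.continuousAt
    exact (continuousAt_id.prodMk (ContinuousAt.comp (g := M.P l) (f := fun x => (M.κ (π x), v))
      (M.continuousAt_P l i1 i2 _ (M.κ.map_source (hVκ hx)) _ hv)
      (e1.prodMk continuousAt_const))).continuousWithinAt
  exact hc.isOpen_inter_preimage (hV.preimage π.continuous_toFun) isClosed_diagonal.isOpen_compl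

open Classical in
/-- Every holomorphic function on the base is locally the residue of a cocycle. -/
lemma exists_cocycle [T2Space X] (M : ChainModel π F k m₁ m₂) (hs : s ∈ M.κ.source) {f : S → ℂ}
    (hf : f ∈ 𝒪 s) : ∃ V, IsOpen V ∧ s ∈ V ∧ ∃ c 𝒰, IsCocycle F (π.toFun ⁻¹' V) c ∧
      M.IsSplitting V c 𝒰 (fun p x => if p = M.P m₁ (M.κ (π p), 1, 0) then 0 else f (π x)) ∧
      (∀ p x, x ∈ 𝒰 p → x ≠ if p = M.P m₁ (M.κ (π p), 1, 0) then M.P m₂ (M.κ (π x), 0, 1) else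
        M.P m₁ (M.κ (π x), 1, 0)) ∧ ∀ t ∈ V, M.IsRes c t (f t) := by
  obtain ⟨V, hV, hVo, hsV⟩ := eventually_nhds_iff.1
    ((HolSpace.eventually hf).and (M.κ.open_source.eventually_mem hs))
  have hVκ : V ⊆ M.κ.source := fun t ht => (hV t ht).2
  set C : X → Prop := fun p => p = M.P m₁ (M.κ (π p), 1, 0) with hC
  set 𝒰 : X → Set X := fun p => if C p then {x | π x ∈ V ∧ x ≠ M.P m₂ (M.κ (π x), 0, 1)}
    else {x | π x ∈ V ∧ x ≠ M.P m₁ (M.κ (π x), 1, 0)} with h𝒰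
  set B : X → X → ℂ := fun p x => if C p then 0 else f (π x) with hB
  have hcov : IsNhdCover (π.toFun ⁻¹' V) 𝒰 := by
    intro p hp
    by_cases h : C p
    · simp only [h𝒰, if_pos h]
      refine ⟨isOpen_ne_section hVo hVκ M.le le_rfl (by simp), ⟨hp, fun he => ?_⟩, fun x hx => hx.1⟩
      exact M.start_ne_end (M.κ.map_source (hVκ hp)) (h.symm.trans he)
    · simp only [h𝒰, if_neg h]
      exact ⟨isOpen_ne_section hVo hVκ le_rfl M.le (by simp), ⟨hp, h⟩, fun x hx => hx.1⟩
  have hBh : ∀ p, π p ∈ V → ∀ x ∈ 𝒰 p, B p ∈ 𝒪 x := by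
    intro p hp x hx
    by_cases h : C p
    · simp only [hB, if_pos h]
      exact zero_mem _
    · simp only [hB, if_neg h]
      exact π.hol x f (hV _ ((hcov p hp).2.2 hx)).1
  have hstart : ∀ p x, x ∈ 𝒰 p → C x → B p x = 0 := by grind
  have hend : ∀ p x, x ∈ 𝒰 p → x = M.P m₂ (M.κ (π x), 0, 1) → B p x = f (π x) := by
    grind
  choose! c hc using fun p q hp hq => M.exists_section_on (f := fun x => B q x - B p x)
    ((hcov p hp).1.inter (hcov q hq).1) (fun x hx => hVκ ((hcov p hp).2.2 hx.1))
    (fun x hx => sub_mem (hBh q hq x hx.2) (hBh p hp x hx.1))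
    (fun x hx he => by simp only [hstart _ x hx.1 he, hstart _ x hx.2 he, sub_self])
    (fun x hx he => by simp only [hend _ x hx.1 he, hend _ x hx.2 he, sub_self])
  have hspl : M.IsSplitting V c 𝒰 B := ⟨hVκ, hcov, fun p q hp hq x hx => (hc p q hp hq x hx).1, hBh,
    fun p q hp hq x hx => (hc p q hp hq x hx).2⟩
  refine ⟨V, hVo, hsV, c, 𝒰, ⟨𝒰, hcov, fun p hp q hq => hspl.hol_c p q hp hq,
    fun p hp q hq r hr x hx => ?_⟩, hspl, fun p x hx => ?_, fun t ht => ?_⟩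
  · refine eq_of_ζ (M := M) (σ := c p q + c q r) (hVκ ((hcov p hp).2.2 hx.1.1)) (F.hol_add
      (hc p q hp hq x hx.1).1 (hc q r hq hr x ⟨hx.1.2, hx.2⟩).1) (hc p r hp hr x ⟨hx.1.1, hx.2⟩).1 ?_
    filter_upwards [(((hcov p hp).1.inter (hcov q hq).1).inter (hcov r hr).1).eventually_mem hx]
      with y hy
    rw [Pi.add_apply, map_add, (hc p q hp hq y hy.1).2, (hc q r hq hr y ⟨hy.1.2, hy.2⟩).2,
      (hc p r hp hr y ⟨hy.1.1, hy.2⟩).2]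
    ring
  · grind
  · have hw := M.κ.map_source (hVκ ht)
    have a3 : π (M.P m₁ (M.κ t, 1, 0)) = t := by
      rw [M.map_P m₁ le_rfl M.le _ hw _ (by simp), M.κ.left_inv (hVκ ht)]
    have b3 : π (M.P m₂ (M.κ t, 0, 1)) = t := by
      rw [M.map_P m₂ M.le le_rfl _ hw _ (by simp), M.κ.left_inv (hVκ ht)]
    have e1 := hstart _ _ (hcov _ (show π (M.P m₁ (M.κ t, 1, 0)) ∈ V by rwa [a3])).2.1
      (by simp only [hC, a3])
    have e2 := hend _ _ (hcov _ (show π (M.P m₂ (M.κ t, 0, 1)) ∈ V by rwa [b3])).2.1 (by rw [b3])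
    have := hspl.isRes ht
    rwa [e1, e2, b3, sub_zero] at this

end ChainModel

/-! ### The residue in two models -/

namespace ChainModel

variable {X S : Type u} [TopologicalSpace X] [HolSpace X] [TopologicalSpace S] [HolSpace S]
  {π : HolMap X S} {F : ValSheaf X} {k m₁ m₂ n : ℕ} {M M' : ChainModel π F k m₁ m₂}
  {c : X → X → ∀ x, F.Fib x} {t : S} {α δ η ε r : ℂ}

/-- The change of the coordinates of two models on the fibre over `t`, for a change of the
orbifold charts whose normal derivative is the matrix `(α, η; ε, δ)`. -/
structure IsChange (M M' : ChainModel π F k m₁ m₂) (n : ℕ) (t : S) (α δ η ε : ℂ) : Prop where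
  one_le : 1 ≤ m₁
  le_n : m₂ ≤ n
  source : t ∈ M.κ.source
  source' : t ∈ M'.κ.source
  ne_zero : n ≠ 1 → α ≠ 0 ∧ δ ≠ 0
  det_ne : α * δ - 0 ^ (n - 1) * (η * ε) ≠ 0
  map : ∀ l j, n = l + 1 + j → m₁ ≤ l + 1 → l + 1 ≤ m₂ → ∀ x y : ℂ, (x ≠ 0 ∨ y ≠ 0) →
    M.P (l + 1) (M.κ t, x, y) = M'.P (l + 1) (M'.κ t, α ^ (j + 1) * x + 0 ^ j * η * y,
      0 ^ l * ε * x + δ ^ (l + 1) * y)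
  ζ : ∀ l j, n = l + 1 + j → m₁ ≤ l + 1 → l + 1 ≤ m₂ → ∀ x : ℂ, x ≠ 0 →
    α + 0 ^ j * η / x ≠ 0 → δ + 0 ^ l * ε * x ≠ 0 → ∀ c, M'.ζ (M.P (l + 1) (M.κ t, x, 1)) c =
      (α + 0 ^ j * η / x) * (δ + 0 ^ l * ε * x) * M.ζ (M.P (l + 1) (M.κ t, x, 1)) c

namespace IsChange

variable (h : IsChange M M' n t α δ η ε) {l j : ℕ} (hn : n = l + 1 + j)
include h hn

lemma ne : α ^ (j + 1) * δ ^ (l + 1) - 0 ^ j * η * (0 ^ l * ε) ≠ 0 := by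
  by_cases h1 : n = 1
  · obtain rfl : l = 0 := by omega
    obtain rfl : j = 0 := by omega
    simpa [h1] using h.det_ne
  · obtain ⟨h2, h3⟩ := h.ne_zero h1
    have : (0 : ℂ) ^ j * η * (0 ^ l * ε) = 0 := by
      rcases Nat.eq_zero_or_pos l with rfl | hl
      · simp [zero_pow (show j ≠ 0 by omega)]
      · simp [zero_pow hl.ne']
    rw [this, sub_zero]
    exact mul_ne_zero (pow_ne_zero _ h2) (pow_ne_zero _ h3)

lemma adj_ne {v : ℂ × ℂ} (hv : v ≠ 0) :
    (δ ^ (l + 1) * v.1 - 0 ^ j * η * v.2, α ^ (j + 1) * v.2 - 0 ^ l * ε * v.1) ≠ (0 : ℂ × ℂ) := by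
  intro h0
  obtain ⟨e1, e2⟩ := Prod.ext_iff.1 h0
  simp only [Prod.fst_zero, Prod.snd_zero] at e1 e2
  refine hv (Prod.ext ?_ ?_)
  all_goals refine (mul_eq_zero.1 ?_).resolve_left (h.ne hn)
  · linear_combination α ^ (j + 1) * e1 + 0 ^ j * η * e2
  · linear_combination δ ^ (l + 1) * e2 + 0 ^ l * ε * e1

lemma symm_map (i1 : m₁ ≤ l + 1) (i2 : l + 1 ≤ m₂) {v : ℂ × ℂ} (hv : v ≠ 0) :
    M'.P (l + 1) (M'.κ t, v) = M.P (l + 1) (M.κ t, δ ^ (l + 1) * v.1 - 0 ^ j * η * v.2,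
      α ^ (j + 1) * v.2 - 0 ^ l * ε * v.1) := by
  have h0 := h.adj_ne hn hv
  rw [h.map l j hn i1 i2 _ _ (by
    by_contra! h1
    exact h0 (Prod.ext h1.1 h1.2)), ← M'.smul_P (l + 1) i1 i2 _ (M'.κ.map_source h.source') v.1 v.2
      _ (h.ne hn)]
  congr 3 <;> ring

lemma analyticAt (i1 : m₁ ≤ l + 1) (i2 : l + 1 ≤ m₂) {v : ℂ × ℂ} (hv : v ≠ 0) {f : X → ℂ}
    (hf : ∀ v' : ℂ × ℂ, v' ≠ 0 → M'.P (l + 1) (M'.κ t, v) = M.P (l + 1) (M.κ t, v') →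
      Ana (fun v => f (M.P (l + 1) (M.κ t, v))) v') :
    Ana (fun v => f (M'.P (l + 1) (M'.κ t, v))) v := by
  refine (AnalyticAt.comp (g := fun v => f (M.P (l + 1) (M.κ t, v))) (f := fun v : ℂ × ℂ =>
    (δ ^ (l + 1) * v.1 - 0 ^ j * η * v.2, α ^ (j + 1) * v.2 - 0 ^ l * ε * v.1))
    (hf _ (h.adj_ne hn hv) (h.symm_map hn i1 i2 hv)) (by fun_prop)).congr ?_
  filter_upwards [continuousAt_id.eventually_ne hv] with v' hv'
  exact congrArg f (h.symm_map hn i1 i2 hv').symm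

omit hn in
open Classical in
/-- The residue of a standard cocycle in the second model. -/
lemma isRes_standard {V : Set S} {𝒰 : X → Set X} (ht : t ∈ V)
    (hs : M.IsSplitting V c 𝒰 (fun p _ => if p = M.P m₁ (M.κ (π p), 1, 0) then 0 else 1))
    (h𝒰 : ∀ p x, x ∈ 𝒰 p → x ≠ if p = M.P m₁ (M.κ (π p), 1, 0) then M.P m₂ (M.κ (π x), 0, 1) else
      M.P m₁ (M.κ (π x), 1, 0)) :
    M'.IsRes c t (α * δ - 0 ^ (n - 1) * (η * ε)) := by
  have hm := h.one_le
  have hmn := h.le_n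
  have hw := M.κ.map_source h.source
  have hw' := M'.κ.map_source h.source'
  have hlj : ∀ l', m₁ ≤ l' → l' ≤ m₂ → ∃ l j, l' = l + 1 ∧ n = l + 1 + j := fun l' i1 i2 =>
    ⟨l' - 1, n - l', by omega, by omega⟩
  set e : ℂ := 0 ^ (n - 1) * (η * ε) with he
  have hee : ∀ l j, n = l + 1 + j → e = 0 ^ j * η * (0 ^ l * ε) := fun l j hn => by
    rw [he, show n - 1 = j + l by omega, pow_add]
    ring
  obtain ⟨G₁, hG₁⟩ := M.glue (fun l q => α * δ + e + 0 ^ (l - 1) * (α * ε * (q.2.1 / q.2.2)))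
    (fun l _ _ w _ x y c hc => by simp only [mul_div_mul_left _ _ hc])
    fun l i1 _ w _ => by simp [zero_pow (show l ≠ 0 by omega)]
  obtain ⟨G₀, hG₀⟩ := M.glue (fun l q => -(0 ^ (n - l) * (δ * η * (q.2.2 / q.2.1))))
    (fun l _ _ w _ x y c hc => by simp only [mul_div_mul_left _ _ hc])
    fun l _ i2 w _ => by simp [zero_pow (show n - l ≠ 0 by omega)]
  have g1 : ∀ l j, n = l + 1 + j → m₁ ≤ l + 1 → l + 1 ≤ m₂ → ∀ v : ℂ × ℂ, v ≠ 0 →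
      G₁ (M.P (l + 1) (M.κ t, v)) = α * δ + e + 0 ^ l * (α * ε * (v.1 / v.2)) :=
    fun l j hn i1 i2 v hv => hG₁ _ i1 i2 _ hw v hv
  have g0 : ∀ l j, n = l + 1 + j → m₁ ≤ l + 1 → l + 1 ≤ m₂ → ∀ v : ℂ × ℂ, v ≠ 0 →
      G₀ (M.P (l + 1) (M.κ t, v)) = -(0 ^ j * (δ * η * (v.2 / v.1))) :=
    fun l j hn i1 i2 v hv => by
      rw [hG₀ _ i1 i2 _ hw v hv, show n - (l + 1) = j by omega]
  set C : X → Prop := fun p => p = M.P m₁ (M.κ (π p), 1, 0) with hC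
  have hCt : ∀ {p}, π p = t → (C p ↔ p = M.P m₁ (M.κ t, 1, 0)) := fun hp => by rw [hC, ← hp]
  set B : X → X → ℂ := fun p => if C p then G₀ else G₁ with hB
  have hπ : ∀ {l}, m₁ ≤ l → l ≤ m₂ → ∀ {v : ℂ × ℂ}, v ≠ 0 → π (M.P l (M.κ t, v)) = t :=
    fun i1 i2 v hv => by rw [M.map_P _ i1 i2 _ hw v hv, M.κ.left_inv h.source]
  have hπ' : ∀ {l}, m₁ ≤ l → l ≤ m₂ → ∀ {v : ℂ × ℂ}, v ≠ 0 → π (M'.P l (M'.κ t, v)) = t :=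
    fun i1 i2 v hv => by rw [M'.map_P _ i1 i2 _ hw' v hv, M'.κ.left_inv h.source']
  have hV : ∀ {p}, π p = t → π p ∈ V := fun hp => by rwa [hp]
  -- analyticity on the lines of the first model
  have hBa : ∀ p, π p = t → ∀ l j, n = l + 1 + j → m₁ ≤ l + 1 → l + 1 ≤ m₂ → ∀ v : ℂ × ℂ, v ≠ 0 →
      M.P (l + 1) (M.κ t, v) ∈ 𝒰 p →
      Ana (fun v => B p (M.P (l + 1) (M.κ t, v))) v := by
    intro p hp l j hn i1 i2 v hv hm
    have hne := h𝒰 p _ hm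
    rw [hπ i1 i2 hv] at hne
    by_cases hCp : C p
    · rw [if_pos hCp] at hne
      simp only [hB, if_pos hCp]
      refine AnalyticAt.congr (f := fun v : ℂ × ℂ => -(0 ^ j * (δ * η * (v.2 / v.1)))) ?_ ?_
      · rcases Nat.eq_zero_or_pos j with rfl | hj
        · refine (analyticAt_const.mul (analyticAt_const.mul
            (analyticAt_snd.div analyticAt_fst fun hx => hne ?_))).neg
          obtain ⟨x, y⟩ := v
          obtain rfl := hx
          have := M.smul_P (l + 1) i1 i2 _ hw 0 1 y (fun hy => hv (by simp [hy]))
          rw [mul_zero, mul_one] at this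
          rw [this, congrArg M.P (show l + 1 = m₂ by omega)]
        · simp [zero_pow hj.ne', analyticAt_const]
      · filter_upwards [continuousAt_id.eventually_ne hv] with v' hv'
        exact (g0 l j hn i1 i2 v' hv').symm
    · rw [if_neg hCp] at hne
      simp only [hB, if_neg hCp]
      refine AnalyticAt.congr (f := fun v : ℂ × ℂ => α * δ + e + 0 ^ l * (α * ε * (v.1 / v.2)))
        ?_ ?_
      · rcases Nat.eq_zero_or_pos l with rfl | hl
        · refine analyticAt_const.add (analyticAt_const.mul (analyticAt_const.mul
            (analyticAt_fst.div analyticAt_snd fun hx => hne ?_)))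
          obtain ⟨x, y⟩ := v
          obtain rfl := hx
          have := M.smul_P (0 + 1) i1 i2 _ hw 1 0 x (fun hy => hv (by simp [hy]))
          rw [mul_zero, mul_one] at this
          rw [this, congrArg M.P (show 0 + 1 = m₁ by omega)]
        · simp [zero_pow hl.ne', analyticAt_const]
      · filter_upwards [continuousAt_id.eventually_ne hv] with v' hv'
        exact (g1 l j hn i1 i2 v' hv').symm
  refine ⟨𝒰, B, fun p hp => ⟨(hs.cover p (hV hp)).1, (hs.cover p (hV hp)).2.1⟩,
    fun p hp l' i1 i2 v hv hm => ?_, fun p q hp hq x hx hxt => ?_, ?_⟩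
  · obtain ⟨l, j, rfl, hn⟩ := hlj l' i1 i2
    exact h.analyticAt hn i1 i2 hv fun v' hv' hvv => hBa p hp l j hn i1 i2 v' hv' (by rwa [← hvv])
  · obtain ⟨l', i1, i2, v, hv, hv'⟩ := M.exists_P x (by rw [hxt]; exact h.source)
    obtain ⟨l, j, rfl, hn⟩ := hlj l' i1 i2
    rw [hxt] at hv'
    subst hv'
    have c1 := (analyticAt_fibre (M := M) i1 i2 hw hv (M'.ζ_hol _ (by rw [hxt]; exact h.source')
      _ (hs.hol_c p q (hV hp) (hV hq) _ hx))).continuousAt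
    have c2 := ((hBa q hq l j hn i1 i2 v hv hx.2).sub (hBa p hp l j hn i1 i2 v hv hx.1)).continuousAt
    have hne := h.ne hn
    have hlin : ∀ p q : ℂ, IsOpen {v : ℂ × ℂ | p * v.1 + q * v.2 ≠ 0} := fun p q =>
      isOpen_ne_fun (by fun_prop) continuous_const
    have hd : Dense ({v : ℂ × ℂ | 1 * v.1 + 0 * v.2 ≠ 0} ∩ ({v : ℂ × ℂ | 0 * v.1 + 1 * v.2 ≠ 0} ∩
        ({v : ℂ × ℂ | α * v.1 + 0 ^ j * η * v.2 ≠ 0} ∩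
          {v : ℂ × ℂ | 0 ^ l * ε * v.1 + δ * v.2 ≠ 0}))) := by
      refine (dense_linear_ne (by simp)).inter_of_isOpen_left ((dense_linear_ne
        (by simp)).inter_of_isOpen_left ((dense_linear_ne ?_).inter_of_isOpen_left (dense_linear_ne
          ?_) (hlin _ _)) (hlin _ _)) (hlin _ _)
      all_goals
        by_contra! h0
        exact hne (by simp [h0])
    have := mem_closure_iff_nhdsWithin_neBot.1 (hd v)
    refine @tendsto_nhds_unique _ _ _ _ _ _ _ _ this ((c1.tendsto.mono_left nhdsWithin_le_nhds).congr' ?_)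
      (c2.tendsto.mono_left nhdsWithin_le_nhds)
    filter_upwards [self_mem_nhdsWithin, nhdsWithin_le_nhds ((tendsto_fibre i1 i2 hw hv).eventually
      (((hs.cover p (hV hp)).1.inter (hs.cover q (hV hq)).1).eventually_mem hx))] with v' k1 k2
    obtain ⟨x, y⟩ := v'
    obtain ⟨h1, h2, h3, h4⟩ := k1
    simp only [one_mul, zero_mul, add_zero, zero_add, mem_ofPred_eq] at h1 h2 h3 h4
    have hv0 : ((x, y) : ℂ × ℂ) ≠ 0 := fun h => h1 (Prod.ext_iff.1 h).1
    have hPe : M.P (l + 1) (M.κ t, x, y) = M.P (l + 1) (M.κ t, x / y, 1) := by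
      have := M.smul_P (l + 1) i1 i2 _ hw (x / y) 1 y h2
      rwa [mul_div_cancel₀ _ h2, mul_one] at this
    have key := h.ζ l j hn i1 i2 (x / y) (div_ne_zero h1 h2)
      (fun h0 => h3 (by field_simp at h0; linear_combination h0))
      (fun h0 => h4 (by field_simp at h0; linear_combination h0))
      (c p q (M.P (l + 1) (M.κ t, x / y, 1)))
    rw [← hPe, hs.split p q (hV hp) (hV hq) _ k2] at key
    rw [key]
    have e1 := g1 l j hn i1 i2 _ hv0
    have e0 := g0 l j hn i1 i2 _ hv0
    have hXW : (α + 0 ^ j * η / (x / y)) * (δ + 0 ^ l * ε * (x / y)) =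
        G₁ (M.P (l + 1) (M.κ t, x, y)) - G₀ (M.P (l + 1) (M.κ t, x, y)) := by
      rw [e1, e0, hee l j hn]
      field_simp
      ring
    rw [hXW]
    simp only [Pi.sub_apply, hB, hC]
    split_ifs <;> ring
  · obtain ⟨l, j, hl, hn⟩ := hlj m₁ le_rfl M.le
    obtain ⟨l', j', hl', hn'⟩ := hlj m₂ M.le le_rfl
    have e1 : B (M'.P m₁ (M'.κ t, 1, 0)) (M'.P m₁ (M'.κ t, 1, 0)) = e := by
      have hv : ((δ ^ (l + 1), -(0 ^ l * ε)) : ℂ × ℂ) ≠ 0 := by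
        simpa using h.adj_ne hn (v := (1, 0)) (by simp)
      have hq : M'.P m₁ (M'.κ t, 1, 0) = M.P (l + 1) (M.κ t, δ ^ (l + 1), -(0 ^ l * ε)) := by
        have := h.symm_map hn hl.le (hl ▸ M.le) (v := (1, 0)) (by simp)
        simp only [mul_one, mul_zero, sub_zero, zero_sub] at this
        rw [← this, congrArg M'.P hl]
      have hCq := hCt (hπ' le_rfl M.le (v := (1, 0)) (by simp))
      have hiff : C (M'.P m₁ (M'.κ t, 1, 0)) ↔ 0 ^ l * ε = 0 := by
        rw [hCq, hq]
        refine ⟨fun h0 => ?_, fun h0 => ?_⟩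
        · rw [congrArg M.P hl] at h0
          rcases M.P_eq _ _ hl.le le_rfl (hl ▸ M.le) _ hw _ _ hv (by simp) h0 with h1 | h1
          · simpa using h1.2
          · omega
        · rw [h0, neg_zero, congrArg M.P hl]
          have := M.smul_P (l + 1) hl.le (hl ▸ M.le) _ hw 1 0 (δ ^ (l + 1)) (fun h1 => hv (by
            simp [h1, h0]))
          rwa [mul_one, mul_zero] at this
      by_cases h0 : 0 ^ l * ε = 0
      · simp only [hB, if_pos (hiff.2 h0)]
        rw [hq, g0 l j hn hl.le (hl ▸ M.le) _ hv, hee l j hn, h0]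
        simp
      · simp only [hB, if_neg (fun hc => h0 (hiff.1 hc))]
        rw [hq, g1 l j hn hl.le (hl ▸ M.le) _ hv]
        have hε := right_ne_zero_of_mul h0
        obtain rfl : l = 0 := by
          by_contra hl0
          simp [zero_pow hl0] at h0
        simp only [pow_zero, one_mul, zero_add, pow_one]
        field_simp
        ring
    have e2 : B (M'.P m₂ (M'.κ t, 0, 1)) (M'.P m₂ (M'.κ t, 0, 1)) = α * δ := by
      have hv : ((-(0 ^ j' * η), α ^ (j' + 1)) : ℂ × ℂ) ≠ 0 := by
        simpa using h.adj_ne hn' (v := (0, 1)) (by simp)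
      have i1 : m₁ ≤ l' + 1 := hl' ▸ M.le
      have hq : M'.P m₂ (M'.κ t, 0, 1) = M.P (l' + 1) (M.κ t, -(0 ^ j' * η), α ^ (j' + 1)) := by
        have := h.symm_map hn' i1 hl'.ge (v := (0, 1)) (by simp)
        simp only [mul_one, mul_zero, sub_zero, zero_sub] at this
        rw [← this, congrArg M'.P hl']
      have hCq := hCt (hπ' M.le le_rfl (v := (0, 1)) (by simp))
      by_cases h0 : C (M'.P m₂ (M'.κ t, 0, 1))
      · simp only [hB, if_pos h0]
        rw [hq, g0 l' j' hn' i1 hl'.ge _ hv]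
        rw [hCq, hq] at h0
        rcases M.P_eq _ _ le_rfl i1 hl'.ge _ hw _ _ (by simp) hv h0.symm with h1 | h1
        · have : α = 0 := by simpa using h1.2
          simp [this]
        · simp at h1
      · simp only [hB, if_neg h0]
        rw [hq, g1 l' j' hn' i1 hl'.ge _ hv]
        rw [hCq, hq] at h0
        rw [hee _ _ hn']
        by_cases hlj' : l' = 0 ∧ j' = 0
        · obtain ⟨rfl, rfl⟩ := hlj'
          have hα : α ≠ 0 := fun hα => h0 (by
            have := M.smul_P (0 + 1) i1 hl'.ge _ hw 1 0 (-η) (fun h1 => hv (by simp [h1, hα]))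
            rw [hα, congrArg M.P (show m₁ = 0 + 1 by omega)]
            simpa using this)
          simp only [pow_zero, one_mul, zero_add, pow_one]
          field_simp
          ring
        · rcases Nat.eq_zero_or_pos l' with rfl | hl0
          · simp [zero_pow (show j' ≠ 0 by omega)]
          · simp [zero_pow hl0.ne']
    rw [e1, e2]

omit hn in
/-- The residues of a cocycle in the two models differ by the determinant of the change. -/
lemma isRes [T2Space X] {U : Set S} (hU : IsOpen U) (ht : t ∈ U)
    (hc : IsCocycle F (π.toFun ⁻¹' U) c) (hr : M.IsRes c t r) :
    M'.IsRes c t ((α * δ - 0 ^ (n - 1) * (η * ε)) * r) := by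
  classical
  obtain ⟨V₁, hV₁, ht₁, c₁, 𝒰₁, hc₁, hs₁, h𝒰, hr₁⟩ :=
    M.exists_cocycle (f := fun _ => 1) h.source (one_mem _)
  obtain ⟨V, hVU, hV, htV, 𝒰, B, hs⟩ := M.exists_isSplitting hU hc ht h.source
  set R : S → ℂ := fun t => B (M.P m₂ (M.κ t, 0, 1)) (M.P m₂ (M.κ t, 0, 1)) -
      B (M.P m₁ (M.κ t, 1, 0)) (M.P m₁ (M.κ t, 1, 0)) with hR
  have hRh : ∀ t ∈ V, R ∈ 𝒪 t := fun t ht => sub_mem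
    (hs.mem_hol hV ht M.le le_rfl (by simp) M.ζ_end) (hs.mem_hol hV ht le_rfl M.le (by simp) M.ζ_start)
  have hRr : R t = r := (hs.isRes htV).unique h.source hr
  have hW := hV.inter hV₁
  have hc₂ : IsCocycle F (π.toFun ⁻¹' (V ∩ V₁)) (c + fun p q x => (-R) (π x) • c₁ p q x) := by
    have h1 := (hc.mono (hW.preimage π.continuous_toFun)
      (preimage_mono (inter_subset_left.trans hVU))).add
      ((hc₁.mono (hW.preimage π.continuous_toFun) (preimage_mono inter_subset_right)).smul
        (fun x => (-R) (π x)) fun x hx => π.hol x (-R) (neg_mem (hRh _ hx.1)))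
    rwa [inter_self] at h1
  obtain ⟨V₂, hV₂, hV₂o, htV₂, 𝒰₂, B₂, hs₂⟩ := M.exists_isSplitting hW hc₂ ⟨htV, ht₁⟩ h.source
  have hcob := hs₂.isCoboundary hV₂o fun t' ht' => by
    have := (hs.isRes (hV₂ ht').1).add ((hr₁ t' (hV₂ ht').2).smul (-R))
    rwa [Pi.neg_apply, mul_one, hR, add_neg_cancel] at this
  have h1 := (isRes_zero_of_isCoboundary (M := M') htV₂ h.source' hcob).add
    ((h.isRes_standard ht₁ hs₁ h𝒰).smul R)
  have h2 : (c + fun p q x => (-R) (π x) • c₁ p q x) + (fun p q x => R (π x) • c₁ p q x) = c := by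
    funext
    simp
  rwa [h2, zero_add, hRr, mul_comm] at h1

end IsChange
end ChainModel

/-! ### Charts that trivialize the monodromy -/

section Monodromy

variable {n k : ℕ} {Y : Type u} [TopologicalSpace Y] [HolSpace Y] {a b a' b' : AChart n k Y}
  {p : Flat k} {φ : Flat k → Flat k}

/-- The identity, or the exchange of the coordinates of `ℂ²`. -/
def coordSwap (k : ℕ) (e : Bool) : Flat k ≃L[ℂ] Flat k :=
  bif e then (ContinuousLinearEquiv.refl ℂ (Fin k → ℂ)).prodCongr (ContinuousLinearEquiv.prodComm ℂ ℂ ℂ)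
  else ContinuousLinearEquiv.refl ℂ _

@[simp] lemma coordSwap_coordSwap (e : Bool) (p : Flat k) : coordSwap k e (coordSwap k e p) = p := by
  cases e <;> rfl

lemma coordSwap_rootAct (e : Bool) (ζ : ℂ) (p : Flat k) :
    coordSwap k e (rootAct ζ p) = rootAct (bif e then ζ⁻¹ else ζ) (coordSwap k e p) := by
  cases e
  · rfl
  · simp [coordSwap, rootAct]

lemma IsArrow.conj (h : IsArrow a b p φ) (τ τ' : Flat k ≃L[ℂ] Flat k) {p' : Flat k} (hp : τ p' = p)
    (hs : p' ∈ a'.dom) (ht : τ' (φ p) ∈ b'.dom) (ha : ∀ᶠ x in 𝓝 p', a.χ (τ x) = a'.χ x)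
    (hb : ∀ᶠ z in 𝓝 (φ p), b'.χ (τ' z) = b.χ z) : IsArrow a' b' p' (fun x => τ' (φ (τ x))) := by
  subst hp
  have h1 : Ana (fun x => φ (τ x)) p' :=
    AnalyticAt.comp h.analytic (τ.analyticAt _)
  have h2 : HasFDerivAt (fun x => τ' (φ (τ x))) ((τ' : Flat k →L[ℂ] Flat k).comp
      ((fderiv ℂ φ (τ p')).comp (τ : Flat k →L[ℂ] Flat k))) p' :=
    τ'.hasFDerivAt.comp p' (h.analytic.differentiableAt.hasFDerivAt.comp p' τ.hasFDerivAt)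
  refine ⟨hs, ht, AnalyticAt.comp (τ'.analyticAt _) h1, ?_, ?_⟩
  · obtain ⟨L, hL⟩ := h.invertible
    exact ⟨(τ.trans L).trans τ', by rw [h2.fderiv, ← hL]; rfl⟩
  · filter_upwards [ha, h1.continuousAt.eventually hb, τ.continuous.continuousAt.eventually h.comm]
      with x k1 k2 k3
    rw [k2, k3, k1]

/-- A chart on a smaller open set, with or without exchange of the coordinates. -/
lemma AChart.exists_twist (a : AChart n k Y) (e : Bool) {O : Set Y} (hO : IsOpen O) :
    ∃ a' : AChart n k Y, a'.ψ.source = a.ψ.source ∩ O ∧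
      ∀ p ∈ a'.dom, coordSwap k e p ∈ a.dom ∧ a.χ (coordSwap k e p) = a'.χ p := by
  have hr : ∃ a' : AChart n k Y, a'.ψ.source = a.ψ.source ∩ O ∧
      ∀ p ∈ a'.dom, p ∈ a.dom ∧ a.χ p = a'.χ p :=
    ⟨⟨a.ψ.restrOpen O hO, fun x hx => a.bihol x hx.1, fun y hy => a.core y hy.1⟩, rfl,
      fun p hp => ⟨hp.1, rfl⟩⟩
  cases e
  · exact hr
  · obtain ⟨a', h1, h2⟩ := hr
    refine ⟨⟨a'.ψ.transHomeomorph (modelSwap n k), fun x hx f => ?_, fun y hy => ?_⟩, h1,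
      fun p hp => ?_⟩
    · exact (isBihol_modelSwap n k _ trivial f).trans (a'.bihol x hx _)
    · rw [a'.core y hy]
      simp [modelSwap, Prod.ext_iff, and_left_comm]
    · have hq : quotMap n k (coordSwap k true p) = (modelSwap n k).symm (quotMap n k p) :=
        Subtype.ext (by simp [coordSwap, quotMap, modelSwap, mul_comm])
      have h3 := h2 (coordSwap k true p) (by
        change quotMap n k (coordSwap k true p) ∈ a'.ψ.target
        rw [hq]
        exact hp)
      refine ⟨h3.1, h3.2.trans ?_⟩
      change a'.ψ.symm _ = a'.ψ.symm _
      rw [hq]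
      rfl

lemma IsArrow.root_eq {w : Fin k → ℂ} (h : IsArrow a b (w, 0, 0) φ) {g g' : ℂ} (hg : g' ≠ 0)
    (hφ : ∀ᶠ x in 𝓝 ((w, 0, 0) : Flat k), φ (rootAct g x) = rootAct g' (φ x)) :
    g' = g ∨ g' = g⁻¹ := by
  have hd : HasFDerivAt φ (fderiv ℂ φ (w, 0, 0)) (w, 0, 0) :=
    h.analytic.differentiableAt.hasFDerivAt
  have hc : ∀ c : ℂ, HasDerivAt (fun s => ((w, c * s, 0) : Flat k)) (0, c, 0) 0 := fun c =>
    (hasDerivAt_const _ _).prodMk (((hasDerivAt_id (0 : ℂ)).const_mul c |>.congr_deriv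
      (mul_one c)).prodMk (hasDerivAt_const _ _))
  have hφc : ∀ c : ℂ, HasDerivAt (fun s => φ (w, c * s, 0)) (c • fderiv ℂ φ (w, 0, 0) (0, 1, 0)) 0 := fun c => by
    have h1 : HasFDerivAt φ (fderiv ℂ φ (w, 0, 0)) (w, c * 0, 0) := by rwa [mul_zero]
    refine (h1.comp_hasDerivAt (0 : ℂ) (hc c)).congr_deriv ?_
    rw [← map_smul]
    simp
  have e : (fun s => φ (w, g * s, 0)) =ᶠ[𝓝 0] fun s => rootAct g' (φ (w, 1 * s, 0)) := by
    have ht : Tendsto (fun s => ((w, s, 0) : Flat k)) (𝓝 0) (𝓝 (w, 0, 0)) :=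
      Continuous.tendsto' (by fun_prop) _ _ rfl
    filter_upwards [ht.eventually hφ] with s hs
    simpa [rootAct] using hs
  have h1 := (hφc 1).hasFDerivAt.snd.hasDerivAt
  have h2 := (hφc g).hasFDerivAt.snd.hasDerivAt
  have k1 := (h2.hasFDerivAt.fst.hasDerivAt.congr_of_eventuallyEq
    (e.symm.fun_comp fun z => z.2.1)).unique ((h1.hasFDerivAt.fst.hasDerivAt).const_mul g')
  have k2 := (h2.hasFDerivAt.snd.hasDerivAt.congr_of_eventuallyEq
    (e.symm.fun_comp fun z => z.2.2)).unique ((h1.hasFDerivAt.snd.hasDerivAt).const_mul g'⁻¹)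
  simp at k1 k2
  by_contra! hne
  refine h.det_ne_zero ?_
  simp [normalDeriv, Matrix.det_fin_two, k1.resolve_left hne.1.symm,
    k2.resolve_left fun h0 => hne.2 (by rw [h0, inv_inv])]

lemma AChart.lift_of_twist {e : Bool} (h : ∀ p ∈ a'.dom, coordSwap k e p ∈ a.dom ∧
    a.χ (coordSwap k e p) = a'.χ p) {y : Y} (hy : y ∈ Sing k Y)
    (hs : y ∈ a'.ψ.source) : y ∈ a.ψ.source ∧ coordSwap k e (a'.lift y) = a.lift y := by
  obtain ⟨h1, h2⟩ := h _ (AChart.lift_mem_dom hs hy)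
  rw [AChart.χ_lift hs hy] at h2
  have h3 := a.ψ_χ h1
  have h4 := a.χ_mem h1
  rw [h2] at h3 h4
  refine ⟨h4, ?_⟩
  rw [show a.lift y = ((a.ψ y).1.1, 0, 0) from rfl, h3]
  cases e <;> rfl

/-- If the monodromy is trivial, the charts can be chosen such that all arrows between fixed points
commute with the roots of unity. -/
theorem exists_trivializing (hY : IsConnected (Sing k Y)) {𝒜₀ : Set (AChart n k Y)}
    (h𝒜₀ : IsOrbifoldAtlas 𝒜₀) (hmon : TrivialMonodromy 𝒜₀) :
    ∃ 𝒜 : Set (AChart n k Y), IsOrbifoldAtlas 𝒜 ∧ TrivializesMonodromy 𝒜 := by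
  set S := Sing k Y with hS
  obtain ⟨y₀, hy₀⟩ := hY.nonempty
  obtain ⟨a₀, ha₀, hya₀⟩ := h𝒜₀.cover y₀ hy₀
  have hζ := isPrimitiveRoot_exp (n + 1) n.succ_ne_zero
  set ζ := exp (2 * Real.pi * I / (n + 1 : ℕ)) with hζdef
  obtain ⟨σ, hσ, hσ₀⟩ := hmon a₀ ha₀ y₀ hy₀ hya₀ ζ hζ.pow_eq_one
  have hσne : ∀ a ∈ 𝒜₀, ∀ y ∈ S, y ∈ a.ψ.source → σ a y ≠ 0 := fun a ha y hy hs h0 => by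
    have := hσ.root a ha y hy hs
    simp [h0] at this
  have hab : ∀ a ∈ 𝒜₀, ∀ b ∈ 𝒜₀, ∀ y ∈ S, y ∈ a.ψ.source → y ∈ b.ψ.source →
      σ b y = σ a y ∨ σ b y = (σ a y)⁻¹ := fun a ha b hb y hy hya hyb => by
    obtain ⟨φ, hφ, -⟩ := h𝒜₀.arrows a ha b hb _ (AChart.lift_mem_dom hya hy) _
      (AChart.lift_mem_dom hyb hy) (by rw [AChart.χ_lift hya hy, AChart.χ_lift hyb hy])
    exact IsArrow.root_eq hφ (hσne b hb y hy hyb) (hσ.compat a ha b hb y hy hya φ hφ)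
  have hg : ∀ y ∈ S, ∀ a ∈ 𝒜₀, y ∈ a.ψ.source → ((∃ a ∈ 𝒜₀, y ∈ a.ψ.source ∧
      (σ a y = ζ ∨ σ a y = ζ⁻¹)) ↔ σ a y = ζ ∨ σ a y = ζ⁻¹) := by
    refine fun y hy a ha hya => ⟨?_, fun h => ⟨a, ha, hya, h⟩⟩
    rintro ⟨b, hb, hyb, h⟩
    rcases hab b hb a ha y hy hyb hya with h1 | h1
    · rwa [h1]
    · rwa [h1, inv_inj, inv_eq_iff_eq_inv, or_comm]
  have hall : ∀ y ∈ S, ∀ a ∈ 𝒜₀, y ∈ a.ψ.source → σ a y = ζ ∨ σ a y = ζ⁻¹ := by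
    have := isPreconnected_iff_preconnectedSpace.1 hY.isPreconnected
    have hlc : IsLocallyConstant fun y : S => ∃ a ∈ 𝒜₀, (y : Y) ∈ a.ψ.source ∧
        (σ a y = ζ ∨ σ a y = ζ⁻¹) := by
      refine (IsLocallyConstant.iff_eventually_eq _).2 fun y => ?_
      obtain ⟨a, ha, hya⟩ := h𝒜₀.cover y y.2
      have h1 := hσ.locally_const a ha y y.2 hya
      rw [nhdsWithin_eq_map_subtype_coe y.2, eventually_map] at h1
      filter_upwards [h1, (a.ψ.open_source.preimage continuous_subtype_val).mem_nhds hya] with y' h2 h3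
      exact propext (by rw [hg y' y'.2 a ha h3, h2, hg y y.2 a ha hya])
    intro y hy a ha hya
    rw [← hg y hy a ha hya]
    exact (hlc.apply_eq_of_preconnectedSpace ⟨y₀, hy₀⟩ ⟨y, hy⟩).mp ⟨a₀, ha₀, hya₀, Or.inl hσ₀⟩
  refine ⟨{a' | ∃ a ∈ 𝒜₀, ∃ e : Bool, (∀ p ∈ a'.dom, coordSwap k e p ∈ a.dom ∧
    a.χ (coordSwap k e p) = a'.χ p) ∧ ∀ y ∈ S, y ∈ a'.ψ.source → σ a y = bif e then ζ⁻¹ else ζ},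
    ⟨fun y hy => ?_, ?_⟩, ?_⟩
  · obtain ⟨a, ha, hya⟩ := h𝒜₀.cover y hy
    obtain ⟨O, hO, h1, h2⟩ := mem_nhdsWithin.1 (hσ.locally_const a ha y hy hya)
    have he : ∃ e : Bool, σ a y = bif e then ζ⁻¹ else ζ :=
      (hall y hy a ha hya).elim (fun h => ⟨false, h⟩) fun h => ⟨true, h⟩
    obtain ⟨e, he⟩ := he
    obtain ⟨a', h3, h4⟩ := a.exists_twist e hO
    refine ⟨a', ⟨a, ha, e, h4, fun y' hy' hs => ?_⟩, h3 ▸ ⟨hya, h1⟩⟩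
    rw [← he]
    exact h2 ⟨(h3 ▸ hs).2, hy'⟩
  · rintro a' ⟨a, ha, e, hr, -⟩ b' ⟨b, hb, e', hr', -⟩ p hp p' hp' hpp
    obtain ⟨φ, hφ, hφp⟩ := h𝒜₀.arrows a ha b hb _ (hr p hp).1 _ (hr' p' hp').1
      (by rw [(hr p hp).2, (hr' p' hp').2, hpp])
    refine ⟨_, hφ.conj (coordSwap k e) (coordSwap k e') rfl hp (by simpa [hφp] using hp')
      ((a'.isOpen_dom.eventually_mem hp).mono fun x hx => (hr x hx).2) ?_, by simp [hφp]⟩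
    filter_upwards [(coordSwap k e').continuous.continuousAt.eventually
      (b'.isOpen_dom.eventually_mem (by simpa [hφp] using hp'))] with z hz
    rw [← (hr' _ hz).2, coordSwap_coordSwap]
  · rintro a' ⟨a, ha, e, hr, hσa⟩ b' ⟨b, hb, e', hr', hσb⟩ y hy hya φ hφ
    obtain ⟨hya', hl⟩ := AChart.lift_of_twist hr hy hya
    have h0 : IsArrow a b (a.lift y) (fun x => coordSwap k e' (φ (coordSwap k e x))) := by
      refine hφ.conj (coordSwap k e) (coordSwap k e') (by simp [← hl]) (hl ▸ (hr _ hφ.source).1)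
        (hr' _ hφ.target).1 ?_ ((b'.isOpen_dom.eventually_mem hφ.target).mono fun z hz => (hr' z hz).2)
      filter_upwards [(coordSwap k e).continuous.continuousAt.eventually
        (a'.isOpen_dom.eventually_mem (by simpa [← hl] using hφ.source))] with z hz
      rw [← (hr _ hz).2, coordSwap_coordSwap]
    have h1 := hσ.compat a ha b hb y hy hya' _ h0
    rw [hσa y hy hya, hσb y hy (hφ.mem_source hya hy)] at h1
    have h2 : ∀ᶠ x in 𝓝 (a'.lift y), φ (rootAct ζ x) = rootAct ζ (φ x) := by
      filter_upwards [(Continuous.tendsto' (coordSwap k e).continuous _ _ hl).eventually h1] with x hx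
      have := congrArg (coordSwap k e') hx
      rw [coordSwap_coordSwap, coordSwap_rootAct, coordSwap_rootAct] at this
      cases e <;> cases e' <;> simpa using this
    intro ξ hξ
    obtain ⟨i, -, rfl⟩ := hζ.eq_pow_of_pow_eq_one hξ
    clear hξ
    induction i with
    | zero => simp [rootAct]
    | succ i ih =>
      have ht : Tendsto (rootAct (ζ ^ i)) (𝓝 (a'.lift y)) (𝓝 (a'.lift y)) :=
        Continuous.tendsto' (by unfold rootAct; fun_prop) _ _ (by simp [rootAct, AChart.lift])
      have hm : ∀ x : Flat k, rootAct (ζ ^ (i + 1)) x = rootAct ζ (rootAct (ζ ^ i) x) := fun x => by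
        simp only [rootAct, pow_succ', mul_inv, mul_assoc]
      filter_upwards [ih, ht.eventually h2] with x k1 k2
      rw [hm, k2, k1, hm]

end Monodromy

/-! ### The comparison with the descended line bundle -/

/-- An isomorphism of sheaves from linear maps between the fibres. -/
lemma OMod.nonempty_iso {S : Type u} [TopologicalSpace S] [HolSpace S] {M N : OMod S}
    (r : ∀ t, M.Fib t →ₗ[Stalk t] N.Fib t)
    (hol : ∀ s σ, M.Hol s σ → N.Hol s fun t => r t (σ t))
    (hev : ∀ s σ, M.Hol s σ → ∀ᶠ t in 𝓝 s, M.Hol t σ)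
    (hinj : ∀ s σ σ', M.Hol s σ → M.Hol s σ' → (∀ᶠ t in 𝓝 s, r t (σ t) = r t (σ' t)) → σ s = σ' s)
    (hsurj : ∀ s τ, N.Hol s τ → ∃ σ, M.Hol s σ ∧ ∀ᶠ t in 𝓝 s, r t (σ t) = τ t) :
    Nonempty (OMod.Iso M N) := by
  have hopen : ∀ (U : TopologicalSpace.Opens S) (x : (U : Set S)) (p : S → Prop),
      (∀ᶠ y : (U : Set S) in 𝓝 x, p y) ↔ ∀ᶠ y in 𝓝 (x : S), p y := fun U x p => by
    rw [← map_nhds_subtype_coe_eq_nhds x.2 (U.2.mem_nhds x.2), eventually_map]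
  set Φ : ∀ U : TopologicalSpace.Opens S, M.Γ U →ₗ[Sect (U : Set S)] N.Γ U := fun U =>
    { toFun := fun s => ⟨fun x => r x (s.1 x), fun x => by
        obtain ⟨t, ht, he⟩ := s.2 x
        exact ⟨_, hol _ _ ht, he.mono fun y hy => congrArg (r y) hy⟩⟩
      map_add' := fun s t => Subtype.ext (funext fun x => map_add (r x) _ _)
      map_smul' := fun f s => Subtype.ext (funext fun x => (r x).map_smul (germ x f) (s.1 x)) } with hΦ
  have hbij : ∀ U, Function.Bijective (Φ U) := by
    refine fun U => ⟨fun s s' h => ?_, fun τ => ?_⟩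
    · refine Subtype.ext (funext fun x => ?_)
      obtain ⟨t, ht, he⟩ := s.2 x
      obtain ⟨t', ht', he'⟩ := s'.2 x
      rw [he.self_of_nhds, he'.self_of_nhds, hinj x t t' ht ht' ((hopen U x _).1 (by
        filter_upwards [he, he'] with y h1 h2
        rw [← h1, ← h2]
        exact congrFun (congrArg Subtype.val h) y))]
    · have hch : ∀ x : (U : Set S), ∃ σ, M.Hol x σ ∧ ∀ᶠ y : (U : Set S) in 𝓝 x,
          r y (σ y) = τ.1 y := fun x => by
        obtain ⟨t, ht, he⟩ := τ.2 x
        obtain ⟨σ, h1, h2⟩ := hsurj x t ht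
        refine ⟨σ, h1, ?_⟩
        filter_upwards [he, (hopen U x _).2 h2] with y k1 k2
        rw [k1, k2]
      choose σ h1 h2 using hch
      refine ⟨⟨fun x => σ x x, fun x => ⟨σ x, h1 x, ?_⟩⟩, Subtype.ext (funext fun x =>
        (h2 x).self_of_nhds)⟩
      filter_upwards [(hopen U x _).2 (hev x _ (h1 x)), (h2 x).eventually_nhds] with y k1 k2
      refine hinj y _ _ (h1 y) k1 ((hopen U y _).1 ?_)
      filter_upwards [k2, h2 y] with z e1 e2
      rw [e1, e2]
  exact ⟨⟨fun U => LinearEquiv.ofBijective (Φ U) (hbij U), fun U V h s t hst x =>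
    congrArg (r x) (hst x)⟩⟩

section Residue

variable {Y X : Type u} [TopologicalSpace Y] [HolSpace Y] [TopologicalSpace X] [HolSpace X]
  {n k : ℕ}

/-- `R a c t r` says that `r` is the residue at `t`, with respect to the chart `a`, of the cocycle
`c`; the residues describe the first direct image, and an arrow `φ` multiplies them by
`J (normalDeriv φ)`. -/
structure IsResidue (π : HolMap X (Sing k Y)) (F : ValSheaf X)
    (𝒜 : Set (AChart n k Y)) (J : Matrix (Fin 2) (Fin 2) ℂ → ℂ) (R : AChart n k Y →
      (X → X → ∀ x, F.Fib x) → Sing k Y → ℂ → Prop) : Prop where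
  add : ∀ {a c c'} {t : Sing k Y} {r r'}, R a c t r → R a c' t r' → R a (c + c') t (r + r')
  smul : ∀ {a c} {t : Sing k Y} {r} (f : Sing k Y → ℂ), R a c t r →
    R a (fun p q x => f (π x) • c p q x) t (f t * r)
  unique : ∀ {a c} {t : Sing k Y} {r r'}, (t : Y) ∈ a.ψ.source → R a c t r → R a c t r' → r = r'
  coboundary : ∀ {a c} {t : Sing k Y} {U : Set (Sing k Y)}, a ∈ 𝒜 →
    (t : Y) ∈ a.ψ.source → t ∈ U →
    IsCoboundary F (π.toFun ⁻¹' U) c → R a c t 0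
  hol : ∀ {a c} {s : Sing k Y} {U : Set (Sing k Y)}, a ∈ 𝒜 → (s : Y) ∈ a.ψ.source →
    IsOpen U → s ∈ U → IsCocycle F (π.toFun ⁻¹' U) c → ∃ f ∈ 𝒪 s, ∀ᶠ t in 𝓝 s, R a c t (f t)
  inj : ∀ {a c} {s : Sing k Y} {U : Set (Sing k Y)}, a ∈ 𝒜 → (s : Y) ∈ a.ψ.source →
    IsOpen U → s ∈ U → IsCocycle F (π.toFun ⁻¹' U) c → (∀ᶠ t in 𝓝 s, R a c t 0) →
      ∃ V, IsOpen V ∧ s ∈ V ∧ IsCoboundary F (π.toFun ⁻¹' V) c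
  surj : ∀ {a} {s : Sing k Y} {f : Sing k Y → ℂ}, a ∈ 𝒜 → (s : Y) ∈ a.ψ.source →
    f ∈ 𝒪 s → ∃ V, IsOpen V ∧ s ∈ V ∧ ∃ c, IsCocycle F (π.toFun ⁻¹' V) c ∧ ∀ t ∈ V, R a c t (f t)
  change : ∀ {a b c} {t : Sing k Y} {r φ} {U : Set (Sing k Y)}, a ∈ 𝒜 →
    b ∈ 𝒜 → (t : Y) ∈ a.ψ.source → (t : Y) ∈ b.ψ.source → IsArrow a b (a.lift t) φ →
      IsOpen U → t ∈ U → IsCocycle F (π.toFun ⁻¹' U) c → R a c t r → R b c t (J (normalDeriv φ (a.lift t)) * r)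

namespace IsResidue

variable {π : HolMap X (Sing k Y)} {F : ValSheaf X} {𝒜 : Set (AChart n k Y)}
  {J : Matrix (Fin 2) (Fin 2) ℂ → ℂ}
  {R : AChart n k Y → (X → X → ∀ x, F.Fib x) → Sing k Y → ℂ → Prop}
  (h : IsResidue π F 𝒜 J R)
include h

lemma exists_residue (t : Sing k Y) (c : cocyclesAt π F t) :
    ∃ σ : descendFib 𝒜 J (t : Y), ∀ a, R a.1 c.1 t (σ.1 a) := by
  obtain ⟨U, hU, htU, hc⟩ := c.2
  have hex : ∀ a : {a : AChart n k Y // a ∈ 𝒜 ∧ (t : Y) ∈ a.ψ.source}, ∃ r, R a.1 c.1 t r := fun a =>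
    let ⟨f, _, h1⟩ := h.hol a.2.1 a.2.2 hU htU hc
    ⟨f t, h1.self_of_nhds⟩
  choose σ hσ using hex
  exact ⟨⟨σ, fun a b φ hφ => h.unique b.2.2 (hσ b)
    (h.change a.2.1 b.2.1 a.2.2 b.2.2 hφ hU htU hc (hσ a))⟩, hσ⟩

def resCocycle (t : Sing k Y) :
    cocyclesAt π F t →ₗ[Stalk t] (descend 𝒜 J).toOMod.Fib t where
  toFun c := (h.exists_residue t c).choose
  map_add' c c' := Subtype.ext (funext fun a => h.unique a.2.2
    ((h.exists_residue t _).choose_spec a) (h.add ((h.exists_residue t _).choose_spec a)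
      ((h.exists_residue t _).choose_spec a)))
  map_smul' f c := Subtype.ext (funext fun a => h.unique a.2.2
    ((h.exists_residue t _).choose_spec a) (h.smul f.fn ((h.exists_residue t _).choose_spec a)))

lemma resCocycle_spec (t : Sing k Y) (c : cocyclesAt π F t)
    (a : {a : AChart n k Y // a ∈ 𝒜 ∧ (t : Y) ∈ a.ψ.source}) :
    R a.1 c.1 t ((h.resCocycle t c : descendFib 𝒜 J (t : Y)).1 a) :=
  (h.exists_residue t c).choose_spec a

def resMap (t : Sing k Y) :
    (R1 π F).Fib t →ₗ[Stalk t] (descend 𝒜 J).toOMod.Fib t :=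
  Submodule.liftQ _ (h.resCocycle t) fun c hc => by
    obtain ⟨U, -, htU, hb⟩ := (hc : c.1 ∈ coboundariesAt π F t)
    exact Subtype.ext (funext fun a => h.unique a.2.2 (h.resCocycle_spec t c a)
      (h.coboundary a.2.1 a.2.2 htU hb))

lemma resMap_spec {U : Set (Sing k Y)} {hU : IsOpen U} {c : X → X → ∀ x, F.Fib x}
    {hc : IsCocycle F (π.toFun ⁻¹' U) c} {t : Sing k Y} (ht : t ∈ U)
    {x : (R1 π F).Fib t} (hx : x = R1class π F hU hc ⟨t, ht⟩)
    (a : {a : AChart n k Y // a ∈ 𝒜 ∧ (t : Y) ∈ a.ψ.source}) :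
    R a.1 c t ((h.resMap t x : descendFib 𝒜 J (t : Y)).1 a) := by
  subst hx
  exact h.resCocycle_spec t ⟨c, U, hU, ht, hc⟩ a

lemma hol_resMap {s : Sing k Y} {σ : ∀ t, (R1 π F).Fib t} (hσ : (R1 π F).Hol s σ) :
    (descend 𝒜 J).Hol s fun t => h.resMap t (σ t) := by
  obtain ⟨U, hU, c, hc, hs, hσ⟩ := hσ
  intro a ha hsa
  obtain ⟨f, hf, h1⟩ := h.hol ha hsa hU hs hc
  refine ⟨f, hf, ?_⟩
  filter_upwards [h1, hU.mem_nhds hs] with t k1 k2 ht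
  exact h.unique ht (h.resMap_spec k2 (hσ ⟨t, k2⟩) ⟨a, ha, ht⟩) k1

omit h in
lemma fib_ext (h𝒜 : IsOrbifoldAtlas 𝒜) {t : Sing k Y} {σ τ : descendFib 𝒜 J (t : Y)}
    (a : {a : AChart n k Y // a ∈ 𝒜 ∧ (t : Y) ∈ a.ψ.source}) (ha : σ.1 a = τ.1 a) : σ = τ := by
  refine Subtype.ext (funext fun b => ?_)
  obtain ⟨φ, hφ, -⟩ := h𝒜.arrows a.1 a.2.1 b.1 b.2.1 _ (AChart.lift_mem_dom a.2.2 t.2) _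
    (AChart.lift_mem_dom b.2.2 t.2) (by rw [AChart.χ_lift a.2.2 t.2, AChart.χ_lift b.2.2 t.2])
  rw [σ.2 a b φ hφ, τ.2 a b φ hφ, ha]

lemma exists_section (h𝒜 : IsOrbifoldAtlas 𝒜) {a : AChart n k Y} (ha : a ∈ 𝒜)
    {s : Sing k Y} (hs : (s : Y) ∈ a.ψ.source) {f : Sing k Y → ℂ}
    (hf : f ∈ 𝒪 s) : ∃ σ, ∀ᶠ t in 𝓝 s, (R1 π F).Hol t σ ∧ ∃ ht : (t : Y) ∈ a.ψ.source,
      (h.resMap t (σ t) : descendFib 𝒜 J (t : Y)).1 ⟨a, ha, ht⟩ = f t := by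
  obtain ⟨V, hV, hsV, c, hc, hcf⟩ := h.surj ha hs hf
  classical
  refine ⟨fun t => if ht : t ∈ V then R1class π F hV hc ⟨t, ht⟩ else 0, ?_⟩
  filter_upwards [hV.mem_nhds hsV, (a.ψ.open_source.preimage continuous_subtype_val).mem_nhds hs]
    with t ht hta
  refine ⟨⟨V, hV, c, hc, ht, fun t => dif_pos t.2⟩, hta, h.unique hta
    (h.resMap_spec ht (dif_pos ht) ⟨a, ha, hta⟩) (hcf t ht)⟩

theorem isLineBundle (h𝒜 : IsOrbifoldAtlas 𝒜) : (descend 𝒜 J).IsLineBundle := by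
  intro s
  obtain ⟨a, ha, hs⟩ := h𝒜.cover s s.2
  obtain ⟨σ, hσ⟩ := h.exists_section h𝒜 ha hs (one_mem _)
  obtain ⟨U, hU, hUo, hsU⟩ := eventually_nhds_iff.1 hσ
  refine ⟨U, hUo, hsU, fun t => h.resMap t (σ t), fun t ht => ?_⟩
  obtain ⟨h1, hta, h2⟩ := hU t ht
  refine ⟨h.hol_resMap h1, fun h0 => ?_, fun α => ⟨α.1 ⟨a, ha, hta⟩, ?_⟩, fun τ hτ => ?_⟩
  · exact zero_ne_one ((congrArg (fun x => x.1 ⟨a, ha, hta⟩) h0).symm.trans h2)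
  · refine fib_ext h𝒜 ⟨a, ha, hta⟩ ?_
    change _ = _ * (h.resMap t (σ t) : descendFib 𝒜 J (t : Y)).1 ⟨a, ha, hta⟩
    rw [h2, Pi.one_apply, mul_one]
  · obtain ⟨f, hf, h3⟩ := hτ a ha hta
    refine ⟨f, hf, ?_⟩
    filter_upwards [h3, hUo.mem_nhds ht] with t' k1 k2
    obtain ⟨-, hta', h2'⟩ := hU t' k2
    refine fib_ext h𝒜 ⟨a, ha, hta'⟩ ?_
    change _ = _ * (h.resMap t' (σ t') : descendFib 𝒜 J (t' : Y)).1 ⟨a, ha, hta'⟩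
    rw [h2', Pi.one_apply, mul_one, k1 hta']

theorem nonempty_iso (h𝒜 : IsOrbifoldAtlas 𝒜) :
    Nonempty (OMod.Iso (R1 π F) (descend 𝒜 J).toOMod) := by
  refine OMod.nonempty_iso h.resMap (fun s σ hσ => h.hol_resMap hσ) ?_ ?_ ?_
  · rintro s σ ⟨U, hU, c, hc, hs, hσ⟩
    filter_upwards [hU.mem_nhds hs] with t ht
    exact ⟨U, hU, c, hc, ht, hσ⟩
  · rintro s σ σ' ⟨U, hU, c, hc, hs, hσ⟩ ⟨U', hU', c', hc', hs', hσ'⟩ he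
    obtain ⟨a, ha, hsa⟩ := h𝒜.cover s s.2
    have hd :=
      hc.add (hc'.smul (fun _ => -1) fun x _ => (neg_mem (one_mem (𝒪 x)) : (-1 : X → ℂ) ∈ 𝒪 x))
    obtain ⟨V, hV, hsV, hb⟩ := h.inj ha hsa (hU.inter hU') ⟨hs, hs'⟩ hd (by
      filter_upwards [he, hU.mem_nhds hs, hU'.mem_nhds hs',
        (a.ψ.open_source.preimage continuous_subtype_val).mem_nhds hsa] with t k1 k2 k3 k4
      have e2 := h.resMap_spec k3 (hσ' ⟨t, k3⟩) ⟨a, ha, k4⟩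
      rw [← k1] at e2
      have e3 := h.add (h.resMap_spec k2 (hσ ⟨t, k2⟩) ⟨a, ha, k4⟩) (h.smul (fun _ => -1) e2)
      rwa [neg_one_mul, add_neg_cancel] at e3)
    rw [hσ ⟨s, hs⟩, hσ' ⟨s, hs'⟩]
    refine (Submodule.Quotient.eq _).2 ⟨V, hV, hsV, ?_⟩
    have : (c + fun p q x => (-1 : ℂ) • c' p q x) = c - c' := by
      funext p q x
      simp [sub_eq_add_neg]
    rwa [this] at hb
  · intro s τ hτ
    obtain ⟨a, ha, hsa⟩ := h𝒜.cover s s.2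
    obtain ⟨f, hf, h1⟩ := (hτ : (descend 𝒜 J).Hol s τ) a ha hsa
    obtain ⟨σ, hσ⟩ := h.exists_section h𝒜 ha hsa hf
    refine ⟨σ, hσ.self_of_nhds.1, ?_⟩
    filter_upwards [h1, hσ] with t k1 k2
    obtain ⟨-, ht, k2⟩ := k2
    exact fib_ext h𝒜 ⟨a, ha, ht⟩ (k2.trans (k1 ht).symm)

end IsResidue
end Residue

section Main

variable {Y Z : Type u} [TopologicalSpace Y] [HolSpace Y] [TopologicalSpace Z] [HolSpace Z]
  {n k : ℕ} {ρ : HolMap Z Y} {𝒜 : Set (AChart n k Y)}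

lemma IsBlowUpResolution.exists_isToricAtlas [T2Space Z] (hn : 1 ≤ n)
    (hρ : IsBlowUpResolution (k + 2) Z Y ρ) (hS : (Sing k Y).Nonempty)
    (h𝒜 : IsOrbifoldAtlas 𝒜) (htr : TrivializesMonodromy 𝒜) : ∃ Θ, IsToricAtlas ρ 𝒜 Θ := by
  have hex : ∀ (a : AChart n k Y) (y : Y), y ∈ Sing k Y → y ∈ a.ψ.source →
      ∃ θ : ℕ → OPH Z (Flat k), IsToricCover a.ψ ρ.toFun θ := fun a y hy hya =>
    let ⟨θ, h1, h2⟩ := hρ.exists_toric rfl n a.ψ a.bihol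
      ⟨a.ψ y, a.ψ.map_source hya, (a.core y hya).1 hy⟩
    ⟨θ, h1, h2, fun p q hpq hp h0 => hρ.injective rfl p q hpq fun hs => h0 ((a.core _ hp).1 hs)⟩
  obtain ⟨y₀, hy₀⟩ := hS
  obtain ⟨a₀, -, hya₀⟩ := h𝒜.cover y₀ hy₀
  obtain ⟨θ₀, -⟩ := hex a₀ y₀ hy₀ hya₀
  have hΘ : ∀ a : AChart n k Y, ∃ θ : ℕ → OPH Z (Flat k),
      ∀ y ∈ Sing k Y, y ∈ a.ψ.source → IsToricCover a.ψ ρ.toFun θ := fun a => by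
    by_cases hne : ∃ y ∈ Sing k Y, y ∈ a.ψ.source
    · obtain ⟨y, hy, hya⟩ := hne
      obtain ⟨θ, hθ⟩ := hex a y hy hya
      exact ⟨θ, fun _ _ _ => hθ⟩
    · exact ⟨θ₀, fun y hy hya => absurd ⟨y, hy, hya⟩ hne⟩
  choose Θ hΘ using hΘ
  refine ⟨Θ, h𝒜.cover, fun a _ => hΘ a, fun a ha b hb y hy hya hyb l' h1 h2 v hv => ?_⟩
  obtain ⟨φ, hφ, -⟩ := h𝒜.arrows a ha b hb _ (AChart.lift_mem_dom hya hy) _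
    (AChart.lift_mem_dom hyb hy) (by rw [AChart.χ_lift hya hy, AChart.χ_lift hyb hy])
  obtain ⟨α, δ, η, ε, -, -, -, hP, -⟩ := exists_chart_change hn (hΘ a y hy hya) (hΘ b y hy hyb) hφ
    (hφ.map_lift hya hy) (htr a ha b hb y hy hya φ hφ)
  obtain ⟨l, rfl⟩ : ∃ l, l' = l + 1 := ⟨l' - 1, by omega⟩
  obtain ⟨g1, g2⟩ := hP l (n - (l + 1)) (by omega) v.1 v.2 (by
    by_contra! h0
    exact hv (Prod.ext h0.1 h0.2))
  exact ⟨_, fun h0 => g1.elim (· (congrArg Prod.fst h0)) (· (congrArg Prod.snd h0)), g2⟩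

variable {Θ : AChart n k Y → ℕ → OPH Z (Flat k)} {m₁ m₂ : ℕ} {X : Set Z}
  [T2Space Z] {π : HolMap X (Sing k Y)}

lemma IsChain.isChange (h : IsChain ρ 𝒜 Θ m₁ m₂ X) (htr : TrivializesMonodromy 𝒜)
    (hπ : ∀ x, ((π x : Sing k Y) : Y) = ρ x) {a b : AChart n k Y} (ha : a ∈ 𝒜)
    (hb : b ∈ 𝒜) {t s s' : Sing k Y} (hta : (t : Y) ∈ a.ψ.source)
    (htb : (t : Y) ∈ b.ψ.source) (hs : (s : Y) ∈ a.ψ.source) (hs' : (s' : Y) ∈ b.ψ.source)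
    {φ : Flat k → Flat k} (hφ : IsArrow a b (a.lift t) φ) :
    ∃ α δ η ε, normalJ n (normalDeriv φ (a.lift t)) = α * δ - 0 ^ (n - 1) * (η * ε) ∧
      ChainModel.IsChange (h.model ha (h.atlas.toric a ha s s.2 hs) hs π hπ)
        (h.model hb (h.atlas.toric b hb s' s'.2 hs') hs' π hπ) n t α δ η ε := by
  have hTa := h.atlas.toric a ha t t.2 hta
  have hwa := AChart.corePt_mem hta t.2
  have h1 := h.one_le
  have h2 := h.le_n
  obtain ⟨α, δ, η, ε, hJ, hne, hdet, hP, hζ⟩ := exists_chart_change (by have := h.le; omega) hTa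
    (h.atlas.toric b hb t t.2 htb) hφ (hφ.map_lift hta t.2) (htr a ha b hb t t.2 hta φ hφ)
  refine ⟨α, δ, η, ε, hJ, h1, h2, hta, htb, hne, hdet, fun l j hn i1 i2 x y hxy => ?_,
    fun l j hn i1 i2 x hx hX hW c => ?_⟩
  · obtain ⟨g1, g2⟩ := hP l j hn x y hxy
    refine Subtype.ext ((h.coe_chainPt ha i1 i2 hwa ?_).trans
      (g2.trans (h.coe_chainPt hb i1 i2 (AChart.corePt_mem htb t.2) ?_).symm))
    · exact fun h0 => hxy.elim (· (congrArg Prod.fst h0)) (· (congrArg Prod.snd h0))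
    · exact fun h0 => g1.elim (· (congrArg Prod.fst h0)) (· (congrArg Prod.snd h0))
  · refine hζ l j hn x hx hX hW X (fun p hp => ?_) ?_ c.1 ((h.coe_chainPt ha i1 i2 hwa (v := (x, 1)) (by simp)) ▸ c.2)
    · obtain ⟨l, -, -, hl⟩ := (h.mem_iff p).1 hp
      exact hl.1
    · filter_upwards [(Θ a (l + 1)).open_source.eventually_mem (hTa.pt_mem_right (by omega)
        (by omega) hwa one_ne_zero).1] with p hp h0
      exact (h.mem_chart ha hTa (by omega) hp).2 (Or.inr ⟨i1, i2, h0⟩)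

open ChainModel in
theorem IsChain.exists_isResidue (h : IsChain ρ 𝒜 Θ m₁ m₂ X) (htr : TrivializesMonodromy 𝒜)
    (hπ : ∀ x, ((π x : Sing k Y) : Y) = ρ x) :
    ∃ R, IsResidue π (normalSheaf X) 𝒜 (normalJ n) R := by
  set M : ∀ a : AChart n k Y, (a ∈ 𝒜 ∧ ∃ s : Sing k Y, (s : Y) ∈ a.ψ.source) →
      ChainModel π (normalSheaf X) k m₁ m₂ := fun a ha =>
    h.model ha.1 (h.atlas.toric a ha.1 _ ha.2.choose.2 ha.2.choose_spec) ha.2.choose_spec π hπ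
  refine ⟨fun a c t r => ∃ ha, (M a ha).IsRes c t r, ?_, ?_, ?_, ?_, ?_, ?_, ?_, ?_⟩
  · rintro a c c' t r r' ⟨ha, h1⟩ ⟨_, h2⟩
    exact ⟨ha, h1.add h2⟩
  · rintro a c t r f ⟨ha, h1⟩
    exact ⟨ha, h1.smul f⟩
  · rintro a c t r r' ht ⟨ha, h1⟩ ⟨_, h2⟩
    exact h1.unique ht h2
  · exact fun ha ht htU hb => ⟨⟨ha, _, ht⟩, isRes_zero_of_isCoboundary htU ht hb⟩
  · intro a c s U ha hs hU hsU hc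
    obtain ⟨V, -, hV, hsV, 𝒰, B, hB⟩ := (M a ⟨ha, s, hs⟩).exists_isSplitting hU hc hsU hs
    exact ⟨_, sub_mem (hB.mem_hol hV hsV h.le le_rfl (by simp) (M a ⟨ha, s, hs⟩).ζ_end)
      (hB.mem_hol hV hsV le_rfl h.le (by simp) (M a ⟨ha, s, hs⟩).ζ_start), (hV.eventually_mem hsV).mono
        fun t ht => ⟨⟨ha, s, hs⟩, hB.isRes ht⟩⟩
  · intro a c s U ha hs hU hsU hc h0
    obtain ⟨W, hW, hWo, hsW⟩ := eventually_nhds_iff.1 h0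
    obtain ⟨V, hVU, hV, hsV, 𝒰, B, hB⟩ := (M a ⟨ha, s, hs⟩).exists_isSplitting (hU.inter hWo)
      (hc.mono ((hU.inter hWo).preimage π.continuous_toFun) (preimage_mono inter_subset_left))
      ⟨hsU, hsW⟩ hs
    exact ⟨V, hV, hsV, hB.isCoboundary hV fun t ht => (hW t (hVU ht).2).2⟩
  · intro a s f ha hs hf
    obtain ⟨V, hV, hsV, c, 𝒰, hc, -, -, hr⟩ := (M a ⟨ha, s, hs⟩).exists_cocycle hs hf
    exact ⟨V, hV, hsV, c, hc, fun t ht => ⟨⟨ha, s, hs⟩, hr t ht⟩⟩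
  · rintro a b c t r φ U ha hb hta htb hφ hU htU hc ⟨ha', hr⟩
    have hb' : b ∈ 𝒜 ∧ ∃ s : Sing k Y, (s : Y) ∈ b.ψ.source := ⟨hb, t, htb⟩
    obtain ⟨α, δ, η, ε, hJ, hch⟩ := h.isChange htr hπ ha hb hta htb ha'.2.choose_spec
      hb'.2.choose_spec hφ
    refine ⟨hb', ?_⟩
    rw [hJ]
    exact hch.isRes hU htU hc hr

end Main

end TransversalAn

end

universe u

open TransversalAn

theorem mainTheorem11 {Y Z : Type u} [TopologicalSpace Y] [T2Space Y] [HolSpace Y]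
    [TopologicalSpace Z] [HolSpace Z] (n k : ℕ) (hY : IsTransversalA n k Y)
    (𝒜₀ : Set (AChart n k Y)) (h𝒜₀ : IsOrbifoldAtlas 𝒜₀) (hmon : TrivialMonodromy 𝒜₀)
    (ρ : HolMap Z Y) (hρ : IsBlowUpResolution (k + 2) Z Y ρ)
    (E : Fin n → Set Z) (hE : IsExceptionalChain ρ (singularLocus (k + 2) Y) E)
    (μ ν : Fin n) (hμν : μ ≤ ν) :
    (∃ 𝒜 : Set (AChart n k Y), IsOrbifoldAtlas 𝒜 ∧ TrivializesMonodromy 𝒜) ∧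
    ∀ 𝒜 : Set (AChart n k Y), IsOrbifoldAtlas 𝒜 → TrivializesMonodromy 𝒜 →
      (2 ≤ n → (bundleK 𝒜).IsLineBundle ∧
        Nonempty (OMod.Iso (R1 (hE.proj μ ν) (normalSheaf (chainUnion E μ ν)))
          (bundleK 𝒜).toOMod)) ∧
      (n = 1 → (bundleDetN 𝒜).IsLineBundle ∧
        Nonempty (OMod.Iso (R1 (hE.proj μ ν) (normalSheaf (chainUnion E μ ν)))
          (bundleDetN 𝒜).toOMod)) := by
  refine ⟨exists_trivializing hY.connected h𝒜₀ hmon, fun 𝒜 h𝒜 htr => ?_⟩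
  have := hρ.t2Space inferInstance
  obtain ⟨Θ, hΘ⟩ := hρ.exists_isToricAtlas (by have := μ.2; omega) hY.connected.nonempty h𝒜 htr
  obtain ⟨m₁, m₂, h1, h2, h3, h4⟩ := hΘ.exists_interval hY.connected hE hμν
  obtain ⟨R, hR⟩ := IsChain.exists_isResidue (π := hE.proj μ ν) ⟨hΘ, h1, h2, h3, h4⟩ htr
    fun _ => rfl
  have key : (descend 𝒜 (normalJ n)).IsLineBundle ∧ Nonempty (OMod.Iso
      (R1 (hE.proj μ ν) (normalSheaf (chainUnion E μ ν))) (descend 𝒜 (normalJ n)).toOMod) :=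
    ⟨hR.isLineBundle h𝒜, hR.nonempty_iso h𝒜⟩
  refine ⟨fun hn => ?_, fun hn => ?_⟩
  · rwa [show normalJ n = fun D => D 0 0 * D 1 1 from
      funext fun D => if_neg (show n ≠ 1 by omega)] at key
  · rwa [show normalJ n = Matrix.det from funext fun D => if_pos hn] at key
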